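/- Let $(X,d,\mu)$ be a separable metric space with a Borel measure $\mu$ such that, with $B(x,r)=\{y: d(x,y)<r\}$ and $V(x,r)=\mu(B(x,r))$, one has $0<V(x,r)<\infty$ for all $x\in X$, $r>0$, and, for some constants $n>0$ and $C_D$, $V(x,\lambda r)\le C_D\lambda^n V(x,r)$ for all $x\in X$, $r>0$, $\lambda\ge 1$. Let $N>n+[n/2]+1$, where $[\cdot]$ is the integer part, put $a=N-n$, fix a constant $C_K$, and set $\sigma_p=|1/p-1/2|$ for $1\le p\le\infty$. For a bounded measurable $F:\mathbb R\to\mathbb C$ let $\|F\|_{W^{s,q}}=\|(I-d^2/dx^2)^{s/2}F\|_{L^q(\mathbb R)}\in[0,\infty]$ (in the sense of tempered distributions, with value $\infty$ if $(I-d^2/dx^2)^{s/2}F\notin L^q$), and $\|F\|_{H^s}=\|F\|_{W^{s,2}}$. For a bounded self-adjoint operator $B$ on the complex space $L^2(X,\mu)$ and a bounded Borel function $F$, $F(B)$ is given by the spectral theorem, and $\|T\|_{p\to p}$ is the least $M\in[0,\infty]$ with $\|Tf\|_p\le M\|f\|_p$ for all $f\in L^2\cap L^p$. Consider bounded self-adjoint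 operators $A$ on $L^2(X,\mu)$ and integers $k\ge 1$ for which $A^k$ has a measurable kernel $A^k(x,y)$ with $$|A^k(x,y)|\le \frac{C_K}{\max\big(V(x,k^{1/2}),V(y,k^{1/2})\big)}\Big(1+\frac{d(x,y)^2}{k}\Big)^{-N}\qquad\text{for all }x,y\in X. \tag{1}$$ (i) Let $1\le p\le\infty$, $s>n\sigma_p+\frac{n}{4[a]}$ and $s'>n\sigma_p+\frac12$. There is a constant $C$ such that for all $A,k$ as above and every bounded continuous $F:\mathbb R\to\mathbb C$, $$\|F(A^k)A^k\|_{p\to p}\le C\min\big(\|F\|_{W^{s,\infty}},\|F\|_{H^{s'}}\big).$$ (ii) Let $1\le p<2\le q\le\infty$, $s>n\sigma_p+\frac{n}{4[a]}$, $-\infty<R_1<R_2<\infty$, $\gamma>0$ and $C_R\geq 0$. There is a constant $C$ such that the following holds for all $A,k$ as above which in addition satisfy the restriction type condition $$\|F(A^k)A^kV_{\tau}^{\sigma_p}h\|_{2}\le C_R\|F\|_{L^q(\mathbb R)}\|h\|_p,\qquad \tau=k^{1/2},\quad V_\tau(x)=V(x,\tau),$$ for all bounded Borel functions $F$ with $\operatorname{supp}F\subset(R_1,R_2)$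 and all $h\in L^p(X)$ with $V_\tau^{\sigma_p}h\in L^2(X)$: for every bounded Borel function $F:\mathbb R\to\mathbb C$ with $\operatorname{supp}F\subset(R_1+\gamma,R_2-\gamma)$, $$\|F(A^k)A^k\|_{p\to p}\le C\|F\|_{W^{s,q}}.$$ -/

import Mathlib

open MeasureTheory Filter Topology
open scoped ENNReal NNReal SchwartzMap InnerProductSpace CompactlySupported

noncomputable section

set_option linter.unusedSimpArgs false

/-- The positive functional `φ ↦ ⟨v, φ(A) v⟩` on `C_c(ℝ)` of a bounded self-adjoint operator `A`,
where `φ(A)` is the continuous functional calculus. -/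
def spectralFunctional {H : Type*} [NormedAddCommGroup H] [InnerProductSpace ℂ H] [CompleteSpace H]
    (A : H →L[ℂ] H) (v : H) : C_c(ℝ, ℝ) →ₚ[ℝ] ℝ :=
  PositiveLinearMap.mk₀
    { toFun := fun φ => (⟪v, cfc (φ : ℝ → ℝ) A v⟫_ℂ).re
      map_add' := fun φ ψ => by
        have h : cfc (⇑(φ + ψ) : ℝ → ℝ) A = cfc (φ : ℝ → ℝ) A + cfc (ψ : ℝ → ℝ) A :=
          cfc_add A (φ : ℝ → ℝ) (ψ : ℝ → ℝ) φ.continuous.continuousOn ψ.continuous.continuousOn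
        rw [h, _root_.add_apply, inner_add_right, Complex.add_re]
      map_smul' := fun c φ => by
        have h : cfc (⇑(c • φ) : ℝ → ℝ) A = c • cfc (φ : ℝ → ℝ) A :=
          cfc_smul c (φ : ℝ → ℝ) A φ.continuous.continuousOn
        rw [h, _root_.smul_apply, inner_smul_right_eq_smul, Complex.smul_re,
          RingHom.id_apply] }
    (fun φ hφ => by
      have h : 0 ≤ cfc (φ : ℝ → ℝ) A := cfc_nonneg fun x _ => hφ x
      exact ((ContinuousLinearMap.nonneg_iff_isPositive _).1 h).re_inner_nonneg_right v)

/-- The spectral measure `μ_v` of the bounded self-adjoint operator `A` at the vector `v`, that is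
`d⟨v, E(λ) v⟩` for the spectral resolution `E` of `A`: the measure that represents
`φ ↦ ⟨v, φ(A) v⟩` by the Riesz-Markov-Kakutani theorem. -/
def spectralMeasure {H : Type*} [NormedAddCommGroup H] [InnerProductSpace ℂ H] [CompleteSpace H]
    (A : H →L[ℂ] H) (v : H) : Measure ℝ :=
  RealRMK.rieszMeasure (spectralFunctional A v)

theorem integral_spectralMeasure {H : Type*} [NormedAddCommGroup H] [InnerProductSpace ℂ H]
    [CompleteSpace H] (A : H →L[ℂ] H) (v : H) (φ : C_c(ℝ, ℝ)) :
    ∫ x, φ x ∂(spectralMeasure A v) = (⟪v, cfc (φ : ℝ → ℝ) A v⟫_ℂ).re :=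
  RealRMK.integral_rieszMeasure (spectralFunctional A v) φ

theorem spectralMeasure_univ_le {H : Type*} [NormedAddCommGroup H] [InnerProductSpace ℂ H]
    [CompleteSpace H] (A : H →L[ℂ] H) (v : H) :
    spectralMeasure A v Set.univ ≤ ENNReal.ofReal (‖v‖ ^ 2) := by
  have hK : ∀ n : ℕ, spectralMeasure A v (Metric.closedBall 0 n) ≤ ENNReal.ofReal (‖v‖ ^ 2) := by
    intro n
    obtain ⟨f, hf1, hf2, hf3⟩ := exists_continuousMap_one_of_isCompact_subset_isOpen
      (isCompact_closedBall (0 : ℝ) n) isOpen_univ (Set.subset_univ _)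
    let φ : C_c(ℝ, ℝ) := ⟨f, hasCompactSupport_def.mpr hf2⟩
    refine (RealRMK.rieszMeasure_le_of_eq_one (spectralFunctional A v) (f := φ)
      (fun x => (hf3.2 x).1) (isCompact_closedBall (0 : ℝ) n) (fun x hx => hf1 hx)).trans ?_
    apply ENNReal.ofReal_le_ofReal
    have hn : ‖cfc (φ : ℝ → ℝ) A‖ ≤ 1 := norm_cfc_le zero_le_one fun x _ => by
      have h0 := (hf3.2 x).1
      have h1 := (hf3.2 x).2
      change ‖f x‖ ≤ 1
      rw [Real.norm_eq_abs, abs_of_nonneg h0]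
      exact h1
    calc (⟪v, cfc (φ : ℝ → ℝ) A v⟫_ℂ).re ≤ ‖⟪v, cfc (φ : ℝ → ℝ) A v⟫_ℂ‖ := Complex.re_le_norm _
      _ ≤ ‖v‖ * ‖cfc (φ : ℝ → ℝ) A v‖ := norm_inner_le_norm _ _
      _ ≤ ‖v‖ * (1 * ‖v‖) := by
        gcongr
        exact (ContinuousLinearMap.le_opNorm _ _).trans (by gcongr)
      _ = ‖v‖ ^ 2 := by ring
  have hU : (Set.univ : Set ℝ) = ⋃ n : ℕ, Metric.closedBall (0 : ℝ) n :=
    (Metric.iUnion_closedBall_nat 0).symm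
  rw [hU, Monotone.measure_iUnion]
  · exact iSup_le hK
  · intro m n h
    exact Metric.closedBall_subset_closedBall (by exact_mod_cast h)

instance isFiniteMeasure_spectralMeasure {H : Type*} [NormedAddCommGroup H]
    [InnerProductSpace ℂ H] [CompleteSpace H] (A : H →L[ℂ] H) (v : H) :
    IsFiniteMeasure (spectralMeasure A v) :=
  ⟨(spectralMeasure_univ_le A v).trans_lt ENNReal.ofReal_lt_top⟩

theorem integrable_spectralMeasure {H : Type*} [NormedAddCommGroup H]
    [InnerProductSpace ℂ H] [CompleteSpace H] (A : H →L[ℂ] H) (v : H) {F : ℝ → ℂ}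
    (hF : Measurable F) {M : ℝ} (hM : ∀ x, ‖F x‖ ≤ M) : Integrable F (spectralMeasure A v) :=
  Integrable.of_bound hF.aestronglyMeasurable M (Eventually.of_forall hM)

theorem sum_real_spectralMeasure {H : Type*} [NormedAddCommGroup H]
    [InnerProductSpace ℂ H] [CompleteSpace H] (A : H →L[ℂ] H) {ι : Type*} (s : Finset ι)
    (c : ι → ℝ) (v : ι → H)
    (h : ∀ T : H →L[ℂ] H, IsSelfAdjoint T → ∑ i ∈ s, c i * (⟪v i, T (v i)⟫_ℂ).re = 0) {F : ℝ → ℂ}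
    (hF : Measurable F) {M : ℝ} (hM : ∀ x, ‖F x‖ ≤ M) :
    ∑ i ∈ s, (c i : ℂ) * ∫ x, F x ∂(spectralMeasure A (v i)) = 0 := by
  let P : Measure ℝ := ∑ i ∈ s, (c i).toNNReal • spectralMeasure A (v i)
  let N : Measure ℝ := ∑ i ∈ s, (-c i).toNNReal • spectralMeasure A (v i)
  have hfin : ∀ d : ι → ℝ≥0, IsFiniteMeasure (∑ i ∈ s, d i • spectralMeasure A (v i)) := by
    intro d
    constructor
    rw [Measure.finsetSum_apply]
    exact ENNReal.sum_lt_top.2 fun i _ => measure_lt_top _ _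
  have hint : ∀ (d : ι → ℝ≥0) {E : Type} [NormedAddCommGroup E] [NormedSpace ℝ E] (G : ℝ → E)
      (hG : ∀ i, Integrable G (spectralMeasure A (v i))),
      ∫ x, G x ∂(∑ i ∈ s, d i • spectralMeasure A (v i))
        = ∑ i ∈ s, (d i : ℝ) • ∫ x, G x ∂(spectralMeasure A (v i)) := by
    intro d E _ _ G hG
    rw [integral_finsetSum_measure fun i _ => (hG i).smul_measure_nnreal]
    exact Finset.sum_congr rfl fun i _ => integral_smul_nnreal_measure _ _
  have hPN : P = N := by
    have : IsFiniteMeasure P := hfin _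
    have : IsFiniteMeasure N := hfin _
    apply Measure.ext_of_integral_eq_on_compactlySupported
    intro φ
    have hφ : ∀ i, Integrable φ (spectralMeasure A (v i)) := fun i => φ.integrable
    rw [hint _ _ hφ, hint _ _ hφ, ← sub_eq_zero, ← Finset.sum_sub_distrib, ← h (cfc (φ : ℝ → ℝ) A) (cfc_predicate _ _)]
    refine Finset.sum_congr rfl fun i _ => ?_
    rw [integral_spectralMeasure, smul_eq_mul, smul_eq_mul, ← sub_mul]
    congr 1
    simp only [Real.coe_toNNReal', max_def]
    split_ifs <;> linarith
  have hFi := fun i => integrable_spectralMeasure A (v i) hF hM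
  have key : ∫ x, F x ∂P = ∫ x, F x ∂N := by rw [hPN]
  rw [hint _ _ hFi, hint _ _ hFi, ← sub_eq_zero, ← Finset.sum_sub_distrib] at key
  rw [← key]
  refine Finset.sum_congr rfl fun i _ => ?_
  rw [← sub_smul, Complex.real_smul]
  congr 2
  simp only [Real.coe_toNNReal', max_def]
  split_ifs <;> linarith

theorem sum_complex_spectralMeasure {H : Type*} [NormedAddCommGroup H]
    [InnerProductSpace ℂ H] [CompleteSpace H] (A : H →L[ℂ] H) {ι : Type*} (s : Finset ι)
    (c : ι → ℂ) (v : ι → H)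
    (h : ∀ T : H →L[ℂ] H, ∑ i ∈ s, c i * ⟪v i, T (v i)⟫_ℂ = 0) {F : ℝ → ℂ}
    (hF : Measurable F) {M : ℝ} (hM : ∀ x, ‖F x‖ ≤ M) :
    ∑ i ∈ s, c i * ∫ x, F x ∂(spectralMeasure A (v i)) = 0 := by
  have him : ∀ T : H →L[ℂ] H, IsSelfAdjoint T → ∀ x, (⟪x, T x⟫_ℂ).im = 0 := by
    intro T hT x
    have hs : (starRingEnd ℂ) ⟪x, T x⟫_ℂ = ⟪x, T x⟫_ℂ := by
      rw [inner_conj_symm]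
      exact hT.isSymmetric x x
    exact Complex.conj_eq_iff_im.1 hs
  have hre := sum_real_spectralMeasure A s (fun i => (c i).re) v (fun T hT => by
    have := congrArg Complex.re (h T)
    simpa [Complex.re_sum, him T hT] using this) hF hM
  have hi := sum_real_spectralMeasure A s (fun i => (c i).im) v (fun T hT => by
    have := congrArg Complex.im (h T)
    simpa [Complex.im_sum, him T hT] using this) hF hM
  calc ∑ i ∈ s, c i * ∫ x, F x ∂(spectralMeasure A (v i))
      = ∑ i ∈ s, ((c i).re : ℂ) * ∫ x, F x ∂(spectralMeasure A (v i))
        + Complex.I * ∑ i ∈ s, ((c i).im : ℂ) * ∫ x, F x ∂(spectralMeasure A (v i)) := by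
        rw [Finset.mul_sum, ← Finset.sum_add_distrib]
        refine Finset.sum_congr rfl fun i _ => ?_
        conv_lhs => rw [← Complex.re_add_im (c i)]
        ring
    _ = 0 := by rw [hre, hi]; simp

/-- The form `(v, w) ↦ ∫ F dμ_{v,w}` obtained by polarization from the spectral measures. -/
def polarForm {H : Type*} [NormedAddCommGroup H]
    [InnerProductSpace ℂ H] [CompleteSpace H] (A : H →L[ℂ] H) (F : ℝ → ℂ) (v w : H) : ℂ :=
  (1 / 4) * ∑ i : Fin 4, (-Complex.I) ^ (i : ℕ) *
    ∫ x, F x ∂(spectralMeasure A (v + Complex.I ^ (i : ℕ) • w))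

theorem sum_polarForm {H : Type*} [NormedAddCommGroup H]
    [InnerProductSpace ℂ H] [CompleteSpace H] (A : H →L[ℂ] H) {F : ℝ → ℂ}
    (hF : Measurable F) {M : ℝ} (hM : ∀ x, ‖F x‖ ≤ M)
    {ι : Type*} (s : Finset ι) (c : ι → ℂ) (v w : ι → H)
    (h : ∀ T : H →L[ℂ] H, ∑ i ∈ s, c i * ⟪v i, T (w i)⟫_ℂ = 0) :
    ∑ i ∈ s, c i * polarForm A F (v i) (w i) = 0 := by
  have key := sum_complex_spectralMeasure A (s ×ˢ (Finset.univ : Finset (Fin 4)))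
    (fun p => c p.1 * ((1 / 4) * (-Complex.I) ^ (p.2 : ℕ)))
    (fun p => v p.1 + Complex.I ^ (p.2 : ℕ) • w p.1) ?_ hF hM
  · rw [Finset.sum_product] at key
    rw [← key]
    refine Finset.sum_congr rfl fun i _ => ?_
    rw [polarForm, Finset.mul_sum, Finset.mul_sum]
    exact Finset.sum_congr rfl fun j _ => by ring
  · intro T
    rw [Finset.sum_product, ← h T]
    refine Finset.sum_congr rfl fun i _ => ?_
    simp only [Fin.sum_univ_four, map_add, map_smul, inner_add_left, inner_add_right,
      inner_smul_left, inner_smul_right, map_pow, Complex.conj_I]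
    have h2 : Complex.I ^ 2 = -1 := Complex.I_sq
    have h3 : Complex.I ^ 3 = -Complex.I := Complex.I_pow_three
    have h6 : Complex.I ^ 6 = -1 := by
      rw [show (6 : ℕ) = 4 + 2 by norm_num, pow_add, Complex.I_pow_four, h2, one_mul]
    have h7 : Complex.I ^ 7 = -Complex.I := by
      rw [show (7 : ℕ) = 4 + 3 by norm_num, pow_add, Complex.I_pow_four, h3, one_mul]
    norm_num
    ring_nf
    simp only [h2, h3, Complex.I_pow_four, h6, h7]
    ring

theorem norm_polarForm_le {H : Type*} [NormedAddCommGroup H]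
    [InnerProductSpace ℂ H] [CompleteSpace H] (A : H →L[ℂ] H) {F : ℝ → ℂ}
    {M : ℝ} (hM : ∀ x, ‖F x‖ ≤ M) (v w : H) :
    ‖polarForm A F v w‖ ≤ M * (‖v‖ + ‖w‖) ^ 2 := by
  have hM0 : 0 ≤ M := (norm_nonneg _).trans (hM 0)
  have hQ : ∀ u : H, ‖∫ x, F x ∂(spectralMeasure A u)‖ ≤ M * ‖u‖ ^ 2 := by
    intro u
    refine (norm_integral_le_of_norm_le_const (Eventually.of_forall hM)).trans ?_
    gcongr
    exact ENNReal.toReal_le_of_le_ofReal (by positivity) (spectralMeasure_univ_le A u)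
  rw [polarForm, norm_mul]
  have h1 : ∀ i : Fin 4, ‖(-Complex.I) ^ (i : ℕ) *
      ∫ x, F x ∂(spectralMeasure A (v + Complex.I ^ (i : ℕ) • w))‖ ≤ M * (‖v‖ + ‖w‖) ^ 2 := by
    intro i
    rw [norm_mul, norm_pow, norm_neg, Complex.norm_I, one_pow, one_mul]
    refine (hQ _).trans ?_
    gcongr
    refine (norm_add_le _ _).trans ?_
    rw [norm_smul, norm_pow, Complex.norm_I, one_pow, one_mul]
  have h2 := (norm_sum_le Finset.univ _).trans (Finset.sum_le_sum fun i _ => h1 i)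
  rw [Finset.sum_const, Finset.card_univ, Fintype.card_fin, nsmul_eq_mul] at h2
  norm_num at h2 ⊢
  linarith

/-- Existence of the Borel functional calculus for bounded Borel functions. -/
theorem exists_borelCalculus {H : Type*} [NormedAddCommGroup H]
    [InnerProductSpace ℂ H] [CompleteSpace H] (A : H →L[ℂ] H) {F : ℝ → ℂ}
    (hF : Measurable F) (hb : ∃ M : ℝ, ∀ x, ‖F x‖ ≤ M) :
    ∃ T : H →L[ℂ] H, ∀ v, ⟪v, T v⟫_ℂ = ∫ x, F x ∂(spectralMeasure A v) := by
  obtain ⟨M, hM⟩ := hb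
  have hM0 : 0 ≤ M := (norm_nonneg _).trans (hM 0)
  have hsmul : ∀ (a b : ℂ) (v w : H), polarForm A F (a • v) (b • w)
      = (starRingEnd ℂ) a * b * polarForm A F v w := by
    intro a b v w
    have := sum_polarForm A hF hM Finset.univ ![1, -((starRingEnd ℂ) a * b)]
      ![a • v, v] ![b • w, w] (fun T => by
        simp [Fin.sum_univ_two, inner_smul_left, inner_smul_right]
        ring)
    simp only [Fin.sum_univ_two, Matrix.cons_val_zero, Matrix.cons_val_one] at this
    linear_combination this
  have haddl : ∀ v v' w : H, polarForm A F (v + v') w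
      = polarForm A F v w + polarForm A F v' w := by
    intro v v' w
    have := sum_polarForm A hF hM Finset.univ ![1, -1, -1]
      ![v + v', v, v'] ![w, w, w] (fun T => by
        simp [Fin.sum_univ_three, inner_add_left])
    simp [Fin.sum_univ_three] at this
    linear_combination this
  have haddr : ∀ v w w' : H, polarForm A F v (w + w')
      = polarForm A F v w + polarForm A F v w' := by
    intro v w w'
    have := sum_polarForm A hF hM Finset.univ ![1, -1, -1]
      ![v, v, v] ![w + w', w, w'] (fun T => by
        simp [Fin.sum_univ_three, inner_add_right])
    simp [Fin.sum_univ_three] at this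
    linear_combination this
  have hbound : ∀ v w : H, ‖polarForm A F v w‖ ≤ (4 * M) * ‖v‖ * ‖w‖ := by
    intro v w
    by_cases hv : v = 0
    · have := hsmul 0 1 v w
      simp [hv] at this
      simp [hv, this]
    by_cases hw : w = 0
    · have := hsmul 1 0 v w
      simp [hw] at this
      simp [hw, this]
    have hv' : (‖v‖ : ℂ) ≠ 0 := by simpa using hv
    have hw' : (‖w‖ : ℂ) ≠ 0 := by simpa using hw
    have h1 := hsmul (‖v‖ : ℂ) (‖w‖ : ℂ) ((‖v‖ : ℂ)⁻¹ • v) ((‖w‖ : ℂ)⁻¹ • w)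
    rw [smul_inv_smul₀ hv', smul_inv_smul₀ hw'] at h1
    have h2 := norm_polarForm_le A hM ((‖v‖ : ℂ)⁻¹ • v) ((‖w‖ : ℂ)⁻¹ • w)
    have hnv : ‖(‖v‖ : ℂ)⁻¹ • v‖ = 1 := by
      rw [norm_smul, norm_inv, Complex.norm_real, norm_norm,
        inv_mul_cancel₀ (norm_ne_zero_iff.2 hv)]
    have hnw : ‖(‖w‖ : ℂ)⁻¹ • w‖ = 1 := by
      rw [norm_smul, norm_inv, Complex.norm_real, norm_norm,
        inv_mul_cancel₀ (norm_ne_zero_iff.2 hw)]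
    rw [hnv, hnw] at h2
    rw [h1, norm_mul, norm_mul, RCLike.norm_conj, Complex.norm_real, Complex.norm_real, norm_norm,
      norm_norm]
    calc ‖v‖ * ‖w‖ * ‖polarForm A F ((‖v‖ : ℂ)⁻¹ • v) ((‖w‖ : ℂ)⁻¹ • w)‖
        ≤ ‖v‖ * ‖w‖ * (M * (1 + 1) ^ 2) := by gcongr
      _ = _ := by ring
  let B : H →ₗ⋆[ℂ] H →ₗ[ℂ] ℂ := LinearMap.mk₂'ₛₗ (starRingEnd ℂ) (RingHom.id ℂ) (polarForm A F)
    haddl (fun a v w => by simpa using hsmul a 1 v w) haddr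
    (fun b v w => by simpa using hsmul 1 b v w)
  let B' : H →L⋆[ℂ] H →L[ℂ] ℂ := LinearMap.mkContinuous₂ B (4 * M) hbound
  refine ⟨ContinuousLinearMap.adjoint (InnerProductSpace.continuousLinearMapOfBilin B'),
    fun v => ?_⟩
  rw [ContinuousLinearMap.adjoint_inner_right,
    InnerProductSpace.continuousLinearMapOfBilin_apply]
  change polarForm A F v v = _
  have key := sum_complex_spectralMeasure A (Finset.univ : Finset (Option (Fin 4)))
    (fun o => o.elim (-1) fun i => (1 / 4) * (-Complex.I) ^ (i : ℕ))
    (fun o => o.elim v fun i => v + Complex.I ^ (i : ℕ) • v) ?_ hF hM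
  · rw [Fintype.sum_option] at key
    rw [polarForm, Finset.mul_sum]
    simp only [Option.elim, mul_assoc] at key ⊢
    linear_combination key
  · intro T
    rw [Fintype.sum_option]
    simp only [Option.elim, Fin.sum_univ_four, map_add, map_smul, inner_add_left, inner_add_right,
      inner_smul_left, inner_smul_right, map_pow, Complex.conj_I]
    have h2 : Complex.I ^ 2 = -1 := Complex.I_sq
    have h3 : Complex.I ^ 3 = -Complex.I := Complex.I_pow_three
    have h6 : Complex.I ^ 6 = -1 := by
      rw [show (6 : ℕ) = 4 + 2 by norm_num, pow_add, Complex.I_pow_four, h2, one_mul]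
    have h7 : Complex.I ^ 7 = -Complex.I := by
      rw [show (7 : ℕ) = 4 + 3 by norm_num, pow_add, Complex.I_pow_four, h3, one_mul]
    norm_num
    ring_nf
    simp only [h2, h3, Complex.I_pow_four, h6, h7]
    ring

open Classical in
/-- The Borel functional calculus `F(A) = ∫ F(λ) dE(λ)` of a bounded self-adjoint operator `A`: the
bounded operator `T` with `⟨v, T v⟩ = ∫ F dμ_v` for all `v`, where `μ_v` is the spectral measure of
`A` at `v`. On a complex Hilbert space it is unique, and it exists for every bounded Borel
function `F` (`exists_borelCalculus`). -/
def borelFC {H : Type*} [NormedAddCommGroup H]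
    [InnerProductSpace ℂ H] [CompleteSpace H] (F : ℝ → ℂ) (A : H →L[ℂ] H) : H →L[ℂ] H :=
  if h : ∃ T : H →L[ℂ] H, ∀ v, ⟪v, T v⟫_ℂ = ∫ x, F x ∂(spectralMeasure A v) then h.choose else 0

theorem inner_borelFC {H : Type*} [NormedAddCommGroup H]
    [InnerProductSpace ℂ H] [CompleteSpace H] (A : H →L[ℂ] H) {F : ℝ → ℂ}
    (hF : Measurable F) (hb : ∃ M : ℝ, ∀ x, ‖F x‖ ≤ M) (v : H) :
    ⟪v, borelFC F A v⟫_ℂ = ∫ x, F x ∂(spectralMeasure A v) := by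
  have h := exists_borelCalculus A hF hb
  rw [borelFC, dif_pos h]
  exact h.choose_spec v

/-- A measure on a metric space of homogeneous type: balls have positive finite volume and
`V(x, l r) ≤ C l ^ n V(x, r)` for all `l ≥ 1`, with doubling exponent `n`. -/
structure IsDoubling {X : Type*} [MetricSpace X] [MeasurableSpace X] (μ : Measure X)
    (n C : ℝ) : Prop where
  ball_pos : ∀ (x : X) (r : ℝ), 0 < r → 0 < μ (Metric.ball x r)
  ball_lt_top : ∀ (x : X) (r : ℝ), 0 < r → μ (Metric.ball x r) < ∞
  doubling : ∀ (x : X) (r l : ℝ), 0 < r → 1 ≤ l →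
    μ.real (Metric.ball x (l * r)) ≤ C * l ^ n * μ.real (Metric.ball x r)

/-- The exponent `σ_p = |1/p - 1/2|`, for `1 ≤ p ≤ ∞`. -/
def sigmaExp (p : ℝ≥0∞) : ℝ := |(p⁻¹).toReal - 1 / 2|

/-- The operator `T` on `L²(X)` is given by a measurable kernel `K` with
`|K(x, y)| ≤ C max(V(x, k^{1/2}), V(y, k^{1/2}))⁻¹ (1 + d(x, y)² / k)^{-N}`. -/
def HasPolyKernel {X : Type*} [MetricSpace X] [MeasurableSpace X] (μ : Measure X)
    (T : Lp ℂ 2 μ →L[ℂ] Lp ℂ 2 μ) (k : ℕ) (N C : ℝ) : Prop :=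
  ∃ K : X → X → ℂ, Measurable (Function.uncurry K) ∧
    (∀ x y, ‖K x y‖ ≤ C * (max (μ.real (Metric.ball x √k)) (μ.real (Metric.ball y √k)))⁻¹ *
      (1 + dist x y ^ 2 / k) ^ (-N)) ∧
    ∀ f : Lp ℂ 2 μ, ∀ᵐ x ∂μ, T f x = ∫ y, K x y * f y ∂μ

/-- `‖T‖_{p → p} ≤ M`: the operator `T` on `L²(X)` is bounded by `M` in the `L^p` norm on
`L² ∩ L^p`. -/
def LpBound {X : Type*} [MeasurableSpace X] (μ : Measure X)
    (T : Lp ℂ 2 μ →L[ℂ] Lp ℂ 2 μ) (p M : ℝ≥0∞) : Prop :=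
  ∀ f : Lp ℂ 2 μ, MemLp f p μ → eLpNorm (T f) p μ ≤ M * eLpNorm f p μ

/-- The restriction type condition at scale `τ` for the bounded self-adjoint operator `B` on the
interval `(R₁, R₂)`: `‖F(B) B V_τ^{σ_p}‖_{p → 2} ≤ C ‖F‖_q` for all bounded Borel functions `F`
with `supp F ⊆ (R₁, R₂)`. The operator `F(B) B V_τ^{σ_p}` is defined on the dense space of all
`h ∈ L^p` with `V_τ^{σ_p} h ∈ L²`. -/
def RestrictionBound {X : Type*} [MetricSpace X] [MeasurableSpace X] (μ : Measure X)
    (B : Lp ℂ 2 μ →L[ℂ] Lp ℂ 2 μ) (p q : ℝ≥0∞) (τ R₁ R₂ : ℝ) (C : ℝ≥0) : Prop :=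
  ∀ F : ℝ → ℂ, Measurable F → (∃ M : ℝ, ∀ x, ‖F x‖ ≤ M) → tsupport F ⊆ Set.Ioo R₁ R₂ →
    ∀ h : X → ℂ, MemLp h p μ →
      ∀ hV : MemLp (fun x => ((μ.real (Metric.ball x τ) ^ sigmaExp p : ℝ) : ℂ) * h x) 2 μ,
        eLpNorm (borelFC F B (B (hV.toLp _))) 2 μ
          ≤ C * eLpNorm F q volume * eLpNorm h p μ

/-- The symbol `(1 + (2 π ξ)²)^{s/2}` of `(I - d²/dx²)^{s/2}`, for the Fourier transform
`∫ f(x) exp(-2 π i x ξ) dx`. -/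
def besselSymbol (s : ℝ) (ξ : ℝ) : ℝ := (1 + (2 * Real.pi * ξ) ^ 2) ^ (s / 2)

theorem besselSymbol_hasTemperateGrowth (s : ℝ) : (besselSymbol s).HasTemperateGrowth := by
  have h : (fun x : ℝ => (1 + ‖x‖ ^ 2) ^ (s / 2)).HasTemperateGrowth := by fun_prop
  have h2 : (fun ξ : ℝ => 2 * Real.pi * ξ).HasTemperateGrowth := by fun_prop
  have h3 : besselSymbol s
      = (fun x : ℝ => (1 + ‖x‖ ^ 2) ^ (s / 2)) ∘ fun ξ : ℝ => 2 * Real.pi * ξ := by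
    ext ξ
    simp only [besselSymbol, Function.comp_apply, Real.norm_eq_abs, sq_abs]
  rw [h3]
  exact h.comp h2

/-- The operator `(I - d²/dx²)^{s/2}` on Schwartz functions. -/
def besselOp (s : ℝ) : 𝓢(ℝ, ℂ) →L[ℝ] 𝓢(ℝ, ℂ) :=
  SchwartzMap.fourierMultiplierCLM ℂ (besselSymbol s)

/-- The norm `‖F‖_{W^{s,q}} = ‖(I - d²/dx²)^{s/2} F‖_q ∈ [0, ∞]` of a bounded Borel function `F`;
it is `∞` if `F ∉ W^{s,q}(ℝ)`. The derivative is taken in the sense of tempered distributions: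
`g = (I - d²/dx²)^{s/2} F` means that `∫ g φ = ∫ F (I - d²/dx²)^{s/2} φ` for every Schwartz
function `φ`. For `q = 2` this is the norm of `H^s(ℝ)`. -/
def sobolevENorm (s : ℝ) (q : ℝ≥0∞) (F : ℝ → ℂ) : ℝ≥0∞ :=
  ⨅ (g : ℝ → ℂ) (_ : MemLp g q volume)
    (_ : ∀ φ : 𝓢(ℝ, ℂ), ∫ x, g x * φ x = ∫ x, F x * besselOp s φ x), eLpNorm g q volume

end

/-! Write `B` for `A ^ k`. Replacing the metric `d` by `d / √k` keeps the doubling constants and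
turns the kernel hypothesis into a bound at unit scale with decay `(1 + d)^(-2N)` and a constant
independent of `k`. So it is enough to treat one self-adjoint `B` with such a kernel, provided that
no constant depends on the metric. For this reason the main estimates fix their constants first and
quantify over the metric afterwards.

For `1 ≤ p ≤ 2`, an `L^p` bound for `T = F(B) B` follows from two `L²` facts: a bound `a` from `L^p`
weighted by `V^(-σ)` to `L²`, and a bound `b` for the `m`-th moments of `T f` away from the support
of `f`. Cutting `X` into cells of size `ρ`, surrounding each by dyadic annuli and applying Hölder's
inequality gives an `L^p` norm of order `ρ^(nσ) (a + b ρ^(-m))` as soon as `m > n/2`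
(`exists_core_bound`).

Moments come from commutators. If `w` is a 1-Lipschitz weight, the `j`-fold commutator of `w` with
`B` has kernel `(w(x) - w(y))^j K(x, y)`, which is still bounded by an integrable model kernel for
`j ≤ m`. Differentiating `exp(-itB) w^m exp(itB)` then shows that the `m`-th moments of `exp(itB) B
f` grow at most like `(1 + |t|)^m` (`exists_norm_pow_unitaryGroup_le`,
`exists_weighted_unitaryGroup_le`).

Functions `F` enter through `g = (I - d²/dx²)^(s/2) F`. By subordination, `F` is the average over a
Gamma variable `u` of shape `s/2` of the Gaussian averages of `g` at scale `c = √(2u)`. Put `v =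
max(1, 1/c)`. At scale `c`, Fourier inversion and Cauchy-Schwarz give `b` of order `v^(m + 1/2)`,
whereas `a` is of order `v^α` with `α = 0` when `g` is measured in `L^∞` and `α = 1/2` when it is
measured in `L²`. The choice `ρ = v^(1 + (1/2 - α)/m)` balances the two and yields `v^θ` with `θ =
(1 + (1/2 - α)/m) nσ + α` (`exists_gaussAvg_bound`). The Gamma average of `u^(-θ/2)` is finite
exactly for `s > θ` (`exists_besselPotential_bound`). With `α = 1/2` this is `s > nσ + 1/2`. With `α
= 0`, `m = [a]` and `σ ≤ 1/2`, it follows from `s > nσ + n/(4[a])`. The values of `g` far from the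
spectrum are treated separately, by expanding exponentials of `B` in power series on `L^p`
(`enorm_polarForm_gaussAvg_le`). Exponents `p > 2` follow by duality.

In part (ii) the restriction condition supplies the bound `a` with `α = 0` and `r = q` inside the
interval, and outside it the smoothing of `(I - d²/dx²)^(s/2)` off the support of `F` gives a sup
bound (`restriction_near_bound`). Since `F` is only Borel, its mollifications converge only almost
everywhere, but the restriction condition also shows that Lebesgue-null sets inside the interval are
invisible to the spectral calculus applied to `B f` (`RestrictionBound.polarForm_indicator_compl`).
-/

noncomputable section

set_option linter.unusedSimpArgs false
set_option linter.unusedSectionVars false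

/-! ### Duality between weak and strong `L^p` bounds -/

section WeakBounds

variable {α : Type*} [MeasurableSpace α] {μ : Measure α}

/-- Jensen's inequality for the finite measure `a dμ`. -/
theorem lintegral_mul_rpow_le {a φ : α → ℝ≥0∞} (ha : AEMeasurable a μ) (hφ : AEMeasurable φ μ)
    {r : ℝ} (hr : 1 ≤ r) :
    (∫⁻ x, a x * φ x ∂μ) ^ r ≤ (∫⁻ x, a x ∂μ) ^ (r - 1) * ∫⁻ x, a x * φ x ^ r ∂μ := by
  have hr0 : 0 < r := by linarith
  have h1 : 1 / r ≤ 1 := by rw [div_le_one hr0]; exact hr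
  have h2 : 0 ≤ 1 / r := by positivity
  have key := ENNReal.lintegral_mul_norm_pow_le (μ := μ) ha (ha.mul (hφ.pow_const r))
    (p := 1 - 1 / r) (q := 1 / r) (by linarith) h2 (by ring)
  have e : ∀ x, a x ^ (1 - 1 / r) * (a * fun x => φ x ^ r) x ^ (1 / r) = a x * φ x := by
    intro x
    rw [Pi.mul_apply, ENNReal.mul_rpow_of_nonneg _ _ h2, ← mul_assoc,
      ← ENNReal.rpow_add_of_nonneg _ _ (by linarith) h2, ← ENNReal.rpow_mul,
      mul_one_div_cancel hr0.ne', sub_add_cancel, ENNReal.rpow_one, ENNReal.rpow_one]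
  simp only [e] at key
  calc (∫⁻ x, a x * φ x ∂μ) ^ r
      ≤ ((∫⁻ x, a x ∂μ) ^ (1 - 1 / r) * (∫⁻ x, (a * fun x => φ x ^ r) x ∂μ) ^ (1 / r)) ^ r := by
        gcongr
    _ = _ := by
        rw [ENNReal.mul_rpow_of_nonneg _ _ hr0.le, ← ENNReal.rpow_mul, ← ENNReal.rpow_mul,
          one_div_mul_cancel hr0.ne', ENNReal.rpow_one, sub_mul, one_div_mul_cancel hr0.ne', one_mul]
        rfl

theorem enorm_inner_le_lintegral (h g : Lp ℂ 2 μ) :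
    ‖⟪h, g⟫_ℂ‖ₑ ≤ ∫⁻ x, ‖h x‖ₑ * ‖g x‖ₑ ∂μ := by
  rw [L2.inner_def]
  refine (enorm_integral_le_lintegral_enorm _).trans (lintegral_mono fun x => ?_)
  rw [RCLike.inner_apply, enorm_mul, RCLike.enorm_conj, mul_comm]

theorem enorm_inner_le_eLpNorm {p q : ℝ≥0∞} [ENNReal.HolderConjugate p q] (h g : Lp ℂ 2 μ) :
    ‖⟪h, g⟫_ℂ‖ₑ ≤ eLpNorm h q μ * eLpNorm g p μ := by
  refine (enorm_inner_le_lintegral h g).trans ?_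
  have := eLpNorm_smul_le_mul_eLpNorm (p := q) (q := p) (r := 1) (f := g) (φ := h) (μ := μ)
    (Lp.aestronglyMeasurable g) (Lp.aestronglyMeasurable h)
  rw [eLpNorm_one_eq_lintegral_enorm] at this
  simpa [enorm_mul] using this

/-- The weak form of `‖T‖_{p → p} ≤ M`, tested against the dual exponent `q`. -/
def WeakLpBound (μ : Measure α) (T : Lp ℂ 2 μ →L[ℂ] Lp ℂ 2 μ) (p q M : ℝ≥0∞) : Prop :=
  ∀ f h : Lp ℂ 2 μ, MemLp f p μ → MemLp h q μ →
    ‖⟪h, T f⟫_ℂ‖ₑ ≤ M * eLpNorm h q μ * eLpNorm f p μ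

theorem LpBound.weak {T : Lp ℂ 2 μ →L[ℂ] Lp ℂ 2 μ} {p q M : ℝ≥0∞} [ENNReal.HolderConjugate p q]
    (hT : LpBound μ T p M) : WeakLpBound μ T p q M := by
  intro f h hf hh
  refine (enorm_inner_le_eLpNorm (p := p) (q := q) h (T f)).trans ?_
  calc eLpNorm h q μ * eLpNorm (T f) p μ ≤ eLpNorm h q μ * (M * eLpNorm f p μ) := by
        gcongr; exact hT f hf
    _ = _ := by ring

/-- The phase of a complex number, `0` at `0`. -/
def phase (z : ℂ) : ℂ := z / ‖z‖

theorem measurable_phase : Measurable phase := by unfold phase; fun_prop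

theorem enorm_phase_le (z : ℂ) : ‖phase z‖ ≤ 1 := by
  unfold phase
  rw [norm_div, Complex.norm_real, norm_norm]
  exact div_self_le_one _

theorem conj_phase_mul (z : ℂ) : z * (starRingEnd ℂ) (phase z) = ‖z‖ := by
  unfold phase
  by_cases hz : z = 0
  · simp [hz]
  have : (‖z‖ : ℂ) ≠ 0 := by simpa using hz
  rw [map_div₀, Complex.conj_ofReal, mul_div_assoc', Complex.mul_conj, Complex.normSq_eq_norm_sq]
  push_cast
  field_simp

/-- Testing an `L²` function on a set where it is bounded. -/
theorem lintegral_rpow_le_of_inner_le {p q M : ℝ≥0∞} [ENNReal.HolderConjugate p q]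
    (hp : p ≠ ∞)
    (g : Lp ℂ 2 μ) (hg : ∀ h : Lp ℂ 2 μ, MemLp h q μ → ‖⟪h, g⟫_ℂ‖ₑ ≤ M * eLpNorm h q μ)
    {E : Set α} (hE : MeasurableSet E) (hμE : μ E < ∞) {k : ℝ} (hk : ∀ x ∈ E, ‖g x‖ ≤ k) :
    ∫⁻ x in E, ‖g x‖ₑ ^ p.toReal ∂μ ≤ M ^ p.toReal := by
  have hp1 : 1 ≤ p := ENNReal.HolderConjugate.one_le p q
  have hpr : 1 ≤ p.toReal := by
    rw [← ENNReal.toReal_one]; exact ENNReal.toReal_mono hp hp1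
  have hp0 : 0 < p.toReal := by linarith
  set a := ∫⁻ x in E, ‖g x‖ₑ ^ p.toReal ∂μ with ha
  by_cases hE0 : E = ∅
  · simp [ha, hE0]
  obtain ⟨x0, hx0⟩ := Set.nonempty_iff_ne_empty.2 hE0
  have hk0 : 0 ≤ k := (norm_nonneg _).trans (hk x0 hx0)
  have hafin : a ≠ ∞ := by
    have : a ≤ ∫⁻ x in E, ENNReal.ofReal k ^ p.toReal ∂μ := by
      refine setLIntegral_mono' hE fun x hx => ?_
      gcongr
      rw [← ofReal_norm]
      exact ENNReal.ofReal_le_ofReal (hk x hx)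
    refine (this.trans_lt ?_).ne
    rw [setLIntegral_const]
    exact ENNReal.mul_lt_top (ENNReal.rpow_lt_top_of_nonneg hp0.le ENNReal.ofReal_ne_top) hμE
  -- The extremal function in Hölder's inequality, cut off to `E`. Since it is bounded and lives on
  -- a set of finite measure it lies in every `L^r`, so it is an admissible test function in `L² ∩
  -- L^q`.
  let h0 : α → ℂ := E.indicator fun x => phase (g x) * ((‖g x‖ ^ (p.toReal - 1) : ℝ) : ℂ)
  have hgm : AEStronglyMeasurable g μ := Lp.aestronglyMeasurable g
  have hgm' : Measurable g := (Lp.stronglyMeasurable g).measurable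
  have hh0m : Measurable h0 := by
    refine Measurable.indicator ?_ hE
    exact (measurable_phase.comp hgm').mul
      (Complex.measurable_ofReal.comp ((hgm'.norm).pow_const _))
  have hh0b : ∀ x, ‖h0 x‖ ≤ k ^ (p.toReal - 1) := by
    intro x
    by_cases hx : x ∈ E
    · simp only [h0, Set.indicator_of_mem hx, norm_mul, Complex.norm_real]
      rw [Real.norm_of_nonneg (by positivity)]
      calc ‖phase (g x)‖ * ‖g x‖ ^ (p.toReal - 1) ≤ 1 * k ^ (p.toReal - 1) := by
            gcongr
            · exact enorm_phase_le _
            · exact hk x hx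
        _ = _ := one_mul _
    · simp only [h0, Set.indicator_of_notMem hx, norm_zero]; positivity
  have hh0mem : ∀ r : ℝ≥0∞, MemLp h0 r μ := by
    intro r
    have h1 : MemLp h0 r (μ.restrict E) := by
      have : IsFiniteMeasure (μ.restrict E) := ⟨by simpa using hμE⟩
      exact MemLp.of_bound hh0m.aestronglyMeasurable _ (Eventually.of_forall hh0b)
    have h2 : E.indicator h0 = h0 := by
      simp only [h0, Set.indicator_indicator, Set.inter_self]
    rw [← h2]
    exact (memLp_indicator_iff_restrict hE).2 h1
  let h : Lp ℂ 2 μ := (hh0mem 2).toLp h0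
  have hh : h =ᵐ[μ] h0 := MemLp.coeFn_toLp _
  have hin : ‖⟪h, g⟫_ℂ‖ₑ = a := by
    have e1 : ⟪h, g⟫_ℂ = ((∫ x in E, ‖g x‖ ^ p.toReal ∂μ : ℝ) : ℂ) := by
      rw [L2.inner_def, ← integral_complex_ofReal, ← integral_indicator hE]
      refine integral_congr_ae ?_
      filter_upwards [hh] with x hx
      rw [hx, RCLike.inner_apply]
      by_cases hxE : x ∈ E
      · simp only [h0, Set.indicator_of_mem hxE, map_mul, Complex.conj_ofReal]
        rw [← mul_assoc, conj_phase_mul, ← Complex.ofReal_mul]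
        congr 1
        by_cases hz : ‖g x‖ = 0
        · rw [hz, zero_mul, Real.zero_rpow hp0.ne']
        · rw [mul_comm, ← Real.rpow_add_one hz, sub_add_cancel]
      · simp [h0, Set.indicator_of_notMem hxE]
    rw [e1, ← ofReal_norm, Complex.norm_real, Real.norm_of_nonneg (by positivity),
      ofReal_integral_eq_lintegral_ofReal]
    · rw [ha]
      refine lintegral_congr fun x => ?_
      rw [← ENNReal.ofReal_rpow_of_nonneg (norm_nonneg _) hp0.le, ofReal_norm]
    · refine ⟨(hgm'.norm.pow_const _).aestronglyMeasurable, ?_⟩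
      rw [HasFiniteIntegral]
      refine lt_of_eq_of_lt ?_ (lt_top_iff_ne_top.2 hafin)
      rw [ha]
      refine lintegral_congr fun x => ?_
      rw [← ofReal_norm, Real.norm_of_nonneg (by positivity),
        ← ENNReal.ofReal_rpow_of_nonneg (norm_nonneg _) hp0.le, ofReal_norm]
    · exact Eventually.of_forall fun x => by positivity
  have hq : eLpNorm h q μ ≤ a ^ (1 - 1 / p.toReal) := by
    rw [eLpNorm_congr_ae hh]
    by_cases hp1' : p = 1
    · subst hp1'
      have hq' : q = ∞ := (ENNReal.HolderConjugate.eq_top_iff_eq_one q 1).2 rfl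
      rw [hq']
      simp only [ENNReal.toReal_one, div_one, sub_self, ENNReal.rpow_zero]
      rw [eLpNorm_exponent_top]
      refine eLpNormEssSup_le_of_ae_enorm_bound (Eventually.of_forall fun x => ?_)
      have := hh0b x
      simp only [ENNReal.toReal_one, sub_self, Real.rpow_zero] at this
      rw [← ofReal_norm]
      simpa using ENNReal.ofReal_le_ofReal this
    · have hq' : q ≠ ∞ := fun hq => hp1' ((ENNReal.HolderConjugate.eq_top_iff_eq_one q p).1 hq)
      have hq0 : q ≠ 0 := ENNReal.HolderConjugate.ne_zero q p
      have hconj : 1 - 1 / p.toReal = 1 / q.toReal := by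
        have := ENNReal.HolderConjugate.inv_add_inv_eq_one p q
        have := congrArg ENNReal.toReal this
        rw [ENNReal.toReal_add (by simpa using (zero_lt_one.trans_le hp1).ne') (by simpa using hq0),
          ENNReal.toReal_inv, ENNReal.toReal_inv, ENNReal.toReal_one] at this
        rw [one_div, one_div]; linarith
      have hqr : 0 < q.toReal := ENNReal.toReal_pos hq0 hq'
      rw [eLpNorm_eq_lintegral_rpow_enorm_toReal hq0 hq', hconj]
      gcongr
      rw [ha, ← lintegral_indicator hE]
      refine lintegral_mono fun x => ?_
      by_cases hx : x ∈ E
      · simp only [h0, Set.indicator_of_mem hx]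
        have e : p.toReal = (p.toReal - 1) * q.toReal := by
          have h3 : q.toReal ≠ 0 := hqr.ne'
          field_simp at hconj
          linarith
        conv_rhs => rw [e]
        rw [ENNReal.rpow_mul]
        gcongr
        rw [enorm_mul]
        calc _ ≤ 1 * ‖g x‖ₑ ^ (p.toReal - 1) := by
              gcongr
              · rw [← ofReal_norm]
                simpa using ENNReal.ofReal_le_ofReal (enorm_phase_le (g x))
              · rw [← ofReal_norm, Complex.norm_real, Real.norm_of_nonneg (by positivity),
                  ← ENNReal.ofReal_rpow_of_nonneg (norm_nonneg _) (by linarith),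
                  ofReal_norm]
          _ = _ := one_mul _
      · simp only [h0, Set.indicator_of_notMem hx]
        simp [hqr]
  have h3 := hg h ((memLp_congr_ae hh).2 (hh0mem q))
  rw [hin] at h3
  -- The norm of the test function is a power of `a` itself, so the bound is self-improving: `a` is
  -- finite because `g` is bounded on `E`, and one may divide by `a ^ (1 - 1/p)`.
  have h4 : a ≤ M * a ^ (1 - 1 / p.toReal) := h3.trans (by gcongr)
  by_cases ha0 : a = 0
  · rw [ha0]; exact zero_le
  have h5 : a ^ (1 / p.toReal) ≤ M := by
    have e : a = a ^ (1 / p.toReal) * a ^ (1 - 1 / p.toReal) := by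
      rw [← ENNReal.rpow_add _ _ ha0 hafin]
      simp
    have hne : a ^ (1 - 1 / p.toReal) ≠ 0 := by
      simp [ENNReal.rpow_eq_zero_iff, ha0, hafin]
    have hnt : a ^ (1 - 1 / p.toReal) ≠ ∞ := by
      simp [ENNReal.rpow_eq_top_iff, ha0, hafin]
    conv_lhs at h4 => rw [e]
    exact (ENNReal.mul_le_mul_iff_left hne hnt).1 h4
  calc a = (a ^ (1 / p.toReal)) ^ p.toReal := by
        rw [← ENNReal.rpow_mul, one_div_mul_cancel hp0.ne', ENNReal.rpow_one]
    _ ≤ _ := by gcongr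

/-- Converse of Hölder's inequality when only test functions in `L²` are allowed. For `p < ∞` the
sets where `|g|` is bounded, intersected with sets of finite measure, exhaust the space, and
monotone convergence concludes. For `p = ∞` the phase of `g` on a finite piece of `{|g| > M}` would
violate the hypothesis. -/
theorem eLpNorm_le_of_inner_le [SigmaFinite μ] {p q M : ℝ≥0∞} [ENNReal.HolderConjugate p q]
    (g : Lp ℂ 2 μ) (hg : ∀ h : Lp ℂ 2 μ, MemLp h q μ → ‖⟪h, g⟫_ℂ‖ₑ ≤ M * eLpNorm h q μ) :
    eLpNorm g p μ ≤ M := by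
  by_cases hM : M = ∞
  · rw [hM]; exact le_top
  have hgm' : Measurable g := (Lp.stronglyMeasurable g).measurable
  by_cases hp : p = ∞
  · have hq : q = 1 := (ENNReal.HolderConjugate.eq_top_iff_eq_one p q).1 hp
    subst hp hq
    rw [eLpNorm_exponent_top]
    refine essSup_le_of_ae_le _ ?_
    by_contra hcon
    have hS : MeasurableSet {x | ¬ ‖g x‖ₑ ≤ M} :=
      (measurableSet_le hgm'.enorm measurable_const).compl
    have hpos : 0 < μ {x | ¬ ‖g x‖ₑ ≤ M} := pos_iff_ne_zero.2 fun h0 => hcon (by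
      rw [EventuallyLE, ae_iff]; exact h0)
    obtain ⟨E, hEsub, hEm, hE0, hEfin⟩ : ∃ E ⊆ {x | ¬ ‖g x‖ₑ ≤ M}, MeasurableSet E ∧ 0 < μ E ∧ μ E < ∞ := by
      obtain ⟨E, h1, h2, h3, h4⟩ := Measure.exists_subset_measure_lt_top hS hpos
      exact ⟨E, h2, h1, h3, h4⟩
    let h0 : α → ℂ := E.indicator fun x => phase (g x)
    have hh0m : Measurable h0 := (measurable_phase.comp hgm').indicator hEm
    have hh0mem : ∀ r : ℝ≥0∞, MemLp h0 r μ := by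
      intro r
      have : IsFiniteMeasure (μ.restrict E) := ⟨by simpa using hEfin⟩
      exact (memLp_indicator_iff_restrict hEm).2 (MemLp.of_bound
        (measurable_phase.comp hgm').aestronglyMeasurable 1 (Eventually.of_forall fun x => enorm_phase_le _))
    let h : Lp ℂ 2 μ := (hh0mem 2).toLp h0
    have hh : h =ᵐ[μ] h0 := MemLp.coeFn_toLp _
    have h1 : eLpNorm h 1 μ ≤ μ E := by
      rw [eLpNorm_congr_ae hh, eLpNorm_one_eq_lintegral_enorm, ← one_mul (μ E), ← setLIntegral_const,
        ← lintegral_indicator hEm]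
      refine lintegral_mono fun x => ?_
      by_cases hx : x ∈ E
      · simp only [h0, Set.indicator_of_mem hx]
        rw [← ofReal_norm]
        simpa using ENNReal.ofReal_le_ofReal (enorm_phase_le (g x))
      · simp [h0, Set.indicator_of_notMem hx]
    have hint : IntegrableOn (fun x => ‖g x‖) E μ := by
      have : IsFiniteMeasure (μ.restrict E) := ⟨by simpa using hEfin⟩
      exact (((Lp.memLp g).restrict E).integrable (by norm_num)).norm
    have hin : ‖⟪h, g⟫_ℂ‖ₑ = ∫⁻ x in E, ‖g x‖ₑ ∂μ := by
      have e1 : ⟪h, g⟫_ℂ = ((∫ x in E, ‖g x‖ ∂μ : ℝ) : ℂ) := by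
        rw [L2.inner_def, ← integral_complex_ofReal, ← integral_indicator hEm]
        refine integral_congr_ae ?_
        filter_upwards [hh] with x hx
        rw [hx, RCLike.inner_apply]
        by_cases hxE : x ∈ E
        · simp only [h0, Set.indicator_of_mem hxE]
          rw [conj_phase_mul]
        · simp [h0, Set.indicator_of_notMem hxE]
      rw [e1, ← ofReal_norm, Complex.norm_real, Real.norm_of_nonneg (by positivity),
        ofReal_integral_eq_lintegral_ofReal hint (Eventually.of_forall fun x => norm_nonneg _)]
      simp_rw [ofReal_norm]
    have h2 := hg h ((memLp_congr_ae hh).2 (hh0mem 1))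
    rw [hin] at h2
    have h3 : ∫⁻ x in E, ‖g x‖ₑ ∂μ ≤ ∫⁻ x in E, M ∂μ := by
      rw [setLIntegral_const]; exact h2.trans (by gcongr)
    have h4 : ∫⁻ x in E, M ∂μ < ∫⁻ x in E, ‖g x‖ₑ ∂μ := by
      refine setLIntegral_strict_mono hEm hE0.ne' hgm'.enorm ?_ ?_
      · rw [setLIntegral_const]; exact ENNReal.mul_ne_top hM hEfin.ne
      · exact Eventually.of_forall fun x hx => not_le.1 (hEsub hx)
    exact absurd h3 (not_le.2 h4)
  · have hp0 : p ≠ 0 := ENNReal.HolderConjugate.ne_zero p q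
    have hpr : 0 < p.toReal := ENNReal.toReal_pos hp0 hp
    let E : ℕ → Set α := fun k => spanningSets μ k ∩ {x | ‖g x‖ ≤ k}
    have hEm : ∀ k, MeasurableSet (E k) := fun k =>
      (measurableSet_spanningSets μ k).inter (measurableSet_le hgm'.norm measurable_const)
    have hEmono : Monotone E := by
      intro i j hij x hx
      exact ⟨monotone_spanningSets μ hij hx.1,
        (show ‖g x‖ ≤ i from hx.2).trans (by exact_mod_cast hij)⟩
    have hEU : ⋃ k, E k = Set.univ := by
      refine Set.eq_univ_of_forall fun x => ?_
      have h1 : x ∈ ⋃ k, spanningSets μ k := by rw [iUnion_spanningSets]; trivial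
      obtain ⟨i, hi⟩ := Set.mem_iUnion.1 h1
      obtain ⟨j, hj⟩ := exists_nat_ge ‖g x‖
      refine Set.mem_iUnion.2 ⟨max i j, monotone_spanningSets μ (le_max_left _ _) hi, hj.trans ?_⟩
      exact_mod_cast le_max_right i j
    rw [eLpNorm_eq_lintegral_rpow_enorm_toReal hp0 hp]
    rw [one_div, ENNReal.rpow_inv_le_iff hpr]
    have hν : ∀ k, (μ.withDensity fun x => ‖g x‖ₑ ^ p.toReal) (E k) ≤ M ^ p.toReal := by
      intro k
      rw [withDensity_apply _ (hEm k)]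
      exact lintegral_rpow_le_of_inner_le hp g hg (hEm k)
        ((measure_mono Set.inter_subset_left).trans_lt (measure_spanningSets_lt_top μ k))
        fun x hx => hx.2
    rw [← setLIntegral_univ, ← withDensity_apply _ MeasurableSet.univ, ← hEU,
      hEmono.measure_iUnion]
    exact iSup_le hν

theorem WeakLpBound.lpBound [SigmaFinite μ] {T : Lp ℂ 2 μ →L[ℂ] Lp ℂ 2 μ} {p q M : ℝ≥0∞}
    [ENNReal.HolderConjugate p q] (hT : WeakLpBound μ T p q M) : LpBound μ T p M := by
  intro f hf
  refine eLpNorm_le_of_inner_le (q := q) _ fun h hh => ?_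
  rw [mul_right_comm]
  exact hT f h hf hh

/-- The weak form is symmetric under taking adjoints and exchanging `p` and `q`. This is how
exponents above `2` are reduced to exponents below `2`. -/
theorem WeakLpBound.of_adjoint {T S : Lp ℂ 2 μ →L[ℂ] Lp ℂ 2 μ} {p q M : ℝ≥0∞}
    (h : ∀ f g : Lp ℂ 2 μ, ⟪g, T f⟫_ℂ = ⟪S g, f⟫_ℂ)
    (hS : WeakLpBound μ S q p M) : WeakLpBound μ T p q M := by
  intro f g hf hg
  rw [h, ← inner_conj_symm, RCLike.enorm_conj, mul_right_comm]
  exact hS g f hg hf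

end WeakBounds

/-! ### Doubling measures: integrals of decaying functions and partitions -/

section Geometry

variable {X : Type*} [MetricSpace X] [MeasurableSpace X] {μ : Measure X} {n C : ℝ}

theorem IsDoubling.mono (hX : IsDoubling μ n C) {C' : ℝ} (h : C ≤ C') : IsDoubling μ n C' where
  ball_pos := hX.ball_pos
  ball_lt_top := hX.ball_lt_top
  doubling x r l hr hl := (hX.doubling x r l hr hl).trans (by gcongr)

theorem IsDoubling.measure_ball_mul_le (hX : IsDoubling μ n C) (x : X) {r l : ℝ} (hr : 0 < r)
    (hl : 1 ≤ l) :
    μ (Metric.ball x (l * r)) ≤ ENNReal.ofReal (C * l ^ n) * μ (Metric.ball x r) := by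
  have h := hX.doubling x r l hr hl
  have h1 : μ (Metric.ball x (l * r)) ≠ ∞ := (hX.ball_lt_top x _ (by positivity)).ne
  have h2 : μ (Metric.ball x r) ≠ ∞ := (hX.ball_lt_top x _ hr).ne
  have hpos : 0 < μ.real (Metric.ball x r) := ENNReal.toReal_pos (hX.ball_pos x r hr).ne' h2
  have hC : 0 ≤ C * l ^ n := by
    by_contra hneg
    have : C * l ^ n * μ.real (Metric.ball x r) < 0 := mul_neg_of_neg_of_pos (not_le.1 hneg) hpos
    linarith [measureReal_nonneg (μ := μ) (s := Metric.ball x (l * r))]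
  rw [← ENNReal.ofReal_toReal h1, ← ENNReal.ofReal_toReal h2, ← ENNReal.ofReal_mul hC]
  exact ENNReal.ofReal_le_ofReal h

theorem IsDoubling.measure_ball_le (hX : IsDoubling μ n C) (x y : X) {r R : ℝ} (hr : 0 < r)
    (hR : r ≤ R + dist x y) :
    μ (Metric.ball x R) ≤ ENNReal.ofReal (C * ((R + dist x y) / r) ^ n) * μ (Metric.ball y r) := by
  refine le_trans (measure_mono ?_) (hX.measure_ball_mul_le y hr ((one_le_div hr).2 hR))
  rw [div_mul_cancel₀ _ hr.ne']
  intro z hz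
  rw [Metric.mem_ball] at hz ⊢
  linarith [dist_triangle z x y]

theorem IsDoubling.sigmaFinite (hX : IsDoubling μ n C) : SigmaFinite μ := by
  rcases isEmpty_or_nonempty X with h | ⟨⟨x⟩⟩
  · have : μ = 0 := Measure.eq_zero_of_isEmpty μ
    rw [this]; infer_instance
  · refine ⟨⟨⟨fun i => Metric.ball x (i + 1), fun _ => trivial,
      fun i => hX.ball_lt_top x _ (by positivity), ?_⟩⟩⟩
    refine Set.eq_univ_of_forall fun y => ?_
    obtain ⟨i, hi⟩ := exists_nat_ge (dist y x)
    exact Set.mem_iUnion.2 ⟨i, by rw [Metric.mem_ball]; linarith⟩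

theorem measurable_measure_ball [TopologicalSpace.SeparableSpace X] [BorelSpace X] [SFinite μ]
    (r : ℝ) : Measurable fun x => μ (Metric.ball x r) := by
  have : SecondCountableTopology X := UniformSpace.secondCountable_of_separable X
  have hs : MeasurableSet {p : X × X | dist p.2 p.1 < r} :=
    (isOpen_lt (by fun_prop) continuous_const).measurableSet
  exact measurable_measure_prodMk_left hs

/-- A bound for `∫ (1 + d(x, y))^{-l} dμ(y) / V(x, 1)`. -/
def decayConst (n C l : ℝ) : ℝ≥0∞ :=
  ∑' i : ℕ, ENNReal.ofReal (2 ^ l * C) * ENNReal.ofReal (2 ^ (n - l)) ^ i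

theorem decayConst_ne_top {n C l : ℝ} (hl : n < l) : decayConst n C l ≠ ∞ := by
  rw [decayConst, ENNReal.tsum_mul_left]
  refine ENNReal.mul_ne_top ENNReal.ofReal_ne_top ?_
  rw [ENNReal.tsum_geometric]
  refine ENNReal.inv_ne_top.2 ?_
  rw [ne_eq, tsub_eq_zero_iff_le, not_le, ENNReal.ofReal_lt_one]
  exact Real.rpow_lt_one_of_one_lt_of_neg (by norm_num) (by linarith)

/-- A single term suffices, that of the least power of `2` exceeding `d`. Written as a sum over
balls, the tail becomes accessible to the doubling condition. -/
theorem one_add_rpow_neg_le_tsum {l : ℝ} (hl : 0 ≤ l) {d : ℝ} (hd : 0 ≤ d) :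
    ENNReal.ofReal ((1 + d) ^ (-l)) ≤
      ∑' i : ℕ, ENNReal.ofReal (2 ^ l * (2 ^ (-l)) ^ i) * (Set.Iio ((2 : ℝ) ^ i)).indicator 1 d := by
  have h2l : (1 : ℝ) ≤ 2 ^ l := Real.one_le_rpow (by norm_num) hl
  have key : ∃ i : ℕ, d < 2 ^ i ∧ (1 + d) ^ (-l) ≤ 2 ^ l * (2 ^ (-l)) ^ i := by
    by_cases h1 : d < 1
    · refine ⟨0, by simpa using h1, ?_⟩
      rw [pow_zero, mul_one]
      exact (Real.rpow_le_one_of_one_le_of_nonpos (by linarith) (by linarith)).trans h2l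
    · obtain ⟨i, hi1, hi2⟩ := exists_nat_pow_near (not_lt.1 h1) (by norm_num : (1 : ℝ) < 2)
      refine ⟨i + 1, hi2, ?_⟩
      rw [pow_succ, mul_comm (((2 : ℝ) ^ (-l)) ^ i), ← mul_assoc, ← Real.rpow_add (by norm_num),
        add_neg_cancel, Real.rpow_zero, one_mul, ← Real.rpow_natCast, ← Real.rpow_mul (by norm_num),
        mul_comm, Real.rpow_mul (by norm_num), Real.rpow_natCast]
      exact Real.rpow_le_rpow_of_nonpos (by positivity) (by linarith) (by linarith)
  obtain ⟨i, hi, hle⟩ := key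
  refine le_trans ?_ (ENNReal.le_tsum i)
  rw [Set.indicator_of_mem (show d ∈ Set.Iio ((2 : ℝ) ^ i) from hi), Pi.one_apply, mul_one]
  exact ENNReal.ofReal_le_ofReal hle

/-- The ball of radius `2^i` costs `C 2^(in)` times the unit ball and carries the weight `2^(-li)`,
so the bound is a geometric series of ratio `2^(n-l)`. The inequality holds for all `l ≥ 0`; the
constant is finite when `l > n`. -/
theorem IsDoubling.lintegral_decay_le [BorelSpace X] (hX : IsDoubling μ n C) {l : ℝ} (hl : 0 ≤ l)
    (x : X) :
    ∫⁻ y, ENNReal.ofReal ((1 + dist x y) ^ (-l)) ∂μ ≤ decayConst n C l * μ (Metric.ball x 1) := by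
  calc ∫⁻ y, ENNReal.ofReal ((1 + dist x y) ^ (-l)) ∂μ
      ≤ ∫⁻ y, ∑' i : ℕ, ENNReal.ofReal (2 ^ l * (2 ^ (-l)) ^ i) *
          (Metric.ball x ((2 : ℝ) ^ i)).indicator 1 y ∂μ := by
        refine lintegral_mono fun y => (one_add_rpow_neg_le_tsum hl dist_nonneg).trans_eq ?_
        refine tsum_congr fun i => ?_
        congr 1
        by_cases h : dist x y < 2 ^ i
        · rw [Set.indicator_of_mem (show dist x y ∈ Set.Iio ((2 : ℝ) ^ i) from h),
            Set.indicator_of_mem (show y ∈ Metric.ball x (2 ^ i) from by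
              rwa [Metric.mem_ball, dist_comm])]
          rfl
        · rw [Set.indicator_of_notMem (show dist x y ∉ Set.Iio ((2 : ℝ) ^ i) from h),
            Set.indicator_of_notMem (show y ∉ Metric.ball x (2 ^ i) from by
              rwa [Metric.mem_ball, dist_comm])]
    _ = ∑' i : ℕ, ENNReal.ofReal (2 ^ l * (2 ^ (-l)) ^ i) * μ (Metric.ball x (2 ^ i)) := by
        rw [lintegral_tsum fun i => ((measurable_one.indicator
          Metric.isOpen_ball.measurableSet).const_mul _).aemeasurable]
        refine tsum_congr fun i => ?_
        rw [lintegral_const_mul _ (measurable_one.indicator Metric.isOpen_ball.measurableSet),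
          lintegral_indicator_one Metric.isOpen_ball.measurableSet]
    _ ≤ ∑' i : ℕ, ENNReal.ofReal (2 ^ l * C) * ENNReal.ofReal (2 ^ (n - l)) ^ i *
          μ (Metric.ball x 1) := by
        refine ENNReal.tsum_le_tsum fun i => ?_
        have h := hX.measure_ball_mul_le x one_pos (one_le_pow₀ (by norm_num : (1 : ℝ) ≤ 2) (n := i))
        rw [mul_one] at h
        calc _ ≤ ENNReal.ofReal (2 ^ l * (2 ^ (-l)) ^ i) *
              (ENNReal.ofReal (C * (2 ^ i) ^ n) * μ (Metric.ball x 1)) := by gcongr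
          _ = _ := by
            rw [← mul_assoc, ← ENNReal.ofReal_pow (by positivity), ← ENNReal.ofReal_mul (by positivity),
              ← ENNReal.ofReal_mul' (by positivity)]
            congr 2
            have e : ((2 : ℝ) ^ (n - l)) ^ i = (2 ^ (-l)) ^ i * (2 ^ i) ^ n := by
              rw [sub_eq_neg_add, Real.rpow_add (by norm_num), mul_pow, ← Real.rpow_natCast (2 ^ n),
                ← Real.rpow_mul (by norm_num), mul_comm n, Real.rpow_mul (by norm_num),
                Real.rpow_natCast]
            rw [e]; ring
    _ = _ := by rw [ENNReal.tsum_mul_right, decayConst]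

/-- A countable measurable partition of `X` into sets of size `ρ` with bounded overlap of the
enlarged balls. -/
theorem IsDoubling.exists_partition [TopologicalSpace.SeparableSpace X] [BorelSpace X]
    (hX : IsDoubling μ n C) (hn : 0 ≤ n) {ρ : ℝ} (hρ : 0 < ρ) :
    ∃ (s : Set X) (Q : s → Set X), s.Countable ∧ (∀ c, MeasurableSet (Q c)) ∧
      Pairwise (Function.onFun Disjoint Q) ∧ (⋃ c, Q c) = Set.univ ∧
      (∀ c, Q c ⊆ Metric.ball (c : X) ρ) ∧
      ∀ (x : X) (i : ℕ), ∑' c : s, (Metric.ball (c : X) (2 ^ (i + 1) * ρ)).indicator 1 x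
        ≤ ENNReal.ofReal (C * (48 * 2 ^ i) ^ n) := by
  -- Balls of radius `ρ/6` are made disjoint, and enlarging them five times covers `X`. Since `5ρ/6
  -- < ρ`, the open balls of radius `ρ` also cover.
  obtain ⟨s, -, hdisj, hcov⟩ := Vitali.exists_disjoint_subfamily_covering_enlargement_closedBall
    (Set.univ : Set X) id (fun _ => ρ / 6) (ρ / 6) (fun _ _ => le_rfl) 5 (by norm_num)
  simp only [id] at hdisj hcov
  have hdisj' : s.PairwiseDisjoint fun a => Metric.ball a (ρ / 6) :=
    hdisj.mono fun a => Metric.ball_subset_closedBall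
  have hs : s.Countable := hdisj'.countable_of_isOpen (fun _ _ => Metric.isOpen_ball)
    fun a _ => ⟨a, Metric.mem_ball_self (by positivity)⟩
  have : Encodable s := hs.toEncodable
  -- The cover becomes a partition by giving each point to the first ball, in the enumeration of
  -- `s`, that contains it.
  let Q : s → Set X := fun c => Metric.ball (c : X) ρ \
    ⋃ d : {d : s // Encodable.encode d < Encodable.encode c}, Metric.ball ((d : s) : X) ρ
  have hcount : Countable s := hs.to_subtype
  refine ⟨s, Q, hs, fun c => ?_, ?_, ?_, fun c => Set.sdiff_subset, ?_⟩
  · exact Metric.isOpen_ball.measurableSet.diff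
      (isOpen_iUnion fun d => Metric.isOpen_ball).measurableSet
  · have hlt : ∀ c d : s, Encodable.encode c < Encodable.encode d → Disjoint (Q c) (Q d) := by
      intro c d hcd
      refine Set.disjoint_left.2 fun x hx hx' => hx'.2 ?_
      exact Set.mem_iUnion.2 ⟨⟨c, hcd⟩, hx.1⟩
    intro c d hcd
    rcases lt_trichotomy (Encodable.encode c) (Encodable.encode d) with h | h | h
    · exact hlt c d h
    · exact absurd (Encodable.encode_injective h) hcd
    · exact (hlt d c h).symm
  · refine Set.eq_univ_of_forall fun x => ?_
    have hex : ∃ k : ℕ, ∃ c : s, Encodable.encode c = k ∧ x ∈ Metric.ball (c : X) ρ := by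
      obtain ⟨b, hb, hxb⟩ := hcov x (Set.mem_univ x)
      refine ⟨_, ⟨b, hb⟩, rfl, ?_⟩
      have := hxb (Metric.mem_closedBall_self (by positivity))
      rw [Metric.mem_closedBall] at this
      rw [Metric.mem_ball]
      linarith
    classical
    obtain ⟨c, hc, hxc⟩ := Nat.find_spec hex
    refine Set.mem_iUnion.2 ⟨c, hxc, fun hx => ?_⟩
    obtain ⟨⟨d, hd⟩, hxd⟩ := Set.mem_iUnion.1 hx
    exact Nat.find_min hex (hc ▸ hd) ⟨d, rfl, hxd⟩
  · intro x i
    classical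
    have h2 : (1 : ℝ) ≤ 2 ^ i := one_le_pow₀ (by norm_num)
    set R : ℝ := 2 ^ (i + 2) * ρ with hR
    have hRρ : R = 4 * (2 ^ i * ρ) := by rw [hR]; ring
    have hρi : ρ ≤ 2 ^ i * ρ := le_mul_of_one_le_left hρ.le h2
    have hRpos : 0 < R := by positivity
    set K := ENNReal.ofReal (C * (48 * 2 ^ i) ^ n)
    -- Packing argument: each centre counted at `x` owns one of the disjoint balls of radius `ρ/6`,
    -- which lies in the ball of radius `R = 4 · 2^i ρ` about `x`. Doubling shows that its measure
    -- is at least `V(x, R) / K`, because `R` plus the distance to the centre is at most `48 · 2^i`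
    -- times `ρ/6`.
    have hstep : (∑' c : s, (Metric.ball (c : X) (2 ^ (i + 1) * ρ)).indicator 1 x) *
        μ (Metric.ball x R) ≤ K * μ (Metric.ball x R) := by
      rw [← ENNReal.tsum_mul_right]
      calc ∑' c : s, (Metric.ball (c : X) (2 ^ (i + 1) * ρ)).indicator 1 x * μ (Metric.ball x R)
          ≤ ∑' c : s, K * μ (if x ∈ Metric.ball (c : X) (2 ^ (i + 1) * ρ) then
              Metric.ball (c : X) (ρ / 6) else ∅) := by
            refine ENNReal.tsum_le_tsum fun c => ?_
            by_cases hx : x ∈ Metric.ball (c : X) (2 ^ (i + 1) * ρ)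
            · rw [if_pos hx, Set.indicator_of_mem hx, Pi.one_apply, one_mul]
              have hx' : dist x c < R / 2 := by
                rw [Metric.mem_ball] at hx; rw [hRρ]; rw [pow_succ] at hx; linarith
              have hd0 : 0 ≤ dist x (c : X) := dist_nonneg
              refine (hX.measure_ball_le x c (by positivity : 0 < ρ / 6) (by linarith)).trans ?_
              have hC : 0 ≤ C := by
                by_contra hneg
                have h := hX.doubling x 1 1 one_pos le_rfl
                have hpos : 0 < μ.real (Metric.ball x 1) :=
                  ENNReal.toReal_pos (hX.ball_pos x 1 one_pos).ne' (hX.ball_lt_top x 1 one_pos).ne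
                rw [Real.one_rpow, mul_one, mul_one] at h
                nlinarith
              have : (R + dist x c) / (ρ / 6) ≤ 48 * 2 ^ i := by
                rw [div_le_iff₀ (by positivity)]
                rw [hRρ] at hx' ⊢
                linarith
              simp only [K]
              gcongr
            · rw [Set.indicator_of_notMem hx]; simp
        _ = K * ∑' c : s, μ (if x ∈ Metric.ball (c : X) (2 ^ (i + 1) * ρ) then
              Metric.ball (c : X) (ρ / 6) else ∅) := ENNReal.tsum_mul_left
        _ ≤ K * μ (Metric.ball x R) := by
            gcongr
            refine (tsum_meas_le_meas_iUnion_of_disjoint μ (fun c => ?_) ?_).trans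
              (measure_mono (Set.iUnion_subset fun c => ?_))
            · split_ifs
              · exact Metric.isOpen_ball.measurableSet
              · exact MeasurableSet.empty
            · intro c d hcd
              have h1 := hdisj' c.2 d.2 (fun h => hcd (Subtype.ext h))
              simp only [Function.onFun]
              split_ifs
              · exact h1
              all_goals simp
            · split_ifs with hx
              · intro z hz
                rw [Metric.mem_ball] at hx hz ⊢
                rw [hRρ]
                rw [pow_succ] at hx
                linarith [dist_triangle z (c : X) x, dist_comm x (c : X)]
              · exact Set.empty_subset _
    exact (ENNReal.mul_le_mul_iff_left (hX.ball_pos x R hRpos).ne' (hX.ball_lt_top x R hRpos).ne).1 hstep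

end Geometry

/-! ### Multiplication operators by bounded weights -/

section MulOp

variable {α : Type*} [MeasurableSpace α] {μ : Measure α}

theorem memLp_ofReal_mul {w : α → ℝ} (hw : Measurable w) {R : ℝ} (hR : ∀ x, |w x| ≤ R) {p : ℝ≥0∞}
    {f : α → ℂ} (hf : MemLp f p μ) : MemLp (fun x => (w x : ℂ) * f x) p μ :=
  MemLp.of_le_mul hf ((Complex.measurable_ofReal.comp hw).aestronglyMeasurable.mul hf.1) (c := R)
    (Eventually.of_forall fun x => by
      rw [norm_mul, Complex.norm_real, Real.norm_eq_abs]
      exact mul_le_mul_of_nonneg_right (hR x) (norm_nonneg _))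

/-- Multiplication by a bounded measurable real function on `L²`. -/
def mulOp (μ : Measure α) (w : α → ℝ) (hw : Measurable w) (R : ℝ) (hR : ∀ x, |w x| ≤ R) :
    Lp ℂ 2 μ →L[ℂ] Lp ℂ 2 μ :=
  LinearMap.mkContinuous
    { toFun := fun f => (memLp_ofReal_mul hw hR (Lp.memLp f)).toLp _
      map_add' := fun f g => by
        rw [← MemLp.toLp_add]
        refine MemLp.toLp_congr _ _ ?_
        filter_upwards [Lp.coeFn_add f g] with x hx
        simp only [hx, Pi.add_apply, mul_add]
      map_smul' := fun c f => by
        rw [RingHom.id_apply, ← MemLp.toLp_const_smul]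
        refine MemLp.toLp_congr _ _ ?_
        filter_upwards [Lp.coeFn_smul c f] with x hx
        simp only [hx, Pi.smul_apply, smul_eq_mul]
        ring }
    R fun f => by
      refine Lp.norm_le_mul_norm_of_ae_le_mul ?_
      filter_upwards [MemLp.coeFn_toLp (memLp_ofReal_mul hw hR (Lp.memLp f))] with x hx
      simp only [LinearMap.coe_mk, AddHom.coe_mk]
      rw [hx, norm_mul, Complex.norm_real, Real.norm_eq_abs]
      exact mul_le_mul_of_nonneg_right (hR x) (norm_nonneg _)

variable {w : α → ℝ} {hw : Measurable w} {R : ℝ} {hR : ∀ x, |w x| ≤ R}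

theorem coeFn_mulOp (f : Lp ℂ 2 μ) : mulOp μ w hw R hR f =ᵐ[μ] fun x => (w x : ℂ) * f x :=
  MemLp.coeFn_toLp (memLp_ofReal_mul hw hR (Lp.memLp f))

theorem coeFn_mulOp_pow (j : ℕ) (f : Lp ℂ 2 μ) :
    (mulOp μ w hw R hR ^ j) f =ᵐ[μ] fun x => (w x : ℂ) ^ j * f x := by
  induction j with
  | zero => simp
  | succ j ih =>
    rw [pow_succ', mul_apply_eq_comp]
    filter_upwards [ih, coeFn_mulOp (hw := hw) (hR := hR) ((mulOp μ w hw R hR ^ j) f)] with x h1 h2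
    rw [h2, h1]; ring

theorem inner_mulOp (h f : Lp ℂ 2 μ) :
    ⟪h, mulOp μ w hw R hR f⟫_ℂ = ⟪mulOp μ w hw R hR h, f⟫_ℂ := by
  rw [L2.inner_def, L2.inner_def]
  refine integral_congr_ae ?_
  filter_upwards [coeFn_mulOp (hw := hw) (hR := hR) f, coeFn_mulOp (hw := hw) (hR := hR) h] with x h1 h2
  rw [h1, h2, RCLike.inner_apply, RCLike.inner_apply, map_mul, Complex.conj_ofReal]
  ring

theorem inner_mulOp_pow (j : ℕ) (h f : Lp ℂ 2 μ) :
    ⟪h, (mulOp μ w hw R hR ^ j) f⟫_ℂ = ⟪(mulOp μ w hw R hR ^ j) h, f⟫_ℂ := by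
  induction j generalizing h with
  | zero => simp
  | succ j ih =>
    rw [pow_succ', mul_apply_eq_comp, inner_mulOp, ih, ← mul_apply_eq_comp,
      ← pow_succ, ← pow_succ']

end MulOp

/-! ### The model kernel: Schur's test and the weighted `L^p → L²` bound -/

section Kernels

variable {X : Type*} [MetricSpace X] [MeasurableSpace X] {μ : Measure X} {n C l : ℝ}

/-- The model kernel `max(V(x, 1), V(y, 1))⁻¹ (1 + d(x, y))^{-l}`. -/
def decayKernel (μ : Measure X) (l : ℝ) (x y : X) : ℝ≥0∞ :=
  (max (μ (Metric.ball x 1)) (μ (Metric.ball y 1)))⁻¹ * ENNReal.ofReal ((1 + dist x y) ^ (-l))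

theorem decayKernel_comm (x y : X) : decayKernel μ l x y = decayKernel μ l y x := by
  rw [decayKernel, decayKernel, max_comm, dist_comm]

theorem measurable_decayKernel [TopologicalSpace.SeparableSpace X] [BorelSpace X] [SFinite μ] :
    Measurable (Function.uncurry (decayKernel μ l)) := by
  have : SecondCountableTopology X := UniformSpace.secondCountable_of_separable X
  have hV := measurable_measure_ball (μ := μ) (X := X) 1
  have hd : Measurable fun p : X × X => dist p.1 p.2 := measurable_dist
  exact ((hV.comp measurable_fst).max (hV.comp measurable_snd)).inv.mul
    (((measurable_const.add hd).pow_const _).ennreal_ofReal)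

theorem IsDoubling.lintegral_decayKernel_le [BorelSpace X] (hX : IsDoubling μ n C) (hl : 0 ≤ l)
    (x : X) : ∫⁻ y, decayKernel μ l x y ∂μ ≤ decayConst n C l := by
  have hV0 := (hX.ball_pos x 1 one_pos).ne'
  have hVt := (hX.ball_lt_top x 1 one_pos).ne
  calc ∫⁻ y, decayKernel μ l x y ∂μ
      ≤ ∫⁻ y, (μ (Metric.ball x 1))⁻¹ * ENNReal.ofReal ((1 + dist x y) ^ (-l)) ∂μ := by
        refine lintegral_mono fun y => ?_
        simp only [decayKernel]
        gcongr
        exact le_max_left _ _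
    _ = (μ (Metric.ball x 1))⁻¹ * ∫⁻ y, ENNReal.ofReal ((1 + dist x y) ^ (-l)) ∂μ :=
        lintegral_const_mul' _ _ (ENNReal.inv_ne_top.2 hV0)
    _ ≤ (μ (Metric.ball x 1))⁻¹ * (decayConst n C l * μ (Metric.ball x 1)) := by
        gcongr; exact hX.lintegral_decay_le hl x
    _ = decayConst n C l := by
        rw [mul_comm, mul_assoc, ENNReal.mul_inv_cancel hV0 hVt, mul_one]

variable [TopologicalSpace.SeparableSpace X] [BorelSpace X]

theorem IsDoubling.lintegral_decayKernel_le' (hX : IsDoubling μ n C) (hl : 0 ≤ l)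
    (y : X) : ∫⁻ x, decayKernel μ l x y ∂μ ≤ decayConst n C l := by
  simp_rw [decayKernel_comm _ y]
  exact hX.lintegral_decayKernel_le hl y

/-- Schur's test for the model kernel. -/
theorem IsDoubling.lintegral_decayKernel_mul_rpow_le (hX : IsDoubling μ n C) (hl : 0 ≤ l)
    {φ : X → ℝ≥0∞} (hφ : Measurable φ) {r : ℝ} (hr : 1 ≤ r) :
    ∫⁻ x, (∫⁻ y, decayKernel μ l x y * φ y ∂μ) ^ r ∂μ ≤
      decayConst n C l ^ r * ∫⁻ y, φ y ^ r ∂μ := by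
  have := hX.sigmaFinite
  have hk := measurable_decayKernel (μ := μ) (l := l)
  set D := decayConst n C l
  calc ∫⁻ x, (∫⁻ y, decayKernel μ l x y * φ y ∂μ) ^ r ∂μ
      ≤ ∫⁻ x, D ^ (r - 1) * ∫⁻ y, decayKernel μ l x y * φ y ^ r ∂μ ∂μ := by
        refine lintegral_mono fun x => ?_
        refine (lintegral_mul_rpow_le (hk.of_uncurry_left.aemeasurable) hφ.aemeasurable hr).trans ?_
        gcongr
        exact hX.lintegral_decayKernel_le hl x
    _ = D ^ (r - 1) * ∫⁻ x, ∫⁻ y, decayKernel μ l x y * φ y ^ r ∂μ ∂μ := by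
        refine lintegral_const_mul _ (Measurable.lintegral_prod_right' (f := fun p : X × X =>
          decayKernel μ l p.1 p.2 * φ p.2 ^ r) ?_)
        exact hk.mul ((hφ.comp measurable_snd).pow_const r)
    _ = D ^ (r - 1) * ∫⁻ y, (∫⁻ x, decayKernel μ l x y ∂μ) * φ y ^ r ∂μ := by
        rw [lintegral_lintegral_swap (hk.mul ((hφ.comp measurable_snd).pow_const r)).aemeasurable]
        congr 1
        refine lintegral_congr fun y => ?_
        rw [lintegral_mul_const]
        exact hk.of_uncurry_right
    _ ≤ D ^ (r - 1) * ∫⁻ y, D * φ y ^ r ∂μ := by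
        gcongr with y
        exact hX.lintegral_decayKernel_le' hl y
    _ = _ := by
        rw [lintegral_const_mul _ (hφ.pow_const r), ← mul_assoc]
        congr 1
        conv_lhs => rw [← ENNReal.rpow_one D, ← ENNReal.rpow_mul, mul_comm 1 (r - 1), mul_one]
        rw [← ENNReal.rpow_add_of_nonneg _ _ (by linarith) (by norm_num), sub_add_cancel]

theorem decayKernel_le (hl : 0 ≤ l) (x y : X) :
    decayKernel μ l x y ≤ (μ (Metric.ball y 1))⁻¹ := by
  have h1 : ENNReal.ofReal ((1 + dist x y) ^ (-l)) ≤ 1 := by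
    rw [ENNReal.ofReal_le_one]
    exact Real.rpow_le_one_of_one_le_of_nonpos (by linarith [dist_nonneg (x := x) (y := y)])
      (by linarith)
  calc decayKernel μ l x y ≤ (μ (Metric.ball y 1))⁻¹ * 1 := by
        unfold decayKernel
        gcongr
        exact le_max_right _ _
    _ = _ := mul_one _

/-- The weighted `L^p → L²` bound for the model kernel, `σ = 1/p - 1/2`. -/
theorem IsDoubling.lintegral_decayKernel_weighted_le (hX : IsDoubling μ n C) (hl : 0 ≤ l)
    {φ : X → ℝ≥0∞} (hφ : Measurable φ) {p : ℝ} (hp1 : 1 ≤ p) (hp2 : p ≤ 2) :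
    ∫⁻ x, (∫⁻ y, decayKernel μ l x y * (μ (Metric.ball y 1) ^ (1 / p - 1 / 2) * φ y) ∂μ) ^ (2 : ℝ) ∂μ
      ≤ decayConst n C l ^ ((p - 1) * (2 / p)) * decayConst n C l *
        (∫⁻ y, φ y ^ p ∂μ) ^ (2 / p) := by
  have := hX.sigmaFinite
  have hk := measurable_decayKernel (μ := μ) (l := l)
  have hV := measurable_measure_ball (μ := μ) (X := X) 1
  set D := decayConst n C l
  set V : X → ℝ≥0∞ := fun y => μ (Metric.ball y 1) with hVdef
  have hp0 : 0 < p := by linarith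
  set r := 2 / p with hr
  have hr1 : 1 ≤ r := by rw [hr, le_div_iff₀ hp0]; linarith
  have hrp : p * r = 2 := by rw [hr]; field_simp
  have hσ : 0 ≤ 1 / p - 1 / 2 := by
    rw [sub_nonneg]; exact one_div_le_one_div_of_le hp0 hp2
  set σ := 1 / p - 1 / 2 with hσdef
  have hσr : σ * p * r = r - 1 := by
    rw [mul_assoc, hrp, hσdef, hr]; field_simp
  set W : X → ℝ≥0∞ := fun y => V y ^ (σ * p) with hW
  have hWm : Measurable W := hV.pow_const _
  -- Jensen's inequality is used twice: with exponent `p` for the measure given by the kernel, then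
  -- with exponent `r = 2/p` for the measure `φ^p dμ`.
  have step1 : ∀ x, (∫⁻ y, decayKernel μ l x y * (V y ^ σ * φ y) ∂μ) ^ (2 : ℝ) ≤
      D ^ ((p - 1) * r) * ((∫⁻ y, φ y ^ p ∂μ) ^ (r - 1) *
        ∫⁻ y, φ y ^ p * (decayKernel μ l x y * W y) ^ r ∂μ) := by
    intro x
    have hkx : Measurable fun y => decayKernel μ l x y := hk.of_uncurry_left
    calc (∫⁻ y, decayKernel μ l x y * (V y ^ σ * φ y) ∂μ) ^ (2 : ℝ)
        = ((∫⁻ y, decayKernel μ l x y * (V y ^ σ * φ y) ∂μ) ^ p) ^ r := by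
          rw [← ENNReal.rpow_mul, hrp]
      _ ≤ (D ^ (p - 1) * ∫⁻ y, decayKernel μ l x y * (V y ^ σ * φ y) ^ p ∂μ) ^ r := by
          gcongr
          refine (lintegral_mul_rpow_le (φ := fun y => V y ^ σ * φ y) hkx.aemeasurable
            ((hV.pow_const σ).mul hφ).aemeasurable hp1).trans ?_
          gcongr
          exact hX.lintegral_decayKernel_le hl x
      _ = D ^ ((p - 1) * r) * (∫⁻ y, φ y ^ p * (decayKernel μ l x y * W y) ∂μ) ^ r := by
          rw [ENNReal.mul_rpow_of_nonneg _ _ (by linarith), ← ENNReal.rpow_mul]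
          congr 2
          refine lintegral_congr fun y => ?_
          rw [ENNReal.mul_rpow_of_nonneg _ _ hp0.le, ← ENNReal.rpow_mul]
          ring
      _ ≤ _ := by
          gcongr
          exact lintegral_mul_rpow_le (hφ.pow_const p).aemeasurable (hkx.mul hWm).aemeasurable hr1
  have hm2 : Measurable fun q : X × X => φ q.2 ^ p * (decayKernel μ l q.1 q.2 * W q.2) ^ r :=
    ((hφ.comp measurable_snd).pow_const p).mul ((hk.mul (hWm.comp measurable_snd)).pow_const r)
  have step2 : ∀ y, ∫⁻ x, φ y ^ p * (decayKernel μ l x y * W y) ^ r ∂μ ≤ D * φ y ^ p := by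
    intro y
    have hV0 : V y ≠ 0 := (hX.ball_pos y 1 one_pos).ne'
    have hVt : V y ≠ ∞ := (hX.ball_lt_top y 1 one_pos).ne
    -- The exponent `σ` is made for this step. Since `σ p r = r - 1`, the weight `W^r = V(y)^(r-1)`
    -- cancels exactly the `r - 1` superfluous powers of the kernel, each of which is at most
    -- `V(y)⁻¹`.
    have hpt : ∀ x, (decayKernel μ l x y * W y) ^ r ≤ decayKernel μ l x y := by
      intro x
      have e1 : (decayKernel μ l x y) ^ r ≤ (V y)⁻¹ ^ (r - 1) * decayKernel μ l x y := by
        calc (decayKernel μ l x y) ^ r = (decayKernel μ l x y) ^ (r - 1) * decayKernel μ l x y := by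
              conv_rhs => rw [← ENNReal.rpow_one (decayKernel μ l x y), ← ENNReal.rpow_mul,
                mul_comm 1 (r - 1), mul_one]
              rw [← ENNReal.rpow_add_of_nonneg _ _ (by linarith) (by norm_num), sub_add_cancel]
          _ ≤ _ := by
              gcongr
              exact decayKernel_le hl x y
      rw [ENNReal.mul_rpow_of_nonneg _ _ (by linarith)]
      calc _ ≤ (V y)⁻¹ ^ (r - 1) * decayKernel μ l x y * W y ^ r := by gcongr
        _ = decayKernel μ l x y * ((V y)⁻¹ ^ (r - 1) * V y ^ (r - 1)) := by
            rw [hW]; simp only; rw [← ENNReal.rpow_mul, hσr]; ring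
        _ = decayKernel μ l x y := by
            rw [← ENNReal.mul_rpow_of_nonneg _ _ (by linarith), ENNReal.inv_mul_cancel hV0 hVt,
              ENNReal.one_rpow, mul_one]
    calc ∫⁻ x, φ y ^ p * (decayKernel μ l x y * W y) ^ r ∂μ
        ≤ ∫⁻ x, φ y ^ p * decayKernel μ l x y ∂μ := by
          refine lintegral_mono fun x => ?_
          gcongr
          exact hpt x
      _ = φ y ^ p * ∫⁻ x, decayKernel μ l x y ∂μ :=
          lintegral_const_mul _ hk.of_uncurry_right
      _ ≤ D * φ y ^ p := by
          rw [mul_comm]; gcongr; exact hX.lintegral_decayKernel_le' hl y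
  calc _ ≤ ∫⁻ x, D ^ ((p - 1) * r) * ((∫⁻ y, φ y ^ p ∂μ) ^ (r - 1) *
        ∫⁻ y, φ y ^ p * (decayKernel μ l x y * W y) ^ r ∂μ) ∂μ := lintegral_mono step1
    _ = D ^ ((p - 1) * r) * ((∫⁻ y, φ y ^ p ∂μ) ^ (r - 1) *
        ∫⁻ x, ∫⁻ y, φ y ^ p * (decayKernel μ l x y * W y) ^ r ∂μ ∂μ) := by
        rw [lintegral_const_mul _ (hm2.lintegral_prod_right'.const_mul _),
          lintegral_const_mul _ hm2.lintegral_prod_right']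
    _ ≤ D ^ ((p - 1) * r) * ((∫⁻ y, φ y ^ p ∂μ) ^ (r - 1) * ∫⁻ y, D * φ y ^ p ∂μ) := by
        refine mul_le_mul' le_rfl (mul_le_mul' le_rfl ?_)
        rw [lintegral_lintegral_swap hm2.aemeasurable]
        exact lintegral_mono step2
    _ = _ := by
        rw [lintegral_const_mul _ (hφ.pow_const p)]
        have e : (∫⁻ y, φ y ^ p ∂μ) ^ r =
            (∫⁻ y, φ y ^ p ∂μ) ^ (r - 1) * ∫⁻ y, φ y ^ p ∂μ := by
          conv_rhs => rw [← ENNReal.rpow_one (∫⁻ y, φ y ^ p ∂μ), ← ENNReal.rpow_mul,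
                mul_comm 1 (r - 1), mul_one]
          rw [← ENNReal.rpow_add_of_nonneg _ _ (by linarith) (by norm_num), sub_add_cancel]
        rw [e]; ring

end Kernels

/-! ### Operators with dominated kernels and their commutators with weights -/

section IntegralOperators

variable {X : Type*} [MetricSpace X] [MeasurableSpace X] {μ : Measure X} {n C l : ℝ}

/-- `T` is the integral operator with kernel `K`, which is dominated by the model kernel. -/
structure IsIntegralOp (μ : Measure X) (T : Lp ℂ 2 μ →L[ℂ] Lp ℂ 2 μ) (K : X → X → ℂ)
    (c : ℝ≥0∞) (l : ℝ) : Prop where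
  measurable : Measurable (Function.uncurry K)
  enorm_le : ∀ x y, ‖K x y‖ₑ ≤ c * decayKernel μ l x y
  apply_ae : ∀ f : Lp ℂ 2 μ, ∀ᵐ x ∂μ, T f x = ∫ y, K x y * f y ∂μ

/-- The norm of `V_1^{-σ_p} f` in `L^p`. -/
def weightedNorm (μ : Measure X) (p : ℝ≥0∞) (f : X → ℂ) : ℝ≥0∞ :=
  eLpNorm (fun x => ((μ.real (Metric.ball x 1) ^ (-sigmaExp p) : ℝ) : ℂ) * f x) p μ

theorem sigmaExp_eq {p : ℝ≥0∞} (hp1 : 1 ≤ p) (hp2 : p ≤ 2) :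
    sigmaExp p = 1 / p.toReal - 1 / 2 := by
  have hpt : p ≠ ∞ := (hp2.trans_lt (by norm_num)).ne
  have h0 : 0 < p.toReal := ENNReal.toReal_pos (zero_lt_one.trans_le hp1).ne' hpt
  have h2 : p.toReal ≤ 2 := by simpa using ENNReal.toReal_mono (by norm_num) hp2
  rw [sigmaExp, ENNReal.toReal_inv, abs_of_nonneg, one_div p.toReal]
  rw [sub_nonneg, ← one_div]
  exact one_div_le_one_div_of_le h0 h2

theorem sigmaExp_nonneg (p : ℝ≥0∞) : 0 ≤ sigmaExp p := abs_nonneg _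

variable [TopologicalSpace.SeparableSpace X] [BorelSpace X]
  {T : Lp ℂ 2 μ →L[ℂ] Lp ℂ 2 μ} {K : X → X → ℂ} {c : ℝ≥0∞}

theorem IsIntegralOp.enorm_apply_le [SFinite μ] (hT : IsIntegralOp μ T K c l) (f : Lp ℂ 2 μ) :
    ∀ᵐ x ∂μ, ‖T f x‖ₑ ≤ c * ∫⁻ y, decayKernel μ l x y * ‖f y‖ₑ ∂μ := by
  have hk := measurable_decayKernel (μ := μ) (l := l)
  have hf : Measurable f := (Lp.stronglyMeasurable f).measurable
  filter_upwards [hT.apply_ae f] with x hx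
  rw [hx, ← lintegral_const_mul _ (f := fun y => decayKernel μ l x y * ‖f y‖ₑ)
    (hk.of_uncurry_left.mul hf.enorm)]
  refine (enorm_integral_le_lintegral_enorm _).trans (lintegral_mono fun y => ?_)
  rw [enorm_mul, ← mul_assoc]
  gcongr
  exact hT.enorm_le x y

theorem IsIntegralOp.lpBound (hT : IsIntegralOp μ T K c l) (hX : IsDoubling μ n C) (hl : 0 ≤ l)
    {p : ℝ≥0∞} (hp1 : 1 ≤ p) (hp : p ≠ ∞) : LpBound μ T p (c * decayConst n C l) := by
  intro f _
  have := hX.sigmaFinite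
  have hk := measurable_decayKernel (μ := μ) (l := l)
  have hf : Measurable f := (Lp.stronglyMeasurable f).measurable
  have hp0 : p ≠ 0 := (zero_lt_one.trans_le hp1).ne'
  have hpr : 1 ≤ p.toReal := by
    rw [← ENNReal.toReal_one]; exact ENNReal.toReal_mono hp hp1
  have hpr0 : 0 < p.toReal := by linarith
  have hm : Measurable fun x => ∫⁻ y, decayKernel μ l x y * ‖f y‖ₑ ∂μ :=
    Measurable.lintegral_prod_right' (f := fun q : X × X => decayKernel μ l q.1 q.2 * ‖f q.2‖ₑ)
      (hk.mul (hf.enorm.comp measurable_snd))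
  rw [eLpNorm_eq_lintegral_rpow_enorm_toReal hp0 hp, eLpNorm_eq_lintegral_rpow_enorm_toReal hp0 hp]
  calc (∫⁻ x, ‖T f x‖ₑ ^ p.toReal ∂μ) ^ (1 / p.toReal)
      ≤ (∫⁻ x, c ^ p.toReal * (∫⁻ y, decayKernel μ l x y * ‖f y‖ₑ ∂μ) ^ p.toReal ∂μ) ^
          (1 / p.toReal) := by
        gcongr ?_ ^ _
        refine lintegral_mono_ae ?_
        filter_upwards [hT.enorm_apply_le f] with x hx
        rw [← ENNReal.mul_rpow_of_nonneg _ _ hpr0.le]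
        gcongr
    _ ≤ (c ^ p.toReal * (decayConst n C l ^ p.toReal * ∫⁻ y, ‖f y‖ₑ ^ p.toReal ∂μ)) ^
          (1 / p.toReal) := by
        rw [lintegral_const_mul _ (hm.pow_const _)]
        gcongr
        exact hX.lintegral_decayKernel_mul_rpow_le hl hf.enorm hpr
    _ = _ := by
        rw [← mul_assoc, ENNReal.mul_rpow_of_nonneg _ _ (by positivity),
          ENNReal.mul_rpow_of_nonneg _ _ (by positivity), ← ENNReal.rpow_mul, ← ENNReal.rpow_mul,
          mul_one_div_cancel hpr0.ne', ENNReal.rpow_one, ENNReal.rpow_one]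

theorem LpBound.opNorm_le {α : Type*} [MeasurableSpace α] {ν : Measure α}
    {S : Lp ℂ 2 ν →L[ℂ] Lp ℂ 2 ν} {M : ℝ≥0∞} (hM : M ≠ ∞) (hS : LpBound ν S 2 M) :
    ‖S‖ ≤ M.toReal := by
  refine ContinuousLinearMap.opNorm_le_bound _ ENNReal.toReal_nonneg fun f => ?_
  rw [Lp.norm_def, Lp.norm_def, ← ENNReal.toReal_mul]
  exact ENNReal.toReal_mono (ENNReal.mul_ne_top hM (Lp.eLpNorm_ne_top f)) (hS f (Lp.memLp f))

theorem IsDoubling.vol_pos (hX : IsDoubling μ n C) (x : X) : 0 < μ.real (Metric.ball x 1) :=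
  ENNReal.toReal_pos (hX.ball_pos x 1 one_pos).ne' (hX.ball_lt_top x 1 one_pos).ne

theorem enorm_vol_rpow (hX : IsDoubling μ n C) (x : X) (s : ℝ) :
    ‖((μ.real (Metric.ball x 1) ^ s : ℝ) : ℂ)‖ₑ = μ (Metric.ball x 1) ^ s := by
  have h := hX.vol_pos x
  rw [← ofReal_norm, Complex.norm_real, Real.norm_of_nonneg (by positivity),
    ← ENNReal.ofReal_rpow_of_pos h, Measure.real, ENNReal.ofReal_toReal
      (hX.ball_lt_top x 1 one_pos).ne]

/-- A bound for integral operators from weighted `L^p` to `L²`. -/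
def weightedConst (n C l : ℝ) (p : ℝ≥0∞) : ℝ≥0∞ :=
  (decayConst n C l ^ ((p.toReal - 1) * (2 / p.toReal)) * decayConst n C l) ^ (1 / 2 : ℝ)

theorem weightedConst_ne_top (hl : n < l) {p : ℝ≥0∞} (hp1 : 1 ≤ p) (hp : p ≠ ∞) :
    weightedConst n C l p ≠ ∞ := by
  have hpr : 1 ≤ p.toReal := by
    rw [← ENNReal.toReal_one]; exact ENNReal.toReal_mono hp hp1
  refine ENNReal.rpow_ne_top_of_nonneg (by norm_num) (ENNReal.mul_ne_top ?_ (decayConst_ne_top hl))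
  exact ENNReal.rpow_ne_top_of_nonneg (mul_nonneg (by linarith) (by positivity))
    (decayConst_ne_top hl)

theorem IsIntegralOp.eLpNorm_two_le (hT : IsIntegralOp μ T K c l) (hX : IsDoubling μ n C)
    (hl : 0 ≤ l) {p : ℝ≥0∞} (hp1 : 1 ≤ p) (hp2 : p ≤ 2) (f : Lp ℂ 2 μ) :
    eLpNorm (T f) 2 μ ≤ c * weightedConst n C l p * weightedNorm μ p f := by
  have := hX.sigmaFinite
  have hk := measurable_decayKernel (μ := μ) (l := l)
  have hf : Measurable f := (Lp.stronglyMeasurable f).measurable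
  have hp : p ≠ ∞ := (hp2.trans_lt (by norm_num)).ne
  have hp0 : p ≠ 0 := (zero_lt_one.trans_le hp1).ne'
  have hpr : 1 ≤ p.toReal := by
    rw [← ENNReal.toReal_one]; exact ENNReal.toReal_mono hp hp1
  have hpr2 : p.toReal ≤ 2 := by simpa using ENNReal.toReal_mono (by norm_num) hp2
  have hpr0 : 0 < p.toReal := by linarith
  have hV := measurable_measure_ball (μ := μ) (X := X) 1
  set σ := 1 / p.toReal - 1 / 2 with hσ
  let φ : X → ℝ≥0∞ := fun y => μ (Metric.ball y 1) ^ (-σ) * ‖f y‖ₑ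
  have hφ : Measurable φ := (hV.pow_const _).mul hf.enorm
  have hm : Measurable fun x => ∫⁻ y, decayKernel μ l x y * ‖f y‖ₑ ∂μ :=
    Measurable.lintegral_prod_right' (f := fun q : X × X => decayKernel μ l q.1 q.2 * ‖f q.2‖ₑ)
      (hk.mul (hf.enorm.comp measurable_snd))
  have hfφ : ∀ y, ‖f y‖ₑ = μ (Metric.ball y 1) ^ σ * φ y := by
    intro y
    simp only [φ]
    rw [← mul_assoc, ← ENNReal.rpow_add _ _ (hX.ball_pos y 1 one_pos).ne'
      (hX.ball_lt_top y 1 one_pos).ne, add_neg_cancel, ENNReal.rpow_zero, one_mul]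
  have hw : weightedNorm μ p f = (∫⁻ y, φ y ^ p.toReal ∂μ) ^ (1 / p.toReal) := by
    rw [weightedNorm, eLpNorm_eq_lintegral_rpow_enorm_toReal hp0 hp]
    congr 1
    refine lintegral_congr fun y => ?_
    rw [enorm_mul, enorm_vol_rpow hX, sigmaExp_eq hp1 hp2]
  rw [hw, eLpNorm_eq_lintegral_rpow_enorm_toReal (by norm_num) (by norm_num), ENNReal.toReal_ofNat]
  calc (∫⁻ x, ‖T f x‖ₑ ^ (2 : ℝ) ∂μ) ^ (1 / 2 : ℝ)
      ≤ (∫⁻ x, c ^ (2 : ℝ) * (∫⁻ y, decayKernel μ l x y * ‖f y‖ₑ ∂μ) ^ (2 : ℝ) ∂μ) ^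
          (1 / 2 : ℝ) := by
        gcongr ?_ ^ _
        refine lintegral_mono_ae ?_
        filter_upwards [hT.enorm_apply_le f] with x hx
        rw [← ENNReal.mul_rpow_of_nonneg _ _ (by norm_num)]
        gcongr
    _ ≤ (c ^ (2 : ℝ) * (decayConst n C l ^ ((p.toReal - 1) * (2 / p.toReal)) * decayConst n C l *
          (∫⁻ y, φ y ^ p.toReal ∂μ) ^ (2 / p.toReal))) ^ (1 / 2 : ℝ) := by
        rw [lintegral_const_mul _ (hm.pow_const _)]
        simp_rw [hfφ]
        gcongr
        exact hX.lintegral_decayKernel_weighted_le hl hφ hpr hpr2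
    _ = _ := by
        rw [← mul_assoc, ENNReal.mul_rpow_of_nonneg _ _ (by positivity),
          ENNReal.mul_rpow_of_nonneg _ _ (by positivity), ← ENNReal.rpow_mul, ← ENNReal.rpow_mul,
          weightedConst]
        norm_num

/-- The map `S ↦ M S - S M`. -/
def commOp (M : Lp ℂ 2 μ →L[ℂ] Lp ℂ 2 μ) :
    Module.End ℂ (Lp ℂ 2 μ →L[ℂ] Lp ℂ 2 μ) :=
  LinearMap.mulLeft ℂ M - LinearMap.mulRight ℂ M

-- Left multiplication by `M` is the sum of the commutator map and right multiplication by `M`.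
-- These two commute, so the binomial theorem applies in the algebra of maps on operators.
omit [MetricSpace X] [TopologicalSpace.SeparableSpace X] [BorelSpace X] in
theorem pow_mul_eq_sum_commOp (M S : Lp ℂ 2 μ →L[ℂ] Lp ℂ 2 μ) (m : ℕ) :
    M ^ m * S = ∑ j ∈ Finset.range (m + 1),
      (m.choose j : ℂ) • ((commOp M ^ j) S * M ^ (m - j)) := by
  have hcomm : Commute (commOp M) (LinearMap.mulRight ℂ M) :=
    (LinearMap.commute_mulLeft_right (R := ℂ) M M).sub_left (Commute.refl _)
  have h := hcomm.add_pow m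
  have e : commOp M + LinearMap.mulRight ℂ M = LinearMap.mulLeft ℂ M := sub_add_cancel _ _
  rw [e, LinearMap.pow_mulLeft] at h
  have h2 := congrArg (fun L => L S) h
  simp only [LinearMap.mulLeft_apply] at h2
  rw [h2, LinearMap.sum_apply]
  refine Finset.sum_congr rfl fun j _ => ?_
  have hc : ((m.choose j : Module.End ℂ (Lp ℂ 2 μ →L[ℂ] Lp ℂ 2 μ))) =
      (m.choose j : ℂ) • 1 := by
    rw [← nsmul_one, Nat.cast_smul_eq_nsmul]
  have hcr : commOp M ^ j * LinearMap.mulRight ℂ M ^ (m - j) =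
      LinearMap.mulRight ℂ M ^ (m - j) * commOp M ^ j := (hcomm.pow_pow j (m - j)).eq
  rw [hcr, hc, mul_smul_comm, mul_one, LinearMap.smul_apply, Module.End.mul_apply,
    LinearMap.pow_mulRight, LinearMap.mulRight_apply]

/-- A commutator with a weight multiplies the kernel by `w(x) - w(y)`. The Lipschitz condition
bounds this by `1 + d(x, y)`, so each commutator costs one power of decay, however large `w` may be.
This independence of the bound for `w` is essential, because the weights used later are truncated at
arbitrary height. -/
theorem IsIntegralOp.commOp_mulOp (hT : IsIntegralOp μ T K c l) (hX : IsDoubling μ n C)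
    (hc : c ≠ ∞) (hn : 0 ≤ n) (hl : n < l) {w : X → ℝ} {hw : Measurable w} {R : ℝ}
    {hR : ∀ x, |w x| ≤ R} (hLip : ∀ x y, |w x - w y| ≤ dist x y) :
    IsIntegralOp μ (commOp (mulOp μ w hw R hR) T) (fun x y => ((w x - w y : ℝ) : ℂ) * K x y)
      c (l - 1) where
  measurable := by
    refine Measurable.mul ?_ hT.measurable
    exact Complex.measurable_ofReal.comp ((hw.comp measurable_fst).sub (hw.comp measurable_snd))
  enorm_le x y := by
    rw [enorm_mul]
    have hd : 0 ≤ dist x y := dist_nonneg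
    have h1 : ‖((w x - w y : ℝ) : ℂ)‖ₑ * ENNReal.ofReal ((1 + dist x y) ^ (-l)) ≤
        ENNReal.ofReal ((1 + dist x y) ^ (-(l - 1))) := by
      rw [← ofReal_norm, Complex.norm_real, Real.norm_eq_abs, ← ENNReal.ofReal_mul (abs_nonneg _)]
      refine ENNReal.ofReal_le_ofReal ?_
      calc |w x - w y| * (1 + dist x y) ^ (-l) ≤ (1 + dist x y) * (1 + dist x y) ^ (-l) := by
            gcongr; linarith [hLip x y]
        _ = _ := by
            rw [neg_sub, sub_eq_add_neg, Real.rpow_add (by linarith), Real.rpow_one]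
    calc ‖((w x - w y : ℝ) : ℂ)‖ₑ * ‖K x y‖ₑ
        ≤ ‖((w x - w y : ℝ) : ℂ)‖ₑ * (c * decayKernel μ l x y) := by
          gcongr; exact hT.enorm_le x y
      _ = c * ((max (μ (Metric.ball x 1)) (μ (Metric.ball y 1)))⁻¹ *
          (‖((w x - w y : ℝ) : ℂ)‖ₑ * ENNReal.ofReal ((1 + dist x y) ^ (-l)))) := by
          rw [decayKernel]; ring
      _ ≤ _ := by
          rw [decayKernel]; gcongr
  apply_ae f := by
    have := hX.sigmaFinite
    have hl0 : 0 ≤ l := by linarith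
    have hk := measurable_decayKernel (μ := μ) (l := l)
    have hf : Measurable f := (Lp.stronglyMeasurable f).measurable
    have hm : Measurable fun x => ∫⁻ y, decayKernel μ l x y * ‖f y‖ₑ ∂μ :=
      Measurable.lintegral_prod_right' (f := fun q : X × X => decayKernel μ l q.1 q.2 * ‖f q.2‖ₑ)
        (hk.mul (hf.enorm.comp measurable_snd))
    -- Schur's test in `L²` shows that the kernel integral converges absolutely for almost every
    -- `x`. This permits subtracting the two integrals under one sign.
    have hfin : ∀ᵐ x ∂μ, (∫⁻ y, decayKernel μ l x y * ‖f y‖ₑ ∂μ) ^ (2 : ℝ) < ∞ := by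
      refine ae_lt_top (hm.pow_const _) ?_
      refine ((hX.lintegral_decayKernel_mul_rpow_le hl0 hf.enorm (by norm_num)).trans_lt ?_).ne
      refine ENNReal.mul_lt_top (ENNReal.rpow_lt_top_of_nonneg (by norm_num)
        (decayConst_ne_top hl)) ?_
      have := lintegral_rpow_enorm_lt_top_of_eLpNorm_lt_top (p := 2) (by norm_num) (by norm_num)
        (Lp.eLpNorm_lt_top f)
      simpa using this
    set M := mulOp μ w hw R hR
    have e : commOp M T f = M (T f) - T (M f) := rfl
    rw [e]
    filter_upwards [Lp.coeFn_sub (M (T f)) (T (M f)), coeFn_mulOp (hw := hw) (hR := hR) (T f),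
      hT.apply_ae f, hT.apply_ae (M f), hfin] with x h1 h2 h3 h4 h5
    rw [h1, Pi.sub_apply, h2, h3, h4]
    have hint : Integrable (fun y => K x y * f y) μ := by
      refine ⟨(hT.measurable.of_uncurry_left.mul hf).aestronglyMeasurable, ?_⟩
      rw [HasFiniteIntegral]
      have hlt : c * ∫⁻ y, decayKernel μ l x y * ‖f y‖ₑ ∂μ < ∞ :=
        ENNReal.mul_lt_top hc.lt_top ((ENNReal.rpow_lt_top_iff_of_pos (by norm_num)).1 h5)
      refine lt_of_le_of_lt ?_ hlt
      rw [← lintegral_const_mul _ (f := fun y => decayKernel μ l x y * ‖f y‖ₑ)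
        (hk.of_uncurry_left.mul hf.enorm)]
      refine lintegral_mono fun y => ?_
      rw [enorm_mul, ← mul_assoc]
      gcongr
      exact hT.enorm_le x y
    have hint2 : Integrable (fun y => K x y * ((w y : ℂ) * f y)) μ := by
      refine Integrable.mono' (hint.norm.const_mul R) (hT.measurable.of_uncurry_left.mul
        ((Complex.measurable_ofReal.comp hw).mul hf)).aestronglyMeasurable
        (Eventually.of_forall fun y => ?_)
      rw [norm_mul, norm_mul, norm_mul, Complex.norm_real, Real.norm_eq_abs]
      have := mul_le_mul_of_nonneg_right (hR y) (mul_nonneg (norm_nonneg (K x y)) (norm_nonneg (f y)))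
      linarith
    have h6 : ∫ y, K x y * M f y ∂μ = ∫ y, K x y * ((w y : ℂ) * f y) ∂μ := by
      refine integral_congr_ae ?_
      filter_upwards [coeFn_mulOp (hw := hw) (hR := hR) f] with y hy
      rw [hy]
    rw [h6, ← integral_const_mul, ← integral_sub (hint.const_mul _) hint2]
    refine integral_congr_ae (Eventually.of_forall fun y => ?_)
    simp only
    push_cast
    ring

theorem IsIntegralOp.commOp_pow (hT : IsIntegralOp μ T K c l) (hX : IsDoubling μ n C)
    (hc : c ≠ ∞) (hn : 0 ≤ n) {w : X → ℝ} {hw : Measurable w} {R : ℝ}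
    {hR : ∀ x, |w x| ≤ R} (hLip : ∀ x y, |w x - w y| ≤ dist x y) (j : ℕ) (hl : n + j < l) :
    IsIntegralOp μ ((commOp (mulOp μ w hw R hR) ^ j) T)
      (fun x y => ((w x - w y : ℝ) : ℂ) ^ j * K x y) c (l - j) := by
  induction j with
  | zero => simpa using hT
  | succ j ih =>
    push_cast at hl
    have h := (ih (by linarith)).commOp_mulOp hX hc hn (by linarith) (hw := hw) (hR := hR) hLip
    rw [pow_succ', Module.End.mul_apply]
    convert h using 1
    · ext x y; ring
    · push_cast; ring

end IntegralOperators

/-! ### Spectral measures, polarization and exponentials of operators -/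

section SpectralCalculus

variable {H : Type*} [NormedAddCommGroup H] [InnerProductSpace ℂ H] [CompleteSpace H]

theorem spectrum_real_subset_Icc (B : H →L[ℂ] H) : spectrum ℝ B ⊆ Set.Icc (-‖B‖) ‖B‖ := by
  intro x hx
  have h1 := spectrum.norm_le_norm_mul_of_mem hx
  have h2 : ‖B‖ * ‖(1 : H →L[ℂ] H)‖ ≤ ‖B‖ * 1 := by
    gcongr
    exact ContinuousLinearMap.norm_id_le
  rw [Set.mem_Icc, ← abs_le, ← Real.norm_eq_abs]
  linarith

/-- By inner regularity it suffices to test compact subsets of the complement. A cutoff equal to `1`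
there and supported off the interval vanishes on the spectrum, so its functional calculus is zero.
-/
theorem spectralMeasure_compl_Icc (B : H →L[ℂ] H) (v : H) :
    spectralMeasure B v (Set.Icc (-‖B‖) ‖B‖)ᶜ = 0 := by
  have hU : IsOpen (Set.Icc (-‖B‖) ‖B‖)ᶜ := isClosed_Icc.isOpen_compl
  rw [hU.measure_eq_iSup_isCompact]
  simp only [ENNReal.iSup_eq_zero]
  intro K hKU hK
  obtain ⟨f, hf1, hf2, hf3, hf4⟩ := exists_continuousMap_one_of_isCompact_subset_isOpen hK hU hKU
  let φ : C_c(ℝ, ℝ) := ⟨f, hasCompactSupport_def.mpr hf2⟩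
  have h0 : cfc (φ : ℝ → ℝ) B = 0 := by
    have : cfc (φ : ℝ → ℝ) B = cfc (fun _ : ℝ => (0 : ℝ)) B := by
      refine cfc_congr fun x hx => ?_
      have hx' : x ∉ tsupport f := fun hxf => hf3 hxf (spectrum_real_subset_Icc B hx)
      exact image_eq_zero_of_notMem_tsupport hx'
    rw [this, cfc_const_zero]
  have h1 := RealRMK.rieszMeasure_le_of_eq_one (spectralFunctional B v) (f := φ)
    (fun x => (hf4 x).1) hK (fun x hx => hf1 hx)
  have h2 : spectralFunctional B v φ = 0 := by
    change (⟪v, cfc (φ : ℝ → ℝ) B v⟫_ℂ).re = 0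
    rw [h0]; simp
  rw [h2, ENNReal.ofReal_zero] at h1
  exact le_antisymm h1 zero_le

theorem ae_spectralMeasure_mem_Icc (B : H →L[ℂ] H) (v : H) :
    ∀ᵐ x ∂(spectralMeasure B v), x ∈ Set.Icc (-‖B‖) ‖B‖ := by
  rw [ae_iff]
  exact spectralMeasure_compl_Icc B v

theorem integrable_spectralMeasure_of_continuous {E : Type*} [NormedAddCommGroup E]
    [SecondCountableTopology E] [MeasurableSpace E] [BorelSpace E]
    (B : H →L[ℂ] H) (v : H) {F : ℝ → E} (hF : Continuous F) :
    Integrable F (spectralMeasure B v) := by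
  obtain ⟨M, hM⟩ := (isCompact_Icc (a := -‖B‖) (b := ‖B‖)).exists_bound_of_continuousOn
    hF.continuousOn
  exact Integrable.of_bound hF.measurable.aestronglyMeasurable M
    ((ae_spectralMeasure_mem_Icc B v).mono hM)

theorem inner_cfc_eq_ofReal_re (B : H →L[ℂ] H) (f : ℝ → ℝ) (v : H) :
    ⟪v, cfc f B v⟫_ℂ = ((⟪v, cfc f B v⟫_ℂ).re : ℂ) := by
  have hT : IsSelfAdjoint (cfc f B) := cfc_predicate f B
  have hs : (starRingEnd ℂ) ⟪v, cfc f B v⟫_ℂ = ⟪v, cfc f B v⟫_ℂ := by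
    rw [inner_conj_symm]
    exact hT.isSymmetric v v
  exact (Complex.conj_eq_iff_re.1 hs).symm

theorem integral_spectralMeasure_of_continuous (B : H →L[ℂ] H) (v : H) {f : ℝ → ℝ}
    (hf : Continuous f) :
    ∫ x, f x ∂(spectralMeasure B v) = (⟪v, cfc f B v⟫_ℂ).re := by
  obtain ⟨g, hg1, hg2, -, -⟩ := exists_continuousMap_one_of_isCompact_subset_isOpen
      (isCompact_Icc (a := -‖B‖) (b := ‖B‖)) isOpen_univ (Set.subset_univ _)
  have hcs : HasCompactSupport fun x => f x * g x :=
    (hasCompactSupport_def.mpr hg2 : HasCompactSupport g).mul_left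
  let φ : C_c(ℝ, ℝ) := ⟨⟨fun x => f x * g x, by fun_prop⟩, hcs⟩
  have e1 : ∫ x, f x ∂(spectralMeasure B v) = ∫ x, φ x ∂(spectralMeasure B v) := by
    refine integral_congr_ae ?_
    filter_upwards [ae_spectralMeasure_mem_Icc B v] with x hx
    change f x = f x * g x
    rw [hg1 hx]; simp
  have e2 : cfc f B = cfc (φ : ℝ → ℝ) B := by
    refine cfc_congr fun x hx => ?_
    change f x = f x * g x
    rw [hg1 (spectrum_real_subset_Icc B hx)]; simp
  rw [e1, integral_spectralMeasure, e2]

/-- The operator `F(B)` for continuous `F`. -/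
def continuousFC (F : ℝ → ℂ) (B : H →L[ℂ] H) : H →L[ℂ] H :=
  cfc (fun x => (F x).re) B + Complex.I • cfc (fun x => (F x).im) B

theorem integral_spectralMeasure_eq_inner (B : H →L[ℂ] H) (v : H) {F : ℝ → ℂ}
    (hF : Continuous F) :
    ∫ x, F x ∂(spectralMeasure B v) = ⟪v, continuousFC F B v⟫_ℂ := by
  have h1 : Continuous fun x => (F x).re := Complex.continuous_re.comp hF
  have h2 : Continuous fun x => (F x).im := Complex.continuous_im.comp hF
  rw [continuousFC, _root_.add_apply, inner_add_right, _root_.smul_apply, inner_smul_right,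
    inner_cfc_eq_ofReal_re B (fun x => (F x).re), inner_cfc_eq_ofReal_re B (fun x => (F x).im),
    ← integral_spectralMeasure_of_continuous B v h1,
    ← integral_spectralMeasure_of_continuous B v h2, mul_comm]
  exact (integral_re_add_im (integrable_spectralMeasure_of_continuous B v hF)).symm

/-- On a complex Hilbert space the quadratic form determines the operator. -/
theorem eq_borelFC {F : ℝ → ℂ} (hF : Measurable F) (hb : ∃ M : ℝ, ∀ x, ‖F x‖ ≤ M)
    {B T : H →L[ℂ] H} (hT : ∀ v, ⟪v, T v⟫_ℂ = ∫ x, F x ∂(spectralMeasure B v)) :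
    borelFC F B = T := by
  refine ContinuousLinearMap.coe_injective ((ext_inner_map _ _).1 fun v => ?_)
  have h : ⟪v, borelFC F B v⟫_ℂ = ⟪v, T v⟫_ℂ := by rw [inner_borelFC B hF hb, hT]
  have := congrArg (starRingEnd ℂ) h
  rwa [inner_conj_symm, inner_conj_symm] at this

theorem borelFC_eq_continuousFC {F : ℝ → ℂ} (hF : Continuous F) (hb : ∃ M : ℝ, ∀ x, ‖F x‖ ≤ M)
    (B : H →L[ℂ] H) : borelFC F B = continuousFC F B :=
  eq_borelFC hF.measurable hb fun v => (integral_spectralMeasure_eq_inner B v hF).symm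

/-- Polarization. Matrix coefficients of `F(B)` become integrals against four finite measures, so
that sums, limits and parameter integrals of functions of `B` reduce to scalar integration theory.
-/
theorem inner_eq_polarForm {F : ℝ → ℂ} {B T : H →L[ℂ] H}
    (hT : ∀ v, ⟪v, T v⟫_ℂ = ∫ x, F x ∂(spectralMeasure B v)) (h f : H) :
    ⟪h, T f⟫_ℂ = polarForm B F h f := by
  rw [polarForm]
  simp_rw [← hT]
  simp only [Fin.sum_univ_four, map_add, map_smul, inner_add_left, inner_add_right,
      inner_smul_left, inner_smul_right, map_pow, Complex.conj_I]
  have h2 : Complex.I ^ 2 = -1 := Complex.I_sq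
  have h3 : Complex.I ^ 3 = -Complex.I := Complex.I_pow_three
  have h6 : Complex.I ^ 6 = -1 := by
    rw [show (6 : ℕ) = 4 + 2 by norm_num, pow_add, Complex.I_pow_four, h2, one_mul]
  have h7 : Complex.I ^ 7 = -Complex.I := by
    rw [show (7 : ℕ) = 4 + 3 by norm_num, pow_add, Complex.I_pow_four, h3, one_mul]
  norm_num
  ring_nf
  simp only [h2, h3, Complex.I_pow_four, h6, h7]
  ring

theorem inner_borelFC_eq_polarForm {F : ℝ → ℂ} (hF : Measurable F)
    (hb : ∃ M : ℝ, ∀ x, ‖F x‖ ≤ M) (B : H →L[ℂ] H) (h f : H) :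
    ⟪h, borelFC F B f⟫_ℂ = polarForm B F h f :=
  inner_eq_polarForm (inner_borelFC B hF hb) h f

theorem polarForm_eq_inner_continuousFC {F : ℝ → ℂ} (hF : Continuous F) (B : H →L[ℂ] H) (h f : H) :
    polarForm B F h f = ⟪h, continuousFC F B f⟫_ℂ :=
  (inner_eq_polarForm (fun v => (integral_spectralMeasure_eq_inner B v hF).symm) h f).symm

theorem polarForm_congr_Icc {F G : ℝ → ℂ} (B : H →L[ℂ] H)
    (h : ∀ x ∈ Set.Icc (-‖B‖) ‖B‖, F x = G x) (v w : H) :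
    polarForm B F v w = polarForm B G v w := by
  have : ∀ u, ∫ x, F x ∂(spectralMeasure B u) = ∫ x, G x ∂(spectralMeasure B u) := fun u =>
    integral_congr_ae ((ae_spectralMeasure_mem_Icc B u).mono h)
  simp only [polarForm, this]

theorem polarForm_add {F G : ℝ → ℂ} (hF : Measurable F) (hG : Measurable G) (B : H →L[ℂ] H)
    {M : ℝ} (hFM : ∀ x ∈ Set.Icc (-‖B‖) ‖B‖, ‖F x‖ ≤ M)
    (hGM : ∀ x ∈ Set.Icc (-‖B‖) ‖B‖, ‖G x‖ ≤ M) (v w : H) :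
    polarForm B (fun x => F x + G x) v w = polarForm B F v w + polarForm B G v w := by
  have : ∀ u, ∫ x, F x + G x ∂(spectralMeasure B u) =
      ∫ x, F x ∂(spectralMeasure B u) + ∫ x, G x ∂(spectralMeasure B u) := fun u =>
    integral_add
      (Integrable.of_bound hF.aestronglyMeasurable M ((ae_spectralMeasure_mem_Icc B u).mono hFM))
      (Integrable.of_bound hG.aestronglyMeasurable M ((ae_spectralMeasure_mem_Icc B u).mono hGM))
  simp only [polarForm, this, mul_add, Finset.sum_add_distrib]

theorem polarForm_const_mul (c : ℂ) (F : ℝ → ℂ) (B : H →L[ℂ] H) (v w : H) :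
    polarForm B (fun x => c * F x) v w = c * polarForm B F v w := by
  simp only [polarForm, integral_const_mul, Finset.mul_sum]
  refine Finset.sum_congr rfl fun i _ => ?_
  ring

/-- The functional calculus commutes with integration over a parameter. -/
theorem polarForm_integral {Ω : Type*} [MeasurableSpace Ω] {ν : Measure Ω} [SFinite ν]
    {G : Ω → ℝ → ℂ} (hG : Measurable (Function.uncurry G)) (B : H →L[ℂ] H) {g : Ω → ℝ}
    (hg : Integrable g ν) (hGg : ∀ ω, ∀ x ∈ Set.Icc (-‖B‖) ‖B‖, ‖G ω x‖ ≤ g ω) (v w : H) :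
    Integrable (fun ω => polarForm B (G ω) v w) ν ∧
    polarForm B (fun x => ∫ ω, G ω x ∂ν) v w = ∫ ω, polarForm B (G ω) v w ∂ν := by
  have hint : ∀ u, Integrable (Function.uncurry fun x ω => G ω x)
      ((spectralMeasure B u).prod ν) := by
    intro u
    have hm : AEStronglyMeasurable (Function.uncurry fun x ω => G ω x)
        ((spectralMeasure B u).prod ν) := (hG.comp measurable_swap).aestronglyMeasurable
    refine Integrable.mono' (hg.comp_snd (spectralMeasure B u)) hm ?_
    have : ∀ᵐ z ∂((spectralMeasure B u).prod ν), z.1 ∈ Set.Icc (-‖B‖) ‖B‖ :=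
      Measure.quasiMeasurePreserving_fst.ae (ae_spectralMeasure_mem_Icc B u)
    filter_upwards [this] with z hz
    exact hGg z.2 z.1 hz
  have hswap : ∀ u, ∫ x, ∫ ω, G ω x ∂ν ∂(spectralMeasure B u) =
      ∫ ω, ∫ x, G ω x ∂(spectralMeasure B u) ∂ν := fun u => integral_integral_swap (hint u)
  have hi : ∀ i : Fin 4, Integrable (fun ω => (-Complex.I) ^ (i : ℕ) *
      ∫ x, G ω x ∂(spectralMeasure B (v + Complex.I ^ (i : ℕ) • w))) ν := fun i =>
    ((hint _).integral_prod_right).const_mul _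
  constructor
  · simp only [polarForm]
    exact (integrable_finsetSum _ fun i _ => hi i).const_mul _
  · simp only [polarForm]
    rw [integral_const_mul, integral_finsetSum _ fun i _ => hi i]
    simp only [hswap, integral_const_mul]

/-- Dominated convergence for the spectral measures. The convergence is required at every point of
the interval: spectral measures may be singular, so Lebesgue-almost everywhere would not do. -/
theorem tendsto_polarForm {F : ℝ → ℂ} {G : ℕ → ℝ → ℂ} (hG : ∀ i, Measurable (G i)) (B : H →L[ℂ] H)
    {M : ℝ} (hM : ∀ i, ∀ x ∈ Set.Icc (-‖B‖) ‖B‖, ‖G i x‖ ≤ M)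
    (hlim : ∀ x ∈ Set.Icc (-‖B‖) ‖B‖, Tendsto (fun i => G i x) atTop (𝓝 (F x))) (v w : H) :
    Tendsto (fun i => polarForm B (G i) v w) atTop (𝓝 (polarForm B F v w)) := by
  simp only [polarForm]
  refine Tendsto.const_mul _ (tendsto_finsetSum _ fun i _ => Tendsto.const_mul _ ?_)
  refine tendsto_integral_of_dominated_convergence (fun _ => M)
    (fun i => (hG i).aestronglyMeasurable) (integrable_const _)
    (fun i => (ae_spectralMeasure_mem_Icc B _).mono (hM i))
    ((ae_spectralMeasure_mem_Icc B _).mono hlim)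

/-- Rescaling both vectors to norm one turns the quadratic bound `(‖v‖ + ‖w‖)²` into a bilinear one.
The factor `4 = (1 + 1)²` is not sharp, but harmless here. -/
theorem norm_polarForm_le_of_Icc (B : H →L[ℂ] H) {F : ℝ → ℂ} (hF : Measurable F) {M : ℝ}
    (hM : ∀ x ∈ Set.Icc (-‖B‖) ‖B‖, ‖F x‖ ≤ M) (v w : H) :
    ‖polarForm B F v w‖ ≤ 4 * M * ‖v‖ * ‖w‖ := by
  classical
  have h0 : (0 : ℝ) ∈ Set.Icc (-‖B‖) ‖B‖ := ⟨by simp, norm_nonneg _⟩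
  have hM0 : 0 ≤ M := (norm_nonneg _).trans (hM 0 h0)
  let G : ℝ → ℂ := (Set.Icc (-‖B‖) ‖B‖).indicator F
  have hG : Measurable G := hF.indicator measurableSet_Icc
  have hGM : ∀ x, ‖G x‖ ≤ M := by
    intro x
    by_cases hx : x ∈ Set.Icc (-‖B‖) ‖B‖
    · simp only [G, Set.indicator_of_mem hx]; exact hM x hx
    · simp only [G, Set.indicator_of_notMem hx, norm_zero]; exact hM0
  have hFG : polarForm B F v w = polarForm B G v w :=
    polarForm_congr_Icc B (fun x hx => by simp only [G, Set.indicator_of_mem hx]) v w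
  rw [hFG]
  have key : ∀ v' w' : H, ‖v'‖ = 1 → ‖w'‖ = 1 → ‖polarForm B G v' w'‖ ≤ 4 * M := by
    intro v' w' hv hw
    have := norm_polarForm_le B hGM v' w'
    rw [hv, hw] at this
    linarith
  have hpol := inner_borelFC_eq_polarForm hG ⟨M, hGM⟩ B
  by_cases hv : v = 0
  · rw [← hpol, hv]; simp
  by_cases hw : w = 0
  · rw [← hpol, hw]; simp
  have hv' : ‖v‖ ≠ 0 := norm_ne_zero_iff.2 hv
  have hw' : ‖w‖ ≠ 0 := norm_ne_zero_iff.2 hw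
  have hnv : ‖(‖v‖ : ℂ)⁻¹ • v‖ = 1 := by
    rw [norm_smul, norm_inv, Complex.norm_real, norm_norm, inv_mul_cancel₀ hv']
  have hnw : ‖(‖w‖ : ℂ)⁻¹ • w‖ = 1 := by
    rw [norm_smul, norm_inv, Complex.norm_real, norm_norm, inv_mul_cancel₀ hw']
  have h1 := key _ _ hnv hnw
  rw [← hpol, map_smul, inner_smul_left, inner_smul_right, norm_mul, norm_mul, hpol,
    RCLike.norm_conj, norm_inv, norm_inv, Complex.norm_real, Complex.norm_real, norm_norm,
    norm_norm] at h1
  calc ‖polarForm B G v w‖ = ‖v‖ * ‖w‖ * (‖v‖⁻¹ * (‖w‖⁻¹ * ‖polarForm B G v w‖)) := by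
        field_simp
    _ ≤ ‖v‖ * ‖w‖ * (4 * M) := by gcongr
    _ = _ := by ring

theorem adjoint_continuousFC (F : ℝ → ℂ) (B : H →L[ℂ] H) :
    ContinuousLinearMap.adjoint (continuousFC F B) =
      continuousFC (fun x => (starRingEnd ℂ) (F x)) B := by
  have h1 : IsSelfAdjoint (cfc (fun x => (F x).re) B) := cfc_predicate _ B
  have h2 : IsSelfAdjoint (cfc (fun x => (F x).im) B) := cfc_predicate _ B
  rw [continuousFC, continuousFC, ← ContinuousLinearMap.star_eq_adjoint, star_add, star_smul,
    h1.star_eq, h2.star_eq]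
  have h3 : cfc (fun x => ((starRingEnd ℂ) (F x)).im) B = - cfc (fun x => (F x).im) B := by
    simp only [Complex.conj_im]
    exact cfc_neg _ _
  rw [h3]
  simp

theorem commute_continuousFC (F : ℝ → ℂ) {B : H →L[ℂ] H} (hB : IsSelfAdjoint B) :
    Commute (continuousFC F B) B := by
  have h : ∀ f : ℝ → ℝ, Commute (cfc f B) B := by
    intro f
    have := cfc_commute_cfc f id B
    rwa [cfc_id ℝ B hB] at this
  exact (h _).add_left ((h _).smul_left _)

theorem continuousFC_eq_cfc {F : ℝ → ℂ} (hF : Continuous F) {B : H →L[ℂ] H}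
    (hB : IsSelfAdjoint B) : continuousFC F B = cfc (fun z : ℂ => F z.re) B := by
  have h1 : Continuous fun x => (F x).re := Complex.continuous_re.comp hF
  have h2 : Continuous fun x => (F x).im := Complex.continuous_im.comp hF
  rw [continuousFC, cfc_real_eq_complex _ hB, cfc_real_eq_complex _ hB, ← cfc_const_mul _ _ _ ?_,
    ← cfc_add _ _ _ ?_ ?_]
  · congr 1
    ext z
    rw [mul_comm]
    exact Complex.re_add_im _
  all_goals fun_prop

/-- Identifies the spectral exponential with the power series. It serves twice: with a linear
exponent for the unitary group, and with a quadratic exponent for Gaussians of `B`, whose series can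
be estimated term by term on `L^p`. -/
theorem continuousFC_cexp {g : ℂ → ℂ} (hg : Continuous g) {B : H →L[ℂ] H}
    (hB : IsSelfAdjoint B) :
    continuousFC (fun x : ℝ => Complex.exp (g x)) B = NormedSpace.exp (cfc g B) := by
  have hn : IsStarNormal B := hB.isStarNormal
  rw [continuousFC_eq_cfc (by fun_prop) hB,
    ← CFC.complex_exp_eq_normedSpace_exp (p := IsStarNormal) (cfc_predicate g B),
    ← cfc_comp' Complex.exp g B]
  refine cfc_congr fun z hz => ?_
  have : (z.re : ℂ) = z := by
    have := hB.mem_spectrum_eq_re hz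
    exact this.symm
  simp only [this]

theorem cfc_quadratic {B : H →L[ℂ] H} (hB : IsSelfAdjoint B) (a b : ℂ) :
    cfc (fun z : ℂ => a * z + b * z ^ 2) B = a • B + b • B ^ 2 := by
  have hn : IsStarNormal B := hB.isStarNormal
  rw [cfc_add .., cfc_const_mul .., cfc_const_mul .., cfc_pow_id .., cfc_id' ..]

end SpectralCalculus

/-! ### Growth of moments under the unitary group -/

section Propagation

variable {X : Type*} [MetricSpace X] [MeasurableSpace X] {μ : Measure X} {n C l : ℝ}

/-- The unitary group `exp(i t B)`. -/
def unitaryGroup {H : Type*} [NormedAddCommGroup H] [InnerProductSpace ℂ H] [CompleteSpace H]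
    (B : H →L[ℂ] H) (t : ℝ) : H →L[ℂ] H :=
  NormedSpace.exp (t • (Complex.I • B))

theorem unitaryGroup_mem {H : Type*} [NormedAddCommGroup H] [InnerProductSpace ℂ H]
    [CompleteSpace H] {B : H →L[ℂ] H} (hB : IsSelfAdjoint B) (t : ℝ) :
    unitaryGroup B t ∈ unitary (H →L[ℂ] H) := by
  let +nondep : NormedAlgebra ℚ (H →L[ℂ] H) := .restrictScalars ℚ ℂ (H →L[ℂ] H)
  refine NormedSpace.exp_mem_unitary_of_mem_skewAdjoint ?_
  rw [skewAdjoint.mem_iff, star_smul, star_smul, hB.star_eq]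
  simp

theorem norm_unitaryGroup_apply {H : Type*} [NormedAddCommGroup H] [InnerProductSpace ℂ H]
    [CompleteSpace H] {B : H →L[ℂ] H} (hB : IsSelfAdjoint B) (t : ℝ) (v : H) :
    ‖unitaryGroup B t v‖ = ‖v‖ :=
  ContinuousLinearMap.norm_map_of_mem_unitary (unitaryGroup_mem hB t) v

theorem unitaryGroup_zero {H : Type*} [NormedAddCommGroup H] [InnerProductSpace ℂ H]
    [CompleteSpace H] (B : H →L[ℂ] H) : unitaryGroup B 0 = 1 := by
  rw [unitaryGroup, zero_smul ℝ (Complex.I • B), NormedSpace.exp_zero]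

/-- Heisenberg's equation. When `S` is a power of a weight, the commutator `S B - B S` contains only
lower powers of it, and this drives the induction on moments. -/
theorem hasDerivAt_unitaryGroup_conj {H : Type*} [NormedAddCommGroup H] [InnerProductSpace ℂ H]
    [CompleteSpace H] (B S : H →L[ℂ] H) (t : ℝ) :
    HasDerivAt (fun s => unitaryGroup B (-s) * (S * unitaryGroup B s))
      (Complex.I • (unitaryGroup B (-t) * ((S * B - B * S) * unitaryGroup B t))) t := by
  have h1 : HasDerivAt (unitaryGroup B) ((Complex.I • B) * unitaryGroup B t) t :=
    hasDerivAt_exp_smul_const' (𝕂 := ℝ) (Complex.I • B) t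
  have h2 : HasDerivAt (fun s => unitaryGroup B (-s))
      (-(unitaryGroup B (-t) * (Complex.I • B))) t := by
    have := (hasDerivAt_exp_smul_const (𝕂 := ℝ) (Complex.I • B) (-t)).scomp t (hasDerivAt_neg t)
    exact this.congr_deriv (neg_one_smul ℝ _)
  refine (h2.mul (h1.const_mul S)).congr_deriv ?_
  simp only [smul_mul_assoc, mul_smul_comm, sub_mul, mul_sub, neg_mul, smul_sub, mul_assoc]
  abel

/-- Growth of `M^j exp(i t B) g` when the iterated commutators of `M` and `B` are bounded. -/
theorem exists_norm_pow_unitaryGroup_le {X : Type*} [MeasurableSpace X] (μ : Measure X) {d : ℝ} (hd : 0 ≤ d) (m : ℕ) :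
    ∃ P : ℝ, 0 ≤ P ∧ ∀ (B M : Lp ℂ 2 μ →L[ℂ] Lp ℂ 2 μ), IsSelfAdjoint B →
      (∀ j ≤ m, ‖(commOp M ^ j) B‖ ≤ d) → ∀ (g : Lp ℂ 2 μ) (A : ℝ), (∀ j ≤ m, ‖(M ^ j) g‖ ≤ A) →
      ∀ j ≤ m, ∀ t : ℝ, ‖(M ^ j) (unitaryGroup B t g)‖ ≤ P * A * (1 + |t|) ^ j := by
  induction m with
  | zero =>
    refine ⟨1, zero_le_one, fun B M hB _ g A hA j hj t => ?_⟩
    obtain rfl : j = 0 := by omega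
    have := hA 0 le_rfl
    simp only [pow_zero, one_apply_eq_self] at this ⊢
    rw [norm_unitaryGroup_apply hB]
    linarith
  | succ m ih =>
    obtain ⟨P, hP, h⟩ := ih
    -- The three terms serve the lower moments, the initial value at time `0`, and the integral of
    -- the derivative over `[0, t]`.
    refine ⟨P + (1 + 2 ^ (m + 1) * d * P), by positivity, fun B M hB hBM g A hA j hj t => ?_⟩
    have hA0 : 0 ≤ A := (norm_nonneg _).trans (hA 0 (Nat.zero_le _))
    have ih' := h B M hB (fun j hj => hBM j (by omega)) g A (fun j hj => hA j (by omega))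
    rcases Nat.lt_or_ge j (m + 1) with hjm | hjm
    · refine (ih' j (by omega) t).trans ?_
      gcongr
      have : 0 ≤ 1 + 2 ^ (m + 1) * d * P := by positivity
      linarith
    obtain rfl : j = m + 1 := by omega
    set z : ℝ → Lp ℂ 2 μ := fun s =>
      (unitaryGroup B (-s) * (M ^ (m + 1) * unitaryGroup B s)) g with hz
    have hzt : ‖(M ^ (m + 1)) (unitaryGroup B t g)‖ = ‖z t‖ := by
      rw [hz]
      simp only [mul_apply_eq_comp]
      rw [norm_unitaryGroup_apply hB]
    have hz0 : z 0 = (M ^ (m + 1)) g := by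
      simp [hz, unitaryGroup_zero]
    have hderiv : ∀ s, HasDerivAt z ((Complex.I • (unitaryGroup B (-s) *
        ((M ^ (m + 1) * B - B * M ^ (m + 1)) * unitaryGroup B s))) g) s := by
      intro s
      exact ((ContinuousLinearMap.apply ℂ (Lp ℂ 2 μ) g).restrictScalars ℝ).hasFDerivAt.comp_hasDerivAt s
        (hasDerivAt_unitaryGroup_conj B (M ^ (m + 1)) s)
    -- The term `j = 0` of the binomial expansion is `B M^(m+1)` and cancels. What remains has at
    -- most `m` powers of `M` on the right, within reach of the induction hypothesis.
    have hcomm : M ^ (m + 1) * B - B * M ^ (m + 1) = ∑ j ∈ Finset.range (m + 1),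
        ((m + 1).choose (j + 1) : ℂ) • ((commOp M ^ (j + 1)) B * M ^ (m - j)) := by
      rw [pow_mul_eq_sum_commOp, Finset.sum_range_succ']
      simp
    have hbound : ∀ s ∈ Set.uIcc 0 t, ‖(Complex.I • (unitaryGroup B (-s) *
        ((M ^ (m + 1) * B - B * M ^ (m + 1)) * unitaryGroup B s))) g‖ ≤
        2 ^ (m + 1) * d * P * A * (1 + |t|) ^ m := by
      intro s hs
      have hst : |s| ≤ |t| := by
        have := Set.abs_sub_left_of_mem_uIcc hs
        simpa using this
      rw [_root_.smul_apply, norm_smul, Complex.norm_I, one_mul, mul_apply_eq_comp,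
        norm_unitaryGroup_apply hB, mul_apply_eq_comp, hcomm, _root_.sum_apply]
      refine (norm_sum_le _ _).trans ?_
      have hterm : ∀ j ∈ Finset.range (m + 1),
          ‖(((m + 1).choose (j + 1) : ℂ) • ((commOp M ^ (j + 1)) B * M ^ (m - j)))
            (unitaryGroup B s g)‖ ≤
          ((m + 1).choose (j + 1) : ℝ) * (d * (P * A * (1 + |t|) ^ m)) := by
        intro j hj
        have hj' : j < m + 1 := Finset.mem_range.1 hj
        rw [_root_.smul_apply, norm_smul, Complex.norm_natCast, mul_apply_eq_comp]
        gcongr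
        refine (ContinuousLinearMap.le_opNorm _ _).trans ?_
        gcongr
        · exact hBM (j + 1) (by omega)
        · refine (ih' (m - j) (by omega) s).trans ?_
          have h1 : (1 : ℝ) ≤ 1 + |t| := by linarith [abs_nonneg t]
          calc P * A * (1 + |s|) ^ (m - j) ≤ P * A * (1 + |t|) ^ (m - j) := by gcongr
            _ ≤ P * A * (1 + |t|) ^ m := by
              gcongr
              omega
      refine (Finset.sum_le_sum hterm).trans ?_
      rw [← Finset.sum_mul]
      have hch : ∑ j ∈ Finset.range (m + 1), ((m + 1).choose (j + 1) : ℝ) ≤ 2 ^ (m + 1) := by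
        have := Nat.sum_range_choose (m + 1)
        rw [Finset.sum_range_succ'] at this
        have h2 : ∑ j ∈ Finset.range (m + 1), (m + 1).choose (j + 1) ≤ 2 ^ (m + 1) := by omega
        exact_mod_cast h2
      calc _ ≤ (2 : ℝ) ^ (m + 1) * (d * (P * A * (1 + |t|) ^ m)) := by gcongr
        _ = _ := by ring
    -- The derivative is at most of order `(1 + |t|)^m` on the whole segment from `0` to `t`, so the
    -- mean value inequality adds one power of `1 + |t|`.
    have hmv := (convex_uIcc (0 : ℝ) t).norm_image_sub_le_of_norm_hasDerivWithin_le
      (fun s _ => (hderiv s).hasDerivWithinAt) hbound Set.left_mem_uIcc Set.right_mem_uIcc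
    rw [sub_zero, Real.norm_eq_abs, hz0] at hmv
    rw [hzt]
    have h1 : (1 : ℝ) ≤ (1 + |t|) ^ (m + 1) := one_le_pow₀ (by linarith [abs_nonneg t])
    have h2 : ‖z t‖ ≤ ‖(M ^ (m + 1)) g‖ + ‖z t - (M ^ (m + 1)) g‖ := by
      have := norm_add_le ((M ^ (m + 1)) g) (z t - (M ^ (m + 1)) g)
      rwa [add_sub_cancel] at this
    have h3 := hA (m + 1) le_rfl
    have h4 : 2 ^ (m + 1) * d * P * A * (1 + |t|) ^ m * |t| ≤
        2 ^ (m + 1) * d * P * A * (1 + |t|) ^ (m + 1) := by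
      rw [pow_succ (1 + |t|), ← mul_assoc]
      gcongr
      linarith
    have h5 : A ≤ A * (1 + |t|) ^ (m + 1) := le_mul_of_one_le_right hA0 h1
    have h6 : 0 ≤ P * A * (1 + |t|) ^ (m + 1) := by positivity
    nlinarith

theorem IsIntegralOp.mono {T : Lp ℂ 2 μ →L[ℂ] Lp ℂ 2 μ} {K : X → X → ℂ} {c : ℝ≥0∞}
    (hT : IsIntegralOp μ T K c l) {l' : ℝ} (hl : l' ≤ l) : IsIntegralOp μ T K c l' where
  measurable := hT.measurable
  apply_ae := hT.apply_ae
  enorm_le x y := by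
    refine (hT.enorm_le x y).trans ?_
    rw [decayKernel, decayKernel]
    gcongr
    linarith [dist_nonneg (x := x) (y := y)]

variable [TopologicalSpace.SeparableSpace X] [BorelSpace X]

/-- Weighted estimate for `exp(i t B) B f`, where the weight `w` vanishes on the support of `f`. -/
theorem exists_weighted_unitaryGroup_le {X : Type*} [MeasurableSpace X] (μ : Measure X)
    (hn : 0 ≤ n) {c : ℝ≥0∞} (hc : c ≠ ∞) (m : ℕ) (hl : n + m < l) {p : ℝ≥0∞} (hp1 : 1 ≤ p) (hp2 : p ≤ 2) :
    ∃ P : ℝ, 0 ≤ P ∧ ∀ [MetricSpace X] [TopologicalSpace.SeparableSpace X] [BorelSpace X],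
      IsDoubling μ n C → ∀ (B : Lp ℂ 2 μ →L[ℂ] Lp ℂ 2 μ) (K : X → X → ℂ), IsSelfAdjoint B →
      IsIntegralOp μ B K c l → ∀ (w : X → ℝ) (hw : Measurable w) (R : ℝ) (hR : ∀ x, |w x| ≤ R),
      (∀ x y, |w x - w y| ≤ dist x y) → ∀ f : Lp ℂ 2 μ, mulOp μ w hw R hR f = 0 →
      weightedNorm μ p f ≠ ∞ → ∀ t : ℝ,
      ‖(mulOp μ w hw R hR ^ m) (unitaryGroup B t (B f))‖ ≤
        P * (1 + |t|) ^ m * (weightedNorm μ p f).toReal := by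
  have hp : p ≠ ∞ := (hp2.trans_lt (by norm_num)).ne
  have hl' : n < l - m := by linarith
  have hl0 : 0 ≤ l - m := by linarith
  set d := (c * decayConst n C (l - m)).toReal
  have hdt : c * decayConst n C (l - m) ≠ ∞ := ENNReal.mul_ne_top hc (decayConst_ne_top hl')
  have het : c * weightedConst n C (l - m) p ≠ ∞ :=
    ENNReal.mul_ne_top hc (weightedConst_ne_top hl' hp1 hp)
  obtain ⟨P, hP, h⟩ := exists_norm_pow_unitaryGroup_le (X := X) μ (d := d) ENNReal.toReal_nonneg m
  refine ⟨P * (c * weightedConst n C (l - m) p).toReal, by positivity, ?_⟩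
  intro _ _ _ hX B K hB hBK w hw R hR hLip f hf hfin t
  set M := mulOp μ w hw R hR with hM
  have hcomm : ∀ j ≤ m, IsIntegralOp μ ((commOp M ^ j) B)
      (fun x y => ((w x - w y : ℝ) : ℂ) ^ j * K x y) c (l - m) := by
    intro j hj
    have hj' : (j : ℝ) ≤ m := by exact_mod_cast hj
    exact (hBK.commOp_pow hX hc hn (hw := hw) (hR := hR) hLip j (by linarith)).mono (by linarith)
  have h1 : ∀ j ≤ m, ‖(commOp M ^ j) B‖ ≤ d := fun j hj =>
    ((hcomm j hj).lpBound hX hl0 (by norm_num) (by norm_num)).opNorm_le hdt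
  have h2 : ∀ j ≤ m, ‖(M ^ j) (B f)‖ ≤
      (c * weightedConst n C (l - m) p).toReal * (weightedNorm μ p f).toReal := by
    intro j hj
    -- Since `M f = 0`, every term of the expansion that ends in a positive power of `M` vanishes,
    -- and only the full commutator survives. Its kernel still decays faster than `(1 + d)^(-n)`.
    have e : (M ^ j) (B f) = ((commOp M ^ j) B) f := by
      rw [← mul_apply_eq_comp, pow_mul_eq_sum_commOp, _root_.sum_apply, Finset.sum_range_succ,
        Finset.sum_eq_zero]
      · simp
      · intro i hi
        have hij : i < j := Finset.mem_range.1 hi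
        obtain ⟨k, hk⟩ : ∃ k, j - i = k + 1 := ⟨j - i - 1, by omega⟩
        rw [_root_.smul_apply, mul_apply_eq_comp, hk, pow_succ, mul_apply_eq_comp, hf]
        simp
    rw [e, Lp.norm_def, ← ENNReal.toReal_mul]
    exact ENNReal.toReal_mono (ENNReal.mul_ne_top het hfin)
      ((hcomm j hj).eLpNorm_two_le hX hl0 hp1 hp2 f)
  have := h B M hB h1 (B f) _ h2 m le_rfl t
  linarith

end Propagation

/-! ### Summation over localized pieces -/

section LocalizedSums

variable {α : Type*} [MeasurableSpace α] {μ : Measure α}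

theorem tsum_setLIntegral_le {ι : Type*} [Countable ι] {A : ι → Set α}
    (hA : ∀ c, MeasurableSet (A c)) {D : ℝ≥0∞} (hD : ∀ x, ∑' c, (A c).indicator 1 x ≤ D)
    {φ : α → ℝ≥0∞} (hφ : AEMeasurable φ μ) :
    ∑' c, ∫⁻ x in A c, φ x ∂μ ≤ D * ∫⁻ x, φ x ∂μ := by
  calc ∑' c, ∫⁻ x in A c, φ x ∂μ = ∑' c, ∫⁻ x, (A c).indicator 1 x * φ x ∂μ := by
        refine tsum_congr fun c => ?_
        rw [← lintegral_indicator (hA c)]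
        refine lintegral_congr fun x => ?_
        by_cases hx : x ∈ A c <;> simp [hx]
    _ = ∫⁻ x, ∑' c, (A c).indicator 1 x * φ x ∂μ := by
        rw [lintegral_tsum]
        exact fun c => (measurable_one.indicator (hA c)).aemeasurable.mul hφ
    _ ≤ ∫⁻ x, D * φ x ∂μ := by
        refine lintegral_mono fun x => ?_
        rw [ENNReal.tsum_mul_right]
        gcongr
        exact hD x
    _ = _ := lintegral_const_mul'' _ hφ

/-- Hölder's inequality for sequences in `ℓ^q` and `ℓ^p`. The sets `A c` overlap at most `D` times,
which costs `D^(1/q)`, while the disjoint sets `Q c` cost nothing. -/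
theorem tsum_eLpNorm_mul_le {ι : Type*} [Countable ι] {A Q : ι → Set α}
    (hA : ∀ c, MeasurableSet (A c)) (hQ : ∀ c, MeasurableSet (Q c))
    (hQd : Pairwise (Function.onFun Disjoint Q)) {D : ℝ≥0∞}
    (hD : ∀ x, ∑' c, (A c).indicator 1 x ≤ D) {p q : ℝ≥0∞} [ENNReal.HolderConjugate p q]
    (hp : p ≠ ∞) {f h : α → ℂ} (hf : AEStronglyMeasurable f μ) (hh : AEStronglyMeasurable h μ) :
    ∑' c, eLpNorm h q (μ.restrict (A c)) * eLpNorm f p (μ.restrict (Q c)) ≤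
      D ^ (1 / q.toReal) * eLpNorm h q μ * eLpNorm f p μ := by
  have hQD : ∀ x, ∑' c, (Q c).indicator (1 : α → ℝ≥0∞) x ≤ 1 := by
    intro x
    by_cases hx : ∃ c, x ∈ Q c
    · obtain ⟨c, hc⟩ := hx
      rw [tsum_eq_single c]
      · exact Set.indicator_le_self' (by simp) _
      · intro d hd
        refine Set.indicator_of_notMem (fun hxd => ?_) _
        exact Set.disjoint_left.1 (hQd hd) hxd hc
    · rw [not_exists] at hx
      simp [hx]
  have hp1 : 1 ≤ p := ENNReal.HolderConjugate.one_le p q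
  have hp0 : p ≠ 0 := (zero_lt_one.trans_le hp1).ne'
  by_cases hq : q = ∞
  · have hp' : p = 1 := (ENNReal.HolderConjugate.eq_top_iff_eq_one q p).1 hq
    subst hp' hq
    simp only [ENNReal.toReal_top, div_zero, ENNReal.rpow_zero, one_mul]
    calc _ ≤ ∑' c, eLpNorm h ∞ μ * eLpNorm f 1 (μ.restrict (Q c)) := by
          refine ENNReal.tsum_le_tsum fun c => ?_
          gcongr
          exact Measure.restrict_le_self
      _ = eLpNorm h ∞ μ * ∑' c, eLpNorm f 1 (μ.restrict (Q c)) := ENNReal.tsum_mul_left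
      _ ≤ _ := by
          gcongr
          simp only [eLpNorm_one_eq_lintegral_enorm]
          simpa using tsum_setLIntegral_le hQ hQD hf.enorm
  · have hq0 : q ≠ 0 := ENNReal.HolderConjugate.ne_zero q p
    have hqr : 0 < q.toReal := ENNReal.toReal_pos hq0 hq
    have hpr : 0 < p.toReal := ENNReal.toReal_pos hp0 hp
    have hconj : p.toReal.HolderConjugate q.toReal :=
      ENNReal.HolderConjugate.toReal (p := p) (q := q)
        (by
          have h1 : p ≠ 1 := fun h => hq ((ENNReal.HolderConjugate.eq_top_iff_eq_one q p).2 h)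
          rw [← ENNReal.toReal_one, ENNReal.toReal_lt_toReal ENNReal.one_ne_top hp]
          exact lt_of_le_of_ne hp1 h1.symm)
    let _ : MeasurableSpace ι := ⊤
    have key := ENNReal.lintegral_mul_le_Lp_mul_Lq (Measure.count : Measure ι) hconj.symm
      (f := fun c => eLpNorm h q (μ.restrict (A c))) (g := fun c => eLpNorm f p (μ.restrict (Q c)))
      (measurable_from_top.aemeasurable) (measurable_from_top.aemeasurable)
    simp only [Pi.mul_apply, lintegral_count] at key
    refine key.trans ?_
    have e1 : ∀ c, eLpNorm h q (μ.restrict (A c)) ^ q.toReal = ∫⁻ x in A c, ‖h x‖ₑ ^ q.toReal ∂μ := by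
      intro c
      rw [eLpNorm_eq_lintegral_rpow_enorm_toReal hq0 hq, ← ENNReal.rpow_mul,
        one_div_mul_cancel hqr.ne', ENNReal.rpow_one]
    have e2 : ∀ c, eLpNorm f p (μ.restrict (Q c)) ^ p.toReal = ∫⁻ x in Q c, ‖f x‖ₑ ^ p.toReal ∂μ := by
      intro c
      rw [eLpNorm_eq_lintegral_rpow_enorm_toReal hp0 hp, ← ENNReal.rpow_mul,
        one_div_mul_cancel hpr.ne', ENNReal.rpow_one]
    simp only [e1, e2]
    rw [eLpNorm_eq_lintegral_rpow_enorm_toReal hq0 hq, eLpNorm_eq_lintegral_rpow_enorm_toReal hp0 hp,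
      ← ENNReal.mul_rpow_of_nonneg _ _ (by positivity)]
    gcongr
    · exact tsum_setLIntegral_le hA hD (hh.enorm.pow_const _)
    · simpa using tsum_setLIntegral_le hQ hQD (hf.enorm.pow_const _)

/-- Restriction of an `L²` function to a measurable set. -/
def restrictLp (f : Lp ℂ 2 μ) {Q : Set α} (hQ : MeasurableSet Q) : Lp ℂ 2 μ :=
  ((Lp.memLp f).indicator hQ).toLp _

theorem coeFn_restrictLp (f : Lp ℂ 2 μ) {Q : Set α} (hQ : MeasurableSet Q) :
    restrictLp f hQ =ᵐ[μ] Q.indicator f := MemLp.coeFn_toLp _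

/-- Moving `T` onto `h` by its adjoint turns the pairing into an integral over `X`, which is
countably additive over the partition. -/
theorem enorm_inner_apply_le_tsum {ι : Type*} [Countable ι] {Q : ι → Set α}
    (hQ : ∀ c, MeasurableSet (Q c)) (hQd : Pairwise (Function.onFun Disjoint Q))
    (hQU : ⋃ c, Q c = Set.univ) (T : Lp ℂ 2 μ →L[ℂ] Lp ℂ 2 μ) (h f : Lp ℂ 2 μ) :
    ‖⟪h, T f⟫_ℂ‖ₑ ≤ ∑' c, ‖⟪h, T (restrictLp f (hQ c))⟫_ℂ‖ₑ := by
  set g := ContinuousLinearMap.adjoint T h with hg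
  have e : ∀ c, ⟪h, T (restrictLp f (hQ c))⟫_ℂ = ∫ x in Q c, ⟪g x, f x⟫_ℂ ∂μ := by
    intro c
    rw [← ContinuousLinearMap.adjoint_inner_left, L2.inner_def, ← integral_indicator (hQ c)]
    refine integral_congr_ae ?_
    filter_upwards [coeFn_restrictLp f (hQ c)] with x hx
    rw [hx]
    by_cases hxQ : x ∈ Q c <;> simp [hxQ, ← hg]
  have hsum := hasSum_integral_iUnion hQ hQd
    (f := fun x => ⟪g x, f x⟫_ℂ) (μ := μ) (L2.integrable_inner g f).integrableOn
  rw [hQU, setIntegral_univ, ← L2.inner_def] at hsum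
  have e' : ⟪g, f⟫_ℂ = ⟪h, T f⟫_ℂ := ContinuousLinearMap.adjoint_inner_left _ _ _
  rw [e', ← funext e] at hsum
  rw [← hsum.tsum_eq]
  exact enorm_tsum_le_tsum_enorm

theorem setLIntegral_enorm_mul_le {A : Set α} (h g : Lp ℂ 2 μ) :
    ∫⁻ x in A, ‖h x‖ₑ * ‖g x‖ₑ ∂μ ≤ eLpNorm h 2 (μ.restrict A) * eLpNorm g 2 (μ.restrict A) := by
  have := eLpNorm_smul_le_mul_eLpNorm (p := 2) (q := 2) (r := 1) (f := g) (φ := h)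
    (μ := μ.restrict A) (Lp.aestronglyMeasurable g).restrict (Lp.aestronglyMeasurable h).restrict
  rw [eLpNorm_one_eq_lintegral_enorm] at this
  simpa [enorm_mul] using this

end LocalizedSums

/-! ### From weighted `L²` bounds and moments to `L^p` bounds -/

section CoreBound

variable {X : Type*} [MetricSpace X] [TopologicalSpace.SeparableSpace X] [MeasurableSpace X]
  [BorelSpace X] {μ : Measure X} {n C : ℝ}
  {p q : ℝ≥0∞}

/-- Chebyshev's inequality for the `m`-th moment. -/
theorem eLpNorm_restrictLp_two_le_of_pow {w : X → ℝ} {hw : Measurable w} {R : ℝ}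
    {hR : ∀ x, |w x| ≤ R} {A : Set X} (hA : MeasurableSet A) {t : ℝ} (ht : 0 < t)
    (hwA : ∀ x ∈ A, t ≤ w x) (m : ℕ) (g : Lp ℂ 2 μ) :
    eLpNorm g 2 (μ.restrict A) ≤
      ENNReal.ofReal ((t ^ m)⁻¹) * eLpNorm ((mulOp μ w hw R hR ^ m) g) 2 μ := by
  refine le_trans ?_ (mul_le_mul_right (eLpNorm_mono_measure _ (Measure.restrict_le_self (s := A))) _)
  refine eLpNorm_le_mul_eLpNorm_of_ae_le_mul'' _ (Lp.aestronglyMeasurable _).restrict ?_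
  filter_upwards [ae_restrict_of_ae (coeFn_mulOp_pow (hw := hw) (hR := hR) m g), ae_restrict_mem hA]
    with x hx hxA
  have h1 := hwA x hxA
  rw [hx, enorm_mul, enorm_pow, ← mul_assoc]
  have h2 : 1 ≤ ENNReal.ofReal ((t ^ m)⁻¹) * ‖(w x : ℂ)‖ₑ ^ m := by
    rw [← ofReal_norm, Complex.norm_real, Real.norm_of_nonneg (ht.le.trans h1),
      ← ENNReal.ofReal_pow (ht.le.trans h1), ← ENNReal.ofReal_mul (by positivity),
      ENNReal.one_le_ofReal, inv_mul_eq_div, one_le_div (by positivity)]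
    gcongr
  calc ‖g x‖ₑ = 1 * ‖g x‖ₑ := (one_mul _).symm
    _ ≤ _ := by gcongr

/-- Doubling compares `V(x, 1)` with `V(c, ρ)` for all `x` in the cell, so the variable weight can
be replaced by a constant one. The loss `ρ^(nσ)` incurred here is the one that appears in the final
exponent. -/
theorem IsDoubling.weightedNorm_restrictLp_le (hX : IsDoubling μ n C) (c : X)
    {ρ : ℝ} (hρ : 1 ≤ ρ) (hC : 0 < C) (hn : 0 ≤ n) {Q : Set X} (hQ : MeasurableSet Q)
    (hQc : Q ⊆ Metric.ball c ρ) (f : Lp ℂ 2 μ) :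
    weightedNorm μ p (restrictLp f hQ) ≤
      ENNReal.ofReal (C * (2 * ρ) ^ n) ^ sigmaExp p * μ (Metric.ball c ρ) ^ (-sigmaExp p) *
        eLpNorm f p (μ.restrict Q) := by
  have hσ := sigmaExp_nonneg p
  rw [weightedNorm, ← eLpNorm_indicator_eq_eLpNorm_restrict hQ]
  refine eLpNorm_le_mul_eLpNorm_of_ae_le_mul'' _ (((Lp.aestronglyMeasurable f).indicator hQ)) ?_
  filter_upwards [coeFn_restrictLp f hQ] with x hx
  rw [hx]
  by_cases hxQ : x ∈ Q
  · rw [enorm_mul, enorm_vol_rpow hX]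
    gcongr
    have hd : dist c x < ρ := by rw [dist_comm]; exact hQc hxQ
    have h1 : μ (Metric.ball c ρ) ≤ ENNReal.ofReal (C * (2 * ρ) ^ n) * μ (Metric.ball x 1) := by
      refine (hX.measure_ball_le c x one_pos (by linarith [dist_nonneg (x := c) (y := x)])).trans ?_
      gcongr
      rw [div_one]
      linarith
    have hD0 : ENNReal.ofReal (C * (2 * ρ) ^ n) ≠ 0 := by
      simp only [ne_eq, ENNReal.ofReal_eq_zero, not_le]
      positivity
    have h2 : (ENNReal.ofReal (C * (2 * ρ) ^ n) * μ (Metric.ball x 1)) ^ (-sigmaExp p)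
        ≤ μ (Metric.ball c ρ) ^ (-sigmaExp p) := by
      rw [ENNReal.rpow_neg, ENNReal.rpow_neg]
      gcongr
    rw [ENNReal.mul_rpow_of_ne_top ENNReal.ofReal_ne_top (hX.ball_lt_top x 1 one_pos).ne] at h2
    calc μ (Metric.ball x 1) ^ (-sigmaExp p)
        = ENNReal.ofReal (C * (2 * ρ) ^ n) ^ sigmaExp p *
          (ENNReal.ofReal (C * (2 * ρ) ^ n) ^ (-sigmaExp p) *
            μ (Metric.ball x 1) ^ (-sigmaExp p)) := by
          rw [← mul_assoc, ← ENNReal.rpow_add _ _ hD0 ENNReal.ofReal_ne_top, add_neg_cancel,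
            ENNReal.rpow_zero, one_mul]
      _ ≤ _ := by gcongr
  · simp [hxQ]

/-- Since `q ≥ 2`, this is the inclusion of `L^q` in `L²` on `A`, with exponent `1/2 - 1/q = 1/p -
1/2 = σ_p`. -/
theorem eLpNorm_two_restrict_le [ENNReal.HolderConjugate p q] (hp1 : 1 ≤ p) (hp2 : p ≤ 2)
    {h : X → ℂ} (hh : AEStronglyMeasurable h μ) (A : Set X) :
    eLpNorm h 2 (μ.restrict A) ≤ eLpNorm h q (μ.restrict A) * μ A ^ sigmaExp p := by
  have hpt : p ≠ ∞ := (hp2.trans_lt (by norm_num)).ne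
  have hpq := ENNReal.HolderConjugate.inv_add_inv_eq_one p q
  have hq0 : q ≠ 0 := ENNReal.HolderConjugate.ne_zero q p
  have h2q : 2 ≤ q := by
    rw [← ENNReal.inv_le_inv]
    by_contra hlt
    rw [not_le] at hlt
    have h3 : (2 : ℝ≥0∞)⁻¹ ≤ p⁻¹ := ENNReal.inv_le_inv.2 hp2
    have h4 : (2 : ℝ≥0∞)⁻¹ + 2⁻¹ < p⁻¹ + q⁻¹ :=
      ENNReal.add_lt_add_of_le_of_lt (by norm_num) h3 hlt
    rw [hpq, ENNReal.inv_two_add_inv_two] at h4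
    exact lt_irrefl _ h4
  have key := eLpNorm_le_eLpNorm_mul_rpow_measure_univ h2q hh.restrict (μ := μ.restrict A)
  rw [Measure.restrict_apply_univ] at key
  convert key using 3
  rw [sigmaExp_eq hp1 hp2]
  have h5 := congrArg ENNReal.toReal hpq
  rw [ENNReal.toReal_add (by simpa using (zero_lt_one.trans_le hp1).ne') (by simpa using hq0), ENNReal.toReal_inv,
    ENNReal.toReal_inv, ENNReal.toReal_one] at h5
  simp only [one_div, ENNReal.toReal_ofNat]
  linarith

/-- The dyadic annulus `2 ^ i ρ ≤ d(x, c) < 2 ^ (i + 1) ρ`, a ball for `i = 0`. -/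
def dyadicAnnulus (c : X) (ρ : ℝ) (i : ℕ) : Set X :=
  Metric.ball c (2 ^ (i + 1) * ρ) ∩ {x | i = 0 ∨ 2 ^ i * ρ ≤ dist x c}

theorem measurableSet_dyadicAnnulus (c : X) (ρ : ℝ) (i : ℕ) :
    MeasurableSet (dyadicAnnulus c ρ i) := by
  refine measurableSet_ball.inter ?_
  by_cases hi : i = 0
  · simp [hi]
  · simp only [hi, false_or]
    exact (isClosed_le continuous_const (continuous_id.dist continuous_const)).measurableSet

theorem iUnion_dyadicAnnulus (c : X) {ρ : ℝ} (hρ : 0 < ρ) :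
    ⋃ i, dyadicAnnulus c ρ i = Set.univ := by
  classical
  refine Set.eq_univ_of_forall fun x => Set.mem_iUnion.2 ?_
  have hex : ∃ i : ℕ, dist x c < 2 ^ (i + 1) * ρ := by
    obtain ⟨i, hi⟩ := pow_unbounded_of_one_lt (dist x c / ρ) (one_lt_two)
    refine ⟨i, ?_⟩
    rw [div_lt_iff₀ hρ] at hi
    refine hi.trans_le ?_
    gcongr
    · norm_num
    · omega
  refine ⟨Nat.find hex, Nat.find_spec hex, ?_⟩
  change _ ∨ _
  rcases Nat.eq_zero_or_pos (Nat.find hex) with h | h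
  · exact Or.inl h
  · right
    have := Nat.find_min hex (Nat.sub_lt h one_pos)
    rw [not_lt] at this
    exact (congrArg (fun j => (2 : ℝ) ^ j * ρ) (Nat.sub_add_cancel h)).symm.le.trans this

/-- `T` satisfies the weighted `L^p → L²` bound `a` and the bound `b` for the `m`-th moments away
from the support. -/
structure HasOffDiagonalBound (μ : Measure X) (T : Lp ℂ 2 μ →L[ℂ] Lp ℂ 2 μ) (p : ℝ≥0∞) (m : ℕ)
    (a b : ℝ≥0∞) : Prop where
  near : ∀ f : Lp ℂ 2 μ, weightedNorm μ p f ≠ ∞ → eLpNorm (T f) 2 μ ≤ a * weightedNorm μ p f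
  moment : ∀ (w : X → ℝ) (hw : Measurable w) (R : ℝ) (hR : ∀ x, |w x| ≤ R), (∀ x, 0 ≤ w x) →
    (∀ x y, |w x - w y| ≤ dist x y) → ∀ f : Lp ℂ 2 μ, mulOp μ w hw R hR f = 0 →
    weightedNorm μ p f ≠ ∞ →
    eLpNorm ((mulOp μ w hw R hR ^ m) (T f)) 2 μ ≤ b * weightedNorm μ p f

/-- For `i = 0` the near bound is enough. For `i ≥ 1` the moment bound is applied to the distance
from the ball that contains `Q`, which is comparable to `2^i ρ` on the annulus. -/
theorem HasOffDiagonalBound.annulus_le {T : Lp ℂ 2 μ →L[ℂ] Lp ℂ 2 μ} {m : ℕ} {a b : ℝ≥0∞}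
    (hT : HasOffDiagonalBound μ T p m a b) (c : X) {ρ : ℝ} (hρ : 1 ≤ ρ) {Q : Set X}
    (hQ : MeasurableSet Q) (hQc : Q ⊆ Metric.ball c ρ) (f : Lp ℂ 2 μ)
    (hf : weightedNorm μ p (restrictLp f hQ) ≠ ∞) (i : ℕ) :
    eLpNorm (T (restrictLp f hQ)) 2 (μ.restrict (dyadicAnnulus c ρ i)) ≤
      ENNReal.ofReal (2 ^ m * ((2 ^ m)⁻¹) ^ i) * (a + b * ENNReal.ofReal ((ρ ^ m)⁻¹)) *
        weightedNorm μ p (restrictLp f hQ) := by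
  have hρ0 : 0 < ρ := by linarith
  rcases Nat.eq_zero_or_pos i with rfl | hi
  · calc _ ≤ eLpNorm (T (restrictLp f hQ)) 2 μ := eLpNorm_mono_measure _ Measure.restrict_le_self
      _ ≤ a * weightedNorm μ p (restrictLp f hQ) := hT.near _ hf
      _ = 1 * (a + 0) * weightedNorm μ p (restrictLp f hQ) := by rw [one_mul, add_zero]
      _ ≤ _ := by
        gcongr
        · rw [ENNReal.one_le_ofReal, pow_zero, mul_one]
          exact one_le_pow₀ one_le_two
        · exact zero_le
  -- The weight is `1`-Lipschitz, vanishes on `Q` and is at least `2^(i-1) ρ` on the annulus. The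
  -- truncation only serves to make it bounded, so that it acts on `L²`.
  · let w : X → ℝ := fun x => min (max (dist x c - ρ) 0) (2 ^ (i + 1) * ρ)
    have hwc : Continuous w := by fun_prop
    have hw0 : ∀ x, 0 ≤ w x := fun x => le_min (le_max_right _ _) (by positivity)
    have hR : ∀ x, |w x| ≤ 2 ^ (i + 1) * ρ := fun x => by
      rw [abs_of_nonneg (hw0 x)]
      exact min_le_right _ _
    have hL : ∀ x y, |w x - w y| ≤ dist x y := fun x y => by
      refine (abs_min_sub_min_le_max _ _ _ _).trans (max_le ?_ (by simp))
      refine (abs_max_sub_max_le_max _ _ _ _).trans (max_le ?_ (by simp))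
      rw [sub_sub_sub_cancel_right]
      exact abs_dist_sub_le x y c
    have h0 : mulOp μ w hwc.measurable _ hR (restrictLp f hQ) = 0 := by
      rw [Lp.eq_zero_iff_ae_eq_zero]
      filter_upwards [coeFn_mulOp (hw := hwc.measurable) (hR := hR) (restrictLp f hQ),
        coeFn_restrictLp f hQ] with x h1 h2
      rw [h1, h2]
      by_cases hxQ : x ∈ Q
      · have : w x = 0 := by
          have hd : dist x c < ρ := hQc hxQ
          simp only [w]
          rw [max_eq_right (by linarith), min_eq_left (by positivity)]
        simp [this]
      · simp [hxQ]
    have hA : ∀ x ∈ dyadicAnnulus c ρ i, 2 ^ (i - 1) * ρ ≤ w x := by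
      intro x hx
      have hx2 : 2 ^ i * ρ ≤ dist x c := hx.2.resolve_left hi.ne'
      have e : (2 : ℝ) ^ i = 2 * 2 ^ (i - 1) := by
        rw [← pow_succ', Nat.sub_add_cancel hi]
      have h1 : (1 : ℝ) ≤ 2 ^ (i - 1) := one_le_pow₀ one_le_two
      refine le_min (le_max_of_le_left ?_) ?_
      · rw [e] at hx2
        nlinarith
      · gcongr
        · norm_num
        · omega
    have h3 := eLpNorm_restrictLp_two_le_of_pow (hw := hwc.measurable) (hR := hR)
      (measurableSet_dyadicAnnulus c ρ i) (by positivity) hA m (T (restrictLp f hQ))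
    refine h3.trans ?_
    calc _ ≤ ENNReal.ofReal (((2 ^ (i - 1) * ρ) ^ m)⁻¹) *
          (b * weightedNorm μ p (restrictLp f hQ)) := by
          gcongr
          exact hT.moment w hwc.measurable _ hR hw0 hL _ h0 hf
      _ = ENNReal.ofReal (2 ^ m * ((2 ^ m)⁻¹) ^ i) * (0 + b * ENNReal.ofReal ((ρ ^ m)⁻¹)) *
          weightedNorm μ p (restrictLp f hQ) := by
          have e : ((2 ^ (i - 1) * ρ) ^ m)⁻¹ = (2 ^ m * ((2 ^ m)⁻¹) ^ i) * (ρ ^ m)⁻¹ := by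
            obtain ⟨j, rfl⟩ : ∃ j, i = j + 1 := ⟨i - 1, by omega⟩
            rw [Nat.add_sub_cancel, mul_pow, mul_inv, pow_succ, ← pow_mul, mul_comm j m, pow_mul,
              inv_pow]
            field_simp
          rw [e, ENNReal.ofReal_mul (by positivity), zero_add]
          ring
      _ ≤ _ := by
          gcongr
          exact zero_le

/-- Each cell is paired with the annuli around its centre. On annulus `i` the volume growth
contributes `2^(inσ)` and the overlap of the annuli contributes `2^(in/q)`. Together they give
`2^(in/2)`, which the factor `2^(-im)` from the moments beats when `m > n/2`. The radius `ρ` is left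
free in order to balance `a` against `b`. The constant precedes the metric, which will be rescaled
with `k`. -/
theorem exists_core_bound {X : Type*} [MeasurableSpace X] (μ : Measure X)
    (hn : 0 ≤ n) (hC : 1 ≤ C) {m : ℕ}
    (hm : n / 2 < m) [ENNReal.HolderConjugate p q] (hp1 : 1 ≤ p) (hp2 : p ≤ 2) :
    ∃ M : ℝ≥0∞, M ≠ ∞ ∧ ∀ [MetricSpace X] [TopologicalSpace.SeparableSpace X] [BorelSpace X],
      IsDoubling μ n C → ∀ (T : Lp ℂ 2 μ →L[ℂ] Lp ℂ 2 μ) (a b : ℝ≥0∞) (ρ : ℝ), 1 ≤ ρ →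
      HasOffDiagonalBound μ T p m a b →
      WeakLpBound μ T p q (M * ENNReal.ofReal (ρ ^ (n * sigmaExp p)) *
        (a + b * ENNReal.ofReal ((ρ ^ m)⁻¹))) := by
  have hσ := sigmaExp_nonneg p
  have hpt : p ≠ ∞ := (hp2.trans_lt (by norm_num)).ne
  have hp0 : p ≠ 0 := (zero_lt_one.trans_le hp1).ne'
  have hC0 : 0 < C := by linarith
  have hq0 : q ≠ 0 := ENNReal.HolderConjugate.ne_zero q p
  have hexp : sigmaExp p + 1 / q.toReal = 1 / 2 := by
    rw [sigmaExp_eq hp1 hp2]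
    have h5 := congrArg ENNReal.toReal (ENNReal.HolderConjugate.inv_add_inv_eq_one p q)
    rw [ENNReal.toReal_add (by simpa using hp0) (by simpa using hq0), ENNReal.toReal_inv,
      ENNReal.toReal_inv, ENNReal.toReal_one] at h5
    simp only [one_div]
    linarith
  have hqr : 0 ≤ 1 / q.toReal := by positivity
  let E : ℕ → ℝ≥0∞ := fun i => ENNReal.ofReal (2 ^ m * ((2 ^ m)⁻¹) ^ i) *
    ENNReal.ofReal (C * (2 ^ (i + 1)) ^ n) ^ sigmaExp p
  let D : ℕ → ℝ≥0∞ := fun i => ENNReal.ofReal (C * (48 * 2 ^ i) ^ n)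
  -- By `hexp` the exponents of volume and overlap add up to `n/2`, so the series is geometric with
  -- ratio `2^(n/2 - m)`.
  have hE : ∑' i, E i * D i ^ (1 / q.toReal) ≠ ∞ := by
    let r : ℝ := (2 : ℝ) ^ (n / 2 - m)
    have hr0 : 0 ≤ r := by positivity
    have hr1 : r < 1 := Real.rpow_lt_one_of_one_lt_of_neg one_lt_two (by linarith)
    have he : ∀ i, E i * D i ^ (1 / q.toReal) =
        ENNReal.ofReal (2 ^ m * (C * 2 ^ n) ^ sigmaExp p * (C * 48 ^ n) ^ (1 / q.toReal) * r ^ i) := by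
      intro i
      simp only [E, D]
      rw [ENNReal.ofReal_rpow_of_nonneg (by positivity) hσ,
        ENNReal.ofReal_rpow_of_nonneg (by positivity) hqr, ← ENNReal.ofReal_mul (by positivity),
        ← ENNReal.ofReal_mul (by positivity)]
      congr 1
      have hb : ∀ t : ℝ, 0 ≤ t → ∀ y : ℝ, (C * (t * 2 ^ i) ^ n) ^ y
          = (C * t ^ n) ^ y * (2 : ℝ) ^ (i * (n * y)) := by
        intro t ht y
        rw [Real.mul_rpow ht (by positivity), ← mul_assoc,
          Real.mul_rpow (by positivity) (by positivity), ← Real.rpow_natCast 2 i,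
          ← Real.rpow_mul two_pos.le, ← Real.rpow_mul two_pos.le]
        congr 2
        ring
      rw [pow_succ' (2 : ℝ) i, hb 2 (by norm_num), hb 48 (by norm_num)]
      have e2 : ((2 ^ m)⁻¹ : ℝ) ^ i * ((2 : ℝ) ^ (i * (n * sigmaExp p)) *
          (2 : ℝ) ^ (i * (n * (1 / q.toReal)))) = r ^ i := by
        rw [← Real.rpow_add two_pos, ← mul_add, ← mul_add, hexp, ← Real.rpow_natCast 2 m,
          ← Real.rpow_neg two_pos.le, ← Real.rpow_mul_natCast two_pos.le,
          ← Real.rpow_add two_pos, ← Real.rpow_mul_natCast two_pos.le]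
        congr 1
        ring
      rw [← e2]
      ring
    simp only [he]
    have hsum := (summable_geometric_of_lt_one hr0 hr1).mul_left
      (2 ^ m * (C * 2 ^ n) ^ sigmaExp p * (C * 48 ^ n) ^ (1 / q.toReal))
    exact hsum.tsum_ofReal_ne_top
  refine ⟨ENNReal.ofReal (C * 2 ^ n) ^ sigmaExp p * ∑' i, E i * D i ^ (1 / q.toReal),
    ENNReal.mul_ne_top (ENNReal.rpow_ne_top_of_nonneg hσ ENNReal.ofReal_ne_top) hE, ?_⟩
  intro _ _ _ hX T a b ρ hρ hT f h hf hh
  have hρ0 : 0 < ρ := by linarith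
  obtain ⟨s, Q, hs, hQ, hQd, hQU, hQb, hov⟩ := hX.exists_partition hn hρ0
  have : Countable s := hs.to_subtype
  set G := a + b * ENNReal.ofReal ((ρ ^ m)⁻¹) with hG
  set Z := ENNReal.ofReal (C * (2 * ρ) ^ n) ^ sigmaExp p with hZ
  have hZtop : Z ≠ ∞ := ENNReal.rpow_ne_top_of_nonneg hσ ENNReal.ofReal_ne_top
  have hloc : ∀ (c : s) (i : ℕ),
      eLpNorm h 2 (μ.restrict (dyadicAnnulus (c : X) ρ i)) *
        eLpNorm (T (restrictLp f (hQ c))) 2 (μ.restrict (dyadicAnnulus (c : X) ρ i)) ≤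
      E i * (G * Z) * (eLpNorm h q (μ.restrict (dyadicAnnulus (c : X) ρ i)) *
        eLpNorm f p (μ.restrict (Q c))) := by
    intro c i
    have hv0 := (hX.ball_pos (c : X) ρ hρ0).ne'
    have hvt := (hX.ball_lt_top (c : X) ρ hρ0).ne
    have hwn := hX.weightedNorm_restrictLp_le (p := p) (c : X) hρ hC0 hn (hQ c) (hQb c) f
    have hfin : weightedNorm μ p (restrictLp f (hQ c)) ≠ ∞ := by
      refine ne_top_of_le_ne_top ?_ hwn
      refine ENNReal.mul_ne_top (ENNReal.mul_ne_top hZtop ?_) ?_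
      · exact ENNReal.rpow_ne_top_of_ne_zero hv0 hvt
      · exact (hf.restrict _).eLpNorm_ne_top
    have h1 := hT.annulus_le (c : X) hρ (hQ c) (hQb c) f hfin i
    have h2 := eLpNorm_two_restrict_le (p := p) (q := q) hp1 hp2 hh.1 (dyadicAnnulus (c : X) ρ i)
    have h3 : μ (dyadicAnnulus (c : X) ρ i) ≤
        ENNReal.ofReal (C * (2 ^ (i + 1)) ^ n) * μ (Metric.ball (c : X) ρ) :=
      (measure_mono Set.inter_subset_left).trans
        (hX.measure_ball_mul_le (c : X) hρ0 (one_le_pow₀ one_le_two))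
    have h4 : μ (dyadicAnnulus (c : X) ρ i) ^ sigmaExp p ≤
        ENNReal.ofReal (C * (2 ^ (i + 1)) ^ n) ^ sigmaExp p *
          μ (Metric.ball (c : X) ρ) ^ sigmaExp p := by
      rw [← ENNReal.mul_rpow_of_nonneg _ _ hσ]
      gcongr
    -- The volume of the cell enters from the weight with exponent `-σ` and from Hölder's inequality
    -- on the annulus with exponent `σ`, so it cancels. This is the purpose of the weight `V^(-σ)`.
    have h5 : μ (Metric.ball (c : X) ρ) ^ sigmaExp p * μ (Metric.ball (c : X) ρ) ^ (-sigmaExp p)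
        = 1 := by
      rw [← ENNReal.rpow_add _ _ hv0 hvt, add_neg_cancel, ENNReal.rpow_zero]
    calc _ ≤ (eLpNorm h q (μ.restrict (dyadicAnnulus (c : X) ρ i)) *
          (ENNReal.ofReal (C * (2 ^ (i + 1)) ^ n) ^ sigmaExp p *
          μ (Metric.ball (c : X) ρ) ^ sigmaExp p)) *
          (ENNReal.ofReal (2 ^ m * ((2 ^ m)⁻¹) ^ i) * G *
          (Z * μ (Metric.ball (c : X) ρ) ^ (-sigmaExp p) * eLpNorm f p (μ.restrict (Q c)))) := by
          gcongr
          · exact h2.trans (by gcongr)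
          · exact h1.trans (by gcongr)
      _ = E i * (G * Z) * (eLpNorm h q (μ.restrict (dyadicAnnulus (c : X) ρ i)) *
          eLpNorm f p (μ.restrict (Q c))) * (μ (Metric.ball (c : X) ρ) ^ sigmaExp p *
          μ (Metric.ball (c : X) ρ) ^ (-sigmaExp p)) := by
          simp only [E]
          ring
      _ = _ := by rw [h5, mul_one]
  have hpair : ∀ c : s, ‖⟪h, T (restrictLp f (hQ c))⟫_ℂ‖ₑ ≤
      ∑' i, E i * (G * Z) * (eLpNorm h q (μ.restrict (dyadicAnnulus (c : X) ρ i)) *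
        eLpNorm f p (μ.restrict (Q c))) := by
    intro c
    calc _ ≤ ∫⁻ x, ‖h x‖ₑ * ‖T (restrictLp f (hQ c)) x‖ₑ ∂μ := enorm_inner_le_lintegral _ _
      _ = ∫⁻ x in ⋃ i, dyadicAnnulus (c : X) ρ i, ‖h x‖ₑ * ‖T (restrictLp f (hQ c)) x‖ₑ ∂μ := by
          rw [iUnion_dyadicAnnulus _ hρ0, Measure.restrict_univ]
      _ ≤ ∑' i, ∫⁻ x in dyadicAnnulus (c : X) ρ i, ‖h x‖ₑ * ‖T (restrictLp f (hQ c)) x‖ₑ ∂μ :=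
          lintegral_iUnion_le _ _
      _ ≤ _ := by
          refine ENNReal.tsum_le_tsum fun i => ?_
          exact (setLIntegral_enorm_mul_le _ _).trans (hloc c i)
  calc ‖⟪h, T f⟫_ℂ‖ₑ ≤ ∑' c : s, ‖⟪h, T (restrictLp f (hQ c))⟫_ℂ‖ₑ :=
        enorm_inner_apply_le_tsum hQ hQd hQU T h f
    _ ≤ ∑' c : s, ∑' i, E i * (G * Z) *
        (eLpNorm h q (μ.restrict (dyadicAnnulus (c : X) ρ i)) * eLpNorm f p (μ.restrict (Q c))) :=
        ENNReal.tsum_le_tsum hpair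
    _ = ∑' i, ∑' c : s, E i * (G * Z) *
        (eLpNorm h q (μ.restrict (dyadicAnnulus (c : X) ρ i)) * eLpNorm f p (μ.restrict (Q c))) :=
        ENNReal.tsum_comm
    _ ≤ ∑' i, E i * (G * Z) * (D i ^ (1 / q.toReal) * eLpNorm h q μ * eLpNorm f p μ) := by
        refine ENNReal.tsum_le_tsum fun i => ?_
        rw [ENNReal.tsum_mul_left]
        gcongr
        refine tsum_eLpNorm_mul_le (fun c => measurableSet_dyadicAnnulus _ _ _) hQ hQd ?_ hpt
          hf.1 hh.1
        intro x
        refine le_trans (ENNReal.tsum_le_tsum fun c => ?_) (hov x i)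
        exact Set.indicator_le_indicator_of_subset Set.inter_subset_left (fun _ => zero_le) x
    _ = (G * Z) * (∑' i, E i * D i ^ (1 / q.toReal)) * eLpNorm h q μ * eLpNorm f p μ := by
        rw [← ENNReal.tsum_mul_left, ← ENNReal.tsum_mul_right, ← ENNReal.tsum_mul_right]
        refine tsum_congr fun i => ?_
        ring
    _ = _ := by
        have e : Z = ENNReal.ofReal (C * 2 ^ n) ^ sigmaExp p *
            ENNReal.ofReal (ρ ^ (n * sigmaExp p)) := by
          rw [hZ, Real.mul_rpow two_pos.le hρ0.le, ← mul_assoc, ENNReal.ofReal_mul (by positivity),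
            ENNReal.mul_rpow_of_nonneg _ _ hσ, Real.rpow_mul hρ0.le,
            ← ENNReal.ofReal_rpow_of_nonneg (by positivity) hσ]
        rw [e]
        ring

end CoreBound

/-! ### Gaussian averages and moments of the Fourier transform -/

section GaussianAverages

open ProbabilityTheory FourierTransform

/-- A probability average of translates does not increase the `L^q` norm. -/
theorem eLpNorm_integral_translate_le {Ω : Type*} [MeasurableSpace Ω] (ν : Measure Ω)
    [IsProbabilityMeasure ν] {τ : Ω → ℝ} (hτ : Measurable τ) {g : ℝ → ℂ} (hg : Measurable g)
    {q : ℝ≥0∞} (hq : 1 ≤ q) :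
    eLpNorm (fun x => ∫ z, g (x + τ z) ∂ν) q volume ≤ eLpNorm g q volume := by
  have hq0 : q ≠ 0 := (zero_lt_one.trans_le hq).ne'
  have hm : Measurable (Function.uncurry fun (x : ℝ) (z : Ω) => g (x + τ z)) :=
    hg.comp (measurable_fst.add (hτ.comp measurable_snd))
  by_cases hqt : q = ∞
  · subst hqt
    rw [eLpNorm_exponent_top, eLpNorm_exponent_top]
    refine essSup_le_of_ae_le _ ?_
    have h1 : ∀ z, ∀ᵐ x : ℝ, ‖g (x + τ z)‖ₑ ≤ eLpNormEssSup g volume := fun z =>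
      (measurePreserving_add_right volume (τ z)).quasiMeasurePreserving.ae
        (enorm_ae_le_eLpNormEssSup g volume)
    have h2 : ∀ᵐ x : ℝ, ∀ᵐ z ∂ν, ‖g (x + τ z)‖ₑ ≤ eLpNormEssSup g volume := by
      rw [Measure.ae_ae_comm]
      · exact Eventually.of_forall h1
      · exact measurableSet_le hm.enorm measurable_const
    filter_upwards [h2] with x hx
    calc _ ≤ ∫⁻ z, ‖g (x + τ z)‖ₑ ∂ν := enorm_integral_le_lintegral_enorm _
      _ ≤ ∫⁻ _, eLpNormEssSup g volume ∂ν := lintegral_mono_ae hx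
      _ = _ := by simp
  · have hqr : 1 ≤ q.toReal := by
      rw [← ENNReal.toReal_one]
      exact ENNReal.toReal_mono hqt hq
    rw [eLpNorm_eq_lintegral_rpow_enorm_toReal hq0 hqt, eLpNorm_eq_lintegral_rpow_enorm_toReal hq0 hqt]
    gcongr ?_ ^ _
    calc ∫⁻ x, ‖∫ z, g (x + τ z) ∂ν‖ₑ ^ q.toReal
        ≤ ∫⁻ x, ∫⁻ z, ‖g (x + τ z)‖ₑ ^ q.toReal ∂ν := by
          refine lintegral_mono fun x => ?_
          have hx : Measurable fun z => ‖g (x + τ z)‖ₑ := (hm.comp measurable_prodMk_left).enorm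
          have := lintegral_mul_rpow_le (μ := ν) (a := fun _ => 1) (φ := fun z => ‖g (x + τ z)‖ₑ)
            aemeasurable_const hx.aemeasurable hqr
          simp only [one_mul, lintegral_one, measure_univ, ENNReal.one_rpow] at this
          exact (by gcongr; exact enorm_integral_le_lintegral_enorm _ :
            ‖∫ z, g (x + τ z) ∂ν‖ₑ ^ q.toReal ≤ (∫⁻ z, ‖g (x + τ z)‖ₑ ∂ν) ^ q.toReal).trans this
      _ = ∫⁻ z, (∫⁻ x : ℝ, ‖g (x + τ z)‖ₑ ^ q.toReal) ∂ν :=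
          lintegral_lintegral_swap (hm.enorm.pow_const _).aemeasurable
      _ = ∫⁻ _, (∫⁻ x : ℝ, ‖g x‖ₑ ^ q.toReal) ∂ν := by
          refine lintegral_congr fun z => ?_
          exact lintegral_add_right_eq_self (fun x => ‖g x‖ₑ ^ q.toReal) (τ z)
      _ = _ := by simp

/-- The average `E g(x + c Z)` over a standard normal variable `Z`. -/
def gaussAvg (c : ℝ) (g : ℝ → ℂ) (x : ℝ) : ℂ := ∫ z, g (x + c * z) ∂(gaussianReal 0 1)

theorem eLpNorm_gaussAvg_le (c : ℝ) {g : ℝ → ℂ} (hg : Measurable g) {q : ℝ≥0∞} (hq : 1 ≤ q) :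
    eLpNorm (gaussAvg c g) q volume ≤ eLpNorm g q volume :=
  eLpNorm_integral_translate_le _ (measurable_const_mul c) hg hq

theorem stronglyMeasurable_gaussAvg (c : ℝ) {g : ℝ → ℂ} (hg : Measurable g) :
    StronglyMeasurable (gaussAvg c g) :=
  StronglyMeasurable.integral_prod_right
    (f := fun x z => g (x + c * z)) (hg.comp (by fun_prop : Measurable
      fun p : ℝ × ℝ => p.1 + c * p.2)).stronglyMeasurable

theorem norm_gaussAvg_le (c : ℝ) {g : ℝ → ℂ} {M : ℝ} (hM : ∀ x, ‖g x‖ ≤ M) (x : ℝ) :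
    ‖gaussAvg c g x‖ ≤ M := by
  have := norm_integral_le_of_norm_le_const (μ := gaussianReal 0 1)
    (f := fun z => g (x + c * z)) (Eventually.of_forall fun z => hM _)
  rwa [probReal_univ, mul_one] at this

/-- The density of `c Z` for a standard normal variable `Z`. -/
def gaussKernel (c t : ℝ) : ℝ := (√(2 * Real.pi) * c)⁻¹ * Real.exp (-t ^ 2 / (2 * c ^ 2))

theorem gaussKernel_nonneg {c : ℝ} (hc : 0 ≤ c) (t : ℝ) : 0 ≤ gaussKernel c t := by
  unfold gaussKernel
  positivity

theorem continuous_gaussKernel (c : ℝ) : Continuous (gaussKernel c) := by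
  unfold gaussKernel
  fun_prop

theorem gaussAvg_eq_integral {c : ℝ} (hc : 0 < c) (g : ℝ → ℂ) (x : ℝ) :
    gaussAvg c g x = ∫ y, g y * gaussKernel c (x - y) := by
  rw [gaussAvg, integral_gaussianReal_eq_integral_smul one_ne_zero]
  have h1 := Measure.integral_comp_mul_left
    (fun t => gaussianPDFReal 0 1 (c⁻¹ * t) • g (x + t)) c
  simp only [inv_mul_cancel_left₀ hc.ne'] at h1
  rw [h1, ← integral_smul, ← integral_sub_right_eq_self _ x]
  refine integral_congr_ae (Eventually.of_forall fun y => ?_)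
  simp only [add_sub_cancel, gaussianPDFReal, gaussKernel, abs_of_pos (inv_pos.2 hc),
    Complex.real_smul, NNReal.coe_one, mul_one, sub_zero]
  rw [mul_comm (g y), ← mul_assoc, ← Complex.ofReal_mul]
  congr 2
  rw [mul_inv, ← mul_assoc, mul_comm c⁻¹]
  congr 2
  field_simp
  ring

/-- The Fourier multiplier of `gaussAvg c`. -/
def gaussMult (c ξ : ℝ) : ℝ := Real.exp (-(c ^ 2 * (2 * Real.pi * ξ) ^ 2 / 2))

theorem gaussMult_nonneg (c ξ : ℝ) : 0 ≤ gaussMult c ξ := (Real.exp_pos _).le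

theorem continuous_gaussMult (c : ℝ) : Continuous (gaussMult c) := by
  unfold gaussMult
  fun_prop

theorem integral_cexp_gaussian {c : ℝ} (hc : 0 < c) (t : ℝ) :
    ∫ ξ : ℝ, Complex.exp (2 * Real.pi * t * ξ * Complex.I) *
      (gaussMult c ξ : ℂ) = gaussKernel c t := by
  have hb : 0 < ((2 * Real.pi ^ 2 * c ^ 2 : ℝ) : ℂ).re := by
    rw [Complex.ofReal_re]
    positivity
  have h := fourierIntegral_gaussian hb (2 * Real.pi * t)
  have e : ∀ ξ : ℝ, Complex.exp (2 * Real.pi * t * ξ * Complex.I) *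
      (gaussMult c ξ : ℂ)
      = Complex.exp (Complex.I * (2 * Real.pi * t) * ξ) *
        Complex.exp (-((2 * Real.pi ^ 2 * c ^ 2 : ℝ) : ℂ) * ξ ^ 2) := by
    intro ξ
    rw [gaussMult, Complex.ofReal_exp]
    congr 2
    · ring
    · push_cast
      ring
  simp only [e]
  rw [h, gaussKernel, ← Complex.ofReal_div,
    show (1 / 2 : ℂ) = ((1 / 2 : ℝ) : ℂ) by norm_num, ← Complex.ofReal_cpow (by positivity),
    ← Real.sqrt_eq_rpow, Complex.ofReal_mul (√(2 * Real.pi) * c)⁻¹, Complex.ofReal_exp]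
  congr 2
  · have hp : Real.pi / (2 * Real.pi ^ 2 * c ^ 2) = ((√(2 * Real.pi) * c)⁻¹) ^ 2 := by
      rw [inv_pow, mul_pow, Real.sq_sqrt (by positivity)]
      have := Real.pi_pos
      field_simp
    rw [hp, Real.sqrt_sq (by positivity)]
  · push_cast
    have : (Real.pi : ℂ) ≠ 0 := by exact_mod_cast Real.pi_ne_zero
    have : (c : ℂ) ≠ 0 := by exact_mod_cast hc.ne'
    field_simp
    ring

theorem integrable_gaussMult {c : ℝ} (hc : 0 < c) :
    Integrable (gaussMult c) := by
  have := integrable_exp_neg_mul_sq (b := 2 * Real.pi ^ 2 * c ^ 2) (by positivity)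
  refine this.congr (Eventually.of_forall fun ξ => ?_)
  simp only [gaussMult]
  congr 1
  ring

/-- The Gaussian factor makes the inversion integral absolutely convergent, so that integrability of
`g` alone suffices for Fubini's theorem. -/
theorem gaussAvg_eq_fourier {c : ℝ} (hc : 0 < c) {g : ℝ → ℂ} (hg : Integrable g) (x : ℝ) :
    gaussAvg c g x = ∫ ξ : ℝ, (gaussMult c ξ : ℂ) * 𝓕 g ξ *
      Complex.exp (2 * Real.pi * x * ξ * Complex.I) := by
  have hswap : Integrable (Function.uncurry fun (ξ y : ℝ) =>
      (gaussMult c ξ : ℂ) *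
        (Complex.exp (2 * Real.pi * (x - y) * ξ * Complex.I) * g y)) (volume.prod volume) := by
    have h1 := (integrable_gaussMult hc).ofReal (𝕜 := ℂ).mul_prod hg
    have h2 : Integrable (fun p : ℝ × ℝ => Complex.exp (2 * Real.pi * (x - p.2) * p.1 * Complex.I) *
        ((gaussMult c p.1 : ℂ) * g p.2)) (volume.prod volume) := by
      refine h1.bdd_mul (c := 1) (by fun_prop) (Eventually.of_forall fun p => ?_)
      rw [show (2 * Real.pi * (x - p.2) * p.1 * Complex.I : ℂ)
        = ((2 * Real.pi * (x - p.2) * p.1 : ℝ) : ℂ) * Complex.I by push_cast; ring,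
        Complex.norm_exp_ofReal_mul_I]
    refine h2.congr (Eventually.of_forall fun p => ?_)
    simp only [Function.uncurry]
    ring
  calc gaussAvg c g x = ∫ y, g y * gaussKernel c (x - y) := gaussAvg_eq_integral hc g x
    _ = ∫ y : ℝ, ∫ ξ : ℝ, (gaussMult c ξ : ℂ) *
        (Complex.exp (2 * Real.pi * (x - y) * ξ * Complex.I) * g y) := by
        refine integral_congr_ae (Eventually.of_forall fun y => ?_)
        simp only
        rw [← integral_cexp_gaussian hc, ← integral_const_mul]
        refine integral_congr_ae (Eventually.of_forall fun ξ => ?_)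
        simp only
        push_cast
        ring
    _ = ∫ ξ : ℝ, ∫ y : ℝ, (gaussMult c ξ : ℂ) *
        (Complex.exp (2 * Real.pi * (x - y) * ξ * Complex.I) * g y) := by
        rw [integral_integral_swap hswap]
    _ = _ := by
        refine integral_congr_ae (Eventually.of_forall fun ξ => ?_)
        simp only
        rw [integral_const_mul, mul_assoc]
        refine congrArg _ ?_
        rw [Real.fourier_real_eq_integral_exp_smul, ← integral_mul_const]
        refine integral_congr_ae (Eventually.of_forall fun y => ?_)
        simp only
        rw [smul_eq_mul, mul_right_comm (Complex.exp _) (g y), ← Complex.exp_add]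
        congr 2
        push_cast
        ring

/-- A regularized Plancherel inequality. The left side is the pairing of `g` with its own Gaussian
average, and averaging is a contraction of `L²`. -/
theorem lintegral_enorm_fourier_sq_le {c : ℝ} (hc : 0 < c) {g : ℝ → ℂ} (hgm : Measurable g)
    (hg : Integrable g) :
    ∫⁻ ξ : ℝ, ‖𝓕 g ξ‖ₑ ^ 2 * ENNReal.ofReal (gaussMult c ξ) ≤
      eLpNorm g 2 volume ^ 2 := by
  have hc0 : (𝓕 g) = fun ξ => ∫ y : ℝ, Complex.exp (↑(-2 * Real.pi * y * ξ) * Complex.I) • g y :=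
    funext fun ξ => Real.fourier_real_eq_integral_exp_smul g ξ
  have hF : Continuous (𝓕 g) := VectorFourier.fourierIntegral_continuous Real.continuous_fourierChar
    (by fun_prop) hg
  have hFb : ∀ ξ, ‖𝓕 g ξ‖ ≤ ∫ y, ‖g y‖ := fun ξ =>
    VectorFourier.norm_fourierIntegral_le_integral_norm _ _ _ _ _
  have hEF : Integrable fun ξ => (gaussMult c ξ : ℂ) * 𝓕 g ξ :=
    (integrable_gaussMult hc).ofReal.mul_bdd (c := ∫ y, ‖g y‖) hF.aestronglyMeasurable
      (Eventually.of_forall hFb)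
  have hEF2 : Integrable fun ξ => ‖𝓕 g ξ‖ ^ 2 * gaussMult c ξ := by
    refine (integrable_gaussMult hc).bdd_mul (c := (∫ y, ‖g y‖) ^ 2)
      (by fun_prop) (Eventually.of_forall fun ξ => ?_)
    rw [norm_pow, norm_norm]
    exact pow_le_pow_left₀ (norm_nonneg _) (hFb ξ) 2
  have hgc : Integrable fun y => (starRingEnd ℂ) (g y) :=
    (integrable_norm_iff (by fun_prop)).1 (by simpa using hg.norm)
  have hswap : Integrable (Function.uncurry fun (ξ y : ℝ) => (starRingEnd ℂ) (g y) *
      (Complex.exp (2 * Real.pi * y * ξ * Complex.I) * ((gaussMult c ξ : ℂ) * 𝓕 g ξ)))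
      (volume.prod volume) := by
    have h2 : Integrable (fun p : ℝ × ℝ => Complex.exp (2 * Real.pi * p.2 * p.1 * Complex.I) *
        (((gaussMult c p.1 : ℂ) * 𝓕 g p.1) * (starRingEnd ℂ) (g p.2))) (volume.prod volume) := by
      refine (hEF.mul_prod hgc).bdd_mul (c := 1) (by fun_prop) (Eventually.of_forall fun p => ?_)
      rw [show (2 * Real.pi * p.2 * p.1 * Complex.I : ℂ)
        = ((2 * Real.pi * p.2 * p.1 : ℝ) : ℂ) * Complex.I by push_cast; ring,
        Complex.norm_exp_ofReal_mul_I]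
    refine h2.congr (Eventually.of_forall fun p => ?_)
    simp only [Function.uncurry]
    ring
  have key : ((∫ ξ, ‖𝓕 g ξ‖ ^ 2 * gaussMult c ξ : ℝ) : ℂ)
      = ∫ y, (starRingEnd ℂ) (g y) * gaussAvg c g y := by
    calc ((∫ ξ, ‖𝓕 g ξ‖ ^ 2 * gaussMult c ξ : ℝ) : ℂ)
        = ∫ ξ, (starRingEnd ℂ) (𝓕 g ξ) * ((gaussMult c ξ : ℂ) * 𝓕 g ξ) := by
          rw [← integral_complex_ofReal]
          refine integral_congr_ae (Eventually.of_forall fun ξ => ?_)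
          simp only
          rw [mul_left_comm, Complex.conj_mul']
          push_cast
          ring
      _ = ∫ ξ : ℝ, ∫ y : ℝ, (starRingEnd ℂ) (g y) *
          (Complex.exp (2 * Real.pi * y * ξ * Complex.I) * ((gaussMult c ξ : ℂ) * 𝓕 g ξ)) := by
          refine integral_congr_ae (Eventually.of_forall fun ξ => ?_)
          simp only
          conv_lhs => rw [hc0]
          simp only
          rw [← integral_conj, ← integral_mul_const]
          refine integral_congr_ae (Eventually.of_forall fun y => ?_)
          simp only
          rw [smul_eq_mul, map_mul, ← Complex.exp_conj, map_mul, Complex.conj_I, Complex.conj_ofReal,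
            ← Real.fourier_real_eq_integral_exp_smul]
          rw [mul_comm (Complex.exp _), mul_assoc]
          congr 3
          push_cast
          ring
      _ = ∫ y : ℝ, ∫ ξ : ℝ, (starRingEnd ℂ) (g y) *
          (Complex.exp (2 * Real.pi * y * ξ * Complex.I) * ((gaussMult c ξ : ℂ) * 𝓕 g ξ)) :=
          integral_integral_swap hswap
      _ = _ := by
          refine integral_congr_ae (Eventually.of_forall fun y => ?_)
          simp only
          rw [integral_const_mul, gaussAvg_eq_fourier hc hg]
          refine congrArg _ (integral_congr_ae (Eventually.of_forall fun ξ => ?_))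
          simp only
          ring
  calc _ = ∫⁻ ξ, ENNReal.ofReal (‖𝓕 g ξ‖ ^ 2 * gaussMult c ξ) := by
        refine lintegral_congr fun ξ => ?_
        rw [ENNReal.ofReal_mul (by positivity), ENNReal.ofReal_pow (norm_nonneg _), ofReal_norm]
    _ = ENNReal.ofReal (∫ ξ, ‖𝓕 g ξ‖ ^ 2 * gaussMult c ξ) :=
        (ofReal_integral_eq_lintegral_ofReal hEF2 (Eventually.of_forall fun ξ =>
          mul_nonneg (by positivity) (gaussMult_nonneg c ξ))).symm
    _ ≤ ‖∫ y, (starRingEnd ℂ) (g y) * gaussAvg c g y‖ₑ := by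
        rw [← key, ← ofReal_norm, Complex.norm_real]
        exact ENNReal.ofReal_le_ofReal (le_abs_self _)
    _ ≤ ∫⁻ y, ‖g y‖ₑ * ‖gaussAvg c g y‖ₑ := by
        refine (enorm_integral_le_lintegral_enorm _).trans (le_of_eq ?_)
        refine lintegral_congr fun y => ?_
        rw [enorm_mul, RCLike.enorm_conj]
    _ ≤ eLpNorm g 2 volume * eLpNorm (gaussAvg c g) 2 volume := by
        have := eLpNorm_smul_le_mul_eLpNorm (p := 2) (q := 2) (r := 1) (f := gaussAvg c g) (φ := g)
          (μ := volume) (stronglyMeasurable_gaussAvg c hgm).aestronglyMeasurable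
          hgm.aestronglyMeasurable
        rw [eLpNorm_one_eq_lintegral_enorm] at this
        simpa [enorm_mul] using this
    _ ≤ eLpNorm g 2 volume * eLpNorm g 2 volume := by
        gcongr
        exact eLpNorm_gaussAvg_le c hgm (by norm_num)
    _ = _ := (sq _).symm

theorem integrable_gaussian_mul_pow (k : ℕ) :
    Integrable fun ξ : ℝ => Real.exp (-((2 * Real.pi * ξ) ^ 2 / 2)) * (1 + 2 * Real.pi * |ξ|) ^ k := by
  have h := (integrable_exp_neg_mul_sq (b := Real.pi ^ 2) (by positivity)).const_mul
    ((k.factorial : ℝ) * Real.exp 2)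
  refine h.mono' (by fun_prop) (Eventually.of_forall fun ξ => ?_)
  have ht : 0 ≤ 2 * Real.pi * |ξ| := by positivity
  rw [Real.norm_of_nonneg (by positivity)]
  set t := 2 * Real.pi * |ξ| with htd
  have e : (2 * Real.pi * ξ) ^ 2 = t ^ 2 := by rw [htd, mul_pow, mul_pow _ |ξ|, sq_abs]
  have h1 : (1 + t) ^ k ≤ k.factorial * Real.exp (1 + t) := by
    have := Real.pow_div_factorial_le_exp (1 + t) (by positivity) k
    rwa [div_le_iff₀ (by positivity), mul_comm] at this
  calc Real.exp (-((2 * Real.pi * ξ) ^ 2 / 2)) * (1 + t) ^ k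
      ≤ Real.exp (-(t ^ 2 / 2)) * (k.factorial * Real.exp (1 + t)) := by
        rw [e]
        gcongr
    _ = k.factorial * Real.exp (1 + t - t ^ 2 / 2) := by
        rw [mul_left_comm, ← Real.exp_add]
        congr 2
        ring
    _ ≤ k.factorial * Real.exp (2 + -Real.pi ^ 2 * ξ ^ 2) := by
        gcongr
        have : Real.pi ^ 2 * ξ ^ 2 = t ^ 2 / 4 := by rw [← e]; ring
        nlinarith [sq_nonneg (t / 2 - 1)]
    _ = _ := by rw [Real.exp_add]; ring

/-- Cauchy-Schwarz with the Gaussian shared equally between the factors. One factor is at most the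
`L²` norm of `g`. In the other the substitution `ξ ↦ c ξ` produces at most `v^(2m)` from the moment
and `v` from the Jacobian, with `v = max(1, 1/c)`. The square root of `v^(2m+1)` is the stated
power. -/
theorem exists_lintegral_moment_le (m : ℕ) : ∃ M : ℝ≥0∞, M ≠ ∞ ∧ ∀ (c : ℝ), 0 < c →
    ∀ g : ℝ → ℂ, Measurable g → Integrable g →
    ∫⁻ ξ : ℝ, ‖𝓕 g ξ‖ₑ * ENNReal.ofReal (gaussMult c ξ * (1 + 2 * Real.pi * |ξ|) ^ m) ≤
      M * ENNReal.ofReal (max 1 c⁻¹ ^ (m + 1 / 2 : ℝ)) * eLpNorm g 2 volume := by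
  set Φ : ℝ → ℝ := fun ξ => Real.exp (-((2 * Real.pi * ξ) ^ 2 / 2)) *
    (1 + 2 * Real.pi * |ξ|) ^ (2 * m) with hΦ
  have hΦ0 : ∀ ξ, 0 ≤ Φ ξ := fun ξ => by positivity
  refine ⟨ENNReal.ofReal (∫ ξ, Φ ξ) ^ (1 / 2 : ℝ),
    ENNReal.rpow_ne_top_of_nonneg (by norm_num) ENNReal.ofReal_ne_top, ?_⟩
  intro c hc g hgm hg
  have hF : Continuous (𝓕 g) := VectorFourier.fourierIntegral_continuous Real.continuous_fourierChar
    (by fun_prop) hg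
  set v := max 1 c⁻¹ with hv
  have hv1 : 1 ≤ v := le_max_left _ _
  have hvc : c⁻¹ ≤ v := le_max_right _ _
  have hv0 : 0 < v := by linarith
  set S : ℝ → ℝ := fun ξ => Real.sqrt (gaussMult c ξ) with hS
  have hSc : Continuous S := (continuous_gaussMult c).sqrt
  have hSS : ∀ ξ, S ξ * S ξ = gaussMult c ξ := fun ξ => Real.mul_self_sqrt (gaussMult_nonneg c ξ)
  have key := ENNReal.lintegral_mul_le_Lp_mul_Lq volume Real.HolderConjugate.two_two
    (f := fun ξ => ‖𝓕 g ξ‖ₑ * ENNReal.ofReal (S ξ))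
    (g := fun ξ => ENNReal.ofReal (S ξ * (1 + 2 * Real.pi * |ξ|) ^ m))
    (by fun_prop) (by fun_prop)
  have h1 : (∫⁻ ξ, (‖𝓕 g ξ‖ₑ * ENNReal.ofReal (S ξ)) ^ (2 : ℝ)) ^ (1 / 2 : ℝ) ≤
      eLpNorm g 2 volume := by
    calc _ = (∫⁻ ξ : ℝ, ‖𝓕 g ξ‖ₑ ^ 2 * ENNReal.ofReal (gaussMult c ξ)) ^ (1 / 2 : ℝ) := by
          congr 1
          refine lintegral_congr fun ξ => ?_
          rw [ENNReal.rpow_two, mul_pow, ← ENNReal.ofReal_pow (Real.sqrt_nonneg _), sq (S ξ), hSS]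
      _ ≤ (eLpNorm g 2 volume ^ 2) ^ (1 / 2 : ℝ) := by
          gcongr
          exact lintegral_enorm_fourier_sq_le hc hgm hg
      _ = _ := by
          rw [← ENNReal.rpow_two, ← ENNReal.rpow_mul]
          norm_num
  have h2 : (∫⁻ ξ : ℝ, ENNReal.ofReal (S ξ * (1 + 2 * Real.pi * |ξ|) ^ m) ^ (2 : ℝ)) ^ (1 / 2 : ℝ) ≤
      ENNReal.ofReal (∫ ξ, Φ ξ) ^ (1 / 2 : ℝ) * ENNReal.ofReal (v ^ (m + 1 / 2 : ℝ)) := by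
    have h3 : ∫⁻ ξ : ℝ, ENNReal.ofReal (S ξ * (1 + 2 * Real.pi * |ξ|) ^ m) ^ (2 : ℝ) ≤
        ENNReal.ofReal ((v ^ (2 * m + 1)) * ∫ ξ, Φ ξ) := by
      calc _ ≤ ∫⁻ ξ : ℝ, ENNReal.ofReal (v ^ (2 * m) * Φ (c * ξ)) := by
            refine lintegral_mono fun ξ => ?_
            rw [ENNReal.rpow_two, ← ENNReal.ofReal_pow (by positivity), mul_pow, sq (S ξ), hSS]
            refine ENNReal.ofReal_le_ofReal ?_
            have e1 : gaussMult c ξ = Real.exp (-((2 * Real.pi * (c * ξ)) ^ 2 / 2)) := by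
              rw [gaussMult]
              congr 1
              ring
            simp only [hΦ]
            rw [e1, mul_left_comm (v ^ (2 * m)), ← pow_mul, mul_comm m 2, ← mul_pow v]
            gcongr
            rw [abs_mul, abs_of_pos hc, mul_add, mul_one]
            have : 1 ≤ v * c := by
              have := mul_le_mul_of_nonneg_right hvc hc.le
              rwa [inv_mul_cancel₀ hc.ne'] at this
            have h0 : 0 ≤ 2 * Real.pi * |ξ| := by positivity
            nlinarith
        _ = ENNReal.ofReal (∫ ξ : ℝ, v ^ (2 * m) * Φ (c * ξ)) := by
            refine (ofReal_integral_eq_lintegral_ofReal ?_ (Eventually.of_forall fun ξ =>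
              mul_nonneg (by positivity) (hΦ0 _))).symm
            exact ((integrable_gaussian_mul_pow (2 * m)).comp_mul_left' hc.ne').const_mul _
        _ ≤ _ := by
            refine ENNReal.ofReal_le_ofReal ?_
            rw [integral_const_mul, Measure.integral_comp_mul_left, abs_of_pos (inv_pos.2 hc),
              smul_eq_mul, pow_succ, mul_assoc]
            gcongr
    calc _ ≤ (ENNReal.ofReal ((v ^ (2 * m + 1)) * ∫ ξ, Φ ξ)) ^ (1 / 2 : ℝ) := by gcongr
      _ = _ := by
          rw [ENNReal.ofReal_mul (by positivity), ENNReal.mul_rpow_of_nonneg _ _ (by norm_num),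
            mul_comm, ENNReal.ofReal_rpow_of_nonneg (show 0 ≤ v ^ (2 * m + 1) by positivity)
              (by norm_num),
            ← Real.rpow_natCast, ← Real.rpow_mul hv0.le]
          congr 3
          push_cast
          ring
  calc _ = ∫⁻ ξ, ((fun ξ => ‖𝓕 g ξ‖ₑ * ENNReal.ofReal (S ξ)) *
        fun ξ => ENNReal.ofReal (S ξ * (1 + 2 * Real.pi * |ξ|) ^ m)) ξ := by
        refine lintegral_congr fun ξ => ?_
        simp only [Pi.mul_apply]
        rw [mul_assoc ‖𝓕 g ξ‖ₑ (ENNReal.ofReal (S ξ)), ← ENNReal.ofReal_mul (Real.sqrt_nonneg _), ← mul_assoc (S ξ), hSS]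
    _ ≤ _ := key
    _ ≤ eLpNorm g 2 volume * (ENNReal.ofReal (∫ ξ, Φ ξ) ^ (1 / 2 : ℝ) *
        ENNReal.ofReal (v ^ (m + 1 / 2 : ℝ))) := by gcongr
    _ = _ := by ring

end GaussianAverages

/-! ### Subordination formulas for powers of `I - d²/dx²` -/

section BesselPotentials

open ProbabilityTheory FourierTransform

theorem gaussAvg_neg (c : ℝ) (g : ℝ → ℂ) (x : ℝ) : gaussAvg (-c) g x = gaussAvg c g x := by
  have h : (gaussianReal 0 1).map (fun z => -z) = gaussianReal 0 1 := by
    rw [gaussianReal_map_neg, neg_zero]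
  rw [gaussAvg, gaussAvg]
  conv_rhs => rw [← h]
  have h2 := (MeasurableEquiv.neg ℝ).measurableEmbedding.integral_map (μ := gaussianReal 0 1)
    (fun z => g (x + c * z))
  refine Eq.trans ?_ h2.symm
  simp

theorem besselOp_apply (s : ℝ) (φ : 𝓢(ℝ, ℂ)) (x : ℝ) :
    besselOp s φ x = ∫ ξ : ℝ, (besselSymbol s ξ : ℂ) * 𝓕 (φ : ℝ → ℂ) ξ *
      Complex.exp (2 * Real.pi * x * ξ * Complex.I) := by
  rw [besselOp, SchwartzMap.fourierMultiplierCLM_apply, SchwartzMap.fourierInv_coe,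
    Real.fourierInv_eq']
  refine integral_congr_ae (Eventually.of_forall fun ξ => ?_)
  simp only
  rw [SchwartzMap.smulLeftCLM_apply_apply (besselSymbol_hasTemperateGrowth s),
    SchwartzMap.fourier_coe, smul_eq_mul, mul_comm, Complex.real_smul]
  congr 2
  simp only [RCLike.inner_apply, conj_trivial]
  push_cast
  ring

theorem integrable_besselSymbol_mul (s : ℝ) (φ : 𝓢(ℝ, ℂ)) :
    Integrable fun ξ : ℝ => (besselSymbol s ξ : ℂ) * 𝓕 (φ : ℝ → ℂ) ξ := by
  have h := (SchwartzMap.smulLeftCLM ℂ (besselSymbol s) (𝓕 φ)).integrable (μ := volume)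
  refine h.congr (Eventually.of_forall fun ξ => ?_)
  simp only
  rw [SchwartzMap.smulLeftCLM_apply_apply (besselSymbol_hasTemperateGrowth s),
    SchwartzMap.fourier_coe, Complex.real_smul]

theorem besselOp_neg_besselOp (s : ℝ) (φ : 𝓢(ℝ, ℂ)) : besselOp s (besselOp (-s) φ) = φ := by
  rw [besselOp, besselOp, SchwartzMap.fourierMultiplierCLM_fourierMultiplierCLM_apply
    (besselSymbol_hasTemperateGrowth s) (besselSymbol_hasTemperateGrowth (-s))]
  have : besselSymbol s * besselSymbol (-s) = fun _ => (1 : ℝ) := by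
    ext ξ
    have h0 : 0 < 1 + (2 * Real.pi * ξ) ^ 2 := by positivity
    rw [Pi.mul_apply, besselSymbol, besselSymbol, ← Real.rpow_add h0]
    ring_nf
    simp
  rw [this, SchwartzMap.fourierMultiplierCLM_const]
  simp

/-- The Gamma distribution of shape `a` and rate `1`, with density `u ^ (a - 1) e ^ (-u) / Γ(a)`. -/
def gammaWeight (a : ℝ) : Measure ℝ :=
  (volume.restrict (Set.Ioi 0)).withDensity
    fun u => ENNReal.ofReal ((Real.Gamma a)⁻¹ * (u ^ (a - 1) * Real.exp (-u)))

theorem gammaWeight_ae_pos (a : ℝ) : ∀ᵐ u ∂(gammaWeight a), 0 < u :=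
  (withDensity_absolutelyContinuous _ _).ae_le (ae_restrict_mem measurableSet_Ioi)

theorem integral_gammaWeight {a : ℝ} (ha : 0 < a) (f : ℝ → ℝ) :
    ∫ u, f u ∂(gammaWeight a) =
      (Real.Gamma a)⁻¹ * ∫ u in Set.Ioi 0, u ^ (a - 1) * Real.exp (-u) * f u := by
  rw [gammaWeight, integral_withDensity_eq_integral_toReal_smul (by fun_prop) (by simp),
    ← integral_const_mul]
  refine setIntegral_congr_fun measurableSet_Ioi fun u (hu : 0 < u) => ?_
  have := Real.Gamma_pos_of_pos ha
  rw [ENNReal.toReal_ofReal (by positivity), smul_eq_mul, mul_assoc]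

theorem integrable_gammaWeight_rpow {a θ : ℝ} (ha : 0 < a) (hθ : 0 < a + θ) :
    Integrable (fun u => u ^ θ) (gammaWeight a) := by
  rw [gammaWeight, integrable_withDensity_iff_integrable_smul' (by fun_prop) (by simp)]
  have h := (Real.GammaIntegral_convergent hθ).const_mul (Real.Gamma a)⁻¹
  refine h.congr ((ae_restrict_iff' measurableSet_Ioi).2 (Eventually.of_forall fun u hu => ?_))
  have hu0 : 0 < u := hu
  have := Real.Gamma_pos_of_pos ha
  simp only
  rw [ENNReal.toReal_ofReal (by positivity), smul_eq_mul, mul_assoc]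
  congr 1
  rw [show a + θ - 1 = (a - 1) + θ by ring, Real.rpow_add hu0]
  ring

theorem isProbabilityMeasure_gammaWeight {a : ℝ} (ha : 0 < a) :
    IsProbabilityMeasure (gammaWeight a) := by
  have h1 : Integrable (fun _ : ℝ => (1 : ℝ)) (gammaWeight a) := by
    simpa using integrable_gammaWeight_rpow (θ := 0) ha (by linarith)
  have h2 : ∫ _, (1 : ℝ) ∂(gammaWeight a) = 1 := by
    rw [integral_gammaWeight ha, inv_mul_eq_one₀ (Real.Gamma_pos_of_pos ha).ne',
      Real.Gamma_eq_integral ha]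
    refine setIntegral_congr_fun measurableSet_Ioi fun u _ => ?_
    ring
  have h3 : IsFiniteMeasure (gammaWeight a) := by
    rwa [integrable_const_iff_isFiniteMeasure one_ne_zero] at h1
  constructor
  rw [integral_const, smul_eq_mul, mul_one] at h2
  rw [← ENNReal.ofReal_toReal (measure_ne_top _ _), ← Measure.real, h2, ENNReal.ofReal_one]

theorem gaussMult_sqrt {u : ℝ} (hu : 0 ≤ u) (ξ : ℝ) :
    gaussMult (√(2 * u)) ξ = Real.exp (-(u * (2 * Real.pi * ξ) ^ 2)) := by
  rw [gaussMult, Real.sq_sqrt (by positivity)]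
  congr 1
  ring

/-- Euler's integral for `λ^(-a)` at `λ = 1 + (2πξ)²`. The factor `e^(-u)` belongs to the Gamma law,
and `e^(-u (2πξ)²)` is the multiplier of a Gaussian average of variance `2u`. -/
theorem integral_gaussMult_gammaWeight {a : ℝ} (ha : 0 < a) (ξ : ℝ) :
    ∫ u, gaussMult (√(2 * u)) ξ ∂(gammaWeight a) = (1 + (2 * Real.pi * ξ) ^ 2) ^ (-a) := by
  have h0 : 0 < 1 + (2 * Real.pi * ξ) ^ 2 := by positivity
  have hG := Real.Gamma_pos_of_pos ha
  have h := Real.integral_rpow_mul_exp_neg_mul_Ioi ha h0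
  rw [integral_gammaWeight ha]
  have e : ∫ u in Set.Ioi 0, u ^ (a - 1) * Real.exp (-u) * gaussMult (√(2 * u)) ξ =
      ∫ u in Set.Ioi 0, u ^ (a - 1) * Real.exp (-((1 + (2 * Real.pi * ξ) ^ 2) * u)) := by
    refine setIntegral_congr_fun measurableSet_Ioi fun u (hu : 0 < u) => ?_
    rw [gaussMult_sqrt hu.le, mul_assoc, ← Real.exp_add]
    congr 2
    ring
  rw [e, h, one_div, Real.inv_rpow h0.le, Real.rpow_neg h0.le]
  field_simp

theorem norm_cexp_two_pi (x ξ : ℝ) : ‖Complex.exp (2 * Real.pi * x * ξ * Complex.I)‖ = 1 := by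
  rw [show (2 * Real.pi * x * ξ * Complex.I : ℂ)
    = ((2 * Real.pi * x * ξ : ℝ) : ℂ) * Complex.I by push_cast; ring, Complex.norm_exp_ofReal_mul_I]

theorem gaussMult_le_one (c ξ : ℝ) : gaussMult c ξ ≤ 1 := by
  rw [gaussMult, Real.exp_le_one_iff, neg_nonpos]
  positivity

/-- The preceding integral read on the Fourier side: the Bessel potential is an average of
translates with respect to a probability law, hence a contraction of every `L^q`. -/
theorem besselOp_neg_apply {s : ℝ} (hs : 0 < s) (φ : 𝓢(ℝ, ℂ)) (x : ℝ) :
    besselOp (-s) φ x = ∫ u, gaussAvg (√(2 * u)) φ x ∂(gammaWeight (s / 2)) := by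
  have hp := isProbabilityMeasure_gammaWeight (half_pos hs)
  have hφ : Integrable (𝓕 (φ : ℝ → ℂ)) := by
    rw [← SchwartzMap.fourier_coe]
    exact (𝓕 φ).integrable
  have hcont : Continuous (𝓕 (φ : ℝ → ℂ)) := by
    rw [← SchwartzMap.fourier_coe]
    exact (𝓕 φ).continuous
  have hswap : Integrable (Function.uncurry fun (ξ u : ℝ) =>
      (gaussMult (√(2 * u)) ξ : ℂ) * 𝓕 (φ : ℝ → ℂ) ξ *
        Complex.exp (2 * Real.pi * x * ξ * Complex.I)) (volume.prod (gammaWeight (s / 2))) := by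
    have h1 : Integrable (fun p : ℝ × ℝ => 𝓕 (φ : ℝ → ℂ) p.1 * 1)
        (volume.prod (gammaWeight (s / 2))) := hφ.mul_prod (integrable_const _)
    refine h1.mono (Continuous.aestronglyMeasurable ?_) (Eventually.of_forall fun p => ?_)
    · unfold gaussMult
      fun_prop
    · simp only [Function.uncurry]
      rw [norm_mul, norm_cexp_two_pi, mul_one, mul_one, norm_mul, Complex.norm_real,
        Real.norm_of_nonneg (gaussMult_nonneg _ _)]
      exact mul_le_of_le_one_left (norm_nonneg _) (gaussMult_le_one _ _)
  rw [besselOp_apply]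
  calc _ = ∫ ξ : ℝ, ∫ u, (gaussMult (√(2 * u)) ξ : ℂ) * 𝓕 (φ : ℝ → ℂ) ξ *
        Complex.exp (2 * Real.pi * x * ξ * Complex.I) ∂(gammaWeight (s / 2)) := by
        refine integral_congr_ae (Eventually.of_forall fun ξ => ?_)
        simp only
        rw [integral_mul_const, integral_mul_const, integral_complex_ofReal,
          integral_gaussMult_gammaWeight (half_pos hs), besselSymbol, neg_div]
    _ = ∫ u, (∫ ξ : ℝ, (gaussMult (√(2 * u)) ξ : ℂ) * 𝓕 (φ : ℝ → ℂ) ξ *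
        Complex.exp (2 * Real.pi * x * ξ * Complex.I)) ∂(gammaWeight (s / 2)) :=
        integral_integral_swap hswap
    _ = _ := by
        refine integral_congr_ae ?_
        filter_upwards [gammaWeight_ae_pos (s / 2)] with u hu
        exact (gaussAvg_eq_fourier (by positivity) φ.integrable x).symm

/-- The density `u ^ (-β - 1) (1 - e ^ (-u)) ^ l`, which represents `λ ^ β` for `β < l`. -/
def diffWeight (β : ℝ) (l : ℕ) (u : ℝ) : ℝ := u ^ (-β - 1) * (1 - Real.exp (-u)) ^ l

theorem integrableOn_diffWeight {β : ℝ} {l : ℕ} (hβ : 0 < β) (hl : β < l) :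
    IntegrableOn (diffWeight β l) (Set.Ioi 0) := by
  have hm : Measurable (diffWeight β l) := by
    unfold diffWeight
    fun_prop
  have h01 : ∀ u : ℝ, 0 < u → 0 ≤ 1 - Real.exp (-u) ∧ 1 - Real.exp (-u) ≤ 1 ∧
      1 - Real.exp (-u) ≤ u := fun u hu =>
    ⟨by simpa using hu.le, by linarith [Real.exp_pos (-u)], by linarith [Real.add_one_le_exp (-u)]⟩
  rw [← Set.Ioc_union_Ioi_eq_Ioi (zero_le_one' ℝ)]
  refine IntegrableOn.union ?_ ?_
  · have h1 : IntegrableOn (fun u : ℝ => u ^ (-β - 1 + l)) (Set.Ioc 0 1) := by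
      rw [← intervalIntegrable_iff_integrableOn_Ioc_of_le zero_le_one]
      exact intervalIntegral.intervalIntegrable_rpow' (by linarith)
    refine h1.mono' hm.aestronglyMeasurable
      ((ae_restrict_iff' measurableSet_Ioc).2 (Eventually.of_forall fun u hu => ?_))
    obtain ⟨a1, a2, a3⟩ := h01 u hu.1
    have hu0 := hu.1
    rw [diffWeight, Real.norm_of_nonneg (by positivity), Real.rpow_add hu.1, Real.rpow_natCast]
    gcongr
  · have h1 : IntegrableOn (fun u : ℝ => u ^ (-β - 1)) (Set.Ioi 1) :=
      integrableOn_Ioi_rpow_of_lt (by linarith) one_pos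
    refine h1.mono' hm.aestronglyMeasurable
      ((ae_restrict_iff' measurableSet_Ioi).2 (Eventually.of_forall fun u hu => ?_))
    have hu0 : 0 < u := zero_lt_one.trans hu
    obtain ⟨a1, a2, a3⟩ := h01 u hu0
    rw [diffWeight, Real.norm_of_nonneg (by positivity)]
    exact mul_le_of_le_one_right (by positivity) (pow_le_one₀ a1 a2)

theorem integral_diffWeight_pos {β : ℝ} {l : ℕ} (hβ : 0 < β) (hl : β < l) :
    0 < ∫ u in Set.Ioi 0, diffWeight β l u := by
  have hpos : ∀ u ∈ Set.Ioi (0 : ℝ), 0 < diffWeight β l u := by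
    intro u hu
    have hu0 : 0 < u := hu
    have : 0 < 1 - Real.exp (-u) := by simpa using hu0
    unfold diffWeight
    positivity
  rw [setIntegral_pos_iff_support_of_nonneg_ae
    ((ae_restrict_iff' measurableSet_Ioi).2 (Eventually.of_forall fun u hu => (hpos u hu).le))
    (integrableOn_diffWeight hβ hl)]
  have : Function.support (diffWeight β l) ∩ Set.Ioi 0 = Set.Ioi 0 :=
    Set.inter_eq_right.2 fun u hu => (hpos u hu).ne'
  rw [this]
  simp

/-- Positive powers of `λ` are superpositions of `(1 - e^(-λu))^l`, a finite combination of heat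
multipliers. The `l`-th power makes the integrand small enough at `u = 0` to compensate the
singularity `u^(-β-1)`. -/
theorem integral_diffWeight_mul {β : ℝ} {l : ℕ} {t : ℝ} (ht : 0 < t) :
    ∫ u in Set.Ioi 0, u ^ (-β - 1) * (1 - Real.exp (-(t * u))) ^ l =
      t ^ β * ∫ u in Set.Ioi 0, diffWeight β l u := by
  have h := integral_comp_mul_left_Ioi (diffWeight β l) 0 ht
  rw [mul_zero, smul_eq_mul] at h
  have e : ∫ u in Set.Ioi 0, diffWeight β l (t * u) =
      t ^ (-β - 1) * ∫ u in Set.Ioi 0, u ^ (-β - 1) * (1 - Real.exp (-(t * u))) ^ l := by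
    rw [← integral_const_mul]
    refine setIntegral_congr_fun measurableSet_Ioi fun u (hu : 0 < u) => ?_
    simp only [diffWeight]
    rw [Real.mul_rpow ht.le hu.le, mul_assoc]
  rw [e] at h
  have h2 : t ^ (-β - 1) = t⁻¹ * (t ^ β)⁻¹ := by
    rw [Real.rpow_sub ht, Real.rpow_neg ht.le, Real.rpow_one]
    ring
  rw [h2, mul_assoc] at h
  have h3 := mul_left_cancel₀ (inv_ne_zero ht.ne') h
  rw [inv_mul_eq_iff_eq_mul₀ (Real.rpow_pos_of_pos ht β).ne'] at h3
  exact h3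

theorem besselOp_zero (φ : 𝓢(ℝ, ℂ)) : besselOp 0 φ = φ := by
  rw [besselOp]
  have : besselSymbol 0 = fun _ => (1 : ℝ) := by
    ext ξ
    simp [besselSymbol]
  rw [this, SchwartzMap.fourierMultiplierCLM_const]
  simp

theorem norm_gaussAvg_le_of_le {φ : ℝ → ℂ} (hφ : Integrable φ) {c : ℝ} (hc : 0 < c) {x D : ℝ}
    (hD : ∀ y, φ y ≠ 0 → gaussKernel c (x - y) ≤ D) : ‖gaussAvg c φ x‖ ≤ D * ∫ y, ‖φ y‖ := by
  rw [gaussAvg_eq_integral hc, ← integral_const_mul]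
  refine norm_integral_le_of_norm_le (hφ.norm.const_mul D) (Eventually.of_forall fun y => ?_)
  rw [norm_mul, Complex.norm_real, Real.norm_of_nonneg (gaussKernel_nonneg hc.le _), mul_comm]
  by_cases hy : φ y = 0
  · simp [hy]
  · gcongr
    exact hD y hy

theorem exp_neg_le_factorial_div {t : ℝ} (ht : 0 < t) (k : ℕ) :
    Real.exp (-t) ≤ k.factorial * t⁻¹ ^ k := by
  have h := Real.pow_div_factorial_le_exp t ht.le k
  rw [Real.exp_neg, inv_pow, ← div_eq_mul_inv, inv_le_comm₀ (Real.exp_pos t) (by positivity)]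
  rwa [inv_div]

theorem gaussKernel_le_of_le_abs {c γ t : ℝ} (hc : 0 < c) (hγ : 0 < γ) (ht : γ ≤ |t|) (k : ℕ) :
    gaussKernel c t ≤ c⁻¹ * (k.factorial * (2 * c ^ 2 / γ ^ 2) ^ k) := by
  have h2 : γ ^ 2 ≤ t ^ 2 := by
    rw [← sq_abs t]
    gcongr
  have h1 : Real.exp (-t ^ 2 / (2 * c ^ 2)) ≤ k.factorial * (2 * c ^ 2 / γ ^ 2) ^ k := by
    calc _ ≤ Real.exp (-(γ ^ 2 / (2 * c ^ 2))) := by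
          rw [Real.exp_le_exp, neg_div, neg_le_neg_iff]
          gcongr
      _ ≤ _ := by
          refine (exp_neg_le_factorial_div (by positivity) k).trans (le_of_eq ?_)
          rw [inv_div]
  have h3 : (√(2 * Real.pi) * c)⁻¹ ≤ c⁻¹ := by
    apply inv_anti₀ hc
    have : 1 ≤ √(2 * Real.pi) := by
      rw [Real.one_le_sqrt]
      linarith [Real.pi_gt_three]
    nlinarith
  rw [gaussKernel]
  gcongr

/-- The operator `(I - d²/dx²)^{s/2}` is smoothing away from the diagonal. -/
theorem exists_norm_besselOp_le {s γ : ℝ} (hs : 0 < s) (hγ : 0 < γ) :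
    ∃ D : ℝ, 0 ≤ D ∧ ∀ (φ : 𝓢(ℝ, ℂ)) (x : ℝ), (∀ y, φ y ≠ 0 → γ ≤ |x - y|) →
      ‖besselOp s φ x‖ ≤ D * ∫ y, ‖φ y‖ := by
  set β := s / 2 with hβd
  have hβ : 0 < β := half_pos hs
  obtain ⟨l, hl⟩ := exists_nat_gt β
  -- At distance `γ` a Gaussian of variance comparable to `u` is of order `u^(k - 1/2)` for every
  -- `k`. Against `u^(-β-1)` this is integrable at `0` once `k > β + 1/2`.
  obtain ⟨k, hk⟩ := exists_nat_gt (β + 1 / 2)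
  have hl0 : 0 < (l : ℝ) := hβ.trans hl
  set κ := ∫ u in Set.Ioi 0, diffWeight β l u with hκ
  have hκ0 : 0 < κ := integral_diffWeight_pos hβ hl
  set A : ℝ := k.factorial * (4 * l / γ ^ 2) ^ k with hA
  have hA0 : 0 ≤ A := by positivity
  set J := ∫ u in Set.Ioi 0, Real.exp (-u) * u ^ ((k : ℝ) - β - 1 / 2 - 1) with hJ
  have hJi : IntegrableOn (fun u : ℝ => Real.exp (-u) * u ^ ((k : ℝ) - β - 1 / 2 - 1)) (Set.Ioi 0) :=
    Real.GammaIntegral_convergent (by linarith)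
  have hJ0 : 0 ≤ J := setIntegral_nonneg measurableSet_Ioi fun u (hu : 0 < u) => by positivity
  refine ⟨κ⁻¹ * (2 ^ l * A * J), by positivity, fun φ x hφx => ?_⟩
  have hφ : Integrable (𝓕 (φ : ℝ → ℂ)) := by
    rw [← SchwartzMap.fourier_coe]
    exact (𝓕 φ).integrable
  have hcont : Continuous (𝓕 (φ : ℝ → ℂ)) := by
    rw [← SchwartzMap.fourier_coe]
    exact (𝓕 φ).continuous
  set e : ℝ → ℂ := fun ξ => Complex.exp (2 * Real.pi * x * ξ * Complex.I) with he
  have hec : Continuous e := by fun_prop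
  set lam : ℝ → ℝ := fun ξ => 1 + (2 * Real.pi * ξ) ^ 2 with hlam
  have hlam1 : ∀ ξ, 1 ≤ lam ξ := fun ξ => by
    have := sq_nonneg (2 * Real.pi * ξ)
    simp only [hlam]
    linarith
  have hlam0 : ∀ ξ, 0 < lam ξ := fun ξ => zero_lt_one.trans_le (hlam1 ξ)
  set W : ℝ → ℝ → ℝ := fun ξ u => u ^ (-β - 1) * (1 - Real.exp (-(lam ξ * u))) ^ l with hW
  have hW0 : ∀ ξ u, 0 < u → 0 ≤ W ξ u := fun ξ u hu => by
    have h1 : 0 < lam ξ * u := mul_pos (hlam0 ξ) hu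
    have : 0 ≤ 1 - Real.exp (-(lam ξ * u)) := by simpa using h1.le
    simp only [hW]
    positivity
  have hWint : ∀ ξ, ∫ u in Set.Ioi 0, W ξ u = lam ξ ^ β * κ := fun ξ =>
    integral_diffWeight_mul (hlam0 ξ)
  -- The integral of a non-integrable function is `0` by convention, whereas the value found in
  -- `hWint` is positive.
  have hWi : ∀ ξ, IntegrableOn (W ξ) (Set.Ioi 0) := fun ξ => by
    by_contra hcon
    have h1 := hWint ξ
    rw [integral_undef hcon] at h1
    exact (mul_pos (Real.rpow_pos_of_pos (hlam0 ξ) β) hκ0).ne h1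
  have hsymb : ∀ ξ, lam ξ ^ β = besselSymbol s ξ := fun ξ => rfl
  have hswap : Integrable (Function.uncurry fun (ξ u : ℝ) => (W ξ u : ℂ) * 𝓕 (φ : ℝ → ℂ) ξ * e ξ)
      (volume.prod (volume.restrict (Set.Ioi 0))) := by
    rw [integrable_prod_iff]
    · constructor
      · refine Eventually.of_forall fun ξ => ?_
        simp only [Function.uncurry, mul_assoc]
        exact (hWi ξ).ofReal.mul_const _
      · have h1 := ((integrable_besselSymbol_mul s φ).norm.mul_const κ)
        refine h1.congr (Eventually.of_forall fun ξ => ?_)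
        simp only [Function.uncurry]
        have h2 : ∫ u in Set.Ioi 0, ‖(W ξ u : ℂ) * 𝓕 (φ : ℝ → ℂ) ξ * e ξ‖ =
            ∫ u in Set.Ioi 0, W ξ u * ‖𝓕 (φ : ℝ → ℂ) ξ‖ := by
          refine setIntegral_congr_fun measurableSet_Ioi fun u (hu : 0 < u) => ?_
          simp only [he]
          rw [norm_mul, norm_cexp_two_pi, mul_one, norm_mul, Complex.norm_real,
            Real.norm_of_nonneg (hW0 ξ u hu)]
        rw [h2, integral_mul_const, hWint, hsymb, norm_mul, Complex.norm_real,
          Real.norm_of_nonneg (by rw [← hsymb]; exact Real.rpow_nonneg (hlam0 ξ).le _)]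
        ring
    · refine Measurable.aestronglyMeasurable ?_
      simp only [Function.uncurry, hW, hlam]
      fun_prop
  have hker : κ * besselOp s φ x =
      ∫ u in Set.Ioi 0, (∫ ξ, (W ξ u : ℂ) * 𝓕 (φ : ℝ → ℂ) ξ * e ξ) := by
    rw [← integral_integral_swap hswap, besselOp_apply, ← integral_const_mul]
    refine integral_congr_ae (Eventually.of_forall fun ξ => ?_)
    simp only
    rw [integral_mul_const, integral_mul_const, integral_complex_ofReal, hWint, hsymb]
    push_cast
    ring
  have hterm : ∀ (i : ℕ) (u : ℝ), Integrable fun ξ =>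
      (gaussMult (√(2 * (i * u))) ξ : ℂ) * 𝓕 (φ : ℝ → ℂ) ξ * e ξ := fun i u => by
    refine (hφ.norm).mono' (Continuous.aestronglyMeasurable ?_) (Eventually.of_forall fun ξ => ?_)
    · unfold gaussMult
      fun_prop
    · simp only [he]
      rw [norm_mul, norm_cexp_two_pi, mul_one, norm_mul, Complex.norm_real,
        Real.norm_of_nonneg (gaussMult_nonneg _ _)]
      exact mul_le_of_le_one_left (norm_nonneg _) (gaussMult_le_one _ _)
  -- The binomial expansion of `(1 - e^(-λu))^l` turns the integrand into a combination of Gaussian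
  -- averages of `φ` of variance `2iu`, each with a factor `e^(-iu)`.
  have hexpand : ∀ u : ℝ, 0 < u → ∫ ξ, (W ξ u : ℂ) * 𝓕 (φ : ℝ → ℂ) ξ * e ξ =
      ((u ^ (-β - 1) : ℝ) : ℂ) * ∑ i ∈ Finset.range (l + 1),
        ((((-1) ^ i * l.choose i * Real.exp (-(i * u)) : ℝ)) : ℂ) *
        ∫ ξ, (gaussMult (√(2 * (i * u))) ξ : ℂ) * 𝓕 (φ : ℝ → ℂ) ξ * e ξ := by
    intro u hu
    have h1 : ∀ ξ, (W ξ u : ℂ) * 𝓕 (φ : ℝ → ℂ) ξ * e ξ = ((u ^ (-β - 1) : ℝ) : ℂ) *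
        ∑ i ∈ Finset.range (l + 1), ((((-1) ^ i * l.choose i * Real.exp (-(i * u)) : ℝ)) : ℂ) *
        ((gaussMult (√(2 * (i * u))) ξ : ℂ) * 𝓕 (φ : ℝ → ℂ) ξ * e ξ) := by
      intro ξ
      have h2 : W ξ u = u ^ (-β - 1) * ∑ i ∈ Finset.range (l + 1),
          ((-1) ^ i * l.choose i * Real.exp (-(i * u))) * gaussMult (√(2 * (i * u))) ξ := by
        simp only [hW]
        congr 1
        rw [sub_eq_neg_add, add_pow]
        refine Finset.sum_congr rfl fun i _ => ?_
        rw [gaussMult_sqrt (by positivity), one_pow, mul_one, neg_pow, ← Real.exp_nat_mul,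
          mul_assoc _ (Real.exp _) (Real.exp _), ← Real.exp_add, mul_right_comm]
        congr 2
        simp only [hlam]
        ring
      rw [h2]
      push_cast
      rw [mul_assoc, mul_assoc, Finset.sum_mul]
      congr 1
      refine Finset.sum_congr rfl fun i _ => ?_
      ring
    simp only [h1]
    rw [integral_const_mul, integral_finsetSum _ fun i _ => (hterm i u).const_mul _]
    simp only [integral_const_mul]
  have hterm_le : ∀ (i : ℕ), i ∈ Finset.range (l + 1) → ∀ u : ℝ, 0 < u →
      ‖((((-1) ^ i * l.choose i * Real.exp (-(i * u)) : ℝ)) : ℂ) *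
        ∫ ξ, (gaussMult (√(2 * (i * u))) ξ : ℂ) * 𝓕 (φ : ℝ → ℂ) ξ * e ξ‖ ≤
      l.choose i * (Real.exp (-u) * (A * u ^ ((k : ℝ) - 1 / 2) * ∫ y, ‖φ y‖)) := by
    intro i hi u hu
    have hR : 0 ≤ ∫ y, ‖φ y‖ := integral_nonneg fun y => norm_nonneg _
    -- The term `i = 0` involves no averaging: it is a multiple of `φ x`, which is zero because `x`
    -- lies away from the support. For `i ≥ 1` the factor `e^(-iu) ≤ e^(-u)` gives decay at
    -- infinity, and the Gaussian tail gives smallness at `0`.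
    rcases Nat.eq_zero_or_pos i with rfl | hi0
    · have h0 : ∫ ξ, (gaussMult (√(2 * ((0 : ℕ) * u))) ξ : ℂ) * 𝓕 (φ : ℝ → ℂ) ξ * e ξ = φ x := by
        have := besselOp_apply 0 φ x
        rw [besselOp_zero] at this
        rw [this]
        refine integral_congr_ae (Eventually.of_forall fun ξ => ?_)
        simp [gaussMult, besselSymbol, he]
      have h2 : φ x = 0 := by
        by_contra hne
        have := hφx x hne
        simp at this
        linarith
      rw [h0, h2, mul_zero, norm_zero]
      positivity
    · have hi1 : (1 : ℝ) ≤ i := by exact_mod_cast hi0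
      have hil : (i : ℝ) ≤ l := by exact_mod_cast Nat.lt_succ_iff.1 (Finset.mem_range.1 hi)
      have hiu : 0 < (i : ℝ) * u := by positivity
      have hc : 0 < √(2 * (i * u)) := by positivity
      have hcsq : √(2 * (i * u)) ^ 2 = 2 * (i * u) := Real.sq_sqrt (by positivity)
      rw [← gaussAvg_eq_fourier hc φ.integrable x, norm_mul, Complex.norm_real, norm_mul, norm_mul,
        norm_pow, norm_neg, norm_one, one_pow, one_mul, Real.norm_natCast,
        Real.norm_of_nonneg (Real.exp_pos _).le, mul_assoc]
      have hker2 : ∀ y, φ y ≠ 0 → gaussKernel (√(2 * (i * u))) (x - y) ≤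
          A * u ^ ((k : ℝ) - 1 / 2) := fun y hy => by
        refine (gaussKernel_le_of_le_abs hc hγ (hφx y hy) k).trans ?_
        rw [hcsq]
        have h1 : (√(2 * (i * u)))⁻¹ ≤ u ^ (-(1 / 2) : ℝ) := by
          rw [Real.rpow_neg hu.le, ← Real.sqrt_eq_rpow]
          gcongr
          nlinarith
        have h3 : (2 * (2 * (i * u)) / γ ^ 2) ^ k ≤ (4 * l / γ ^ 2) ^ k * u ^ (k : ℝ) := by
          rw [Real.rpow_natCast, ← mul_pow]
          gcongr
          rw [div_mul_eq_mul_div]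
          gcongr ?_ / _
          nlinarith
        calc _ ≤ u ^ (-(1 / 2) : ℝ) * (k.factorial * ((4 * l / γ ^ 2) ^ k * u ^ (k : ℝ))) := by
              gcongr
          _ = A * (u ^ (k : ℝ) * u ^ (-(1 / 2) : ℝ)) := by rw [hA]; ring
          _ = _ := by rw [← Real.rpow_add hu, ← sub_eq_add_neg]
      have h4 := norm_gaussAvg_le_of_le φ.integrable hc hker2
      gcongr
      nlinarith
  have hbound : ‖(κ : ℂ) * besselOp s φ x‖ ≤ 2 ^ l * A * J * ∫ y, ‖φ y‖ := by
    rw [hker]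
    have hle : ∀ u ∈ Set.Ioi (0 : ℝ), ‖∫ ξ, (W ξ u : ℂ) * 𝓕 (φ : ℝ → ℂ) ξ * e ξ‖ ≤
        (2 ^ l * A * ∫ y, ‖φ y‖) * (Real.exp (-u) * u ^ ((k : ℝ) - β - 1 / 2 - 1)) := by
      intro u hu
      have hu0 : 0 < u := hu
      rw [hexpand u hu0, norm_mul, Complex.norm_real, Real.norm_of_nonneg (by positivity)]
      calc _ ≤ u ^ (-β - 1) * ∑ i ∈ Finset.range (l + 1), l.choose i *
            (Real.exp (-u) * (A * u ^ ((k : ℝ) - 1 / 2) * ∫ y, ‖φ y‖)) := by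
            gcongr
            exact (norm_sum_le _ _).trans (Finset.sum_le_sum fun i hi => hterm_le i hi u hu0)
        _ = _ := by
            rw [← Finset.sum_mul, ← Nat.cast_sum, Nat.sum_range_choose]
            have : u ^ ((k : ℝ) - β - 1 / 2 - 1) = u ^ (-β - 1) * u ^ ((k : ℝ) - 1 / 2) := by
              rw [← Real.rpow_add hu0]
              congr 1
              ring
            rw [this]
            push_cast
            ring
    refine (norm_integral_le_of_norm_le (hJi.const_mul _)
      ((ae_restrict_iff' measurableSet_Ioi).2 (Eventually.of_forall hle))).trans (le_of_eq ?_)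
    rw [integral_const_mul]
    ring
  rw [norm_mul, Complex.norm_real, Real.norm_of_nonneg hκ0.le] at hbound
  rw [mul_assoc, ← div_eq_inv_mul, le_div_iff₀ hκ0, mul_comm]
  exact hbound

end BesselPotentials

/-! ### Mollification of Bessel derivatives -/

section Mollification

open ProbabilityTheory

/-- Convolution with the normalized bump function `φ`. -/
def mollify (φ : ContDiffBump (0 : ℝ)) (g : ℝ → ℂ) (x : ℝ) : ℂ :=
  convolution (φ.normed volume) g (ContinuousLinearMap.lsmul ℝ ℝ) volume x

variable (φ : ContDiffBump (0 : ℝ)) {g F : ℝ → ℂ} {q : ℝ≥0∞} {s : ℝ}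

theorem mollify_eq (g : ℝ → ℂ) (x : ℝ) : mollify φ g x = ∫ t, φ.normed volume t • g (x - t) := rfl

theorem mollify_eq_integral (g : ℝ → ℂ) (x : ℝ) :
    mollify φ g x = ∫ y, g y * (φ.normed volume (x - y) : ℂ) := by
  rw [mollify_eq, ← integral_sub_left_eq_self _ volume x]
  refine integral_congr_ae (Eventually.of_forall fun y => ?_)
  simp only [sub_sub_cancel, Complex.real_smul]
  ring

/-- The probability measure with density `φ.normed`. -/
def bumpMeasure : Measure ℝ := volume.withDensity fun t => ENNReal.ofReal (φ.normed volume t)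

theorem isProbabilityMeasure_bumpMeasure : IsProbabilityMeasure (bumpMeasure φ) := by
  constructor
  rw [bumpMeasure, withDensity_apply _ MeasurableSet.univ, Measure.restrict_univ,
    ← ofReal_integral_eq_lintegral_ofReal φ.integrable_normed
      (Eventually.of_forall fun t => φ.nonneg_normed t), φ.integral_normed, ENNReal.ofReal_one]

theorem mollify_eq_integral_bumpMeasure (g : ℝ → ℂ) (x : ℝ) :
    mollify φ g x = ∫ t, g (x + -t) ∂(bumpMeasure φ) := by
  rw [mollify_eq, bumpMeasure, integral_withDensity_eq_integral_toReal_smul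
    (φ.continuous_normed.measurable.ennreal_ofReal) (by simp)]
  refine integral_congr_ae (Eventually.of_forall fun t => ?_)
  simp only
  rw [ENNReal.toReal_ofReal (φ.nonneg_normed t), sub_eq_add_neg]

theorem eLpNorm_mollify_le (hg : Measurable g) (hq : 1 ≤ q) :
    eLpNorm (mollify φ g) q volume ≤ eLpNorm g q volume := by
  have := isProbabilityMeasure_bumpMeasure φ
  rw [funext (mollify_eq_integral_bumpMeasure φ g)]
  exact eLpNorm_integral_translate_le _ measurable_neg hg hq

theorem norm_mollify_le {M : ℝ} (hM : ∀ x, ‖g x‖ ≤ M) (x : ℝ) : ‖mollify φ g x‖ ≤ M := by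
  have := isProbabilityMeasure_bumpMeasure φ
  rw [mollify_eq_integral_bumpMeasure]
  have := norm_integral_le_of_norm_le_const (μ := bumpMeasure φ)
    (f := fun t => g (x + -t)) (Eventually.of_forall fun t => hM _)
  rwa [probReal_univ, mul_one] at this

theorem measurable_mollify (hg : Measurable g) : Measurable (mollify φ g) := by
  rw [funext (mollify_eq φ g)]
  refine StronglyMeasurable.measurable (StronglyMeasurable.integral_prod_right
    (f := fun x t => φ.normed volume t • g (x - t)) (Measurable.stronglyMeasurable ?_))
  have := φ.continuous_normed (μ := volume).measurable
  change Measurable fun p : ℝ × ℝ => φ.normed volume p.2 • g (p.1 - p.2)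
  fun_prop

theorem mollify_eq_zero {x : ℝ} (h : ∀ y, |x - y| < φ.rOut → F y = 0) : mollify φ F x = 0 := by
  rw [mollify_eq_integral]
  refine integral_eq_zero_of_ae (Eventually.of_forall fun y => ?_)
  change F y * (φ.normed volume (x - y) : ℂ) = 0
  by_cases hy : |x - y| < φ.rOut
  · rw [h y hy, zero_mul]
  · have : φ.normed volume (x - y) = 0 := by
      rw [← Function.notMem_support, φ.support_normed_eq]
      simpa using hy
    rw [this, Complex.ofReal_zero, mul_zero]

theorem exists_lintegral_bump_le (q : ℝ≥0∞) (hq : 1 ≤ q) : ∃ K : ℝ≥0∞, K ≠ ∞ ∧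
    ∀ g : ℝ → ℂ, Measurable g → ∀ x,
      ∫⁻ y, ‖g y‖ₑ * ‖(φ.normed volume (x - y) : ℂ)‖ₑ ≤ K * eLpNorm g q volume := by
  have := ENNReal.HolderConjugate.conjExponent hq
  have hc : Continuous fun t => (φ.normed volume t : ℂ) :=
    Complex.continuous_ofReal.comp φ.continuous_normed
  have hcs : HasCompactSupport fun t => (φ.normed volume t : ℂ) :=
    φ.hasCompactSupport_normed.comp_left (g := fun r : ℝ => (r : ℂ)) Complex.ofReal_zero
  refine ⟨eLpNorm (fun t => (φ.normed volume t : ℂ)) (ENNReal.conjExponent q) volume,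
    (hc.memLp_of_hasCompactSupport hcs).eLpNorm_ne_top, fun g hg x => ?_⟩
  have e := eLpNorm_comp_measurePreserving (p := ENNReal.conjExponent q) (μ := volume)
    (g := fun t => (φ.normed volume t : ℂ)) hc.aestronglyMeasurable
    (volume.measurePreserving_sub_left x)
  rw [← e]
  have h := eLpNorm_smul_le_mul_eLpNorm (p := ENNReal.conjExponent q) (q := q) (r := 1)
    (φ := (fun t => (φ.normed volume t : ℂ)) ∘ fun y => x - y)
    (f := g) (μ := volume) hg.aestronglyMeasurable
    (hc.comp (continuous_const.sub continuous_id)).aestronglyMeasurable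
  rw [eLpNorm_one_eq_lintegral_enorm] at h
  refine le_trans (le_of_eq ?_) h
  refine lintegral_congr fun y => ?_
  simp only [Pi.smul_apply', Function.comp_apply, smul_eq_mul, enorm_mul]
  ring

theorem exists_norm_mollify_le (hg : Measurable g) (hq : 1 ≤ q) (hgq : eLpNorm g q volume ≠ ∞) :
    ∃ M : ℝ, ∀ x, ‖mollify φ g x‖ ≤ M := by
  obtain ⟨K, hK, h⟩ := exists_lintegral_bump_le φ q hq
  refine ⟨(K * eLpNorm g q volume).toReal, fun x => ?_⟩
  rw [← toReal_enorm]
  refine ENNReal.toReal_mono (ENNReal.mul_ne_top hK hgq) ?_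
  rw [mollify_eq_integral]
  refine (enorm_integral_le_lintegral_enorm _).trans ?_
  simp only [enorm_mul]
  exact h g hg x

/-- The translated bump function `y ↦ φ.normed (x - y)` as a Schwartz function. -/
def bumpSchwartz (x : ℝ) : 𝓢(ℝ, ℂ) :=
  HasCompactSupport.toSchwartzMap (f := fun y => (φ.normed volume (x - y) : ℂ))
    (by
      have h : HasCompactSupport fun y => φ.normed volume (x - y) :=
        φ.hasCompactSupport_normed.comp_homeomorph (Homeomorph.subLeft x)
      exact h.comp_left (g := fun r : ℝ => (r : ℂ)) Complex.ofReal_zero)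
    (Complex.ofRealCLM.contDiff.comp (φ.contDiff_normed.comp (contDiff_const.sub contDiff_id)))

theorem bumpSchwartz_apply (x y : ℝ) : bumpSchwartz φ x y = (φ.normed volume (x - y) : ℂ) := rfl

/-- `g = (I - d²/dx²)^{s/2} F` in the sense of tempered distributions. -/
def IsBesselDeriv (s : ℝ) (F g : ℝ → ℂ) : Prop :=
  ∀ ψ : 𝓢(ℝ, ℂ), ∫ x, g x * ψ x = ∫ x, F x * besselOp s ψ x

/-- The law of the pair of the Gamma and the normal variable that represents the Bessel
potential. -/
def besselLaw (s : ℝ) : Measure (ℝ × ℝ) := (gammaWeight (s / 2)).prod (gaussianReal 0 1)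

theorem isProbabilityMeasure_besselLaw (hs : 0 < s) : IsProbabilityMeasure (besselLaw s) := by
  have := isProbabilityMeasure_gammaWeight (half_pos hs)
  unfold besselLaw
  infer_instance

/-- Testing the distributional identity on the Bessel potential of a translated bump recovers the
mollified `F` from `g`. The potential is an average of translates, and Fubini's theorem moves these
translates onto the mollified `g`, which is bounded. -/
theorem IsBesselDeriv.mollify_eq_integral_besselLaw (hs : 0 < s) (hq : 1 ≤ q)
    (h : IsBesselDeriv s F g) (hg : Measurable g) (hgq : eLpNorm g q volume ≠ ∞) (x : ℝ) :
    mollify φ F x = ∫ p, mollify φ g (x + √(2 * p.1) * p.2) ∂(besselLaw s) := by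
  have hp := isProbabilityMeasure_gammaWeight (half_pos hs)
  have hp2 := isProbabilityMeasure_besselLaw hs
  set ψ := bumpSchwartz φ x with hψ
  have hψm : Measurable ψ := ψ.continuous.measurable
  have h1 : mollify φ F x = ∫ y, g y * besselOp (-s) ψ y := by
    rw [mollify_eq_integral, h, besselOp_neg_besselOp]
    rfl
  have hshift : ∀ y t : ℝ, ψ (y + -t) = (φ.normed volume (x + t - y) : ℂ) := fun y t => by
    rw [hψ, bumpSchwartz_apply]
    congr 2
    ring
  have hm : Measurable (Function.uncurry fun (y : ℝ) (p : ℝ × ℝ) =>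
      g y * ψ (y + -(√(2 * p.1) * p.2))) := by
    change Measurable fun z : ℝ × ℝ × ℝ => g z.1 * ψ (z.1 + -(√(2 * z.2.1) * z.2.2))
    fun_prop
  have h2 : ∀ y, besselOp (-s) ψ y = ∫ p, ψ (y + -(√(2 * p.1) * p.2)) ∂(besselLaw s) := by
    intro y
    rw [besselOp_neg_apply hs, besselLaw, integral_prod]
    · refine integral_congr_ae (Eventually.of_forall fun u => ?_)
      simp only
      rw [← gaussAvg_neg, gaussAvg]
      simp only [neg_mul]
    · have hM : ∀ y, ‖ψ y‖ ≤ ‖ψ.toBoundedContinuousFunction‖ := fun y =>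
        ψ.toBoundedContinuousFunction.norm_coe_le_norm y
      refine Integrable.of_bound (C := ‖ψ.toBoundedContinuousFunction‖) (Measurable.aestronglyMeasurable (by fun_prop)) ?_
      exact Eventually.of_forall fun p => hM _
  obtain ⟨K, hK, hKle⟩ := exists_lintegral_bump_le φ q hq
  have hint : Integrable (Function.uncurry fun (y : ℝ) (p : ℝ × ℝ) =>
      g y * ψ (y + -(√(2 * p.1) * p.2))) (volume.prod (besselLaw s)) := by
    refine ⟨hm.aestronglyMeasurable, ?_⟩
    rw [hasFiniteIntegral_iff_enorm, lintegral_prod_symm _ hm.enorm.aemeasurable]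
    refine lt_of_le_of_lt ?_ (ENNReal.mul_lt_top hK.lt_top hgq.lt_top)
    calc _ ≤ ∫⁻ _, K * eLpNorm g q volume ∂(besselLaw s) := by
          refine lintegral_mono fun p => ?_
          simp only [Function.uncurry, enorm_mul, hshift]
          exact hKle g hg _
      _ = _ := by simp
  rw [h1]
  calc _ = ∫ y, ∫ p, g y * ψ (y + -(√(2 * p.1) * p.2)) ∂(besselLaw s) := by
        refine integral_congr_ae (Eventually.of_forall fun y => ?_)
        simp only
        rw [h2, integral_const_mul]
    _ = ∫ p, (∫ y, g y * ψ (y + -(√(2 * p.1) * p.2))) ∂(besselLaw s) :=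
        integral_integral_swap hint
    _ = _ := by
        refine integral_congr_ae (Eventually.of_forall fun p => ?_)
        simp only [hshift]
        rw [mollify_eq_integral]

theorem IsBesselDeriv.mollify_eq_integral_gaussAvg (hs : 0 < s) (hq : 1 ≤ q)
    (h : IsBesselDeriv s F g) (hg : Measurable g) (hgq : eLpNorm g q volume ≠ ∞) (x : ℝ) :
    mollify φ F x = ∫ u, gaussAvg (√(2 * u)) (mollify φ g) x ∂(gammaWeight (s / 2)) := by
  have hp := isProbabilityMeasure_gammaWeight (half_pos hs)
  rw [h.mollify_eq_integral_besselLaw φ hs hq hg hgq, besselLaw, integral_prod]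
  · rfl
  · obtain ⟨M, hM⟩ := exists_norm_mollify_le φ hg hq hgq
    have := measurable_mollify φ hg
    refine Integrable.of_bound (C := M) (Measurable.aestronglyMeasurable (by fun_prop)) ?_
    exact Eventually.of_forall fun p => hM _

/-- Bump functions that shrink to the origin. -/
def shrinkingBump (k : ℕ) : ContDiffBump (0 : ℝ) where
  rIn := 1 / (2 * (k + 1))
  rOut := 1 / (k + 1)
  rIn_pos := by positivity
  rIn_lt_rOut := by
    apply one_div_lt_one_div_of_lt
    · positivity
    · have : (0 : ℝ) ≤ k := by positivity
      linarith

theorem tendsto_rOut_shrinkingBump : Tendsto (fun k => (shrinkingBump k).rOut) atTop (𝓝 0) :=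
  tendsto_one_div_add_atTop_nhds_zero_nat

theorem tendsto_mollify_shrinkingBump (hF : Continuous F) (x : ℝ) :
    Tendsto (fun k => mollify (shrinkingBump k) F x) atTop (𝓝 (F x)) :=
  ContDiffBump.convolution_tendsto_right_of_continuous tendsto_rOut_shrinkingBump hF x

theorem ae_tendsto_mollify_shrinkingBump (hF : LocallyIntegrable F) :
    ∀ᵐ x, Tendsto (fun k => mollify (shrinkingBump k) F x) atTop (𝓝 (F x)) := by
  refine ContDiffBump.ae_convolution_tendsto_right_of_locallyIntegrable (K := 2)
    tendsto_rOut_shrinkingBump (Eventually.of_forall fun k => ?_) hF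
  simp only [shrinkingBump]
  field_simp
  exact le_rfl

theorem tendsto_mollify_of_notMem_tsupport {x : ℝ} (hx : x ∉ tsupport F) :
    Tendsto (fun k => mollify (shrinkingBump k) F x) atTop (𝓝 (F x)) := by
  obtain ⟨δ, hδ, hball⟩ := Metric.isOpen_iff.1 (isClosed_tsupport F).isOpen_compl x hx
  have hF0 : ∀ y, |x - y| < δ → F y = 0 := fun y hy => by
    have : y ∈ (tsupport F)ᶜ := hball (by rwa [Metric.mem_ball, dist_comm, Real.dist_eq])
    exact image_eq_zero_of_notMem_tsupport this
  rw [hF0 x (by simpa using hδ)]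
  refine tendsto_const_nhds.congr' ?_
  filter_upwards [tendsto_rOut_shrinkingBump.eventually (gt_mem_nhds hδ)] with k hk
  exact (mollify_eq_zero _ fun y hy => hF0 y (hy.trans hk)).symm

/-- Each mollification of `F` is a probability average of translates of the mollified `g`, so its
norm is at most that of `g`. Fatou's lemma passes to `F`. -/
theorem IsBesselDeriv.eLpNorm_le (hs : 0 < s) (hq : 1 ≤ q) (h : IsBesselDeriv s F g)
    (hF : Measurable F) (hFi : LocallyIntegrable F) (hg : Measurable g)
    (hgq : eLpNorm g q volume ≠ ∞) : eLpNorm F q volume ≤ eLpNorm g q volume := by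
  have hp := isProbabilityMeasure_besselLaw hs
  refine (Lp.eLpNorm_lim_le_liminf_eLpNorm (f := fun k => mollify (shrinkingBump k) F)
    (fun k => (measurable_mollify _ hF).aestronglyMeasurable) F
    (ae_tendsto_mollify_shrinkingBump hFi)).trans ?_
  refine liminf_le_of_frequently_le' (Frequently.of_forall fun k => ?_)
  rw [funext (h.mollify_eq_integral_besselLaw (shrinkingBump k) hs hq hg hgq)]
  exact (eLpNorm_integral_translate_le _ (τ := fun p : ℝ × ℝ => √(2 * p.1) * p.2)
    (by fun_prop) (measurable_mollify _ hg) hq).trans (eLpNorm_mollify_le _ hg hq)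

/-- Away from the support of `F`, the mollified derivatives of `F` are bounded by the `L¹` norm. -/
theorem exists_norm_mollify_le_of_support {γ : ℝ} (hs : 0 < s) (hγ : 0 < γ) :
    ∃ D : ℝ, 0 ≤ D ∧ ∀ (φ : ContDiffBump (0 : ℝ)) (F g : ℝ → ℂ), IsBesselDeriv s F g →
      Integrable F → ∀ x, (∀ y, F y ≠ 0 → γ + φ.rOut ≤ |x - y|) →
      ‖mollify φ g x‖ ≤ D * ∫ y, ‖F y‖ := by
  obtain ⟨D, hD, hb⟩ := exists_norm_besselOp_le hs hγ
  refine ⟨D, hD, fun φ F g h hF x hx => ?_⟩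
  have e : mollify φ g x = ∫ y, F y * besselOp s (bumpSchwartz φ x) y := by
    rw [mollify_eq_integral, ← h]
    rfl
  have hn : ∫ y, ‖bumpSchwartz φ x y‖ = 1 := by
    simp only [bumpSchwartz_apply, Complex.norm_real, Real.norm_of_nonneg (φ.nonneg_normed _)]
    rw [integral_sub_left_eq_self (fun y => φ.normed volume y) volume x, φ.integral_normed]
  rw [e, ← integral_const_mul]
  refine norm_integral_le_of_norm_le (hF.norm.const_mul D) (Eventually.of_forall fun y => ?_)
  rw [norm_mul, mul_comm]
  by_cases hy : F y = 0
  · simp [hy]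
  · gcongr
    refine (hb (bumpSchwartz φ x) y fun z hz => ?_).trans (by rw [hn, mul_one])
    have h1 : |x - z| < φ.rOut := by
      rw [bumpSchwartz_apply] at hz
      have hz2 : x - z ∈ Function.support (φ.normed volume) := by simpa using hz
      rw [φ.support_normed_eq] at hz2
      simpa using hz2
    have h2 := hx y hy
    have h3 := abs_sub_le x z y
    rw [abs_sub_comm y z]
    linarith

end Mollification

/-! ### Gaussian averages evaluated at an operator -/

section GaussianFunctionsOfOperators

open ProbabilityTheory FourierTransform

variable {X : Type*} [MetricSpace X] [TopologicalSpace.SeparableSpace X] [MeasurableSpace X]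
  [BorelSpace X] {μ : Measure X} {n C l : ℝ} {p q : ℝ≥0∞}

theorem polarForm_cexp {H : Type*} [NormedAddCommGroup H] [InnerProductSpace ℂ H]
    [CompleteSpace H] {B : H →L[ℂ] H} (hB : IsSelfAdjoint B) (ξ : ℝ) (h f : H) :
    polarForm B (fun x : ℝ => Complex.exp (2 * Real.pi * x * ξ * Complex.I)) h f =
      ⟪h, unitaryGroup B (2 * Real.pi * ξ) f⟫_ℂ := by
  have hc : Continuous fun z : ℂ => (2 * Real.pi * ξ * Complex.I) * z + 0 * z ^ 2 := by fun_prop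
  have h1 := continuousFC_cexp hc hB
  rw [cfc_quadratic hB] at h1
  have e : (fun x : ℝ => Complex.exp (2 * Real.pi * x * ξ * Complex.I)) =
      fun x : ℝ => Complex.exp ((2 * Real.pi * ξ * Complex.I) * x + 0 * (x : ℂ) ^ 2) := by
    ext x
    congr 1
    ring
  rw [e, polarForm_eq_inner_continuousFC (by fun_prop), h1, unitaryGroup]
  congr 4
  rw [zero_smul, add_zero, ← smul_assoc, Complex.real_smul]
  push_cast
  rfl

theorem enorm_le_of_enorm_inner_le {H : Type*} [NormedAddCommGroup H] [InnerProductSpace ℂ H]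
    {v : H} {M : ℝ≥0∞} (h : ∀ w : H, ‖⟪w, v⟫_ℂ‖ₑ ≤ M * ‖w‖ₑ) : ‖v‖ₑ ≤ M := by
  by_cases hv : v = 0
  · simp [hv]
  · have h1 := h v
    have h2 : ‖⟪v, v⟫_ℂ‖ₑ = ‖v‖ₑ * ‖v‖ₑ := by
      rw [← ofReal_norm, inner_self_eq_norm_sq_to_K, norm_pow, RCLike.norm_ofReal, abs_norm,
        ENNReal.ofReal_pow (norm_nonneg _), ofReal_norm, sq]
    rw [h2] at h1
    exact (ENNReal.mul_le_mul_iff_left (by simpa using hv) (by simp)).1 h1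

theorem lintegral_gaussKernel {c : ℝ} (hc : 0 < c) (x : ℝ) :
    ∫⁻ y, ENNReal.ofReal (gaussKernel c (x - y)) = 1 := by
  have h := gaussAvg_eq_integral hc (fun _ => 1) x
  simp only [gaussAvg, integral_const, probReal_univ, one_smul, one_mul] at h
  rw [integral_complex_ofReal] at h
  have h1 : ∫ y, gaussKernel c (x - y) = 1 := by exact_mod_cast h.symm
  have hi : Integrable fun y => gaussKernel c (x - y) := by
    by_contra hcon
    rw [integral_undef hcon] at h1
    exact zero_ne_one h1
  rw [← ofReal_integral_eq_lintegral_ofReal hi (Eventually.of_forall fun y =>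
    gaussKernel_nonneg hc.le _), h1, ENNReal.ofReal_one]

theorem enorm_gaussAvg_le_lintegral {c : ℝ} (hc : 0 < c) (g : ℝ → ℂ) (x : ℝ) :
    ‖gaussAvg c g x‖ₑ ≤ ∫⁻ y, ENNReal.ofReal (gaussKernel c (x - y)) * ‖g y‖ₑ := by
  rw [gaussAvg_eq_integral hc]
  refine (enorm_integral_le_lintegral_enorm _).trans (le_of_eq (lintegral_congr fun y => ?_))
  rw [enorm_mul, mul_comm, ← ofReal_norm (E := ℂ) (gaussKernel c (x - y) : ℂ), Complex.norm_real,
    Real.norm_of_nonneg (gaussKernel_nonneg hc.le _)]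

theorem enorm_gaussAvg_le_top {c : ℝ} (hc : 0 < c) (g : ℝ → ℂ) (x : ℝ) :
    ‖gaussAvg c g x‖ₑ ≤ eLpNorm g ∞ volume := by
  refine (enorm_gaussAvg_le_lintegral hc g x).trans ?_
  rw [eLpNorm_exponent_top]
  calc _ ≤ ∫⁻ y, ENNReal.ofReal (gaussKernel c (x - y)) * eLpNormEssSup g volume := by
        refine lintegral_mono_ae ?_
        filter_upwards [enorm_ae_le_eLpNormEssSup g volume] with y hy
        gcongr
    _ = _ := by
        have hm : Measurable fun y => ENNReal.ofReal (gaussKernel c (x - y)) :=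
          ((continuous_gaussKernel c).comp (continuous_const.sub continuous_id)).measurable.ennreal_ofReal
        rw [lintegral_mul_const _ hm, lintegral_gaussKernel hc, one_mul]

/-- Jensen's inequality for the Gaussian probability density, whose supremum is at most `1/c`. This
is the source of `α = 1/2` for `L²`, while `enorm_gaussAvg_le_top` corresponds to `α = 0` for `L^∞`.
-/
theorem enorm_gaussAvg_le_two {c : ℝ} (hc : 0 < c) {g : ℝ → ℂ} (hg : Measurable g) (x : ℝ) :
    ‖gaussAvg c g x‖ₑ ≤ ENNReal.ofReal (max 1 c⁻¹ ^ (1 / 2 : ℝ)) * eLpNorm g 2 volume := by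
  refine (enorm_gaussAvg_le_lintegral hc g x).trans ?_
  have hm : Measurable fun y => ENNReal.ofReal (gaussKernel c (x - y)) :=
    ((continuous_gaussKernel c).comp (continuous_const.sub continuous_id)).measurable.ennreal_ofReal
  have h1 := lintegral_mul_rpow_le (μ := volume) hm.aemeasurable hg.enorm.aemeasurable one_le_two
  rw [lintegral_gaussKernel hc, ENNReal.one_rpow, one_mul] at h1
  have hle : ∀ y, gaussKernel c (x - y) ≤ max 1 c⁻¹ := fun y => by
    refine le_trans ?_ (le_max_right _ _)
    rw [gaussKernel]
    have h2 : Real.exp (-(x - y) ^ 2 / (2 * c ^ 2)) ≤ 1 := by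
      rw [Real.exp_le_one_iff, neg_div, neg_nonpos]
      positivity
    have h3 : (√(2 * Real.pi) * c)⁻¹ ≤ c⁻¹ := by
      apply inv_anti₀ hc
      have : 1 ≤ √(2 * Real.pi) := by
        rw [Real.one_le_sqrt]
        linarith [Real.pi_gt_three]
      nlinarith
    exact (mul_le_of_le_one_right (by positivity) h2).trans h3
  have h4 : (∫⁻ y, ENNReal.ofReal (gaussKernel c (x - y)) * ‖g y‖ₑ) ^ (2 : ℝ) ≤
      ENNReal.ofReal (max 1 c⁻¹) * ∫⁻ y, ‖g y‖ₑ ^ (2 : ℝ) := by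
    refine h1.trans ?_
    rw [← lintegral_const_mul _ (hg.enorm.pow_const _)]
    refine lintegral_mono fun y => ?_
    gcongr
    exact hle y
  have h5 : 0 ≤ max 1 c⁻¹ := le_max_of_le_left zero_le_one
  rw [eLpNorm_eq_lintegral_rpow_enorm_toReal (by norm_num) (by norm_num), ENNReal.toReal_ofNat,
    ← ENNReal.ofReal_rpow_of_nonneg h5 (by norm_num), ← ENNReal.mul_rpow_of_nonneg _ _ (by norm_num)]
  rw [one_div, ENNReal.le_rpow_inv_iff two_pos]
  exact h4

/-- The moments of `F(B) B f` away from the support of `f`, for the Gaussian average `F` of `g`. -/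
theorem exists_moment_gaussAvg_le {X : Type*} [MeasurableSpace X] (μ : Measure X)
    (hn : 0 ≤ n) {c₀ : ℝ≥0∞} (hc₀ : c₀ ≠ ∞)
    (m : ℕ) (hl : n + m < l) (hp1 : 1 ≤ p) (hp2 : p ≤ 2) :
    ∃ D : ℝ≥0∞, D ≠ ∞ ∧ ∀ [MetricSpace X] [TopologicalSpace.SeparableSpace X] [BorelSpace X],
      IsDoubling μ n C → ∀ (B : Lp ℂ 2 μ →L[ℂ] Lp ℂ 2 μ) (K : X → X → ℂ), IsSelfAdjoint B →
      IsIntegralOp μ B K c₀ l → ∀ (c : ℝ), 0 < c → ∀ g : ℝ → ℂ, Measurable g →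
      (∃ M, ∀ x, ‖g x‖ ≤ M) → Integrable g →
      ∀ (w : X → ℝ) (hw : Measurable w) (R : ℝ) (hR : ∀ x, |w x| ≤ R),
      (∀ x y, |w x - w y| ≤ dist x y) → ∀ f : Lp ℂ 2 μ, mulOp μ w hw R hR f = 0 →
      weightedNorm μ p f ≠ ∞ →
      eLpNorm ((mulOp μ w hw R hR ^ m) (borelFC (gaussAvg c g) B (B f))) 2 μ ≤
        D * ENNReal.ofReal (max 1 c⁻¹ ^ (m + 1 / 2 : ℝ)) * eLpNorm g 2 volume *
          weightedNorm μ p f := by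
  obtain ⟨P, hP, hPb⟩ := exists_weighted_unitaryGroup_le μ (C := C) hn hc₀ m hl hp1 hp2
  obtain ⟨M, hM, hMb⟩ := exists_lintegral_moment_le m
  refine ⟨ENNReal.ofReal P * M, ENNReal.mul_ne_top ENNReal.ofReal_ne_top hM, ?_⟩
  intro _ _ _ hX B K hB hK c hc g hg hgb hgi w hw R hR hL f hf hfin
  obtain ⟨Mg, hMg⟩ := hgb
  have hF : Continuous (𝓕 g) := VectorFourier.fourierIntegral_continuous Real.continuous_fourierChar
    (by fun_prop) hgi
  have hFb : ∀ ξ, ‖𝓕 g ξ‖ ≤ ∫ y, ‖g y‖ := fun ξ =>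
    VectorFourier.norm_fourierIntegral_le_integral_norm _ _ _ _ _
  have hEF : Integrable fun ξ => (gaussMult c ξ : ℂ) * 𝓕 g ξ :=
    (integrable_gaussMult hc).ofReal.mul_bdd (c := ∫ y, ‖g y‖) hF.aestronglyMeasurable
      (Eventually.of_forall hFb)
  rw [← Lp.enorm_def]
  refine enorm_le_of_enorm_inner_le fun h => ?_
  rw [inner_mulOp_pow, inner_borelFC_eq_polarForm (stronglyMeasurable_gaussAvg c hg).measurable
    ⟨Mg, norm_gaussAvg_le c hMg⟩, funext (gaussAvg_eq_fourier hc hgi)]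
  have hmeas : Measurable (Function.uncurry fun ξ x : ℝ => (gaussMult c ξ : ℂ) * 𝓕 g ξ *
      Complex.exp (2 * Real.pi * x * ξ * Complex.I)) := by
    have := (continuous_gaussMult c).measurable
    have := hF.measurable
    change Measurable fun z : ℝ × ℝ => (gaussMult c z.1 : ℂ) * 𝓕 g z.1 *
      Complex.exp (2 * Real.pi * z.2 * z.1 * Complex.I)
    fun_prop
  -- The operator becomes a superposition of the unitaries `exp(2πiξB)` with density `gaussMult c ξ
  -- · 𝓕 g ξ`. The growth of moments at time `t = 2πξ` then leads to the Fourier moment of order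
  -- `m`.
  obtain ⟨-, h2⟩ := polarForm_integral hmeas B hEF.norm (fun ξ x _ => by
    rw [norm_mul, norm_cexp_two_pi, mul_one]) ((mulOp μ w hw R hR ^ m) h) (B f)
  rw [h2]
  have hW : weightedNorm μ p f = ENNReal.ofReal (weightedNorm μ p f).toReal :=
    (ENNReal.ofReal_toReal hfin).symm
  calc _ ≤ ∫⁻ ξ, ‖polarForm B (fun x : ℝ => (gaussMult c ξ : ℂ) * 𝓕 g ξ *
        Complex.exp (2 * Real.pi * x * ξ * Complex.I)) ((mulOp μ w hw R hR ^ m) h) (B f)‖ₑ :=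
        enorm_integral_le_lintegral_enorm _
    _ ≤ ∫⁻ ξ : ℝ, (‖𝓕 g ξ‖ₑ * ENNReal.ofReal (gaussMult c ξ * (1 + 2 * Real.pi * |ξ|) ^ m)) *
        (ENNReal.ofReal P * weightedNorm μ p f * ‖h‖ₑ) := by
        refine lintegral_mono fun ξ => ?_
        rw [polarForm_const_mul, polarForm_cexp hB, ← inner_mulOp_pow, enorm_mul, enorm_mul]
        have h3 := hPb hX B K hB hK w hw R hR hL f hf hfin (2 * Real.pi * ξ)
        have h4 : ‖⟪h, (mulOp μ w hw R hR ^ m) (unitaryGroup B (2 * Real.pi * ξ) (B f))⟫_ℂ‖ₑ ≤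
            ‖h‖ₑ * ENNReal.ofReal (P * (1 + 2 * Real.pi * |ξ|) ^ m *
              (weightedNorm μ p f).toReal) := by
          rw [← ofReal_norm, ← ofReal_norm, ← ENNReal.ofReal_mul (norm_nonneg _)]
          refine ENNReal.ofReal_le_ofReal ((norm_inner_le_norm _ _).trans ?_)
          gcongr
          refine h3.trans (le_of_eq ?_)
          rw [abs_mul, abs_of_pos Real.two_pi_pos]
        calc _ ≤ ‖(gaussMult c ξ : ℂ)‖ₑ * ‖𝓕 g ξ‖ₑ * (‖h‖ₑ * ENNReal.ofReal
              (P * (1 + 2 * Real.pi * |ξ|) ^ m * (weightedNorm μ p f).toReal)) := by gcongr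
          _ = _ := by
              have e : ‖(gaussMult c ξ : ℂ)‖ₑ = ENNReal.ofReal (gaussMult c ξ) := by
                rw [← ofReal_norm, Complex.norm_real, Real.norm_of_nonneg (gaussMult_nonneg _ _)]
              rw [e, ENNReal.ofReal_mul (by positivity), ENNReal.ofReal_mul hP, ← hW,
                ENNReal.ofReal_mul (gaussMult_nonneg _ _)]
              ring
    _ = (∫⁻ ξ : ℝ, ‖𝓕 g ξ‖ₑ * ENNReal.ofReal (gaussMult c ξ * (1 + 2 * Real.pi * |ξ|) ^ m)) *
        (ENNReal.ofReal P * weightedNorm μ p f * ‖h‖ₑ) := by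
        refine lintegral_mul_const _ (hF.measurable.enorm.mul ?_)
        have := (continuous_gaussMult c).measurable
        fun_prop
    _ ≤ (M * ENNReal.ofReal (max 1 c⁻¹ ^ (m + 1 / 2 : ℝ)) * eLpNorm g 2 volume) *
        (ENNReal.ofReal P * weightedNorm μ p f * ‖h‖ₑ) := by
        gcongr
        exact hMb c hc g hg hgi
    _ = _ := by ring

theorem eLpNorm_borelFC_apply_le {F : ℝ → ℂ} (hF : Measurable F) (hb : ∃ M, ∀ x, ‖F x‖ ≤ M)
    (B : Lp ℂ 2 μ →L[ℂ] Lp ℂ 2 μ) {M : ℝ≥0∞} (hM : ∀ x ∈ Set.Icc (-‖B‖) ‖B‖, ‖F x‖ₑ ≤ M)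
    (f : Lp ℂ 2 μ) : eLpNorm (borelFC F B f) 2 μ ≤ 4 * M * eLpNorm f 2 μ := by
  rw [← Lp.enorm_def, ← Lp.enorm_def]
  by_cases hMt : M = ∞
  · by_cases hf : f = 0
    · simp [hf]
    · rw [hMt, ENNReal.mul_top (by norm_num), ENNReal.top_mul (by simpa using hf)]
      exact le_top
  refine enorm_le_of_enorm_inner_le fun h => ?_
  rw [inner_borelFC_eq_polarForm hF hb]
  have h1 := norm_polarForm_le_of_Icc B hF (M := M.toReal) (fun x hx => by
    rw [← toReal_enorm]
    exact ENNReal.toReal_mono hMt (hM x hx)) h f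
  rw [← ofReal_norm, ← ofReal_norm, ← ofReal_norm]
  refine (ENNReal.ofReal_le_ofReal h1).trans (le_of_eq ?_)
  rw [ENNReal.ofReal_mul (by positivity), ENNReal.ofReal_mul (by positivity),
    ENNReal.ofReal_mul (by norm_num), ENNReal.ofReal_toReal hMt]
  norm_num
  ring

end GaussianFunctionsOfOperators

/-! ### Exponentials on `L^p` and the part of `g` far from the spectrum -/

section ExponentialBounds

variable {α : Type*} [MeasurableSpace α] {μ : Measure α} {p q : ℝ≥0∞}

theorem LpBound.memLp {T : Lp ℂ 2 μ →L[ℂ] Lp ℂ 2 μ} {M : ℝ≥0∞} (hT : LpBound μ T p M) (hM : M ≠ ∞)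
    {f : Lp ℂ 2 μ} (hf : MemLp f p μ) : MemLp (T f) p μ :=
  ⟨Lp.aestronglyMeasurable _, (hT f hf).trans_lt (ENNReal.mul_lt_top hM.lt_top hf.2)⟩

theorem LpBound.mul {S T : Lp ℂ 2 μ →L[ℂ] Lp ℂ 2 μ} {a b : ℝ≥0∞} (hS : LpBound μ S p a)
    (hT : LpBound μ T p b) (hb : b ≠ ∞) : LpBound μ (S * T) p (a * b) := fun f hf => by
  rw [mul_apply_eq_comp, mul_assoc]
  exact (hS _ (hT.memLp hb hf)).trans (by gcongr; exact hT f hf)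

theorem LpBound.one : LpBound μ (1 : Lp ℂ 2 μ →L[ℂ] Lp ℂ 2 μ) p 1 := fun f _ => by
  rw [one_apply_eq_self, one_mul]

theorem LpBound.pow {T : Lp ℂ 2 μ →L[ℂ] Lp ℂ 2 μ} {a : ℝ≥0∞} (hT : LpBound μ T p a) (ha : a ≠ ∞)
    (k : ℕ) : LpBound μ (T ^ k) p (a ^ k) := by
  induction k with
  | zero => simpa using LpBound.one
  | succ k ih =>
    rw [pow_succ, pow_succ]
    exact ih.mul hT ha

theorem LpBound.add {S T : Lp ℂ 2 μ →L[ℂ] Lp ℂ 2 μ} {a b : ℝ≥0∞} (hp : 1 ≤ p)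
    (hS : LpBound μ S p a) (hT : LpBound μ T p b) : LpBound μ (S + T) p (a + b) := fun f hf => by
  rw [_root_.add_apply, eLpNorm_congr_ae (Lp.coeFn_add _ _), add_mul]
  exact (eLpNorm_add_le (Lp.aestronglyMeasurable _) (Lp.aestronglyMeasurable _) hp).trans
    (add_le_add (hS f hf) (hT f hf))

theorem LpBound.smul {T : Lp ℂ 2 μ →L[ℂ] Lp ℂ 2 μ} {a : ℝ≥0∞} (hT : LpBound μ T p a) (c : ℂ) :
    LpBound μ (c • T) p (‖c‖ₑ * a) := fun f hf => by
  rw [_root_.smul_apply, eLpNorm_congr_ae (Lp.coeFn_smul _ _), eLpNorm_const_smul, mul_assoc]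
  gcongr
  exact hT f hf

theorem LpBound.mono {T : Lp ℂ 2 μ →L[ℂ] Lp ℂ 2 μ} {a b : ℝ≥0∞} (hT : LpBound μ T p a)
    (h : a ≤ b) : LpBound μ T p b := fun f hf => (hT f hf).trans (by gcongr)

/-- The power series is estimated term by term. It converges in the operator norm of `L²`, so it may
be paired with a fixed `h`; this is why the conclusion is in weak form. -/
theorem LpBound.weak_exp [ENNReal.HolderConjugate p q] {S : Lp ℂ 2 μ →L[ℂ] Lp ℂ 2 μ} {a : ℝ}
    (ha : 0 ≤ a) (hS : LpBound μ S p (ENNReal.ofReal a)) :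
    WeakLpBound μ (NormedSpace.exp S) p q (ENNReal.ofReal (Real.exp a)) := by
  intro f h hf hh
  let +nondep : NormedAlgebra ℚ (Lp ℂ 2 μ →L[ℂ] Lp ℂ 2 μ) := .restrictScalars ℚ ℂ _
  have h1 : HasSum (fun k : ℕ => ((k.factorial : ℂ)⁻¹) • S ^ k) (NormedSpace.exp S) :=
    NormedSpace.exp_series_hasSum_exp' (𝕂 := ℂ) S
  have h2 : HasSum (fun k : ℕ => ⟪h, (((k.factorial : ℂ)⁻¹) • S ^ k) f⟫_ℂ)
      ⟪h, NormedSpace.exp S f⟫_ℂ :=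
    h1.mapL ((innerSL ℂ h).comp (ContinuousLinearMap.apply ℂ _ f))
  rw [← h2.tsum_eq]
  refine enorm_tsum_le_tsum_enorm.trans ?_
  have h3 : ∀ k : ℕ, ‖⟪h, (((k.factorial : ℂ)⁻¹) • S ^ k) f⟫_ℂ‖ₑ ≤
      ENNReal.ofReal (a ^ k / k.factorial) * (eLpNorm h q μ * eLpNorm f p μ) := by
    intro k
    refine (((hS.pow ENNReal.ofReal_ne_top k).smul ((k.factorial : ℂ)⁻¹)).weak (q := q) f h hf
      hh).trans (le_of_eq ?_)
    rw [mul_assoc]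
    congr 1
    rw [← ofReal_norm, norm_inv, Complex.norm_natCast, ← ENNReal.ofReal_pow ha,
      ← ENNReal.ofReal_mul (by positivity), div_eq_inv_mul]
  have h4 : HasSum (fun k : ℕ => a ^ k / k.factorial) (Real.exp a) := by
    have := NormedSpace.expSeries_div_hasSum_exp a
    rwa [← Real.exp_eq_exp_ℝ] at this
  calc _ ≤ ∑' k : ℕ, ENNReal.ofReal (a ^ k / k.factorial) * (eLpNorm h q μ * eLpNorm f p μ) :=
        ENNReal.tsum_le_tsum h3
    _ = _ := by
        rw [ENNReal.tsum_mul_right, ← ENNReal.ofReal_tsum_of_nonneg (fun k => by positivity)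
          h4.summable, h4.tsum_eq, mul_assoc]

/-- Completing the square, the Gaussian centred at `y` is `e^(-y²/2c²)` times the exponential of
`xy/c² - x²/2c²`, up to normalization. On `L^p` the exponential costs at most `exp(|y| b/c² +
b²/2c²)`. Since `|y| ≥ 4b`, the total exponent is still at most `-y²/8c²`. -/
theorem enorm_polarForm_gaussKernel_le [ENNReal.HolderConjugate p q] (hp1 : 1 ≤ p)
    {B : Lp ℂ 2 μ →L[ℂ] Lp ℂ 2 μ} (hB : IsSelfAdjoint B) {b : ℝ} (hb : 0 ≤ b)
    (hBp : LpBound μ B p (ENNReal.ofReal b)) {c y : ℝ} (hc : 0 < c) (hy : 4 * b ≤ |y|)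
    {f h : Lp ℂ 2 μ} (hf : MemLp f p μ) (hh : MemLp h q μ) :
    ‖polarForm B (fun x => (gaussKernel c (x - y) : ℂ)) h (B f)‖ₑ ≤
      ENNReal.ofReal (b * (c⁻¹ * Real.exp (-(y ^ 2 / (8 * c ^ 2))))) * eLpNorm h q μ *
        eLpNorm f p μ := by
  set a₁ : ℂ := ((y / c ^ 2 : ℝ) : ℂ) with ha₁
  set a₂ : ℂ := ((-(1 / (2 * c ^ 2)) : ℝ) : ℂ) with ha₂
  set S : Lp ℂ 2 μ →L[ℂ] Lp ℂ 2 μ := a₁ • B + a₂ • B ^ 2 with hS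
  set d : ℝ := (√(2 * Real.pi) * c)⁻¹ * Real.exp (-(y ^ 2 / (2 * c ^ 2))) with hd
  have hd0 : 0 ≤ d := by positivity
  have hc1 : Continuous fun z : ℂ => a₁ * z + a₂ * z ^ 2 := by fun_prop
  have h1 := continuousFC_cexp hc1 hB
  rw [cfc_quadratic hB] at h1
  have e : (fun x : ℝ => (gaussKernel c (x - y) : ℂ)) =
      fun x : ℝ => (d : ℂ) * Complex.exp (a₁ * x + a₂ * (x : ℂ) ^ 2) := by
    ext x
    have : gaussKernel c (x - y) = d * Real.exp (y / c ^ 2 * x + -(1 / (2 * c ^ 2)) * x ^ 2) := by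
      rw [gaussKernel, hd, mul_assoc, ← Real.exp_add]
      congr 2
      field_simp
      ring
    rw [this, ha₁, ha₂]
    push_cast
    rfl
  have hSb : LpBound μ S p (ENNReal.ofReal (|y| / c ^ 2 * b + 1 / (2 * c ^ 2) * b ^ 2)) := by
    refine ((hBp.smul a₁).add hp1 ((hBp.pow ENNReal.ofReal_ne_top 2).smul a₂)).mono (le_of_eq ?_)
    rw [ENNReal.ofReal_add (by positivity) (by positivity), ENNReal.ofReal_mul (by positivity),
      ENNReal.ofReal_mul (by positivity), ENNReal.ofReal_pow hb, ← ofReal_norm, ← ofReal_norm,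
      Complex.norm_real, Complex.norm_real, norm_neg, Real.norm_eq_abs, Real.norm_eq_abs, abs_div,
      abs_of_nonneg (show 0 ≤ c ^ 2 by positivity),
      abs_of_nonneg (show 0 ≤ 1 / (2 * c ^ 2) by positivity)]
  have h2 := hSb.weak_exp (q := q) (by positivity) (B f) h (hBp.memLp ENNReal.ofReal_ne_top hf) hh
  rw [e, polarForm_const_mul, polarForm_eq_inner_continuousFC (by fun_prop), h1, enorm_mul]
  have hde : ‖(d : ℂ)‖ₑ = ENNReal.ofReal d := by
    rw [← ofReal_norm, Complex.norm_real, Real.norm_of_nonneg hd0]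
  rw [hde]
  have h5 : d * Real.exp (|y| / c ^ 2 * b + 1 / (2 * c ^ 2) * b ^ 2) ≤
      c⁻¹ * Real.exp (-(y ^ 2 / (8 * c ^ 2))) := by
    rw [hd, mul_assoc, ← Real.exp_add]
    have h3 : (√(2 * Real.pi) * c)⁻¹ ≤ c⁻¹ := by
      apply inv_anti₀ hc
      have : 1 ≤ √(2 * Real.pi) := by
        rw [Real.one_le_sqrt]
        linarith [Real.pi_gt_three]
      nlinarith
    gcongr
    have e1 : -(y ^ 2 / (2 * c ^ 2)) + (|y| / c ^ 2 * b + 1 / (2 * c ^ 2) * b ^ 2) =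
        (-y ^ 2 + 2 * |y| * b + b ^ 2) / (2 * c ^ 2) := by
      field_simp
      ring
    have e2 : -(y ^ 2 / (8 * c ^ 2)) = (-(y ^ 2) / 4) / (2 * c ^ 2) := by
      field_simp
      ring
    rw [e1, e2]
    gcongr
    have hy2 : y ^ 2 = |y| ^ 2 := (sq_abs y).symm
    rw [hy2]
    nlinarith [abs_nonneg y]
  calc _ ≤ ENNReal.ofReal d * (ENNReal.ofReal (Real.exp (|y| / c ^ 2 * b +
        1 / (2 * c ^ 2) * b ^ 2)) * eLpNorm h q μ * (ENNReal.ofReal b * eLpNorm f p μ)) := by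
        gcongr
        refine h2.trans ?_
        gcongr
        exact hBp f hf
    _ = ENNReal.ofReal (b * (d * Real.exp (|y| / c ^ 2 * b + 1 / (2 * c ^ 2) * b ^ 2))) *
        eLpNorm h q μ * eLpNorm f p μ := by
        rw [ENNReal.ofReal_mul hb, ENNReal.ofReal_mul hd0]
        ring
    _ ≤ _ := by gcongr

/-- Half of the exponential absorbs the singularity `1/c`, the other half yields an integrable
weight in `y` independent of `c`. The polynomial growth in `c` is harmless, as it is later
integrated against `e^(-u)` with `c² = 2u`. -/
theorem inv_mul_exp_neg_le {c y r : ℝ} (hc : 0 < c) (hr : 0 < r) (hy : r ≤ |y|) :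
    c⁻¹ * Real.exp (-(y ^ 2 / (8 * c ^ 2))) ≤ 256 / r ^ 2 * (1 + c ^ 2) ^ 2 * (1 + y ^ 2)⁻¹ := by
  have hy2 : r ^ 2 ≤ y ^ 2 := by
    rw [← sq_abs y]
    gcongr
  have hr2 : 0 < r ^ 2 := by positivity
  have hyp : 0 < y ^ 2 := hr2.trans_le hy2
  set t := y ^ 2 / (16 * c ^ 2) with ht
  have ht0 : 0 < t := by positivity
  have h1 : Real.exp (-t) ≤ 16 * c ^ 2 / r ^ 2 := by
    have := exp_neg_le_factorial_div ht0 1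
    simp only [Nat.factorial_one, Nat.cast_one, one_mul, pow_one] at this
    refine this.trans ?_
    rw [ht, inv_div]
    gcongr
  have h2 : Real.exp (-t) ≤ 16 * (1 + c ^ 2) * (1 + y ^ 2)⁻¹ := by
    have h3 : Real.exp (-t) ≤ (1 + t)⁻¹ := by
      rw [Real.exp_neg]
      apply inv_anti₀ (by positivity)
      linarith [Real.add_one_le_exp t]
    refine h3.trans ?_
    rw [← div_eq_mul_inv, le_div_iff₀ (by positivity), inv_mul_le_iff₀ (by positivity), ht]
    have : (1 + y ^ 2 / (16 * c ^ 2)) * (16 * (1 + c ^ 2)) =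
        16 + 16 * c ^ 2 + y ^ 2 / c ^ 2 + y ^ 2 := by
      field_simp
      ring
    rw [this]
    have : 0 ≤ y ^ 2 / c ^ 2 := by positivity
    nlinarith [sq_nonneg c]
  have e : Real.exp (-(y ^ 2 / (8 * c ^ 2))) = Real.exp (-t) * Real.exp (-t) := by
    rw [← Real.exp_add, ht]
    congr 1
    field_simp
    ring
  rw [e]
  calc _ ≤ c⁻¹ * (16 * c ^ 2 / r ^ 2 * (16 * (1 + c ^ 2) * (1 + y ^ 2)⁻¹)) := by gcongr
    _ = 256 / r ^ 2 * (c * (1 + c ^ 2)) * (1 + y ^ 2)⁻¹ := by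
        field_simp
        ring
    _ ≤ _ := by
        gcongr
        nlinarith [sq_nonneg (c - 1)]

theorem integrable_cauchy : Integrable fun y : ℝ => (1 + y ^ 2)⁻¹ := integrable_inv_one_add_sq

/-- The contribution of the values of `g` far from the spectrum of `B`. -/
theorem enorm_polarForm_gaussAvg_le [ENNReal.HolderConjugate p q] (hp1 : 1 ≤ p)
    {B : Lp ℂ 2 μ →L[ℂ] Lp ℂ 2 μ} (hB : IsSelfAdjoint B) {b : ℝ} (hb : 0 < b)
    (hBp : LpBound μ B p (ENNReal.ofReal b)) {c : ℝ} (hc : 0 < c) {g : ℝ → ℂ} (hg : Measurable g)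
    (hgb : ∃ M, ∀ x, ‖g x‖ ≤ M) (hg0 : ∀ y, |y| < 4 * b → g y = 0)
    {f h : Lp ℂ 2 μ} (hf : MemLp f p μ) (hh : MemLp h q μ) :
    ‖polarForm B (gaussAvg c g) h (B f)‖ₑ ≤
      ENNReal.ofReal (16 / b * (1 + c ^ 2) ^ 2) *
        (∫⁻ y, ‖g y‖ₑ * ENNReal.ofReal ((1 + y ^ 2)⁻¹)) * eLpNorm h q μ * eLpNorm f p μ := by
  obtain ⟨M, hM⟩ := hgb
  have hM0 : 0 ≤ M := (norm_nonneg _).trans (hM 0)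
  have hkc := continuous_gaussKernel c
  have hm : Measurable (Function.uncurry fun y x : ℝ => g y * (gaussKernel c (x - y) : ℂ)) := by
    have := hkc.measurable
    change Measurable fun z : ℝ × ℝ => g z.1 * (gaussKernel c (z.2 - z.1) : ℂ)
    fun_prop
  -- A majorant uniform in the spectral variable `|x| ≤ ‖B‖`, from `(x - y)² ≥ y²/2 - x²`. It
  -- justifies exchanging the functional calculus with the integral over `y`.
  have hdom : Integrable fun y : ℝ => M * ((√(2 * Real.pi) * c)⁻¹ *
      Real.exp (‖B‖ ^ 2 / (2 * c ^ 2)) * Real.exp (-(1 / (4 * c ^ 2)) * y ^ 2)) :=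
    ((integrable_exp_neg_mul_sq (by positivity)).const_mul _).const_mul _
  obtain ⟨-, h2⟩ := polarForm_integral hm B hdom (fun y x hx => by
    rw [norm_mul, Complex.norm_real, Real.norm_of_nonneg (gaussKernel_nonneg hc.le _)]
    refine mul_le_mul (hM y) ?_ (gaussKernel_nonneg hc.le _) hM0
    rw [gaussKernel, mul_assoc, ← Real.exp_add]
    gcongr
    have hx2 : x ^ 2 ≤ ‖B‖ ^ 2 := sq_le_sq' hx.1 hx.2
    have e1 : ‖B‖ ^ 2 / (2 * c ^ 2) + -(1 / (4 * c ^ 2)) * y ^ 2 =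
        (‖B‖ ^ 2 - y ^ 2 / 2) / (2 * c ^ 2) := by
      field_simp
      ring
    rw [e1]
    gcongr
    nlinarith [sq_nonneg (2 * x - y)]) h (B f)
  rw [funext (gaussAvg_eq_integral hc g), h2]
  calc _ ≤ ∫⁻ y, ‖polarForm B (fun x => g y * (gaussKernel c (x - y) : ℂ)) h (B f)‖ₑ :=
        enorm_integral_le_lintegral_enorm _
    _ ≤ ∫⁻ y, ENNReal.ofReal (16 / b * (1 + c ^ 2) ^ 2) * eLpNorm h q μ * eLpNorm f p μ *
        (‖g y‖ₑ * ENNReal.ofReal ((1 + y ^ 2)⁻¹)) := by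
        refine lintegral_mono fun y => ?_
        rw [polarForm_const_mul, enorm_mul]
        by_cases hy : |y| < 4 * b
        · simp [hg0 y hy]
        · rw [not_lt] at hy
          have h3 := enorm_polarForm_gaussKernel_le hp1 hB hb.le hBp hc hy hf hh
          have h4 : b * (c⁻¹ * Real.exp (-(y ^ 2 / (8 * c ^ 2)))) ≤
              16 / b * (1 + c ^ 2) ^ 2 * (1 + y ^ 2)⁻¹ := by
            refine (mul_le_mul_of_nonneg_left (inv_mul_exp_neg_le hc (by positivity) hy)
              hb.le).trans (le_of_eq ?_)
            field_simp
            ring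
          calc _ ≤ ‖g y‖ₑ * (ENNReal.ofReal (16 / b * (1 + c ^ 2) ^ 2 * (1 + y ^ 2)⁻¹) *
                eLpNorm h q μ * eLpNorm f p μ) := by
                gcongr
                exact h3.trans (by gcongr)
            _ = _ := by
                rw [ENNReal.ofReal_mul (by positivity)]
                ring
    _ = ENNReal.ofReal (16 / b * (1 + c ^ 2) ^ 2) * eLpNorm h q μ * eLpNorm f p μ *
        ∫⁻ y, (‖g y‖ₑ * ENNReal.ofReal ((1 + y ^ 2)⁻¹)) := by
        refine lintegral_const_mul _ (hg.enorm.mul ?_)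
        fun_prop
    _ = _ := by ring

/-- The Cauchy weight defines a finite measure below Lebesgue measure, so `L^r(dx)` embeds in its
`L¹`. -/
theorem exists_lintegral_cauchy_le {r : ℝ≥0∞} (hr : 1 ≤ r) : ∃ D : ℝ≥0∞, D ≠ ∞ ∧
    ∀ g : ℝ → ℂ, Measurable g →
      ∫⁻ y, ‖g y‖ₑ * ENNReal.ofReal ((1 + y ^ 2)⁻¹) ≤ D * eLpNorm g r volume := by
  set ν : Measure ℝ := volume.withDensity fun y => ENNReal.ofReal ((1 + y ^ 2)⁻¹) with hν
  have hm : Measurable fun y : ℝ => ENNReal.ofReal ((1 + y ^ 2)⁻¹) := by fun_prop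
  have hνu : ν Set.univ ≠ ∞ := by
    rw [hν, withDensity_apply _ MeasurableSet.univ, Measure.restrict_univ]
    exact integrable_cauchy.lintegral_lt_top.ne
  have hle : ν ≤ volume := by
    conv_rhs => rw [← withDensity_one (μ := (volume : Measure ℝ))]
    refine withDensity_mono (Eventually.of_forall fun y => ?_)
    simp only [Pi.one_apply]
    rw [ENNReal.ofReal_le_one]
    apply inv_le_one_of_one_le₀
    nlinarith [sq_nonneg y]
  have h0 : 0 ≤ 1 / (1 : ℝ≥0∞).toReal - 1 / r.toReal := by
    rw [sub_nonneg, ENNReal.toReal_one, div_one]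
    by_cases hrt : r = ∞
    · simp [hrt]
    · have : 1 ≤ r.toReal := by
        rw [← ENNReal.toReal_one]
        exact ENNReal.toReal_mono hrt hr
      exact (div_le_one (by linarith)).2 this
  refine ⟨ν Set.univ ^ (1 / (1 : ℝ≥0∞).toReal - 1 / r.toReal),
    ENNReal.rpow_ne_top_of_nonneg h0 hνu, fun g hg => ?_⟩
  have h1 := eLpNorm_le_eLpNorm_mul_rpow_measure_univ hr hg.aestronglyMeasurable (μ := ν)
  rw [eLpNorm_one_eq_lintegral_enorm, hν, lintegral_withDensity_eq_lintegral_mul _ hm hg.enorm] at h1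
  calc _ = ∫⁻ y, ((fun y => ENNReal.ofReal ((1 + y ^ 2)⁻¹)) * fun y => ‖g y‖ₑ) y := by
        refine lintegral_congr fun y => ?_
        rw [Pi.mul_apply, mul_comm]
    _ ≤ _ := h1
    _ ≤ _ := by
        rw [mul_comm]
        gcongr

end ExponentialBounds

/-! ### Balancing the scales and integrating over the Gamma law -/

section SmoothBound

variable {X : Type*} [MetricSpace X] [TopologicalSpace.SeparableSpace X] [MeasurableSpace X]
  [BorelSpace X] {μ : Measure X} {n C l : ℝ} {p q r : ℝ≥0∞}

/-- A bound for the operator norms on `L^p` of integral operators, and for their spectra. -/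
def kernelOpBound (n C l : ℝ) (c₀ : ℝ≥0∞) : ℝ := (c₀ * decayConst n C l).toReal + 1

theorem kernelOpBound_pos (n C l : ℝ) (c₀ : ℝ≥0∞) : 0 < kernelOpBound n C l c₀ := by
  unfold kernelOpBound
  positivity

theorem IsIntegralOp.lpBound_ofReal {B : Lp ℂ 2 μ →L[ℂ] Lp ℂ 2 μ} {K : X → X → ℂ} {c₀ : ℝ≥0∞}
    (hB : IsIntegralOp μ B K c₀ l) (hX : IsDoubling μ n C) (hc₀ : c₀ ≠ ∞) (hn : 0 ≤ n) (hl : n < l)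
    (hp1 : 1 ≤ p) (hp : p ≠ ∞) : LpBound μ B p (ENNReal.ofReal (kernelOpBound n C l c₀)) := by
  refine (hB.lpBound hX (hn.trans hl.le) hp1 hp).mono ?_
  rw [kernelOpBound]
  refine (ENNReal.ofReal_toReal (ENNReal.mul_ne_top hc₀ (decayConst_ne_top hl))).symm.le.trans ?_
  gcongr
  linarith

/-- The part of `g` on an interval which contains all relevant spectra. -/
def innerPart (b : ℝ) (g : ℝ → ℂ) : ℝ → ℂ := (Set.Ioo (-(4 * b)) (4 * b)).indicator g

theorem measurable_innerPart (b : ℝ) {g : ℝ → ℂ} (hg : Measurable g) :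
    Measurable (innerPart b g) := hg.indicator measurableSet_Ioo

theorem norm_innerPart_le (b : ℝ) {g : ℝ → ℂ} {M : ℝ} (hM : ∀ x, ‖g x‖ ≤ M) (x : ℝ) :
    ‖innerPart b g x‖ ≤ M := (norm_indicator_le_norm_self _ _).trans (hM x)

theorem eLpNorm_innerPart_le (b : ℝ) (g : ℝ → ℂ) (r : ℝ≥0∞) :
    eLpNorm (innerPart b g) r volume ≤ eLpNorm g r volume := eLpNorm_indicator_le _

theorem integrable_innerPart (b : ℝ) {g : ℝ → ℂ} (hg : Measurable g) {M : ℝ}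
    (hM : ∀ x, ‖g x‖ ≤ M) : Integrable (innerPart b g) := by
  rw [innerPart, integrable_indicator_iff measurableSet_Ioo]
  exact Measure.integrableOn_of_bounded (M := M) (by simp) hg.aestronglyMeasurable
    (Eventually.of_forall hM)

theorem exists_eLpNorm_innerPart_two_le (b : ℝ) (hr : 2 ≤ r) : ∃ D : ℝ≥0∞, D ≠ ∞ ∧
    ∀ g : ℝ → ℂ, Measurable g →
      eLpNorm (innerPart b g) 2 volume ≤ D * eLpNorm g r volume := by
  have h0 : 0 ≤ 1 / (2 : ℝ≥0∞).toReal - 1 / r.toReal := by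
    rw [sub_nonneg, ENNReal.toReal_ofNat]
    by_cases hrt : r = ∞
    · simp [hrt]
    · have : 2 ≤ r.toReal := by
        simpa using ENNReal.toReal_mono hrt hr
      exact one_div_le_one_div_of_le two_pos this
  refine ⟨volume (Set.Ioo (-(4 * b)) (4 * b)) ^ (1 / (2 : ℝ≥0∞).toReal - 1 / r.toReal),
    ENNReal.rpow_ne_top_of_nonneg h0 (by simp), fun g hg => ?_⟩
  rw [innerPart, eLpNorm_indicator_eq_eLpNorm_restrict measurableSet_Ioo]
  have h1 := eLpNorm_le_eLpNorm_mul_rpow_measure_univ hr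
    (hg.aestronglyMeasurable (μ := volume.restrict (Set.Ioo (-(4 * b)) (4 * b))))
  rw [Measure.restrict_apply_univ] at h1
  refine h1.trans ?_
  rw [mul_comm]
  gcongr
  exact Measure.restrict_le_self

theorem gaussAvg_add (c : ℝ) {g₁ g₂ : ℝ → ℂ} (h₁ : Measurable g₁) (h₂ : Measurable g₂) {M : ℝ}
    (hM₁ : ∀ x, ‖g₁ x‖ ≤ M) (hM₂ : ∀ x, ‖g₂ x‖ ≤ M) (x : ℝ) :
    gaussAvg c (fun y => g₁ y + g₂ y) x = gaussAvg c g₁ x + gaussAvg c g₂ x := by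
  rw [gaussAvg, gaussAvg, gaussAvg, integral_add]
  · exact Integrable.of_bound (C := M) (Measurable.aestronglyMeasurable (by fun_prop))
      (Eventually.of_forall fun z => hM₁ _)
  · exact Integrable.of_bound (C := M) (Measurable.aestronglyMeasurable (by fun_prop))
      (Eventually.of_forall fun z => hM₂ _)

theorem measurable_gaussAvg_uncurry {g : ℝ → ℂ} (hg : Measurable g) :
    Measurable (Function.uncurry fun u x : ℝ => gaussAvg (√(2 * u)) g x) := by
  have h : StronglyMeasurable fun z : ℝ × ℝ =>
      ∫ t, (fun (z : ℝ × ℝ) (t : ℝ) => g (z.2 + √(2 * z.1) * t)) z t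
        ∂(ProbabilityTheory.gaussianReal 0 1) :=
    StronglyMeasurable.integral_prod_right (Measurable.stronglyMeasurable (by
      change Measurable fun y : (ℝ × ℝ) × ℝ => g (y.1.2 + √(2 * y.1.1) * y.2)
      fun_prop))
  exact h.measurable

theorem max_one_inv_sqrt_rpow_le {u θ : ℝ} (hu : 0 < u) (hθ : 0 ≤ θ) :
    max 1 (√(2 * u))⁻¹ ^ θ ≤ 1 + u ^ (-(θ / 2)) := by
  have h1 : 0 < √(2 * u) := by positivity
  rcases le_total 1 (√(2 * u))⁻¹ with h | h
  · rw [max_eq_right h]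
    have h2 : (√(2 * u))⁻¹ ≤ (√u)⁻¹ := by
      gcongr
      linarith
    have h3 : (√u)⁻¹ ^ θ = u ^ (-(θ / 2)) := by
      rw [Real.sqrt_eq_rpow, ← Real.rpow_neg hu.le, ← Real.rpow_mul hu.le]
      congr 1
      ring
    have h4 : (√(2 * u))⁻¹ ^ θ ≤ (√u)⁻¹ ^ θ := by gcongr
    rw [h3] at h4
    linarith
  · rw [max_eq_left h, Real.one_rpow]
    have : 0 ≤ u ^ (-(θ / 2)) := by positivity
    linarith

/-- The near bound for the Gaussian averages of `g` that the estimate of `F(B) B` needs. -/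
def HasNearBound (μ : Measure X) (B : Lp ℂ 2 μ →L[ℂ] Lp ℂ 2 μ) (p : ℝ≥0∞) (b α : ℝ) (a : ℝ≥0∞)
    (g : ℝ → ℂ) : Prop :=
  ∀ c : ℝ, 0 < c → ∀ f : Lp ℂ 2 μ, weightedNorm μ p f ≠ ∞ →
    eLpNorm (borelFC (gaussAvg c (innerPart b g)) B (B f)) 2 μ ≤
      a * ENNReal.ofReal (max 1 c⁻¹ ^ α) * weightedNorm μ p f

/-- The central estimate at a single scale `c`. The part of `g` near the spectrum is square
integrable, because `r ≥ 2` and the interval is bounded, so the core bound applies with the optimal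
radius. The part far away is controlled by exponentials of `B`. -/
theorem exists_gaussAvg_bound {X : Type*} [MeasurableSpace X] (μ : Measure X)
    (hn : 0 ≤ n) (hC : 1 ≤ C) {c₀ : ℝ≥0∞}
    (hc₀ : c₀ ≠ ∞) {m : ℕ} (hm : n / 2 < m) (hl : n + m < l) [ENNReal.HolderConjugate p q]
    (hp1 : 1 ≤ p) (hp2 : p ≤ 2) (hr : 2 ≤ r) {α : ℝ} (hα1 : α ≤ 1 / 2) {a₀ : ℝ≥0∞}
    (ha₀ : a₀ ≠ ∞) :
    ∃ D : ℝ≥0∞, D ≠ ∞ ∧ ∀ [MetricSpace X] [TopologicalSpace.SeparableSpace X] [BorelSpace X],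
      IsDoubling μ n C → ∀ (B : Lp ℂ 2 μ →L[ℂ] Lp ℂ 2 μ) (K : X → X → ℂ), IsSelfAdjoint B →
      IsIntegralOp μ B K c₀ l → ∀ g : ℝ → ℂ, Measurable g → (∃ M, ∀ x, ‖g x‖ ≤ M) →
      ∀ A : ℝ≥0∞, eLpNorm g r volume ≤ A →
      HasNearBound μ B p (kernelOpBound n C l c₀) α (a₀ * A) g →
      ∀ f h : Lp ℂ 2 μ, MemLp f p μ → MemLp h q μ → ∀ c : ℝ, 0 < c →
      ‖polarForm B (gaussAvg c g) h (B f)‖ₑ ≤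
        D * (ENNReal.ofReal (max 1 c⁻¹ ^ ((1 + (1 / 2 - α) / m) * (n * sigmaExp p) + α)) +
          ENNReal.ofReal ((1 + c ^ 2) ^ 2)) * (A * eLpNorm h q μ * eLpNorm f p μ) := by
  have hm0 : 0 < (m : ℝ) := lt_of_le_of_lt (by positivity) hm
  have hpt : p ≠ ∞ := (hp2.trans_lt (by norm_num)).ne
  have hnl : n < l := by linarith
  set b := kernelOpBound n C l c₀ with hb
  have hb0 : 0 < b := kernelOpBound_pos n C l c₀
  -- With `ρ = v^κ` this exponent makes `v^(m + 1/2) ρ^(-m)` equal to `v^α`, so that the moment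
  -- bound matches the near bound.
  set κ : ℝ := 1 + (1 / 2 - α) / m with hκ
  have hκ0 : 0 ≤ κ := by
    have : 0 ≤ (1 / 2 - α) / m := div_nonneg (by linarith) hm0.le
    linarith
  obtain ⟨M₁, hM₁, hcore⟩ := exists_core_bound (p := p) (q := q) μ hn hC hm hp1 hp2
  obtain ⟨D₂, hD₂, hmom⟩ := exists_moment_gaussAvg_le (p := p) (C := C) μ hn hc₀ m hl hp1 hp2
  obtain ⟨D₃, hD₃, hin⟩ := exists_eLpNorm_innerPart_two_le b hr
  obtain ⟨D₄, hD₄, hout⟩ := exists_lintegral_cauchy_le (r := r) (le_trans (by norm_num) hr)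
  refine ⟨M₁ * (a₀ + D₂ * D₃) + ENNReal.ofReal (16 / b) * D₄, by finiteness, ?_⟩
  intro _ _ _ hX B K hB hK g hg hgb A hA hnear f h hf hh c hc
  obtain ⟨M, hM⟩ := hgb
  have hM0 : 0 ≤ M := (norm_nonneg _).trans (hM 0)
  set v := max 1 c⁻¹ with hv
  have hv1 : 1 ≤ v := le_max_left _ _
  have hv0 : 0 < v := by linarith
  set g₁ := innerPart b g with hg₁
  set g₂ : ℝ → ℂ := (Set.Ioo (-(4 * b)) (4 * b))ᶜ.indicator g with hg₂
  have hg₁m : Measurable g₁ := measurable_innerPart b hg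
  have hg₂m : Measurable g₂ := hg.indicator measurableSet_Ioo.compl
  have hM₁' : ∀ x, ‖g₁ x‖ ≤ M := norm_innerPart_le b hM
  have hM₂' : ∀ x, ‖g₂ x‖ ≤ M := fun x => (norm_indicator_le_norm_self _ _).trans (hM x)
  have hsum : ∀ x, gaussAvg c g x = gaussAvg c g₁ x + gaussAvg c g₂ x := fun x => by
    rw [← gaussAvg_add c hg₁m hg₂m hM₁' hM₂']
    congr 1
    ext y
    exact (congrFun (Set.indicator_self_add_compl (Set.Ioo (-(4 * b)) (4 * b)) g) y).symm
  rw [funext hsum, polarForm_add (stronglyMeasurable_gaussAvg c hg₁m).measurable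
    (stronglyMeasurable_gaussAvg c hg₂m).measurable B (fun x _ => norm_gaussAvg_le c hM₁' x)
    (fun x _ => norm_gaussAvg_le c hM₂' x)]
  have hoff : HasOffDiagonalBound μ (borelFC (gaussAvg c g₁) B ∘L B) p m
      (a₀ * A * ENNReal.ofReal (v ^ α))
      (D₂ * ENNReal.ofReal (v ^ (m + 1 / 2 : ℝ)) * (D₃ * A)) :=
    ⟨fun f hf => hnear c hc f hf, fun w hw R hR _ hL f hf0 hf => by
      refine (hmom hX B K hB hK c hc g₁ hg₁m ⟨M, hM₁'⟩ (integrable_innerPart b hg hM) w hw R hR hL f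
        hf0 hf).trans ?_
      gcongr
      exact (hin g hg).trans (by gcongr)⟩
  have hρ : 1 ≤ v ^ κ := Real.one_le_rpow hv1 hκ0
  have h1 := hcore hX _ _ _ (v ^ κ) hρ hoff f h hf hh
  have e1 : (v ^ κ) ^ (n * sigmaExp p) = v ^ (κ * (n * sigmaExp p)) := (Real.rpow_mul hv0.le _ _).symm
  have e2 : v ^ (m + 1 / 2 : ℝ) * ((v ^ κ) ^ m)⁻¹ = v ^ α := by
    rw [← Real.rpow_natCast, ← Real.rpow_mul hv0.le, ← Real.rpow_neg hv0.le, ← Real.rpow_add hv0]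
    congr 1
    rw [hκ]
    field_simp
    ring
  have h2 : ‖polarForm B (gaussAvg c g₁) h (B f)‖ₑ ≤ M₁ * (a₀ + D₂ * D₃) *
      ENNReal.ofReal (v ^ (κ * (n * sigmaExp p) + α)) * (A * eLpNorm h q μ * eLpNorm f p μ) := by
    rw [← inner_borelFC_eq_polarForm (stronglyMeasurable_gaussAvg c hg₁m).measurable
      ⟨M, norm_gaussAvg_le c hM₁'⟩]
    refine h1.trans (le_of_eq ?_)
    have e3 : D₂ * ENNReal.ofReal (v ^ (m + 1 / 2 : ℝ)) * (D₃ * A) *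
        ENNReal.ofReal (((v ^ κ) ^ m)⁻¹) = D₂ * D₃ * A * ENNReal.ofReal (v ^ α) := by
      rw [← e2, ENNReal.ofReal_mul (by positivity)]
      ring
    rw [e3, e1, Real.rpow_add hv0, ENNReal.ofReal_mul (by positivity)]
    ring
  have h3 : ‖polarForm B (gaussAvg c g₂) h (B f)‖ₑ ≤ ENNReal.ofReal (16 / b) * D₄ *
      ENNReal.ofReal ((1 + c ^ 2) ^ 2) * (A * eLpNorm h q μ * eLpNorm f p μ) := by
    refine (enorm_polarForm_gaussAvg_le hp1 hB hb0 (hK.lpBound_ofReal hX hc₀ hn hnl hp1 hpt) hc hg₂m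
      ⟨M, hM₂'⟩ (fun y hy => ?_) hf hh).trans ?_
    · have hy' : y ∉ (Set.Ioo (-(4 * b)) (4 * b))ᶜ := Set.notMem_compl_iff.2 (abs_lt.1 hy)
      rw [hg₂, Set.indicator_of_notMem hy']
    · have h4 : ∫⁻ y, ‖g₂ y‖ₑ * ENNReal.ofReal ((1 + y ^ 2)⁻¹) ≤ D₄ * A := by
        refine (hout g₂ hg₂m).trans ?_
        gcongr
        exact (eLpNorm_indicator_le _).trans hA
      calc _ ≤ ENNReal.ofReal (16 / b * (1 + c ^ 2) ^ 2) * (D₄ * A) * eLpNorm h q μ *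
            eLpNorm f p μ := by gcongr
        _ = _ := by
            rw [ENNReal.ofReal_mul (by positivity)]
            ring
  refine (enorm_add_le _ _).trans ((add_le_add h2 h3).trans ?_)
  rw [← add_mul]
  gcongr ?_ * _
  have h5 : ∀ x₁ x₂ y₁ y₂ : ℝ≥0∞, x₁ * y₁ + x₂ * y₂ ≤ (x₁ + x₂) * (y₁ + y₂) :=
    fun x₁ x₂ y₁ y₂ => by
      rw [mul_add]
      exact add_le_add (by gcongr; exact le_self_add) (by gcongr; exact le_add_self)
  exact h5 _ _ _ _

/-- The estimate of `F(B) B` for the Bessel potential `F` of a bounded function `g`. -/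
theorem exists_besselPotential_bound {X : Type*} [MeasurableSpace X] (μ : Measure X)
    (hn : 0 ≤ n) (hC : 1 ≤ C) {c₀ : ℝ≥0∞}
    (hc₀ : c₀ ≠ ∞) {m : ℕ} (hm : n / 2 < m) (hl : n + m < l) [ENNReal.HolderConjugate p q]
    (hp1 : 1 ≤ p) (hp2 : p ≤ 2) (hr : 2 ≤ r) {α s : ℝ} (hα0 : 0 ≤ α) (hα1 : α ≤ 1 / 2)
    (hs : (1 + (1 / 2 - α) / m) * (n * sigmaExp p) + α < s) {a₀ : ℝ≥0∞} (ha₀ : a₀ ≠ ∞) :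
    ∃ D : ℝ≥0∞, D ≠ ∞ ∧ ∀ [MetricSpace X] [TopologicalSpace.SeparableSpace X] [BorelSpace X],
      IsDoubling μ n C → ∀ (B : Lp ℂ 2 μ →L[ℂ] Lp ℂ 2 μ) (K : X → X → ℂ), IsSelfAdjoint B →
      IsIntegralOp μ B K c₀ l → ∀ g : ℝ → ℂ, Measurable g → (∃ M, ∀ x, ‖g x‖ ≤ M) →
      ∀ A : ℝ≥0∞, eLpNorm g r volume ≤ A →
      HasNearBound μ B p (kernelOpBound n C l c₀) α (a₀ * A) g →
      ∀ f h : Lp ℂ 2 μ, MemLp f p μ → MemLp h q μ →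
      ‖polarForm B (fun x => ∫ u, gaussAvg (√(2 * u)) g x ∂(gammaWeight (s / 2))) h (B f)‖ₑ ≤
        D * A * eLpNorm h q μ * eLpNorm f p μ := by
  have hm0 : 0 < (m : ℝ) := lt_of_le_of_lt (by positivity) hm
  have hσ := sigmaExp_nonneg p
  set θ := (1 + (1 / 2 - α) / m) * (n * sigmaExp p) + α with hθ
  have hθ0 : 0 ≤ θ := by
    have : 0 ≤ (1 / 2 - α) / m := div_nonneg (by linarith) hm0.le
    positivity
  have hs0 : 0 < s := hθ0.trans_lt hs
  have hs2 := half_pos hs0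
  have hprob := isProbabilityMeasure_gammaWeight hs2
  obtain ⟨D, hD, hb⟩ := exists_gaussAvg_bound (p := p) (q := q) μ hn hC hc₀ hm hl hp1 hp2 hr hα1 ha₀
  -- The first half dominates the singular factor at `c = √(2u)`, the second half dominates `(1 +
  -- 2u)²`. The Gamma density of shape `s/2` makes `u^(-θ/2)` integrable because `θ < s`.
  set J : ℝ → ℝ := fun u => 1 + u ^ (-(θ / 2)) + (2 + 8 * u ^ (2 : ℝ)) with hJ
  have hJi : Integrable J (gammaWeight (s / 2)) := by
    refine ((integrable_const _).add ?_).add ((integrable_const _).add (Integrable.const_mul ?_ _))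
    · exact integrable_gammaWeight_rpow hs2 (by linarith)
    · exact integrable_gammaWeight_rpow hs2 (by linarith)
  refine ⟨D * ∫⁻ u, ENNReal.ofReal (J u) ∂(gammaWeight (s / 2)),
    ENNReal.mul_ne_top hD hJi.lintegral_lt_top.ne, ?_⟩
  intro _ _ _ hX B K hB hK g hg hgb A hA hnear f h hf hh
  obtain ⟨M, hM⟩ := hgb
  obtain ⟨-, h2⟩ := polarForm_integral (ν := gammaWeight (s / 2)) (measurable_gaussAvg_uncurry hg) B
    (integrable_const M) (fun u x _ => norm_gaussAvg_le _ hM x) h (B f)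
  rw [h2]
  refine (enorm_integral_le_lintegral_enorm _).trans ?_
  calc _ ≤ ∫⁻ u, D * (A * eLpNorm h q μ * eLpNorm f p μ) * ENNReal.ofReal (J u)
        ∂(gammaWeight (s / 2)) := by
        refine lintegral_mono_ae ?_
        filter_upwards [gammaWeight_ae_pos (s / 2)] with u hu
        refine (hb hX B K hB hK g hg ⟨M, hM⟩ A hA hnear f h hf hh _
          (show 0 < √(2 * u) by positivity)).trans ?_
        rw [mul_right_comm]
        gcongr
        rw [← ENNReal.ofReal_add (by positivity) (by positivity)]
        refine ENNReal.ofReal_le_ofReal (add_le_add (max_one_inv_sqrt_rpow_le hu hθ0) ?_)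
        rw [Real.sq_sqrt (by positivity), Real.rpow_two]
        nlinarith [sq_nonneg (2 * u - 1)]
    _ = D * (A * eLpNorm h q μ * eLpNorm f p μ) * ∫⁻ u, ENNReal.ofReal (J u)
        ∂(gammaWeight (s / 2)) := by
        refine lintegral_const_mul _ ?_
        simp only [hJ]
        fun_prop
    _ = _ := by ring

end SmoothBound

/-! ### Unit scale: continuous functions, and the near bound from restriction -/

section NormalizedBounds

variable {X : Type*} [MetricSpace X] [TopologicalSpace.SeparableSpace X] [MeasurableSpace X]
  [BorelSpace X] {μ : Measure X} {n C l : ℝ} {p q r : ℝ≥0∞}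

/-- Mollifying `F` replaces `g` by a bounded function without increasing its norm, and by continuity
the mollifications converge to `F` at every point, as spectral measures require. The near bound
combines the hypothesis `hsup` on the spectrum with the weighted bound for `B`. -/
theorem exists_continuous_bound {X : Type*} [MeasurableSpace X] (μ : Measure X)
    (hn : 0 ≤ n) (hC : 1 ≤ C) {c₀ : ℝ≥0∞}
    (hc₀ : c₀ ≠ ∞) {m : ℕ} (hm : n / 2 < m) (hl : n + m < l) [ENNReal.HolderConjugate p q]
    (hp1 : 1 ≤ p) (hp2 : p ≤ 2) (hr : 2 ≤ r) {α s : ℝ} (hα0 : 0 ≤ α) (hα1 : α ≤ 1 / 2)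
    (hs : (1 + (1 / 2 - α) / m) * (n * sigmaExp p) + α < s)
    (hsup : ∀ c : ℝ, 0 < c → ∀ g : ℝ → ℂ, Measurable g → ∀ x,
      ‖gaussAvg c g x‖ₑ ≤ ENNReal.ofReal (max 1 c⁻¹ ^ α) * eLpNorm g r volume) :
    ∃ D : ℝ≥0∞, D ≠ ∞ ∧ ∀ [MetricSpace X] [TopologicalSpace.SeparableSpace X] [BorelSpace X],
      IsDoubling μ n C → ∀ (B : Lp ℂ 2 μ →L[ℂ] Lp ℂ 2 μ) (K : X → X → ℂ), IsSelfAdjoint B →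
      IsIntegralOp μ B K c₀ l → ∀ F : ℝ → ℂ, Continuous F → (∃ M, ∀ x, ‖F x‖ ≤ M) →
      ∀ g : ℝ → ℂ, Measurable g → eLpNorm g r volume ≠ ∞ → IsBesselDeriv s F g →
      WeakLpBound μ (borelFC F B ∘L B) p q (D * eLpNorm g r volume) := by
  have hm0 : 0 < (m : ℝ) := lt_of_le_of_lt (by positivity) hm
  have hl0 : 0 ≤ l := by linarith
  have hpt : p ≠ ∞ := (hp2.trans_lt (by norm_num)).ne
  have hr1 : 1 ≤ r := le_trans (by norm_num) hr
  have hσ := sigmaExp_nonneg p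
  have hs0 : 0 < s := by
    have h1 : 0 ≤ (1 / 2 - α) / m := div_nonneg (by linarith) hm0.le
    have h2 : 0 ≤ (1 + (1 / 2 - α) / m) * (n * sigmaExp p) + α := by positivity
    linarith
  have hw : weightedConst n C l p ≠ ∞ := weightedConst_ne_top (by linarith) hp1 hpt
  obtain ⟨D, hD, hb⟩ := exists_besselPotential_bound (p := p) (q := q) μ hn hC hc₀ hm hl hp1 hp2 hr
    hα0 hα1 hs (a₀ := 4 * (c₀ * weightedConst n C l p)) (by finiteness)
  refine ⟨D, hD, ?_⟩
  intro _ _ _ hX B K hB hK F hF hFb g hg hgr hFg f h hf hh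
  obtain ⟨M, hM⟩ := hFb
  rw [ContinuousLinearMap.comp_apply, inner_borelFC_eq_polarForm hF.measurable ⟨M, hM⟩]
  have hlim := tendsto_polarForm (fun k => measurable_mollify (shrinkingBump k) hF.measurable) B
    (fun k x _ => norm_mollify_le (shrinkingBump k) hM x)
    (fun x _ => tendsto_mollify_shrinkingBump hF x) h (B f)
  refine le_of_tendsto (hlim.enorm) (Eventually.of_forall fun k => ?_)
  set φ := shrinkingBump k
  have hgm := measurable_mollify φ hg
  have hgb := exists_norm_mollify_le φ hg hr1 hgr
  rw [funext (hFg.mollify_eq_integral_gaussAvg φ hs0 hr1 hg hgr)]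
  refine hb hX B K hB hK _ hgm hgb _ (eLpNorm_mollify_le φ hg hr1) ?_ f h hf hh
  intro c hc f hwf
  obtain ⟨Mg, hMg⟩ := hgb
  have him := measurable_innerPart (kernelOpBound n C l c₀) hgm
  refine (eLpNorm_borelFC_apply_le (M := ENNReal.ofReal (max 1 c⁻¹ ^ α) * eLpNorm g r volume)
    (stronglyMeasurable_gaussAvg c him).measurable
    ⟨Mg, norm_gaussAvg_le c (norm_innerPart_le _ hMg)⟩ B (fun x _ => ?_) _).trans ?_
  · refine (hsup c hc _ him x).trans ?_
    gcongr
    exact (eLpNorm_innerPart_le _ _ _).trans (eLpNorm_mollify_le φ hg hr1)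
  · calc _ ≤ 4 * (ENNReal.ofReal (max 1 c⁻¹ ^ α) * eLpNorm g r volume) *
          (c₀ * weightedConst n C l p * weightedNorm μ p f) := by
          gcongr
          exact hK.eLpNorm_two_le hX hl0 hp1 hp2 f
      _ = _ := by ring

theorem exists_eLpNorm_one_restrict_le {S : Set ℝ} (hS : volume S ≠ ∞) (hr : 1 ≤ r) :
    ∃ D : ℝ≥0∞, D ≠ ∞ ∧ ∀ g : ℝ → ℂ, Measurable g →
      ∫⁻ x in S, ‖g x‖ₑ ≤ D * eLpNorm g r volume := by
  have h0 : 0 ≤ 1 / (1 : ℝ≥0∞).toReal - 1 / r.toReal := by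
    rw [sub_nonneg, ENNReal.toReal_one, div_one]
    by_cases hrt : r = ∞
    · simp [hrt]
    · have : 1 ≤ r.toReal := by
        rw [← ENNReal.toReal_one]
        exact ENNReal.toReal_mono hrt hr
      exact (div_le_one (by linarith)).2 this
  refine ⟨volume S ^ (1 / (1 : ℝ≥0∞).toReal - 1 / r.toReal),
    ENNReal.rpow_ne_top_of_nonneg h0 hS, fun g hg => ?_⟩
  have h1 := eLpNorm_le_eLpNorm_mul_rpow_measure_univ hr
    (hg.aestronglyMeasurable (μ := volume.restrict S))
  rw [Measure.restrict_apply_univ, eLpNorm_one_eq_lintegral_enorm] at h1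
  refine h1.trans ?_
  rw [mul_comm]
  gcongr
  exact Measure.restrict_le_self

theorem gaussKernel_le_const {c γ t : ℝ} (hc : 0 < c) (hγ : 0 < γ) (ht : γ ≤ |t|) :
    gaussKernel c t ≤ 1 + 2 / γ ^ 2 := by
  have h0 : 0 ≤ 2 / γ ^ 2 := by positivity
  rcases le_total 1 c with h | h
  · have h1 := gaussKernel_le_of_le_abs hc hγ ht 0
    simp only [Nat.factorial_zero, Nat.cast_one, pow_zero, mul_one] at h1
    have h2 : c⁻¹ ≤ 1 := inv_le_one_of_one_le₀ h
    linarith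
  · have h1 := gaussKernel_le_of_le_abs hc hγ ht 1
    simp only [Nat.factorial_one, Nat.cast_one, pow_one, one_mul] at h1
    have h2 : c⁻¹ * (2 * c ^ 2 / γ ^ 2) = 2 / γ ^ 2 * c := by
      field_simp
    have h3 : 2 / γ ^ 2 * c ≤ 2 / γ ^ 2 := mul_le_of_le_one_right h0 h
    linarith

theorem RestrictionBound.eLpNorm_apply_le {B : Lp ℂ 2 μ →L[ℂ] Lp ℂ 2 μ} {R₁ R₂ : ℝ} {C_R : ℝ≥0}
    (hX : IsDoubling μ n C) (hR : RestrictionBound μ B p r 1 R₁ R₂ C_R) {F : ℝ → ℂ}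
    (hF : Measurable F) (hFb : ∃ M, ∀ x, ‖F x‖ ≤ M) (hFs : tsupport F ⊆ Set.Ioo R₁ R₂)
    (f : Lp ℂ 2 μ) (hf : weightedNorm μ p f ≠ ∞) :
    eLpNorm (borelFC F B (B f)) 2 μ ≤ C_R * eLpNorm F r volume * weightedNorm μ p f := by
  have := hX.sigmaFinite
  set h : X → ℂ := fun x => ((μ.real (Metric.ball x 1) ^ (-sigmaExp p) : ℝ) : ℂ) * f x with hh
  have hvm : Measurable fun x => μ.real (Metric.ball x 1) := (measurable_measure_ball 1).ennreal_toReal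
  have hm : MemLp h p μ :=
    ⟨(Complex.measurable_ofReal.comp (hvm.pow_const _)).aestronglyMeasurable.mul
      (Lp.aestronglyMeasurable f), hf.lt_top⟩
  have e : (fun x => ((μ.real (Metric.ball x 1) ^ sigmaExp p : ℝ) : ℂ) * h x) = f := by
    ext x
    rw [hh]
    simp only
    rw [← mul_assoc, ← Complex.ofReal_mul, ← Real.rpow_add (hX.vol_pos x), add_neg_cancel,
      Real.rpow_zero, Complex.ofReal_one, one_mul]
  have hV : MemLp (fun x => ((μ.real (Metric.ball x 1) ^ sigmaExp p : ℝ) : ℂ) * h x) 2 μ := by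
    rw [e]
    exact Lp.memLp f
  have h1 := hR F hF hFb hFs h hm hV
  have e2 : hV.toLp _ = f := by
    apply Lp.ext
    refine (MemLp.coeFn_toLp hV).trans ?_
    rw [e]
  rwa [e2] at h1

theorem borelFC_add_apply {H : Type*} [NormedAddCommGroup H] [InnerProductSpace ℂ H]
    [CompleteSpace H] (B : H →L[ℂ] H) {F G : ℝ → ℂ} (hF : Measurable F) (hG : Measurable G) {M : ℝ}
    (hFb : ∀ x, ‖F x‖ ≤ M) (hGb : ∀ x, ‖G x‖ ≤ M) (v : H) :
    borelFC (fun x => F x + G x) B v = borelFC F B v + borelFC G B v := by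
  refine ext_inner_left ℂ fun h => ?_
  rw [inner_add_right, inner_borelFC_eq_polarForm hF ⟨M, hFb⟩,
    inner_borelFC_eq_polarForm hG ⟨M, hGb⟩,
    inner_borelFC_eq_polarForm (F := fun x => F x + G x) (hF.add hG)
      ⟨M + M, fun x => (norm_add_le _ _).trans (add_le_add (hFb x) (hGb x))⟩,
    polarForm_add hF hG B (fun x _ => hFb x) (fun x _ => hGb x)]

/-- The Gaussian average is cut at the interval shrunk by `γ`. Inside, the restriction condition
needs only its `L^r` norm, which averaging does not increase. Outside, it is bounded: mass of `g`
from the interval shrunk by `2γ` arrives through a kernel at distance at least `γ`, bounded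
uniformly in `c`, and the remaining values of `g` are small by `hout`. Hence `α = 0`. -/
theorem restriction_near_bound (hX : IsDoubling μ n C) (hl : 0 ≤ l) {c₀ : ℝ≥0∞} (hp1 : 1 ≤ p)
    (hp2 : p ≤ 2) (hr : 1 ≤ r) {R₁ R₂ γ : ℝ} (hγ : 0 < γ) {C_R : ℝ≥0} {D₁ : ℝ≥0∞} {b : ℝ}
    (hD₁ : ∀ g : ℝ → ℂ, Measurable g →
      ∫⁻ x in Set.Ioo (-(4 * b)) (4 * b), ‖g x‖ₑ ≤ D₁ * eLpNorm g r volume)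
    {B : Lp ℂ 2 μ →L[ℂ] Lp ℂ 2 μ} {K : X → X → ℂ} (hK : IsIntegralOp μ B K c₀ l)
    (hR : RestrictionBound μ B p r 1 R₁ R₂ C_R) {g : ℝ → ℂ} (hg : Measurable g)
    (hgb : ∃ M, ∀ x, ‖g x‖ ≤ M) {A D₂ : ℝ≥0∞} (hA : eLpNorm g r volume ≤ A)
    (hout : ∀ x, x ∉ Set.Icc (R₁ + 2 * γ) (R₂ - 2 * γ) → ‖g x‖ₑ ≤ D₂ * A) :
    HasNearBound μ B p b 0 ((C_R + 4 * (ENNReal.ofReal (1 + 2 / γ ^ 2) * D₁ + D₂) *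
      (c₀ * weightedConst n C l p)) * A) g := by
  intro c hc f hf
  obtain ⟨M, hM⟩ := hgb
  have hM0 : 0 ≤ M := (norm_nonneg _).trans (hM 0)
  set g₁ := innerPart b g with hg₁
  have hg₁m : Measurable g₁ := measurable_innerPart b hg
  have hg₁M : ∀ x, ‖g₁ x‖ ≤ M := norm_innerPart_le b hM
  set G := gaussAvg c g₁ with hG
  have hGm : Measurable G := (stronglyMeasurable_gaussAvg c hg₁m).measurable
  have hGM : ∀ x, ‖G x‖ ≤ M := norm_gaussAvg_le c hg₁M
  set S := Set.Icc (R₁ + γ) (R₂ - γ) with hS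
  have hSm : MeasurableSet S := measurableSet_Icc
  have hsplit : G = fun x => S.indicator G x + Sᶜ.indicator G x :=
    (Set.indicator_self_add_compl S G).symm
  have hi : ∀ (T : Set ℝ) (x : ℝ), ‖T.indicator G x‖ ≤ M := fun T x =>
    (norm_indicator_le_norm_self _ _).trans (hGM x)
  have hsup : tsupport (S.indicator G) ⊆ Set.Ioo R₁ R₂ := by
    have h1 : tsupport (S.indicator G) ⊆ S :=
      closure_minimal Set.support_indicator_subset isClosed_Icc
    refine h1.trans fun x hx => ⟨?_, ?_⟩
    · linarith [hx.1]
    · linarith [hx.2]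
  have hnear : eLpNorm (borelFC (S.indicator G) B (B f)) 2 μ ≤ C_R * A * weightedNorm μ p f := by
    refine (hR.eLpNorm_apply_le hX (hGm.indicator hSm) ⟨M, hi S⟩ hsup f hf).trans ?_
    gcongr
    exact (eLpNorm_indicator_le _).trans ((eLpNorm_gaussAvg_le c hg₁m hr).trans
      ((eLpNorm_innerPart_le b g r).trans hA))
  have hfar : ∀ x, ‖Sᶜ.indicator G x‖ₑ ≤ (ENNReal.ofReal (1 + 2 / γ ^ 2) * D₁ + D₂) * A := by
    intro x
    by_cases hx : x ∈ S
    · rw [Set.indicator_of_notMem (Set.notMem_compl_iff.2 hx), enorm_zero]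
      exact zero_le
    · rw [Set.indicator_of_mem (Set.mem_compl hx)]
      refine (enorm_gaussAvg_le_lintegral hc g₁ x).trans ?_
      have hkm : Measurable fun y => ENNReal.ofReal (gaussKernel c (x - y)) :=
        ((continuous_gaussKernel c).comp
          (continuous_const.sub continuous_id)).measurable.ennreal_ofReal
      calc _ ≤ ∫⁻ y, (ENNReal.ofReal (1 + 2 / γ ^ 2) * ‖g₁ y‖ₑ +
            ENNReal.ofReal (gaussKernel c (x - y)) * (D₂ * A)) := by
            refine lintegral_mono fun y => ?_
            by_cases hy : y ∈ Set.Icc (R₁ + 2 * γ) (R₂ - 2 * γ)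
            · have hxy : γ ≤ |x - y| := by
                rw [hS, Set.mem_Icc, not_and_or, not_le, not_le] at hx
                rcases hx with hx | hx
                · rw [abs_sub_comm, le_abs]
                  left
                  linarith [hy.1]
                · rw [le_abs]
                  left
                  linarith [hy.2]
              refine le_trans ?_ le_self_add
              gcongr
              exact gaussKernel_le_const hc hγ hxy
            · refine le_trans ?_ le_add_self
              gcongr
              refine le_trans ?_ (hout y hy)
              exact enorm_indicator_le_enorm_self _ _
        _ = ENNReal.ofReal (1 + 2 / γ ^ 2) * (∫⁻ y in Set.Ioo (-(4 * b)) (4 * b), ‖g y‖ₑ) +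
            D₂ * A := by
            rw [lintegral_add_left (hg₁m.enorm.const_mul _), lintegral_const_mul _ hg₁m.enorm,
              lintegral_mul_const _ hkm, lintegral_gaussKernel hc, one_mul,
              ← lintegral_indicator measurableSet_Ioo]
            congr 3
            ext y
            rw [hg₁, innerPart, enorm_indicator_eq_indicator_enorm]
        _ ≤ ENNReal.ofReal (1 + 2 / γ ^ 2) * (D₁ * A) + D₂ * A := by
            gcongr
            exact (hD₁ g hg).trans (by gcongr)
        _ = _ := by ring
  have h2 : eLpNorm (borelFC (Sᶜ.indicator G) B (B f)) 2 μ ≤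
      4 * ((ENNReal.ofReal (1 + 2 / γ ^ 2) * D₁ + D₂) * A) *
        (c₀ * weightedConst n C l p * weightedNorm μ p f) := by
    refine (eLpNorm_borelFC_apply_le (hGm.indicator hSm.compl) ⟨M, hi Sᶜ⟩ B
      (fun x _ => hfar x) (B f)).trans ?_
    gcongr
    exact hK.eLpNorm_two_le hX hl hp1 hp2 f
  rw [hsplit, borelFC_add_apply B (hGm.indicator hSm) (hGm.indicator hSm.compl) (hi S) (hi Sᶜ),
    eLpNorm_congr_ae (Lp.coeFn_add _ _), Real.rpow_zero, ENNReal.ofReal_one, mul_one]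
  refine (eLpNorm_add_le (Lp.aestronglyMeasurable _) (Lp.aestronglyMeasurable _)
    (by norm_num)).trans ((add_le_add hnear h2).trans (le_of_eq ?_))
  ring

end NormalizedBounds

/-! ### Unit scale: Borel functions under the restriction condition -/

section NormalizedRestriction

variable {X : Type*} [MetricSpace X] [TopologicalSpace.SeparableSpace X] [MeasurableSpace X]
  [BorelSpace X] {μ : Measure X} {n C l : ℝ} {p q r : ℝ≥0∞}

theorem enorm_inner_apply_le_of_restrictLp_ball (T : Lp ℂ 2 μ →L[ℂ] Lp ℂ 2 μ) (h f : Lp ℂ 2 μ)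
    (x₀ : X) {M : ℝ≥0∞} (hM : ∀ j : ℕ,
      ‖⟪h, T (restrictLp f (Metric.isOpen_ball (x := x₀) (ε := j + 1)).measurableSet)⟫_ℂ‖ₑ ≤ M) :
    ‖⟪h, T f⟫_ℂ‖ₑ ≤ M := by
  set g := ContinuousLinearMap.adjoint T h with hg
  have e : ∀ j : ℕ,
      ⟪h, T (restrictLp f (Metric.isOpen_ball (x := x₀) (ε := j + 1)).measurableSet)⟫_ℂ
        = ∫ x in Metric.ball x₀ (j + 1), ⟪g x, f x⟫_ℂ ∂μ := by
    intro j
    rw [← ContinuousLinearMap.adjoint_inner_left, L2.inner_def,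
      ← integral_indicator Metric.isOpen_ball.measurableSet]
    refine integral_congr_ae ?_
    filter_upwards [coeFn_restrictLp f
      (Metric.isOpen_ball (x := x₀) (ε := j + 1)).measurableSet] with x hx
    rw [hx]
    by_cases hxQ : x ∈ Metric.ball x₀ ((j : ℝ) + 1)
    · rw [Set.indicator_of_mem hxQ, Set.indicator_of_mem hxQ, ← hg]
    · rw [Set.indicator_of_notMem hxQ, Set.indicator_of_notMem hxQ, inner_zero_right]
  have hU : ⋃ j : ℕ, Metric.ball x₀ ((j : ℝ) + 1) = Set.univ := by
    refine Set.eq_univ_of_forall fun x => ?_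
    obtain ⟨j, hj⟩ := exists_nat_gt (dist x x₀)
    exact Set.mem_iUnion.2 ⟨j, Metric.mem_ball.2 (by linarith)⟩
  have hlim := tendsto_setIntegral_of_monotone (μ := μ) (f := fun x => ⟪g x, f x⟫_ℂ)
    (s := fun j : ℕ => Metric.ball x₀ ((j : ℝ) + 1))
    (fun j => Metric.isOpen_ball.measurableSet)
    (fun i j hij => Metric.ball_subset_ball (by
      have : (i : ℝ) ≤ j := by exact_mod_cast hij
      linarith)) (L2.integrable_inner g f).integrableOn
  rw [hU, setIntegral_univ, ← L2.inner_def, hg, ContinuousLinearMap.adjoint_inner_left] at hlim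
  refine le_of_tendsto hlim.enorm (Eventually.of_forall fun j => ?_)
  rw [← e j]
  exact hM j

/-- A function in `L² ∩ L^p` may have infinite weighted norm, since unit volumes can degenerate at
infinity. Its restrictions to balls have finite weighted norm, and the pairing converges along them.
-/
theorem WeakLpBound.of_restrictLp_ball {T : Lp ℂ 2 μ →L[ℂ] Lp ℂ 2 μ} {M : ℝ≥0∞}
    (hX : IsDoubling μ n C) (hn : 0 ≤ n) (hC : 1 ≤ C)
    (h : ∀ f h : Lp ℂ 2 μ, weightedNorm μ p f ≠ ∞ → MemLp f p μ → MemLp h q μ →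
      ‖⟪h, T f⟫_ℂ‖ₑ ≤ M * eLpNorm h q μ * eLpNorm f p μ) : WeakLpBound μ T p q M := by
  intro f g hf hg
  rcases isEmpty_or_nonempty X with hE | ⟨⟨x₀⟩⟩
  · have : μ = 0 := μ.eq_zero_of_isEmpty
    rw [L2.inner_def]
    simp [this]
  refine enorm_inner_apply_le_of_restrictLp_ball T g f x₀ fun j => ?_
  have hm : MeasurableSet (Metric.ball x₀ ((j : ℝ) + 1)) := Metric.isOpen_ball.measurableSet
  have hj : (0 : ℝ) < j + 1 := by positivity
  have hw : weightedNorm μ p (restrictLp f hm) ≠ ∞ := by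
    refine ne_top_of_le_ne_top ?_ (hX.weightedNorm_restrictLp_le (p := p) x₀ (ρ := j + 1)
      (by linarith [hj, (Nat.cast_nonneg j : (0 : ℝ) ≤ j)]) (by linarith) hn hm subset_rfl f)
    refine ENNReal.mul_ne_top (ENNReal.mul_ne_top ?_ ?_) ?_
    · exact ENNReal.rpow_ne_top_of_nonneg (sigmaExp_nonneg p) ENNReal.ofReal_ne_top
    · exact ENNReal.rpow_ne_top_of_ne_zero (hX.ball_pos x₀ _ hj).ne' (hX.ball_lt_top x₀ _ hj).ne
    · exact (hf.restrict _).eLpNorm_ne_top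
  refine (h _ g hw ((memLp_congr_ae (coeFn_restrictLp f hm)).2 (hf.indicator hm)) hg).trans ?_
  gcongr
  rw [eLpNorm_congr_ae (coeFn_restrictLp f hm)]
  exact eLpNorm_indicator_le _

/-- Applied to a function supported on a Lebesgue-null set, the restriction condition has right side
zero. So such sets inside the interval do not contribute to the spectral calculus applied to `B f`,
and functions may be altered on them. -/
theorem RestrictionBound.polarForm_indicator_compl {B : Lp ℂ 2 μ →L[ℂ] Lp ℂ 2 μ} {R₁ R₂ : ℝ}
    {C_R : ℝ≥0} (hX : IsDoubling μ n C) (hR : RestrictionBound μ B p r 1 R₁ R₂ C_R) {E S : Set ℝ}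
    (hE : MeasurableSet E) (hE0 : volume E = 0) (hS : IsClosed S) (hES : E ⊆ S)
    (hSR : S ⊆ Set.Ioo R₁ R₂) {F : ℝ → ℂ} (hF : Measurable F) {M : ℝ} (hM : ∀ x, ‖F x‖ ≤ M)
    (h f : Lp ℂ 2 μ) (hf : weightedNorm μ p f ≠ ∞) :
    polarForm B (Eᶜ.indicator F) h (B f) = polarForm B F h (B f) := by
  have hi : ∀ (T : Set ℝ) (x : ℝ), ‖T.indicator F x‖ ≤ M := fun T x =>
    (norm_indicator_le_norm_self _ _).trans (hM x)
  have h0 : eLpNorm (E.indicator F) r volume = 0 := by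
    rw [eLpNorm_congr_ae (g := 0), eLpNorm_zero]
    exact indicator_meas_zero hE0
  have h1 := hR.eLpNorm_apply_le hX (hF.indicator hE) ⟨M, hi E⟩
    ((closure_minimal (Set.support_indicator_subset.trans hES) hS).trans hSR) f hf
  rw [h0, mul_zero, zero_mul, nonpos_iff_eq_zero] at h1
  have h2 : borelFC (E.indicator F) B (B f) = 0 :=
    (Lp.eq_zero_iff_ae_eq_zero).2
      ((eLpNorm_eq_zero_iff (Lp.aestronglyMeasurable _) (by norm_num)).1 h1)
  have h3 : polarForm B (E.indicator F) h (B f) = 0 := by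
    rw [← inner_borelFC_eq_polarForm (hF.indicator hE) ⟨M, hi E⟩, h2, inner_zero_right]
  have h4 := polarForm_add (hF.indicator hE) (hF.indicator hE.compl) B (fun x _ => hi E x)
    (fun x _ => hi Eᶜ x) h (B f)
  have h5 : (fun x => E.indicator F x + Eᶜ.indicator F x) = F := Set.indicator_self_add_compl E F
  rw [h5, h3, zero_add] at h4
  exact h4.symm

/-- As in the continuous case `F` is mollified, but convergence may fail on a null set, which the
restriction condition allows one to discard. The near bound requires `g` to be small outside a
slightly larger interval; this holds because `(I - d²/dx²)^(s/2)` is smoothing away from the support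
of `F`. -/
theorem exists_restriction_bound {X : Type*} [MeasurableSpace X] (μ : Measure X)
    (hn : 0 ≤ n) (hC : 1 ≤ C) {c₀ : ℝ≥0∞}
    (hc₀ : c₀ ≠ ∞) {m : ℕ} (hm : n / 2 < m) (hl : n + m < l) [ENNReal.HolderConjugate p q]
    (hp1 : 1 ≤ p) (hp2 : p ≤ 2) (hr : 2 ≤ r) {s R₁ R₂ γ : ℝ} (hγ : 0 < γ)
    (hs : (1 + (1 / 2) / m) * (n * sigmaExp p) < s) (C_R : ℝ≥0) :
    ∃ D : ℝ≥0∞, D ≠ ∞ ∧ ∀ [MetricSpace X] [TopologicalSpace.SeparableSpace X] [BorelSpace X],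
      IsDoubling μ n C → ∀ (B : Lp ℂ 2 μ →L[ℂ] Lp ℂ 2 μ) (K : X → X → ℂ), IsSelfAdjoint B →
      IsIntegralOp μ B K c₀ l → RestrictionBound μ B p r 1 R₁ R₂ C_R →
      ∀ F : ℝ → ℂ, Measurable F → (∃ M, ∀ x, ‖F x‖ ≤ M) →
      tsupport F ⊆ Set.Ioo (R₁ + γ) (R₂ - γ) →
      ∀ g : ℝ → ℂ, Measurable g → eLpNorm g r volume ≠ ∞ → IsBesselDeriv s F g →
      WeakLpBound μ (borelFC F B ∘L B) p q (D * eLpNorm g r volume) := by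
  have hm0 : 0 < (m : ℝ) := lt_of_le_of_lt (by positivity) hm
  have hl0 : 0 ≤ l := by linarith
  have hpt : p ≠ ∞ := (hp2.trans_lt (by norm_num)).ne
  have hr1 : 1 ≤ r := le_trans (by norm_num) hr
  have hσ := sigmaExp_nonneg p
  have hs0 : 0 < s := lt_of_le_of_lt (by positivity) hs
  have hw : weightedConst n C l p ≠ ∞ := weightedConst_ne_top (by linarith) hp1 hpt
  have hγ4 : 0 < γ / 4 := by linarith
  set b := kernelOpBound n C l c₀ with hb
  obtain ⟨D₁, hD₁, hin⟩ := exists_eLpNorm_one_restrict_le (r := r)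
    (S := Set.Ioo (-(4 * b)) (4 * b)) (by simp) hr1
  obtain ⟨D₅, hD₅, hint⟩ := exists_eLpNorm_one_restrict_le (r := r)
    (S := Set.Ioo (R₁ + γ) (R₂ - γ)) (by simp) hr1
  obtain ⟨D₂, hD₂, hfar⟩ := exists_norm_mollify_le_of_support hs0 hγ4
  obtain ⟨D, hD, hmain⟩ := exists_besselPotential_bound (p := p) (q := q) (α := 0) (s := s)
    μ hn hC hc₀ hm hl hp1 hp2 hr le_rfl (by norm_num) (by simpa using hs)
    (a₀ := C_R + 4 * (ENNReal.ofReal (1 + 2 / (γ / 4) ^ 2) * D₁ + ENNReal.ofReal D₂ * D₅) *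
      (c₀ * weightedConst n C l p)) (by finiteness)
  refine ⟨D, hD, ?_⟩
  intro _ _ _ hX B K hB hK hR F hF ⟨M, hM⟩ hFs g hg hgr hFg
  have hFz : ∀ y, F y ≠ 0 → y ∈ Set.Ioo (R₁ + γ) (R₂ - γ) := fun y hy =>
    hFs (subset_tsupport F hy)
  have hFi : Integrable F := by
    rw [← integrableOn_iff_integrable_of_support_subset (s := Set.Ioo (R₁ + γ) (R₂ - γ))
      fun y hy => hFz y hy]
    exact Measure.integrableOn_of_bounded (M := M) (by simp) hF.aestronglyMeasurable
      (Eventually.of_forall hM)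
  have hF1 : ENNReal.ofReal (∫ y, ‖F y‖) ≤ D₅ * eLpNorm g r volume := by
    rw [ofReal_integral_norm_eq_lintegral_enorm hFi]
    calc ∫⁻ y, ‖F y‖ₑ = ∫⁻ y in Set.Ioo (R₁ + γ) (R₂ - γ), ‖F y‖ₑ := by
          rw [setLIntegral_eq_of_support_subset fun y hy => hFz y (by simpa using hy)]
      _ ≤ D₅ * eLpNorm F r volume := hint F hF
      _ ≤ _ := by
          gcongr
          exact hFg.eLpNorm_le hs0 hr1 hF hFi.locallyIntegrable hg hgr
  -- Off the closed support the mollifications converge everywhere, so the exceptional null set can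
  -- be taken inside `tsupport F`, hence inside the interval where the restriction condition speaks.
  obtain ⟨E, hE, hE0, hES, hElim⟩ : ∃ E : Set ℝ, MeasurableSet E ∧ volume E = 0 ∧ E ⊆ tsupport F ∧
      ∀ x, x ∉ E → Tendsto (fun k => mollify (shrinkingBump k) F x) atTop (𝓝 (F x)) := by
    have h0 := ae_iff.1 (ae_tendsto_mollify_shrinkingBump hFi.locallyIntegrable)
    refine ⟨toMeasurable volume _ ∩ tsupport F,
      (measurableSet_toMeasurable _ _).inter (isClosed_tsupport F).measurableSet,
      measure_mono_null Set.inter_subset_left ((measure_toMeasurable _).trans h0),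
      Set.inter_subset_right, fun x hx => ?_⟩
    by_cases hxs : x ∈ tsupport F
    · by_contra hc
      exact hx ⟨subset_toMeasurable _ _ hc, hxs⟩
    · exact tendsto_mollify_of_notMem_tsupport hxs
  have hSR : tsupport F ⊆ Set.Ioo R₁ R₂ := hFs.trans (Set.Ioo_subset_Ioo (by linarith) (by linarith))
  refine WeakLpBound.of_restrictLp_ball hX hn hC fun f h hwf hf hh => ?_
  rw [ContinuousLinearMap.comp_apply, inner_borelFC_eq_polarForm hF ⟨M, hM⟩,
    ← hR.polarForm_indicator_compl hX hE hE0 (isClosed_tsupport F) hES hSR hF hM h f hwf]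
  have hlim := tendsto_polarForm (F := Eᶜ.indicator F)
    (G := fun k => Eᶜ.indicator (mollify (shrinkingBump k) F))
    (fun k => (measurable_mollify (shrinkingBump k) hF).indicator hE.compl) B
    (fun k x _ => (norm_indicator_le_norm_self _ _).trans (norm_mollify_le (shrinkingBump k) hM x))
    (fun x _ => by
      by_cases hx : x ∈ E
      · simp [hx]
      · simpa [hx] using hElim x hx) h (B f)
  refine le_of_tendsto hlim.enorm ?_
  -- With `γ/4` as margin, points outside `[R₁ + γ/2, R₂ - γ/2]` have distance at least `γ/2` from
  -- the support of `F`, which exceeds `γ/4` plus the radius of the bump.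
  filter_upwards [tendsto_rOut_shrinkingBump.eventually (gt_mem_nhds hγ4)] with k hk
  set φ := shrinkingBump k
  rw [hR.polarForm_indicator_compl hX hE hE0 (isClosed_tsupport F) hES hSR
    (measurable_mollify φ hF) (norm_mollify_le φ hM) h f hwf,
    funext (hFg.mollify_eq_integral_gaussAvg φ hs0 hr1 hg hgr)]
  have hgm := measurable_mollify φ hg
  have hgb := exists_norm_mollify_le φ hg hr1 hgr
  have hgA := eLpNorm_mollify_le φ hg hr1
  refine hmain hX B K hB hK _ hgm hgb _ hgA ?_ f h hf hh
  refine restriction_near_bound hX hl0 hp1 hp2 hr1 hγ4 hin hK hR hgm hgb hgA fun x hx => ?_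
  have h1 := hfar φ F g hFg hFi x fun y hy => by
    have hy := hFz y hy
    rw [Set.mem_Icc, not_and_or, not_le, not_le] at hx
    rcases hx with hx | hx
    · rw [abs_sub_comm, le_abs]
      left
      linarith [hy.1]
    · rw [le_abs]
      left
      linarith [hy.2]
  calc ‖mollify φ g x‖ₑ = ENNReal.ofReal ‖mollify φ g x‖ := (ofReal_norm _).symm
    _ ≤ ENNReal.ofReal (D₂ * ∫ y, ‖F y‖) := ENNReal.ofReal_le_ofReal h1
    _ = ENNReal.ofReal D₂ * ENNReal.ofReal (∫ y, ‖F y‖) := ENNReal.ofReal_mul hD₂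
    _ ≤ ENNReal.ofReal D₂ * (D₅ * eLpNorm g r volume) := by gcongr
    _ = _ := by ring

end NormalizedRestriction

/-! ### Complex conjugation and Bessel derivatives -/

section Conjugation

open FourierTransform

theorem besselSymbol_neg (s ξ : ℝ) : besselSymbol s (-ξ) = besselSymbol s ξ := by
  simp [besselSymbol]

/-- The complex conjugate of a Schwartz function. -/
def conjSchwartz (ψ : 𝓢(ℝ, ℂ)) : 𝓢(ℝ, ℂ) :=
  SchwartzMap.postcompCLM (𝕜 := ℝ) (Complex.conjCLE : ℂ →L[ℝ] ℂ) ψ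

theorem conjSchwartz_apply (ψ : 𝓢(ℝ, ℂ)) (x : ℝ) : conjSchwartz ψ x = (starRingEnd ℂ) (ψ x) := rfl

theorem fourier_conj (g : ℝ → ℂ) (ξ : ℝ) :
    𝓕 (fun x => (starRingEnd ℂ) (g x)) ξ = (starRingEnd ℂ) (𝓕 g (-ξ)) := by
  rw [Real.fourier_eq', Real.fourier_eq', ← integral_conj]
  refine integral_congr_ae (Eventually.of_forall fun x => ?_)
  simp only [smul_eq_mul, map_mul, ← Complex.exp_conj, Complex.conj_I, Complex.conj_ofReal]
  congr 2
  simp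

theorem besselOp_conjSchwartz (s : ℝ) (ψ : 𝓢(ℝ, ℂ)) (x : ℝ) :
    besselOp s (conjSchwartz ψ) x = (starRingEnd ℂ) (besselOp s ψ x) := by
  rw [besselOp_apply, besselOp_apply, ← integral_conj, ← integral_neg_eq_self]
  refine integral_congr_ae (Eventually.of_forall fun ξ => ?_)
  have h : 𝓕 (conjSchwartz ψ : ℝ → ℂ) (-ξ) = (starRingEnd ℂ) (𝓕 (ψ : ℝ → ℂ) ξ) := by
    conv_rhs => rw [← neg_neg ξ]
    exact fourier_conj ψ (-ξ)
  simp only [map_mul, ← Complex.exp_conj, Complex.conj_I, Complex.conj_ofReal, h,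
    besselSymbol_neg, map_ofNat]
  congr 2
  push_cast
  ring

/-- The symbol is real and even, so the operator commutes with conjugation. This is needed for
duality, since the adjoint of `F(B)` is the conjugate function of `B`. -/
theorem IsBesselDeriv.conj {s : ℝ} {F g : ℝ → ℂ} (h : IsBesselDeriv s F g) :
    IsBesselDeriv s (fun x => (starRingEnd ℂ) (F x)) (fun x => (starRingEnd ℂ) (g x)) := by
  intro ψ
  have h1 := congrArg (starRingEnd ℂ) (h (conjSchwartz ψ))
  rw [← integral_conj, ← integral_conj] at h1
  simpa only [map_mul, conjSchwartz_apply, besselOp_conjSchwartz, Complex.conj_conj] using h1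

end Conjugation

/-! ### Rescaling the metric to unit scale -/

section Scaling

variable {X : Type*} [MetricSpace X]

/-- The metric `d / t`, with the topology of `d`. -/
abbrev scaledMetric (X : Type*) [MetricSpace X] {t : ℝ} (ht : 0 < t) : MetricSpace X :=
  MetricSpace.ofDistTopology (fun x y => dist x y / t) (by simp) (by simp [dist_comm])
    (fun x y z => by
      rw [← add_div]
      gcongr
      exact dist_triangle x y z)
    (fun s => by
      rw [Metric.isOpen_iff]
      refine forall₂_congr fun x _ => ⟨fun ⟨ε, hε, h⟩ => ⟨ε / t, by positivity, fun y hy => ?_⟩,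
        fun ⟨ε, hε, h⟩ => ⟨ε * t, by positivity, fun y hy => ?_⟩⟩
      · apply h
        rw [Metric.mem_ball, dist_comm]
        exact (div_lt_div_iff_of_pos_right ht).1 hy
      · apply h
        rw [Metric.mem_ball, dist_comm] at hy
        exact (div_lt_iff₀ ht).2 hy)
    (fun x y h => by simpa [ht.ne'] using h)

theorem ball_scaledMetric {t : ℝ} (ht : 0 < t) (x : X) (r : ℝ) :
    @Metric.ball X (scaledMetric X ht).toPseudoMetricSpace x r = Metric.ball x (t * r) := by
  ext y
  change dist y x / t < r ↔ dist y x < t * r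
  rw [div_lt_iff₀ ht, mul_comm]

variable [MeasurableSpace X] {μ : Measure X} {n C : ℝ}

theorem IsDoubling.scaledMetric (hX : IsDoubling μ n C) {t : ℝ} (ht : 0 < t) :
    @IsDoubling X (scaledMetric X ht) _ μ n C := by
  refine @IsDoubling.mk X (_root_.scaledMetric X ht) _ μ n C (fun x r hr => ?_) (fun x r hr => ?_)
    (fun x r l hr hl => ?_)
  · rw [ball_scaledMetric]
    exact hX.ball_pos x _ (by positivity)
  · rw [ball_scaledMetric]
    exact hX.ball_lt_top x _ (by positivity)
  · rw [ball_scaledMetric, ball_scaledMetric, mul_left_comm]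
    exact hX.doubling x _ l (by positivity) hl

theorem RestrictionBound.scaledMetric {B : Lp ℂ 2 μ →L[ℂ] Lp ℂ 2 μ} {p q : ℝ≥0∞} {t R₁ R₂ : ℝ}
    {C_R : ℝ≥0} (ht : 0 < t) (h : RestrictionBound μ B p q t R₁ R₂ C_R) :
    @RestrictionBound X (scaledMetric X ht) _ μ B p q 1 R₁ R₂ C_R := by
  have e : ∀ x : X, @Metric.ball X (_root_.scaledMetric X ht).toPseudoMetricSpace x 1
      = Metric.ball x t := fun x => by rw [ball_scaledMetric, mul_one]
  intro F hF hFb hFs f hf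
  simp only [e]
  exact h F hF hFb hFs f hf

theorem one_add_sq_rpow_neg_le {N d : ℝ} (hN : 0 ≤ N) (hd : 0 ≤ d) :
    (1 + d ^ 2) ^ (-N) ≤ 2 ^ N * (1 + d) ^ (-(2 * N)) := by
  have h1 : (1 + d) ^ (-(2 * N)) = (((1 + d) ^ 2)⁻¹) ^ N := by
    rw [Real.inv_rpow (by positivity),
      ← Real.rpow_natCast, ← Real.rpow_mul (by positivity), ← Real.rpow_neg (by positivity)]
    congr 1
  rw [h1, ← Real.mul_rpow (by norm_num) (by positivity), Real.rpow_neg (by positivity),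
    ← Real.inv_rpow (by positivity)]
  refine Real.rpow_le_rpow (by positivity) ?_ hN
  rw [← div_eq_mul_inv, le_div_iff₀ (by positivity), inv_mul_le_iff₀ (by positivity)]
  nlinarith [sq_nonneg (1 - d)]

/-- Unit balls of `d / √k` are balls of radius `√k` of `d`, and `1 + d²/k` is comparable to `(1 +
d/√k)²`. Hence the decay exponent is `2N` and the constant does not depend on `k`. The absolute
value covers constants `C_K` of either sign. -/
theorem HasPolyKernel.exists_isIntegralOp (hX : IsDoubling μ n C)
    {B : Lp ℂ 2 μ →L[ℂ] Lp ℂ 2 μ} {k : ℕ} (hk : 0 < √(k : ℝ)) {N C_K : ℝ} (hN : 0 ≤ N)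
    (h : HasPolyKernel μ B k N C_K) :
    ∃ K : X → X → ℂ, @IsIntegralOp X (_root_.scaledMetric X hk) _ μ B K
      (ENNReal.ofReal (|C_K| * 2 ^ N)) (2 * N) := by
  obtain ⟨K, hK, hKb, hKa⟩ := h
  refine ⟨K, @IsIntegralOp.mk X (_root_.scaledMetric X hk) _ μ B K _ _ hK (fun x y => ?_) hKa⟩
  have hv : ∀ x : X, 0 < μ.real (Metric.ball x √k) := fun x =>
    ENNReal.toReal_pos (hX.ball_pos x _ hk).ne' (hX.ball_lt_top x _ hk).ne
  have hve : ∀ x : X, ENNReal.ofReal (μ.real (Metric.ball x √k)) = μ (Metric.ball x √k) := fun x =>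
    ENNReal.ofReal_toReal (hX.ball_lt_top x _ hk).ne
  have hd0 : 0 ≤ dist x y / √k := by positivity
  have hm : 0 < max (μ.real (Metric.ball x √k)) (μ.real (Metric.ball y √k)) := lt_max_of_lt_left (hv x)
  change _ ≤ _ * ((max (μ (@Metric.ball X (_root_.scaledMetric X hk).toPseudoMetricSpace x 1))
    (μ (@Metric.ball X (_root_.scaledMetric X hk).toPseudoMetricSpace y 1)))⁻¹ *
    ENNReal.ofReal ((1 + dist x y / √k) ^ (-(2 * N))))
  rw [ball_scaledMetric, ball_scaledMetric, mul_one, ← hve x, ← hve y, ← ENNReal.ofReal_max, ← ENNReal.ofReal_inv_of_pos hm,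
    ← ENNReal.ofReal_mul (by positivity), ← ENNReal.ofReal_mul (by positivity), ← ofReal_norm]
  refine ENNReal.ofReal_le_ofReal ((hKb x y).trans ?_)
  have e : dist x y ^ 2 / k = (dist x y / √k) ^ 2 := by
    rw [div_pow, Real.sq_sqrt (Nat.cast_nonneg k)]
  rw [e]
  calc _ ≤ |C_K| * (max (μ.real (Metric.ball x √k)) (μ.real (Metric.ball y √k)))⁻¹ *
        (2 ^ N * (1 + dist x y / √k) ^ (-(2 * N))) := by
        gcongr
        · exact le_abs_self _
        · exact one_add_sq_rpow_neg_le hN hd0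
    _ = _ := by ring

end Scaling

/-! ### Passing to the infimum in the Sobolev norm -/

section SobolevNorm

variable {X : Type*} [MeasurableSpace X] {μ : Measure X} {p q r : ℝ≥0∞}

theorem sigmaExp_le_half (hp : 1 ≤ p) : sigmaExp p ≤ 1 / 2 := by
  have h1 : (p⁻¹).toReal ≤ 1 := by
    rw [← ENNReal.toReal_one]
    exact ENNReal.toReal_mono ENNReal.one_ne_top (ENNReal.inv_le_one.2 hp)
  have h0 : 0 ≤ (p⁻¹).toReal := ENNReal.toReal_nonneg
  rw [sigmaExp, abs_le]
  constructor <;> linarith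

theorem sigmaExp_conj [h : ENNReal.HolderConjugate p q] : sigmaExp q = sigmaExp p := by
  have h5 := congrArg ENNReal.toReal (ENNReal.HolderConjugate.inv_add_inv_eq_one p q)
  have hp0 : p ≠ 0 := ENNReal.HolderConjugate.ne_zero p q
  have hq0 : q ≠ 0 := ENNReal.HolderConjugate.ne_zero q p
  rw [ENNReal.toReal_add (by simpa using hp0) (by simpa using hq0), ENNReal.toReal_one] at h5
  rw [sigmaExp, sigmaExp, ← abs_neg]
  congr 1
  linarith

/-- A bound in terms of all Bessel derivatives is a bound in terms of the Sobolev norm. -/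
theorem LpBound.of_isBesselDeriv {T : Lp ℂ 2 μ →L[ℂ] Lp ℂ 2 μ} (hp : 1 ≤ p) {s : ℝ} {F : ℝ → ℂ}
    {D : ℝ≥0∞} {E : ℝ≥0} (hD : D ≤ E) (hE : E ≠ 0)
    (h : ∀ g : ℝ → ℂ, Measurable g → eLpNorm g r volume ≠ ∞ → IsBesselDeriv s F g →
      LpBound μ T p (D * eLpNorm g r volume)) : LpBound μ T p (E * sobolevENorm s r F) := by
  intro f hf
  rcases eq_or_ne (eLpNorm f p μ) 0 with h0 | h0
  · have hf0 : f = 0 := Lp.eq_zero_iff_ae_eq_zero.2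
      ((eLpNorm_eq_zero_iff (Lp.aestronglyMeasurable f) (zero_lt_one.trans_le hp).ne').1 h0)
    rw [hf0, map_zero, eLpNorm_congr_ae (Lp.coeFn_zero ℂ 2 μ), eLpNorm_zero]
    exact zero_le
  -- Dividing by this factor brings the claim under the infimum. It must be neither `0` nor `∞`,
  -- also to avoid the product `0 · ∞` when the Sobolev norm is infinite; the case of vanishing `f`
  -- was settled above.
  have hb0 : (E : ℝ≥0∞) * eLpNorm f p μ ≠ 0 := mul_ne_zero (by simpa using hE) h0
  have hbt : (E : ℝ≥0∞) * eLpNorm f p μ ≠ ∞ := ENNReal.mul_ne_top ENNReal.coe_ne_top hf.2.ne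
  rw [mul_comm (E : ℝ≥0∞), mul_assoc]
  refine (ENNReal.div_le_iff hb0 hbt).1 ?_
  refine le_iInf fun g => le_iInf fun hg => le_iInf fun hd => ENNReal.div_le_of_le_mul ?_
  have e := hg.1.ae_eq_mk
  have h1 := h (hg.1.mk g) hg.1.stronglyMeasurable_mk.measurable
    (by rw [← eLpNorm_congr_ae e]; exact hg.2.ne) (fun ψ => by
      rw [← hd ψ]
      refine integral_congr_ae ?_
      filter_upwards [e] with x hx
      rw [hx]) f hf
  rw [← eLpNorm_congr_ae e] at h1
  refine h1.trans ?_
  rw [mul_comm D, mul_assoc]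
  gcongr

end SobolevNorm

/-! ### Choice of `m`, duality and uniformity in `k` -/

section MainBounds

variable {X : Type*} [MetricSpace X] [TopologicalSpace.SeparableSpace X] [MeasurableSpace X]
  [BorelSpace X] {μ : Measure X} {n C : ℝ} {p q r : ℝ≥0∞}

/-- The order of moments is `m = [a]`. The hypothesis on `N` is what makes it exceed `n/2`, as the
core bound requires, while `m ≤ a` keeps `n + m ≤ N`. -/
theorem exists_nat_eq_floor {N : ℝ} (hn : 0 ≤ n) (hN : n + ⌊n / 2⌋ + 1 < N) :
    ∃ m : ℕ, (m : ℝ) = ⌊N - n⌋ ∧ n / 2 < m ∧ m ≤ N - n := by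
  have h1 : ⌊n / 2⌋ + 1 ≤ ⌊N - n⌋ := by
    rw [Int.le_floor]
    push_cast
    linarith
  have h2 : n / 2 < ⌊N - n⌋ := by
    have h3 := Int.lt_floor_add_one (n / 2)
    have h4 : ((⌊n / 2⌋ + 1 : ℤ) : ℝ) ≤ ⌊N - n⌋ := by exact_mod_cast h1
    push_cast at h4
    linarith
  have h0 : 0 ≤ ⌊N - n⌋ := by
    have : (0 : ℝ) < ⌊N - n⌋ := by linarith [div_nonneg hn zero_le_two]
    exact_mod_cast this.le
  have e : ((⌊N - n⌋.toNat : ℕ) : ℝ) = ⌊N - n⌋ := by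
    exact_mod_cast congrArg (Int.cast (R := ℝ)) (Int.toNat_of_nonneg h0)
  exact ⟨⌊N - n⌋.toNat, e, e ▸ h2, e ▸ Int.floor_le _⟩

/-- The excess `nσ/(2m)` left by the balancing at `α = 0` is at most `n/(4m)`, because `σ ≤ 1/2`.
This is the origin of the term `n/(4[a])`. -/
theorem add_div_mul_le {m : ℝ} (hn : 0 ≤ n) (hm : 0 ≤ m) (hp : 1 ≤ p) :
    (1 + (1 / 2) / m) * (n * sigmaExp p) ≤ n * sigmaExp p + n / (4 * m) := by
  have h : (1 / 2) / m * (n * sigmaExp p) ≤ (1 / 2) / m * (n * (1 / 2)) := by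
    gcongr
    exact sigmaExp_le_half hp
  have e : (1 / 2) / m * (n * (1 / 2)) = n / (4 * m) := by
    rw [div_mul_eq_mul_div, show 1 / 2 * (n * (1 / 2)) = n / 4 by ring, div_div]
  rw [add_mul, one_mul]
  linarith

theorem exists_lpBound_of_continuous (hX : IsDoubling μ n C) (hn : 0 ≤ n) {N : ℝ}
    (hN : n + ⌊n / 2⌋ + 1 < N) (C_K : ℝ) (hp : 1 ≤ p) (hr : 2 ≤ r) {α s : ℝ} (hα0 : 0 ≤ α)
    (hα1 : α ≤ 1 / 2)
    (hs : (1 + (1 / 2 - α) / ⌊N - n⌋) * (n * sigmaExp p) + α < s)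
    (hsup : ∀ c : ℝ, 0 < c → ∀ g : ℝ → ℂ, Measurable g → ∀ x,
      ‖gaussAvg c g x‖ₑ ≤ ENNReal.ofReal (max 1 c⁻¹ ^ α) * eLpNorm g r volume) :
    ∃ E : ℝ≥0, ∀ (A : Lp ℂ 2 μ →L[ℂ] Lp ℂ 2 μ) (k : ℕ), IsSelfAdjoint A → 1 ≤ k →
      HasPolyKernel μ (A ^ k) k N C_K →
      ∀ F : ℝ → ℂ, Continuous F → (∃ M : ℝ, ∀ x, ‖F x‖ ≤ M) →
        LpBound μ (borelFC F (A ^ k) ∘L A ^ k) p (E * sobolevENorm s r F) := by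
  have := hX.sigmaFinite
  obtain ⟨m, hmN, hm, hmle⟩ := exists_nat_eq_floor hn hN
  rw [← hmN] at hs
  have hN0 : 0 ≤ N := by
    have : (0 : ℝ) ≤ m := m.cast_nonneg
    linarith
  have hl : n + m < 2 * N := by
    have : 0 ≤ n / 2 := by positivity
    linarith
  have hX' : IsDoubling μ n (max C 1) := hX.mono (le_max_left _ _)
  have hsk : ∀ k : ℕ, 1 ≤ k → 0 < √(k : ℝ) := fun k hk => Real.sqrt_pos.2 (by exact_mod_cast hk)
  have key : ∀ p' q' : ℝ≥0∞, ENNReal.HolderConjugate p' q' → 1 ≤ p' → p' ≤ 2 →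
      sigmaExp p' = sigmaExp p → ∃ D : ℝ≥0∞, D ≠ ∞ ∧
      ∀ (A : Lp ℂ 2 μ →L[ℂ] Lp ℂ 2 μ) (k : ℕ), IsSelfAdjoint A → 1 ≤ k →
      HasPolyKernel μ (A ^ k) k N C_K →
      ∀ F : ℝ → ℂ, Continuous F → (∃ M : ℝ, ∀ x, ‖F x‖ ≤ M) →
      ∀ g : ℝ → ℂ, Measurable g → eLpNorm g r volume ≠ ∞ → IsBesselDeriv s F g →
      WeakLpBound μ (borelFC F (A ^ k) ∘L A ^ k) p' q' (D * eLpNorm g r volume) := by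
    intro p' q' hpq hp1 hp2 hσ
    rw [← hσ] at hs
    obtain ⟨D, hD, hb⟩ := exists_continuous_bound (p := p') (q := q') μ hn (le_max_right C 1)
      (c₀ := ENNReal.ofReal (|C_K| * 2 ^ N)) ENNReal.ofReal_ne_top hm hl hp1 hp2 hr hα0 hα1 hs hsup
    refine ⟨D, hD, fun A k hA hk hK F hF hFb g hg hgr hFg => ?_⟩
    obtain ⟨K, hK⟩ := hK.exists_isIntegralOp hX (hsk k hk) hN0
    exact @hb (scaledMetric X (hsk k hk)) ‹_› ‹_› (hX'.scaledMetric _) (A ^ k) K (hA.pow k) hK F hF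
      hFb g hg hgr hFg
  rcases le_total p 2 with hp2 | hp2
  · obtain ⟨D, hD, hb⟩ := key p _ (ENNReal.HolderConjugate.conjExponent hp) hp hp2 rfl
    have := ENNReal.HolderConjugate.conjExponent hp
    refine ⟨D.toNNReal + 1, fun A k hA hk hK F hF hFb => ?_⟩
    refine LpBound.of_isBesselDeriv (D := D) hp ?_ (by positivity) fun g hg hgr hFg =>
      (hb A k hA hk hK F hF hFb g hg hgr hFg).lpBound
    rw [ENNReal.coe_add, ENNReal.coe_toNNReal hD]
    exact le_self_add
  -- For `p ≥ 2` the bound is proved for the conjugate function at the dual exponent, which has the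
  -- same `σ`, and then transferred to the adjoint.
  · have hpq := ENNReal.HolderConjugate.conjExponent hp
    set q := ENNReal.conjExponent p
    have hqp : ENNReal.HolderConjugate q p := hpq.symm
    have hq1 : 1 ≤ q := ENNReal.HolderConjugate.one_le q p
    have hq2 : q ≤ 2 := by
      by_contra! h
      have h1 : q⁻¹ < 2⁻¹ := ENNReal.inv_lt_inv.2 h
      have h2 : p⁻¹ ≤ 2⁻¹ := ENNReal.inv_le_inv.2 hp2
      have h3 := ENNReal.add_lt_add_of_le_of_lt (h2.trans_lt (by norm_num)).ne h2 h1
      rw [ENNReal.inv_two_add_inv_two, ENNReal.HolderConjugate.inv_add_inv_eq_one p q] at h3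
      exact lt_irrefl _ h3
    obtain ⟨D, hD, hb⟩ := key q p hqp hq1 hq2 sigmaExp_conj
    refine ⟨D.toNNReal + 1, fun A k hA hk hK F hF hFb => ?_⟩
    have hFc : Continuous fun x => (starRingEnd ℂ) (F x) := by fun_prop
    have hFcb : ∃ M, ∀ x, ‖(starRingEnd ℂ) (F x)‖ ≤ M := by simpa using hFb
    refine LpBound.of_isBesselDeriv (D := D) hp ?_ (by positivity) fun g hg hgr hFg => ?_
    · rw [ENNReal.coe_add, ENNReal.coe_toNNReal hD]
      exact le_self_add
    have hgc : eLpNorm (fun x => (starRingEnd ℂ) (g x)) r volume = eLpNorm g r volume :=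
      eLpNorm_congr_norm_ae (Eventually.of_forall fun x => by simp)
    have h1 := hb A k hA hk hK _ hFc hFcb _ (by fun_prop) (by rwa [hgc]) hFg.conj
    rw [hgc] at h1
    refine (WeakLpBound.of_adjoint (fun f h => ?_) h1).lpBound
    -- The adjoint of `F(B) B` is `B` followed on the left by nothing but a conjugate calculus that
    -- commutes with it: both orders agree, since functions of `B` commute with `B`.
    rw [borelFC_eq_continuousFC hF hFb, borelFC_eq_continuousFC hFc hFcb, ← adjoint_continuousFC,
      ContinuousLinearMap.comp_apply, ContinuousLinearMap.comp_apply,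
      ContinuousLinearMap.adjoint_inner_left, ← mul_apply_eq_comp,
      (commute_continuousFC F (hA.pow k)).eq, mul_apply_eq_comp]
    exact ((hA.pow k).isSymmetric _ _).symm

theorem exists_lpBound_of_restrictionBound (hX : IsDoubling μ n C) (hn : 0 ≤ n) {N : ℝ}
    (hN : n + ⌊n / 2⌋ + 1 < N) (C_K : ℝ) (hp : 1 ≤ p) (hp2 : p ≤ 2) (hr : 2 ≤ r) {s R₁ R₂ γ : ℝ}
    (hγ : 0 < γ) (hs : n * sigmaExp p + n / (4 * ⌊N - n⌋) < s) (C_R : ℝ≥0) :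
    ∃ E : ℝ≥0, ∀ (A : Lp ℂ 2 μ →L[ℂ] Lp ℂ 2 μ) (k : ℕ), IsSelfAdjoint A → 1 ≤ k →
      HasPolyKernel μ (A ^ k) k N C_K → RestrictionBound μ (A ^ k) p r √k R₁ R₂ C_R →
      ∀ F : ℝ → ℂ, Measurable F → (∃ M : ℝ, ∀ x, ‖F x‖ ≤ M) →
        tsupport F ⊆ Set.Ioo (R₁ + γ) (R₂ - γ) →
        LpBound μ (borelFC F (A ^ k) ∘L A ^ k) p (E * sobolevENorm s r F) := by
  have := hX.sigmaFinite
  obtain ⟨m, hmN, hm, hmle⟩ := exists_nat_eq_floor hn hN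
  rw [← hmN] at hs
  have hN0 : 0 ≤ N := by
    have : (0 : ℝ) ≤ m := m.cast_nonneg
    linarith
  have hl : n + m < 2 * N := by
    have : 0 ≤ n / 2 := by positivity
    linarith
  have hsk : ∀ k : ℕ, 1 ≤ k → 0 < √(k : ℝ) := fun k hk => Real.sqrt_pos.2 (by exact_mod_cast hk)
  have hpq := ENNReal.HolderConjugate.conjExponent hp
  obtain ⟨D, hD, hb⟩ := exists_restriction_bound (p := p) (q := ENNReal.conjExponent p) (r := r) μ hn (le_max_right C 1)
    (c₀ := ENNReal.ofReal (|C_K| * 2 ^ N)) ENNReal.ofReal_ne_top hm hl hp hp2 hr (R₁ := R₁)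
    (R₂ := R₂) hγ ((add_div_mul_le hn m.cast_nonneg hp).trans_lt hs) C_R
  refine ⟨D.toNNReal + 1, fun A k hA hk hK hR F hF hFb hFs => ?_⟩
  obtain ⟨K, hK⟩ := hK.exists_isIntegralOp hX (hsk k hk) hN0
  refine LpBound.of_isBesselDeriv (D := D) hp ?_ (by positivity) fun g hg hgr hFg =>
    (@hb (scaledMetric X (hsk k hk)) ‹_› ‹_› ((hX.mono (le_max_left C 1)).scaledMetric _) (A ^ k) K
      (hA.pow k) hK (hR.scaledMetric _) F hF hFb hFs g hg hgr hFg).lpBound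
  rw [ENNReal.coe_add, ENNReal.coe_toNNReal hD]
  exact le_self_add

end MainBounds
end

/-! ### The theorem -/

theorem theorem5p2 {X : Type*} [MetricSpace X] [TopologicalSpace.SeparableSpace X]
    [MeasurableSpace X] [BorelSpace X] (μ : Measure X)
    (n C_D : ℝ) (hn : 0 < n) (hX : IsDoubling μ n C_D)
    (N : ℝ) (hN : n + ⌊n / 2⌋ + 1 < N) (C_K : ℝ) :
    (∀ (p : ℝ≥0∞) (s s' : ℝ), 1 ≤ p →
      n * sigmaExp p + n / (4 * ⌊N - n⌋) < s → n * sigmaExp p + 1 / 2 < s' →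
      ∃ C : ℝ≥0, ∀ (A : Lp ℂ 2 μ →L[ℂ] Lp ℂ 2 μ) (k : ℕ), IsSelfAdjoint A → 1 ≤ k →
        HasPolyKernel μ (A ^ k) k N C_K →
        ∀ F : ℝ → ℂ, Continuous F → (∃ M : ℝ, ∀ x, ‖F x‖ ≤ M) →
          LpBound μ (borelFC F (A ^ k) ∘L A ^ k) p
            (C * min (sobolevENorm s ∞ F) (sobolevENorm s' 2 F))) ∧
    (∀ (p q : ℝ≥0∞) (s R₁ R₂ γ : ℝ) (C_R : ℝ≥0), 1 ≤ p → p < 2 → 2 ≤ q →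
      R₁ < R₂ → 0 < γ → n * sigmaExp p + n / (4 * ⌊N - n⌋) < s →
      ∃ C : ℝ≥0, ∀ (A : Lp ℂ 2 μ →L[ℂ] Lp ℂ 2 μ) (k : ℕ), IsSelfAdjoint A → 1 ≤ k →
        HasPolyKernel μ (A ^ k) k N C_K →
        RestrictionBound μ (A ^ k) p q √k R₁ R₂ C_R →
        ∀ F : ℝ → ℂ, Measurable F → (∃ M : ℝ, ∀ x, ‖F x‖ ≤ M) →
          tsupport F ⊆ Set.Ioo (R₁ + γ) (R₂ - γ) →
          LpBound μ (borelFC F (A ^ k) ∘L A ^ k) p (C * sobolevENorm s q F)) := by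
  refine ⟨fun p s s' hp hs hs' => ?_, fun p q s R₁ R₂ γ C_R hp hp2 hq _ hγ hs =>
    exists_lpBound_of_restrictionBound hX hn.le hN C_K hp hp2.le hq hγ hs C_R⟩
  obtain ⟨m, hmN, -, -⟩ := exists_nat_eq_floor hn.le hN
  -- The `L^∞` scale corresponds to `α = 0`.
  obtain ⟨E₁, h₁⟩ := exists_lpBound_of_continuous (r := ∞) (α := 0) (s := s) hX hn.le hN C_K hp
    le_top le_rfl (by norm_num)
    (by
      rw [← hmN] at hs ⊢
      rw [sub_zero, add_zero]
      exact (add_div_mul_le hn.le m.cast_nonneg hp).trans_lt hs)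
    (fun c hc g _ x => by simpa using enorm_gaussAvg_le_top hc g x)
  -- The `L²` scale corresponds to `α = 1/2`, for which the balancing correction vanishes and the
  -- exponent is exactly `nσ + 1/2`.
  obtain ⟨E₂, h₂⟩ := exists_lpBound_of_continuous (r := 2) (α := 1 / 2) (s := s') hX hn.le hN C_K hp
    le_rfl (by norm_num) le_rfl (by simpa using hs') (fun c hc g hg x => enorm_gaussAvg_le_two hc hg x)
  refine ⟨max E₁ E₂, fun A k hA hk hK F hF hFb => ?_⟩
  rcases min_choice (sobolevENorm s ∞ F) (sobolevENorm s' 2 F) with h | h <;> rw [h]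
  · refine (h₁ A k hA hk hK F hF hFb).mono ?_
    gcongr
    exact le_max_left _ _
  · refine (h₂ A k hA hk hK F hF hFb).mono ?_
    gcongr
    exact le_max_right _ _
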